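/- **Notation.** Let $0<q<1$, $0<k_1\le k_2$, $s\in\mathbb R$ with $|s|\ge q^{-1}$. Let $L\ge 0$ be the integer with $\varepsilon=k_1-k_2+L\in[0,1)$, and let $K\ge0$ be the integer such that $|sq^{2k_1-2k_2+2i}|>1$ holds exactly for $i\le K$ among the integers $i\geq 0$. Write $\mu(v)=\frac12(v+v^{-1})$, $(a;q)_n=\prod_{j<n}(1-aq^j)$, $(a_1,\dots,a_r;q)_n=\prod_i(a_i;q)_n$. *Askey–Wilson polynomials.* For $y=\cos\theta$, $$p_n(y;a,b,c,d|q)=a^{-n}(ab,ac,ad;q)_n\,{}_4\varphi_3\!\left(q^{-n},abcdq^{n-1},ae^{i\theta},ae^{-i\theta};ab,ac,ad;q,q\right),$$ $$\tilde p_n=\Big(\tfrac{(abcd;q)_{2n}}{(q,ab,ac,ad,bc,bd,cd,abcdq^{n-1};q)_n}\Big)^{1/2}p_n .$$ $dm(y;a,b,c,d|q)$ is their orthogonality measure: for $y=\cos\theta$ the density with respect to $d\theta$ on $(0,\pi)$ is $$w(\cos\theta;a,b,c,d|q)=\frac1{2\pi}\frac{(q,ab,ac,ad,bc,bd,cd;q)_\infty}{(abcd;q)_\infty}\left|\frac{(e^{2i\theta};q)_\infty}{(ae^{i\theta},be^{i\theta},ce^{i\theta},de^{i\theta};q)_\infty}\right|^2,$$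 and for each parameter $e\in\{a,b,c,d\}$ and $k\ge0$ with $|eq^k|>1$ there is a mass at $\mu(eq^k)$, for $e=a$ equal to $$\frac{1-a^2q^{2k}}{1-a^2}\frac{(a^{-2},bc,bd,cd;q)_\infty}{(b/a,c/a,d/a,abcd;q)_\infty}\frac{(a^2,ab,ac,ad;q)_k}{(q,aq/b,aq/c,aq/d;q)_k}\Big(\frac{q}{abcd}\Big)^k$$ (by continuity if some of $b,c,d$ are $0$). Put $\tilde s_n(y;a,b|q)=\tilde p_n(y;a,b,0,0|q)$ and $dm(y;a,b|q)=dm(y;a,b,0,0|q)$ (Al-Salam–Chihara); $\tilde s_n$ is also used in base $q^{-2}$. *The function $F$.* For $n_1,n_2,p\in\mathbb Z_{\ge0}$, $$F_{n_1,n_2}(x,p)=(-1)^{n_2}\tilde s_{n_1}\big(x;sq^{2k_1-2k_2-2p},q^{2k_1+2k_2+2p}/s\,|\,q^2\big)\,\tilde s_{n_2}\big(\mu(q^{2k_2+2p}/s);q^{-2k_2}s,q^{-2k_2}/s\,|\,q^{-2}\big),$$ and $dm(x,p)=W_p\,dm(x;sq^{2k_1-2k_2-2p},q^{2k_1+2k_2+2p}/s|q^2)$,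 where, with $a=q^{-2k_2}s$, $b=q^{-2k_2}/s$, $Q=q^2$, $$W_p=\frac{(1-a^{-2}Q^{2p})(a^{-2},a^{-1}b^{-1};Q)_p(a^{-1}bQ;Q)_\infty}{(1-a^{-2})(Q,a^{-1}bQ;Q)_p(a^{-2}Q;Q)_\infty}\Big(\frac ba\Big)^pQ^{p^2}.$$ *Continuous dual $q$-Hahn polynomials.* With $n=\min\{n_1,n_2\}$, $\widetilde P_n(y)=\tilde p_n(y;a,b,c,0|q^2)$ and $dm(y)=dm(y;a,b,c,0|q^2)$, where $b=q^{2k_1+2k_2-1}$ and $(a,c)=(q^{2k_2-2k_1+2n_2-2n_1+1},q^{2k_1-2k_2+1})$ if $n_1\le n_2$, $(a,c)=(q^{2k_1-2k_2+2n_1-2n_2+1},q^{2k_2-2k_1+1})$ if $n_1\ge n_2$. *Little $q$-Jacobi functions.* Let $x=\mu(u)$, $y=\mu(Y)$. For $|Y|=1$, $n\in\mathbb Z$ and $w=q^{1-2\varepsilon-2n}/Y$, $$\phi_n(x;y)=(-\operatorname{sgn}s)^n\frac{(w;q^2)_\infty}{|(w;q^2)_\infty|}\,\Big|\frac sq\Big|^{n}\,{}_2\varphi_1\!\left(\frac{qYu}{s},\frac{qY}{us};\frac{q^2}{s^2};q^2,w\right)$$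 with the ${}_2\varphi_1$ continued analytically in $w$. With $c=q^2/s^2$, $d=qY/s$, $r=q^{1-2\varepsilon}/Y$, the measure $d\nu(x;y)$ has, at $x=\cos\theta$, the density $$\frac1{2\pi}\left|\frac{(e^{2i\theta},c,r,q^2/r;q^2)_\infty}{(ce^{i\theta}/d,de^{i\theta},dre^{i\theta},q^2e^{i\theta}/dr;q^2)_\infty}\right|^2$$ with respect to $d\theta$ on $(0,\pi)$, and for $i\in\mathbb Z$ with $|q^{-2i}/dr|>1$ the mass $$\frac{|(c,r,q^2/r;q^2)_\infty|^2}{(q^2;q^2)_\infty^2}\frac{(1-d^2r^2q^{4i})(dr)^{-2i-2}q^{-2i(i+1)}}{(crq^{2i},cq^{-2i}/d^2r,d^2rq^{2i},q^{-2i}/r;q^2)_\infty}$$ at $\mu(q^{-2i}/dr)$. Here $dr=q^{2-2\varepsilon}/s$, so these mass points do not depend on $y$; in order of increasing absolute value they are $x_l=\mu(u_l)$, $u_l=sq^{2k_1-2k_2+2K-2l}$, $l\ge0$. Since both $\phi_n(x;y)$ and $d\nu(x;y)$ are unchanged under $Y\mapsto Y^{-1}$, they are functions of $y$; for the finitely many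 mass points $y\notin[-1,1]$ that occur below, they are continued in $Y$ from $|Y|=1$, with $|(aY;q^2)_\infty|^2$ for real $a$ replaced by $(aY,a/Y;q^2)_\infty$ and removable singularities in $Y$ filled in by continuity. *The polynomials $\tilde p_m(y;x)$.* Let $(x,p)$ be in the support of $dm(x,p)$, i.e. $p\in\mathbb Z_{\ge0}$ and either $x\in[-1,1]$, or $x=x_l$ with $0\le l\le K+p$. If $x=\mu(u)\in[-1,1]$, or $x=x_l=\mu(u_l)$ with $l\le K$ (then $u=u_l$), put $m=p$ and $$a=qu/s,\quad b=q/us,\quad c=q^{2k_2-2k_1+1},\quad d=q^{2k_1+2k_2-1};$$ if $x=x_l$ with $l>K$ put $m=p+K-l$ and $$a=q^{2k_1-2k_2+1},\quad b=q^{2k_2-2k_1+2l-2K+1}/s^2,\quad c=q^{2k_2-2k_1+2l-2K+1},\quad d=q^{2k_1+2k_2-1}.$$ Let $\tilde p_m(y;x)=\tilde p_m(y;a,b,c,d|q^2)$, and define the measure $dM(y;x,p)$ by $dM(y;x,p)\,dm(x,p)=dm(y;a,b,c,d|q^2)\,d\nu(x;y)$, that is, $dm(y;a,b,c,d|q^2)$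 times the quotient of $d\nu(x;y)$ and $dm(x,p)$ at $x$ (the quotient of the densities for $x\in(-1,1)$, extended by continuity to $x=\pm1$, and the quotient of the masses for $x=x_l$). For measures $dm=f\,d\lambda$ and $dM=g\,d\lambda$ on $\mathbb R$ let $dm^{1/2}dM^{1/2}=\sqrt{fg}\,d\lambda$. **Proposition 3.5.** For all $n_1,n_2,p\in\mathbb Z_{\ge0}$ and all $x$ with $(x,p)$ in the support described above, with $n=\min\{n_1,n_2\}$ and $m$ as above, $$F_{n_1,n_2}(x,p)=\sigma\,(-1)^{p-m}\,(-\operatorname{sgn}s)^L\int_{\mathbb R}\tilde p_m(y;x)\,\widetilde P_n(y)\,\phi_{n_1-n_2-L}(x;y)\,dm^{\frac12}(y)\,dM^{\frac12}(y;x,p),$$ where the integral converges absolutely, $\sigma=(-1)^{n_1-n_2}$ if $n_1\le n_2$, and $\sigma=1$ if $n_1\ge n_2$. -/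

import Mathlib

open MeasureTheory

noncomputable section

namespace AWClebschGordan

/-! ### q-shifted factorials and basic hypergeometric series -/

/-- The finite q-shifted factorial `(a; q)_n`. -/
def qPoch (a q : ℂ) (n : ℕ) : ℂ := ∏ j ∈ Finset.range n, (1 - a * q ^ j)

/-- The infinite q-shifted factorial `(a; q)_∞` (used for `|q| < 1`). -/
def qPochInf (a q : ℂ) : ℂ := ∏' j : ℕ, (1 - a * q ^ j)

/-- `(a₁, …, a_r; q)_n`. -/
def qPochs (l : List ℂ) (q : ℂ) (n : ℕ) : ℂ := (l.map fun a => qPoch a q n).prod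

/-- `(a₁, …, a_r; q)_∞`. -/
def qPochInfs (l : List ℂ) (q : ℂ) : ℂ := (l.map fun a => qPochInf a q).prod

/-- The series `₂φ₁(a, b; c; q, w)`, convergent for `|w| < 1`. -/
def phi21Series (a b c q w : ℂ) : ℂ :=
  ∑' k : ℕ, qPochs [a, b] q k / qPochs [q, c] q k * w ^ k

open Classical in
/-- `(w; q)_∞ · ₂φ₁(a, b; c; q, w)` for all complex `w`, the series being continued analytically:
the entire function of `w` which for `|w| < 1` is the product of `(w; q)_∞` and the convergent
series. (The analytic continuation of the `₂φ₁` is meromorphic, and the factor `(w; q)_∞` cancels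
its poles.) By the identity theorem there is at most one such entire function. -/
def phi21Entire (a b c q w : ℂ) : ℂ :=
  if h : ∃ E : ℂ → ℂ, Differentiable ℂ E ∧
      ∀ t : ℂ, ‖t‖ < 1 → E t = qPochInf t q * phi21Series a b c q t
  then h.choose w else 0

/-- `μ(v) = (v + v⁻¹) / 2`. -/
def mu (v : ℝ) : ℝ := (v + v⁻¹) / 2

/-- A solution `v` of `(v + v⁻¹) / 2 = y`. For `y ∈ [-1, 1]` it is `e^{iθ}` with `θ ∈ [0, π]` and
`y = cos θ`; for real `y` with `|y| > 1` it is real. Everything below to which it is applied is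
invariant under `v ↦ v⁻¹`. -/
def expArg (y : ℝ) : ℂ := (y : ℂ) + ((y : ℂ) ^ 2 - 1) ^ (1 / 2 : ℂ)

/-! ### Askey-Wilson polynomials and their orthogonality measure -/

/-- The Askey-Wilson polynomial
`p_n(y; a, b, c, d | q) = a⁻ⁿ (ab, ac, ad; q)_n
  ₄φ₃(q⁻ⁿ, abcd qⁿ⁻¹, a e^{iθ}, a e^{-iθ}; ab, ac, ad; q, q)`, `y = cos θ`, with
`(a e^{iθ}, a e^{-iθ}; q)_k = ∏_{j < k} (1 - 2 a y q^j + a² q^{2j})`. -/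
def awPoly (a b c d q : ℂ) (n : ℕ) (y : ℝ) : ℂ :=
  a⁻¹ ^ n * qPochs [a * b, a * c, a * d] q n *
    ∑ k ∈ Finset.range (n + 1),
      qPochs [q ^ (-(n : ℤ)), a * b * c * d * q ^ ((n : ℤ) - 1)] q k *
        (∏ j ∈ Finset.range k, (1 - 2 * a * (y : ℂ) * q ^ j + a ^ 2 * q ^ (2 * j))) /
        qPochs [a * b, a * c, a * d, q] q k * q ^ k

/-- The orthonormal Askey-Wilson polynomial. The number under the root is real and positive for all
parameters used below. -/
def awOrtho (a b c d q : ℂ) (n : ℕ) (y : ℝ) : ℂ :=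
  (Real.sqrt (qPoch (a * b * c * d) q (2 * n) /
    qPochs [q, a * b, a * c, a * d, b * c, b * d, c * d,
      a * b * c * d * q ^ ((n : ℤ) - 1)] q n).re : ℂ) * awPoly a b c d q n y

/-- The weight function `w(cos θ; a, b, c, d | q)` with respect to `dθ`. -/
def awWeight (a b c d q : ℂ) (θ : ℝ) : ℝ :=
  1 / (2 * Real.pi) *
    (qPochInfs [q, a * b, a * c, a * d, b * c, b * d, c * d] q /
      qPochInf (a * b * c * d) q).re *
    ‖qPochInf (Complex.exp (2 * Complex.I * θ)) q /
      qPochInfs [a * Complex.exp (Complex.I * θ), b * Complex.exp (Complex.I * θ),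
        c * Complex.exp (Complex.I * θ), d * Complex.exp (Complex.I * θ)] q‖ ^ 2

/-- The mass `w_k(a; b, c, d | q)` at the point `μ(a q^k)`,
`(1 - a² q^{2k}) / (1 - a²) * (a⁻², bc, bd, cd; q)_∞ / (b/a, c/a, d/a, abcd; q)_∞
  * (a², ab, ac, ad; q)_k / (q, aq/b, aq/c, aq/d; q)_k * (q / (abcd))^k`.
It is written with `(aq/b; q)_k b^k = ∏_{j < k} (b - a q^{j+1})`, and the same for `c` and `d`, so
that it makes sense when some of `b, c, d` vanish. -/
def awMass (a b c d q : ℂ) (k : ℕ) : ℂ :=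
  (1 - a ^ 2 * q ^ (2 * k)) / (1 - a ^ 2) *
    (qPochInfs [(a ^ 2)⁻¹, b * c, b * d, c * d] q /
      qPochInfs [b / a, c / a, d / a, a * b * c * d] q) *
    (qPochs [a ^ 2, a * b, a * c, a * d] q k /
      (qPoch q q k * ∏ j ∈ Finset.range k,
        ((b - a * q ^ (j + 1)) * (c - a * q ^ (j + 1)) * (d - a * q ^ (j + 1))))) *
    (q / a) ^ k

open Classical in
/-- The discrete part of the Askey-Wilson measure that belongs to the parameter `a`: masses
at `μ(a q^k)` for all `k ≥ 0` with `|a q^k| > 1`. -/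
def awAtoms (a b c d q : ℂ) : Measure ℝ :=
  Measure.sum fun k : ℕ =>
    if 1 < ‖a * q ^ k‖ then
      ENNReal.ofReal (awMass a b c d q k).re •
        Measure.dirac (((a * q ^ k + (a * q ^ k)⁻¹) / 2).re)
    else 0

/-- The orthogonality measure `dm(· ; a, b, c, d | q)` of the Askey-Wilson polynomials. -/
def awMeasure (a b c d q : ℂ) : Measure ℝ :=
  Measure.map Real.cos
      ((volume.restrict (Set.Ioc 0 Real.pi)).withDensity
        fun θ => ENNReal.ofReal (awWeight a b c d q θ)) +
    awAtoms a b c d q + awAtoms b a c d q + awAtoms c a b d q + awAtoms d a b c q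

/-- For measures `m`, `M`, the measure `dm^{1/2} dM^{1/2}`: if `dm = f dλ` and `dM = g dλ`, it is
`(f g)^{1/2} dλ` (here `λ = m + M`; the result does not depend on the choice of `λ`). -/
def geomMean (m M : Measure ℝ) : Measure ℝ :=
  (m + M).withDensity fun y => (m.rnDeriv (m + M) y * M.rnDeriv (m + M) y) ^ (1 / 2 : ℝ)

/-! ### The functions of the tensor product `π⁺_{k₁} ⊗ π⁻_{k₂}` -/

/-- The parameters: the base `q`, the representation labels `k₁`, `k₂`, the parameter `s` of the
twisted primitive element, and the integers `L` and `K` determined by them. -/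
structure Params where
  q : ℝ
  k₁ : ℝ
  k₂ : ℝ
  s : ℝ
  L : ℕ
  K : ℕ

/-- The conditions on the parameters. `L` is the non-negative integer with
`k₁ - k₂ + L ∈ [0, 1)`, and `K + 1` is the number of integers `i ≥ 0` with
`|s q^{2k₁ - 2k₂ + 2i}| > 1`. -/
structure Params.Admissible (P : Params) : Prop where
  q_pos : 0 < P.q
  q_lt_one : P.q < 1
  k₁_pos : 0 < P.k₁
  k₁_le_k₂ : P.k₁ ≤ P.k₂
  s_large : P.q⁻¹ ≤ |P.s|
  L_lower : 0 ≤ P.k₁ - P.k₂ + P.L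
  L_upper : P.k₁ - P.k₂ + P.L < 1
  K_lower : 1 < |P.s| * P.q ^ (2 * P.k₁ - 2 * P.k₂ + 2 * (P.K : ℝ))
  K_upper : |P.s| * P.q ^ (2 * P.k₁ - 2 * P.k₂ + 2 * ((P.K : ℝ) + 1)) ≤ 1

namespace Params

variable (P : Params)

/-- `q ^ t` for real `t`, as a complex number. -/
def qp (t : ℝ) : ℂ := ((P.q ^ t : ℝ) : ℂ)

/-- The base `q²`. -/
def Q : ℂ := (P.q : ℂ) ^ 2

/-- `ε = k₁ - k₂ + L`. -/
def eps : ℝ := P.k₁ - P.k₂ + P.L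

/-- The first parameter `s q^{2k₁ - 2k₂ - 2p}` of the Al-Salam-Chihara polynomials in base `q²`. -/
def ascA (p : ℕ) : ℂ := P.s * P.qp (2 * P.k₁ - 2 * P.k₂ - 2 * p)

/-- The second parameter `q^{2k₁ + 2k₂ + 2p} / s`. -/
def ascB (p : ℕ) : ℂ := P.qp (2 * P.k₁ + 2 * P.k₂ + 2 * p) / P.s

/-- `F_{n₁, n₂}(x, p) = (-1)^{n₂} s̃_{n₁}(x; s q^{2k₁-2k₂-2p}, q^{2k₁+2k₂+2p}/s | q²)
  s̃_{n₂}(μ(q^{2k₂+2p}/s); q^{-2k₂} s, q^{-2k₂}/s | q⁻²)`; the Al-Salam-Chihara polynomials are the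
Askey-Wilson polynomials with two parameters equal to zero. -/
def F (n₁ n₂ : ℕ) (x : ℝ) (p : ℕ) : ℂ :=
  (-1) ^ n₂ * awOrtho (P.ascA p) (P.ascB p) 0 0 P.Q n₁ x *
    awOrtho (P.qp (-2 * P.k₂) * P.s) (P.qp (-2 * P.k₂) / P.s) 0 0 P.Q⁻¹ n₂
      (mu (P.q ^ (2 * P.k₂ + 2 * (p : ℝ)) / P.s))

/-- The mass at `p` of the orthogonality measure of the polynomials
`s̃_n(· ; a, b | q⁻²)`, `a = q^{-2k₂} s`, `b = q^{-2k₂}/s`: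
`W_p = (1 - a⁻² Q^{2p}) (a⁻², a⁻¹b⁻¹; Q)_p (a⁻¹bQ; Q)_∞ /
  ((1 - a⁻²) (Q, a⁻¹bQ; Q)_p (a⁻²Q; Q)_∞) (b/a)^p Q^{p²}` with `Q = q²`. -/
def ascInvMass (p : ℕ) : ℂ :=
  let a : ℂ := P.qp (-2 * P.k₂) * P.s
  let b : ℂ := P.qp (-2 * P.k₂) / P.s
  (1 - (a ^ 2)⁻¹ * P.Q ^ (2 * p)) * qPochs [(a ^ 2)⁻¹, a⁻¹ * b⁻¹] P.Q p *
      qPochInf (a⁻¹ * b * P.Q) P.Q /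
    ((1 - (a ^ 2)⁻¹) * qPochs [P.Q, a⁻¹ * b * P.Q] P.Q p * qPochInf ((a ^ 2)⁻¹ * P.Q) P.Q) *
    (b / a) ^ p * P.Q ^ (p ^ 2)

/-- The first parameter of the continuous dual `q`-Hahn polynomials (with fourth parameter `0`). -/
def cdhA (n₁ n₂ : ℕ) : ℂ :=
  if n₁ ≤ n₂ then P.qp (2 * P.k₂ - 2 * P.k₁ + 2 * n₂ - 2 * n₁ + 1)
  else P.qp (2 * P.k₁ - 2 * P.k₂ + 2 * n₁ - 2 * n₂ + 1)

/-- The second parameter of the continuous dual `q`-Hahn polynomials. -/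
def cdhB : ℂ := P.qp (2 * P.k₁ + 2 * P.k₂ - 1)

/-- The third parameter of the continuous dual `q`-Hahn polynomials. -/
def cdhC (n₁ n₂ : ℕ) : ℂ :=
  if n₁ ≤ n₂ then P.qp (2 * P.k₁ - 2 * P.k₂ + 1) else P.qp (2 * P.k₂ - 2 * P.k₁ + 1)

/-- The orthonormal continuous dual `q`-Hahn polynomial `P̃_n(y)`, `n = min {n₁, n₂}`, base `q²`. -/
def cdhOrtho (n₁ n₂ : ℕ) (y : ℝ) : ℂ :=
  awOrtho (P.cdhA n₁ n₂) P.cdhB (P.cdhC n₁ n₂) 0 P.Q (min n₁ n₂) y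

/-- The orthogonality measure `dm(y)` of the continuous dual `q`-Hahn polynomials. -/
def cdhMeasure (n₁ n₂ : ℕ) : Measure ℝ :=
  awMeasure (P.cdhA n₁ n₂) P.cdhB (P.cdhC n₁ n₂) 0 P.Q

/-- The little `q`-Jacobi function
`φ_n(x; y) = φ_n(x; q²/s², q Y/s, q^{1-2ε}/Y | q²)`, `x = (u + u⁻¹)/2`, `y = (Y + Y⁻¹)/2`.

Put `w = q^{1-2ε-2n} / Y`. For `|Y| = 1` this is
`(-sgn s)^n (w; q²)_∞ / |(w; q²)_∞| * |q/s|^{-n} * ₂φ₁(q Y u/s, q Y/(u s); q²/s²; q², w)`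
with the analytically continued `₂φ₁`. It is invariant under `Y ↦ Y⁻¹`, thus a function of `y`.
For the points `y` outside `[-1, 1]` the formula is continued from `|Y| = 1` with
`|(w; q²)_∞|² = (q^{1-2ε-2n} Y, q^{1-2ε-2n} / Y; q²)_∞`. -/
def jacobi (n : ℤ) (u Y : ℂ) : ℂ :=
  let z : ℂ := P.qp (1 - 2 * P.eps - 2 * n)
  (-(P.s : ℂ) / P.q) ^ n *
    phi21Entire (P.q * Y * u / P.s) (P.q * Y / (u * P.s)) (P.Q / (P.s : ℂ) ^ 2) P.Q (z / Y) /
    (Real.sqrt (qPochInfs [z * Y, z / Y] P.Q).re : ℂ)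

/-- The density with respect to `dθ` at `x = cos θ`, `u = e^{iθ}`, of the orthogonality measure
`dν(x; q²/s², q Y/s, q^{1-2ε}/Y | q²)` of the little `q`-Jacobi functions. With `c = q²/s²`,
`d = q Y/s`, `r = q^{1-2ε}/Y` it is, for `|Y| = 1`,
`(2π)⁻¹ |(e^{2iθ}, c, r, q²/r; q²)_∞ / (c e^{iθ}/d, d e^{iθ}, d r e^{iθ}, q² e^{iθ}/(d r); q²)_∞|²`;
the square of the absolute value is written out as a product that is analytic in `Y`, with
`r' = q^{1-2ε} Y` the conjugate of `r` for `|Y| = 1`. -/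
def nuDensity (u Y : ℂ) : ℂ :=
  let c : ℂ := P.Q / (P.s : ℂ) ^ 2
  let r : ℂ := P.qp (1 - 2 * P.eps) / Y
  let r' : ℂ := P.qp (1 - 2 * P.eps) * Y
  let dr : ℂ := P.qp (2 - 2 * P.eps) / P.s
  1 / (2 * Real.pi) *
    qPochInfs [u ^ 2, (u ^ 2)⁻¹, c, c, r, P.Q / r, r', P.Q / r'] P.Q /
    qPochInfs [P.q * u / (P.s * Y), P.q / (P.s * u * Y), P.q * Y * u / P.s, P.q * Y / (u * P.s),
      dr * u, dr / u, P.Q * u / dr, P.Q / (dr * u)] P.Q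

/-- The denominator `(c r q^{2i}, c q^{-2i}/(d² r), d² r q^{2i}, q^{-2i}/r; q²)_∞` in the masses of
the measure `dν`; recall `c/(d² r) = 1/r'`. -/
def nuMassDen (i : ℤ) (Y : ℂ) : ℂ :=
  let c : ℂ := P.Q / (P.s : ℂ) ^ 2
  let d : ℂ := P.q * Y / P.s
  let r : ℂ := P.qp (1 - 2 * P.eps) / Y
  qPochInfs [c * r * P.Q ^ i, c * P.Q ^ (-i) / (d ^ 2 * r), d ^ 2 * r * P.Q ^ i, P.Q ^ (-i) / r] P.Q

/-- The mass of the measure `dν(x; q²/s², q Y/s, q^{1-2ε}/Y | q²)` at the point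
`x = μ(q^{-2i}/(d r))`, where its denominator does not vanish:
`|(c, r, q²/r; q²)_∞|² / (q²; q²)_∞² * (1 - d² r² q^{4i}) (d r)^{-2i-2} q^{-2i(i+1)} /
  (c r q^{2i}, c q^{-2i}/(d² r), d² r q^{2i}, q^{-2i}/r; q²)_∞`. -/
def nuMassFormula (i : ℤ) (Y : ℂ) : ℂ :=
  let c : ℂ := P.Q / (P.s : ℂ) ^ 2
  let r : ℂ := P.qp (1 - 2 * P.eps) / Y
  let r' : ℂ := P.qp (1 - 2 * P.eps) * Y
  let dr : ℂ := P.qp (2 - 2 * P.eps) / P.s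
  qPochInfs [c, c, r, P.Q / r, r', P.Q / r'] P.Q / qPochInf P.Q P.Q ^ 2 *
    (1 - dr ^ 2 * P.Q ^ (2 * i)) * dr ^ (-2 * i - 2) * P.Q ^ (-i * (i + 1)) / P.nuMassDen i Y

/-- The mass of the measure `dν` at `x = μ(q^{-2i}/(d r))`, extended by continuity in `Y` to the
removable singularities; these are met at the points `y` that belong to the negative discrete series
in the tensor product. -/
def nuMass (i : ℤ) (Y : ℂ) : ℂ :=
  extendFrom {Z : ℂ | Z ≠ 0 ∧ P.nuMassDen i Z ≠ 0} (P.nuMassFormula i) Y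

end Params

/-- The values of `x`: either a point of `[-1, 1]`, or one of the points
`x_l = μ(s q^{2k₁ - 2k₂ + 2K - 2l})`, `l ≥ 0`, which are all the discrete mass points of `dν` in
order of increasing absolute value. -/
inductive SpecPoint where
  | cont (x : ℝ)
  | disc (l : ℕ)

namespace SpecPoint

variable (P : Params)

/-- The support of the measure `dm(x, p)` for fixed `p`: the interval `[-1, 1]` and the points `x_l`
with `l ≤ K + p`. -/
def InSupport (p : ℕ) : SpecPoint → Prop
  | cont x => x ∈ Set.Icc (-1 : ℝ) 1
  | disc l => l ≤ P.K + p

/-- The number `u_l = s q^{2k₁ - 2k₂ + 2K - 2l}`, so that `x_l = μ(u_l)`. -/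
def uDisc (l : ℕ) : ℝ := P.s * P.q ^ (2 * P.k₁ - 2 * P.k₂ + 2 * (P.K : ℝ) - 2 * (l : ℝ))

/-- The real number `x`. -/
def x : SpecPoint → ℝ
  | cont x => x
  | disc l => mu (uDisc P l)

/-- A number `u` with `x = (u + u⁻¹)/2`. -/
def u : SpecPoint → ℂ
  | cont x => expArg x
  | disc l => uDisc P l

/-- The degree `m`: equal to `p` if `x ∈ [-1, 1]` or `x = x_l` with `l ≤ K`, and to `p + K - l` if
`x = x_l` with `l > K`. -/
def deg (p : ℕ) : SpecPoint → ℕ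
  | cont _ => p
  | disc l => if l ≤ P.K then p else p + P.K - l

/-- The parameters `a, b, c, d` of the Askey-Wilson polynomials `p̃_m(y; x)`. -/
def awParams : SpecPoint → ℂ × ℂ × ℂ × ℂ
  | cont x =>
    (P.q * expArg x / P.s, P.q / (expArg x * P.s), P.qp (2 * P.k₂ - 2 * P.k₁ + 1),
      P.qp (2 * P.k₁ + 2 * P.k₂ - 1))
  | disc l =>
    if l ≤ P.K then
      (P.q * uDisc P l / P.s, P.q / (uDisc P l * P.s), P.qp (2 * P.k₂ - 2 * P.k₁ + 1),
        P.qp (2 * P.k₁ + 2 * P.k₂ - 1))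
    else
      (P.qp (2 * P.k₁ - 2 * P.k₂ + 1),
        P.qp (2 * P.k₂ - 2 * P.k₁ + 2 * l - 2 * P.K + 1) / (P.s : ℂ) ^ 2,
        P.qp (2 * P.k₂ - 2 * P.k₁ + 2 * l - 2 * P.K + 1), P.qp (2 * P.k₁ + 2 * P.k₂ - 1))

/-- The orthonormal Askey-Wilson polynomial `p̃_m(y; x)` in base `q²`. -/
def awOrthoAt (X : SpecPoint) (p : ℕ) (y : ℝ) : ℂ :=
  let t := X.awParams P
  awOrtho t.1 t.2.1 t.2.2.1 t.2.2.2 P.Q (X.deg P p) y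

/-- The orthogonality measure `dm(y; a, b, c, d | q²)` of the polynomials `p̃_m(y; x)`. -/
def awMeasureAt (X : SpecPoint) : Measure ℝ :=
  let t := X.awParams P
  awMeasure t.1 t.2.1 t.2.2.1 t.2.2.2 P.Q

/-- The quotient `dν(x; y) / dm(x, p)` at the point `x`, where
`dm(x, p) = W_p · dm(x; s q^{2k₁-2k₂-2p}, q^{2k₁+2k₂+2p}/s | q²)`. For `x ∈ (-1, 1)` it is the
quotient of the densities, extended by continuity to `x = ±1`; at `x_l` it is the quotient of the
masses. Here `x_l = μ(a q^{2(K+p-l)})` with `a = s q^{2k₁-2k₂-2p}`, and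
`x_l = μ(q^{-2i}/(d r))` with `i = L - 1 - K + l`. -/
def nuOverM (p : ℕ) (y : ℝ) : SpecPoint → ℝ
  | cont x =>
    extendFrom (Set.Ioo (-1 : ℝ) 1)
      (fun t => (P.nuDensity (expArg t) (expArg y)).re /
        ((P.ascInvMass p).re * awWeight (P.ascA p) (P.ascB p) 0 0 P.Q (Real.arccos t))) x
  | disc l =>
    (P.nuMass ((P.L : ℤ) - 1 - P.K + l) (expArg y)).re /
      ((P.ascInvMass p).re * (awMass (P.ascA p) (P.ascB p) 0 0 P.Q (P.K + p - l)).re)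

/-- The measure `dM(y; x, p)`, defined by
`dM(y; x, p) dm(x, p) = dm(y; a, b, c, d | q²) dν(x; y)`. -/
def measureM (X : SpecPoint) (p : ℕ) : Measure ℝ :=
  (X.awMeasureAt P).withDensity fun y => ENNReal.ofReal (X.nuOverM P p y)

end SpecPoint

end AWClebschGordan

end

noncomputable section

namespace AWClebschGordan

open Filter Topology
open Complex (I exp norm_real ofReal_mul exp_ne_zero ofReal_re ofReal_pow ofReal_div conj_ofReal measurable_re ofReal_zero exp_neg real_smul ofReal_one exp_conj re_ofReal_mul)
open Real (cos arccos norm_of_nonneg rpow_add norm_eq_abs rpow_sub sqrt_pos measurable_cos pi_pos cos_arccos sqrt_mul)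
open Finset (range sum_congr mem_range mul_sum prod_congr sum_range_succ' prod_mul_distrib prod_range_succ sum_sub_distrib sum_range_succ sum_add_distrib sum_eq_zero)
open Nat (choose_succ_succ' choose_one_right choose_two_right exists_eq_add_of_le)
open ENNReal (measurable_ofReal toReal_ofReal)
open Set (Ioo Ioc Icc)
open scoped Real ComplexConjugate
open SpecPoint (uDisc)

/-- `(a; q)_∞`. -/
notation "Π(" a ";" q ")" => qPochInf a q

lemma ofReal_ne {x : ℝ} (h : 0 < x) : (x:ℂ) ≠ 0 := by exact_mod_cast h.ne'

lemma mul_lt_one_left {a b : ℝ} (h0 : 0 ≤ a) (h1 : a < 1) (h : b ≤ 1) : a*b < 1 :=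
  mul_lt_one_of_nonneg_of_lt_one_left h0 h1 h

lemma qPochInfs_cons (a : ℂ) (l : List ℂ) (q : ℂ) :
    qPochInfs (a :: l) q = Π(a;q)*qPochInfs l q := rfl

lemma qPochInfs_nil (q : ℂ) : qPochInfs [] q = 1 := rfl

lemma qPochs_cons (a : ℂ) (l : List ℂ) (q : ℂ) (n : ℕ) :
    qPochs (a :: l) q n = qPoch a q n*qPochs l q n := rfl

lemma qPochs_nil (q : ℂ) (n : ℕ) : qPochs [] q n = 1 := rfl

/-! ### q-shifted factorials -/

@[simp] lemma qPoch_zero (a q:ℂ) : qPoch a q 0 = 1 := by simp [qPoch]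

lemma qPoch_succ (a q:ℂ) (n:ℕ) : qPoch a q (n+1) = qPoch a q n*(1-a*q^n) := by
  simp [qPoch, prod_range_succ]

@[simp] lemma qPoch_zero_left (q:ℂ) (n:ℕ) : qPoch 0 q n = 1 := by simp [qPoch]

lemma qPoch_succ' (a q:ℂ) (n:ℕ) : qPoch a q (n+1) = (1-a)*qPoch (a*q) q n := by
  simp only [qPoch, Finset.prod_range_succ', pow_zero, mul_one, pow_succ']; ring

lemma qPoch_add (a q:ℂ) (m n:ℕ) : qPoch a q (m+n) = qPoch a q m*qPoch (a*q^m) q n := by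
  simp only [qPoch, Finset.prod_range_add]; ring

lemma qPoch_ne_zero {a q : ℂ} {n : ℕ} (h : ∀ j < n, a*q^j ≠ 1) : qPoch a q n ≠ 0 := by
  refine Finset.prod_ne_zero_iff.2 fun j hj => ?_; grind

lemma qPoch_eq_zero {a q : ℂ} {n j : ℕ} (hj : j < n) (h : a*q^j = 1) : qPoch a q n = 0 :=
  Finset.prod_eq_zero (mem_range.2 hj) (by rw [h, sub_self])

lemma summable_norm_mul_pow {q : ℂ} (hq : ‖q‖ < 1) (a:ℂ) : Summable fun j : ℕ => ‖-(a*q^j)‖ := by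
  simp only [norm_neg, norm_mul, norm_pow]
  exact (summable_geometric_of_lt_one (norm_nonneg _) hq).mul_left _

lemma multipliable_qPochInf {q : ℂ} (hq : ‖q‖ < 1) (a:ℂ) : Multipliable fun j : ℕ => 1-a*q^j := by
  simpa [sub_eq_add_neg] using multipliable_one_add_of_summable (summable_norm_mul_pow hq a)

lemma tendsto_qPoch {q : ℂ} (hq : ‖q‖ < 1) (a:ℂ) :
    Tendsto (fun n => qPoch a q n) atTop (𝓝 (Π(a;q))) :=
  (multipliable_qPochInf hq a).hasProd.tendsto_prod_nat

lemma qPochInf_split {q : ℂ} (hq : ‖q‖ < 1) (a:ℂ) (n:ℕ) : Π(a;q) = qPoch a q n*Π(a*q^n;q) := by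
  have h1 := (tendsto_qPoch hq (a*q^n)).const_mul (qPoch a q n)
  have h2 := (tendsto_qPoch hq a).comp (tendsto_add_atTop_nat n)
  refine tendsto_nhds_unique h2 (h1.congr fun m => ?_); simp [← qPoch_add, add_comm]

lemma qPochInf_step {q : ℂ} (hq : ‖q‖ < 1) (a:ℂ) : Π(a;q) = (1-a)*Π(a*q;q) := by
  simpa [qPoch] using qPochInf_split hq a 1

@[simp] lemma qPochInf_zero_left (q:ℂ) : Π(0;q) = 1 := by simp [qPochInf]

lemma qPochInf_ne_zero {q : ℂ} (hq : ‖q‖ < 1) {a : ℂ} (h : ∀ j : ℕ, a*q^j ≠ 1) : Π(a;q) ≠ 0 := by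
  have := tprod_one_add_ne_zero_of_summable (f := fun j : ℕ => -(a*q^j)) (fun j => by grind)
    (summable_norm_mul_pow hq a)
  bound

lemma mul_pow_ne_one {q : ℂ} (hq : ‖q‖ < 1) {a : ℂ} (ha : ‖a‖ < 1) (j:ℕ) : a*q^j ≠ 1 := by
  intro h
  have h1 : ‖a*q^j‖ < 1 := by
    rw [norm_mul, norm_pow]
    exact mul_lt_one_left (norm_nonneg _) ha (pow_le_one₀ (norm_nonneg _) hq.le)
  rw [h] at h1; simp at h1

lemma qPochInf_ne {q : ℂ} (hq : ‖q‖ < 1) {a : ℂ} (ha : ‖a‖ < 1) :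
    Π(a;q) ≠ 0 := qPochInf_ne_zero hq (mul_pow_ne_one hq ha)

lemma qPoch_ne {q : ℂ} (hq : ‖q‖ < 1) {a : ℂ} (ha : ‖a‖ < 1) (n:ℕ) :
    qPoch a q n ≠ 0 := qPoch_ne_zero fun j _ => mul_pow_ne_one hq ha j

lemma qPochInf_eq_zero {q : ℂ} (hq : ‖q‖ < 1) {a : ℂ} {j : ℕ} (h : a*q^j = 1) : Π(a;q) = 0 := by
  rw [qPochInf_split hq a (j+1), qPoch_eq_zero (Nat.lt_succ_self j) h, zero_mul]

lemma differentiable_qPochInf {q : ℂ} (hq : ‖q‖ < 1) : Differentiable ℂ fun a => Π(a;q) := by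
  intro a
  have hu : Summable fun j : ℕ => (‖a‖ + 1) * ‖q‖ ^ j :=
    (summable_geometric_of_lt_one (norm_nonneg _) hq).mul_left _
  have h := (Summable.hasProdLocallyUniformlyOn_nat_one_add (f := fun (j:ℕ) (x:ℂ) => -(x*q^j))
    (K := Metric.ball 0 (‖a‖ + 1)) Metric.isOpen_ball hu
    (Eventually.of_forall fun n x hx => by
      rw [norm_neg, norm_mul, norm_pow]
      have : ‖x‖ ≤ ‖a‖ + 1 := by simpa using (mem_ball_zero_iff.1 hx).le
      gcongr) (fun n => by fun_prop))
  have hd : DifferentiableOn ℂ (fun x => ∏' j : ℕ, (1 + -(x*q^j))) (Metric.ball 0 (‖a‖ + 1)) := by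
    refine TendstoLocallyUniformlyOn.differentiableOn h ?_ Metric.isOpen_ball
    refine Eventually.of_forall fun s => ?_
    have : (fun b : ℂ => ∏ i ∈ s, (1 + -(b*q^i))) = fun b => ∏ i ∈ s, (1 + -(b*q^i)) := rfl
    refine DifferentiableOn.fun_finsetProd fun i _ => by fun_prop
  have := hd.differentiableAt (Metric.isOpen_ball.mem_nhds (x := a) (by simp))
  simpa [qPochInf, sub_eq_add_neg] using this

lemma continuous_qPochInf {q : ℂ} (hq : ‖q‖ < 1) : Continuous fun a => Π(a;q) :=
  (differentiable_qPochInf hq).continuous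

/-- Composition lemma that lets `fun_prop`-style arguments pass through `(·; q)_∞`. -/
lemma Continuous.qPochInf {X : Type*} [TopologicalSpace X] {q : ℂ} (hq : ‖q‖ < 1) {f : X → ℂ}
    (hf : Continuous f) : Continuous fun x => Π(f x;q) :=
  (continuous_qPochInf hq).comp hf

lemma exists_norm_qPochInf_le {q : ℂ} (hq : ‖q‖ < 1) (R:ℝ) :
    ∃ M : ℝ, 0 < M ∧ ∀ a : ℂ, ‖a‖ ≤ R → ‖Π(a;q)‖ ≤ M := by
  obtain ⟨M, hM⟩ := (isCompact_closedBall (0:ℂ) R).exists_bound_of_continuousOn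
    (continuous_qPochInf hq).continuousOn
  exact ⟨max M 1, by simp, fun a ha => (hM a (by simp [*])).trans (le_max_left _ _)⟩

lemma exists_le_norm_qPochInf {q : ℂ} (hq : ‖q‖ < 1) {R : ℝ} (hR : R < 1) :
    ∃ M : ℝ, 0 < M ∧ ∀ a : ℂ, ‖a‖ ≤ R → M ≤ ‖Π(a;q)‖ := by
  have hc : ContinuousOn (fun a => (Π(a;q))⁻¹) (Metric.closedBall (0:ℂ) R) :=
    (continuous_qPochInf hq).continuousOn.inv₀ fun a ha =>
      qPochInf_ne hq (lt_of_le_of_lt (by simpa using ha) hR)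
  obtain ⟨M, hM⟩ := (isCompact_closedBall (0:ℂ) R).exists_bound_of_continuousOn hc
  refine ⟨(max M 1)⁻¹, by positivity, fun a ha => ?_⟩
  have h0 := qPochInf_ne hq (lt_of_le_of_lt ha hR)
  have h1 := (hM a (by simpa using ha)).trans (le_max_left M 1); rw [norm_inv] at h1
  exact inv_le_of_inv_le₀ (by positivity) h1

/-- `‖(a; q)_n‖` is bounded uniformly in `n`. -/
lemma exists_norm_qPoch_le {q : ℂ} (hq : ‖q‖ < 1) (a:ℂ) :
    ∃ M : ℝ, 0 < M ∧ ∀ n, ‖qPoch a q n‖ ≤ M := by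
  obtain ⟨M, hM⟩ := (tendsto_qPoch hq a).norm.bddAbove_range
  exact ⟨max M 1, by simp, fun n => (hM ⟨n, rfl⟩).trans (le_max_left _ _)⟩

lemma exists_le_norm_qPoch {q : ℂ} (hq : ‖q‖ < 1) {a : ℂ} (h : ∀ j : ℕ, a*q^j ≠ 1) :
    ∃ M : ℝ, 0 < M ∧ ∀ n, ‖(qPoch a q n)⁻¹‖ ≤ M := by
  obtain ⟨M, hM⟩ := ((tendsto_qPoch hq a).inv₀ (qPochInf_ne_zero hq h)).norm.bddAbove_range
  exact ⟨max M 1, by simp, fun n => (hM ⟨n, rfl⟩).trans (le_max_left _ _)⟩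

lemma tendsto_mul_pow_zero {q : ℂ} (hq : ‖q‖ < 1) (a:ℂ) :
    Tendsto (fun n : ℕ => a*q^n) atTop (𝓝 0) := by
  simpa using (tendsto_pow_atTop_nhds_zero_of_norm_lt_one hq).const_mul a

lemma tendsto_qPochInf_mul_pow {q : ℂ} (hq : ‖q‖ < 1) (a:ℂ) :
    Tendsto (fun n : ℕ => Π(a*q^n;q)) atTop (𝓝 1) := by
  simpa [Function.comp_def] using
    ((continuous_qPochInf hq).tendsto 0).comp (tendsto_mul_pow_zero hq a)

lemma conj_qPoch (a:ℂ) (q:ℝ) (n:ℕ) : conj (qPoch a q n) = qPoch (conj a) q n := by simp [qPoch]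

lemma conj_qPochInf (a:ℂ) {q : ℝ} (hq : ‖(q:ℂ)‖ < 1) : conj (Π(a;q)) = Π(conj a;q) := by
  refine tendsto_nhds_unique ((Complex.continuous_conj.tendsto _).comp (tendsto_qPoch hq a))
    ((tendsto_qPoch hq _).congr fun n => ?_)
  simp [conj_qPoch]

/-! ### Positive complex numbers -/

/-- A complex number that is a positive real. -/
def IsPos (z:ℂ) : Prop := ∃ r : ℝ, 0 < r ∧ z = r

namespace IsPos

lemma of_real {r : ℝ} (h : 0 < r) : IsPos (r:ℂ) := ⟨r, h, rfl⟩

lemma mul {z w : ℂ} (hz : IsPos z) (hw : IsPos w) : IsPos (z*w) := by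
  obtain ⟨r, hr, rfl⟩ := hz; obtain ⟨t, ht, rfl⟩ := hw; exact ⟨r*t, mul_pos hr ht, by simp⟩

lemma inv {z : ℂ} (hz : IsPos z) : IsPos z⁻¹ := by
  obtain ⟨r, hr, rfl⟩ := hz; exact ⟨r⁻¹, inv_pos.2 hr, by simp⟩

lemma div {z w : ℂ} (hz : IsPos z) (hw : IsPos w) : IsPos (z/w) := by
  rw [div_eq_mul_inv]; exact hz.mul hw.inv

lemma pow {z : ℂ} (hz : IsPos z) (n:ℕ) : IsPos (z^n) := by
  obtain ⟨r, hr, rfl⟩ := hz; exact ⟨r^n, pow_pos hr n, by simp⟩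

lemma one : IsPos 1 := ⟨1, one_pos, by simp⟩

lemma ne_zero {z : ℂ} (hz : IsPos z) : z ≠ 0 := by obtain ⟨r, hr, rfl⟩ := hz; exact_mod_cast hr.ne'

lemma re_pos {z : ℂ} (hz : IsPos z) : 0 < z.re := by obtain ⟨r, hr, rfl⟩ := hz; simpa using hr

lemma coe_re {z : ℂ} (hz : IsPos z) : (z.re:ℂ) = z := by obtain ⟨r, hr, rfl⟩ := hz; simp

lemma mul_conj {z : ℂ} (hz : z ≠ 0) : IsPos (z*conj z) :=
  ⟨Complex.normSq z, Complex.normSq_pos.2 hz, Complex.mul_conj z⟩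

lemma sq_sqrt {z : ℂ} (hz : IsPos z) : ((√z.re:ℝ):ℂ)^2 = z := by
  rw [← ofReal_pow, Real.sq_sqrt hz.re_pos.le, hz.coe_re]

lemma sqrt {z : ℂ} (hz : IsPos z) : IsPos ((√z.re:ℝ):ℂ) := .of_real (sqrt_pos.2 hz.re_pos)

lemma eq_of_sq_eq {z w : ℂ} (hz : IsPos z) (hw : IsPos w) (h : z^2 = w^2) : z = w := by
  obtain ⟨r, hr, rfl⟩ := hz; obtain ⟨t, ht, rfl⟩ := hw; have h' : r^2 = t^2 := by exact_mod_cast h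
  rw [(pow_left_inj₀ hr.le ht.le two_ne_zero).1 h']

end IsPos

lemma isPos_qPoch {x q : ℝ} (hq0 : 0 < q) (hq1 : q < 1) (hx : x < 1) (n:ℕ) :
    IsPos (qPoch x q n) := by
  refine ⟨∏ j ∈ range n, (1-x*q^j), Finset.prod_pos fun j _ => ?_, by simp [qPoch]⟩; rw [sub_pos]
  rcases le_or_gt x 0 with h | h
  · exact lt_of_le_of_lt (mul_nonpos_of_nonpos_of_nonneg h (pow_pos hq0 j).le) one_pos
  · exact lt_of_le_of_lt (mul_le_of_le_one_right h.le (pow_le_one₀ hq0.le hq1.le)) hx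

lemma norm_lt_one {q : ℝ} (hq0 : 0 < q) (hq1 : q < 1) : ‖(q:ℂ)‖ < 1 := by
  rwa [norm_real, norm_of_nonneg hq0.le]

lemma isPos_qPochInf {x q : ℝ} (hq0 : 0 < q) (hq1 : q < 1) (hx : x < 1) : IsPos (Π(x;q)) := by
  have hq := norm_lt_one hq0 hq1
  have h0 : Π((x:ℂ);q) ≠ 0 := by
    refine qPochInf_ne_zero hq fun j h => ?_; have h' : x*q^j = 1 := by exact_mod_cast h
    rcases le_or_gt x 0 with h | h
    · have := mul_nonpos_of_nonpos_of_nonneg h (pow_pos hq0 j).le; linarith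
    · have := mul_le_of_le_one_right h.le (pow_le_one₀ hq0.le hq1.le : q^j ≤ 1); linarith
  have ht := tendsto_qPoch hq (x:ℂ)
  have hre : 0 ≤ (Π((x:ℂ);q)).re := ge_of_tendsto' ((Complex.continuous_re.tendsto _).comp ht)
      fun n => (isPos_qPoch hq0 hq1 hx n).re_pos.le
  have him : (Π((x:ℂ);q)).im = 0 := by
    refine tendsto_nhds_unique ((Complex.continuous_im.tendsto _).comp ht)
      (tendsto_const_nhds.congr fun n => ?_)
    have := (isPos_qPoch hq0 hq1 hx n).coe_re; simp only [Function.comp_apply]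
    rw [← this, Complex.ofReal_im]
  refine ⟨(Π((x:ℂ);q)).re, lt_of_le_of_ne hre fun h => h0 ?_, ?_⟩
  · exact Complex.ext h.symm him
  · exact Complex.ext (by simp) (by omega)

/-! ### The Askey-Wilson integral for small parameters -/

/-- `(e z, e / z; q)_∞`. -/
def symPoch (e q z:ℂ) : ℂ := Π(e*z;q)*Π(e*z⁻¹;q)

@[simp] lemma symPoch_zero_left (q z:ℂ) : symPoch 0 q z = 1 := by simp [symPoch]

lemma symPoch_inv (e q z:ℂ) : symPoch e q z⁻¹ = symPoch e q z := by simp [symPoch, mul_comm]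

lemma symPoch_step {q : ℂ} (hq : ‖q‖ < 1) (e z:ℂ) :
    symPoch e q z = (1-e*z)*(1-e*z⁻¹)*symPoch (e*q) q z := by
  rw [symPoch, qPochInf_step hq (e*z), qPochInf_step hq (e*z⁻¹), symPoch]
  rw [mul_right_comm e z q, mul_right_comm e z⁻¹ q]; ring

lemma symPoch_ne_zero {q : ℂ} (hq : ‖q‖ < 1) {e z : ℂ} (h1 : ‖e*z‖ < 1) (h2 : ‖e*z⁻¹‖ < 1) :
    symPoch e q z ≠ 0 :=
  mul_ne_zero (qPochInf_ne hq h1) (qPochInf_ne hq h2)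

lemma symPoch_ne {q : ℂ} (hq : ‖q‖ < 1) {e z : ℂ} (he : ‖e‖ < 1)
    (hz : ‖z‖ = 1) : symPoch e q z ≠ 0 :=
  symPoch_ne_zero hq (by simp [hz, he]) (by simp [hz, he])

/-- If `‖b z‖` and `‖b / z‖` stay below a constant `ρ < 1`, the factor `(b z, b / z; q)_∞` in the
denominator may be removed in the limit `b → 0` along `b q^n`. -/
lemma tendsto_integral_div_symPoch {X : Type*} [MeasurableSpace X] {μ : Measure X} {g : X → ℂ}
    (hg : Integrable g μ) {z : X → ℂ} (hz : Measurable z) {q b : ℂ} (hq : ‖q‖ < 1) {ρ : ℝ}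
    (hρ : ρ < 1) (h1 : ∀ᵐ x ∂μ, ‖b*z x‖ ≤ ρ) (h2 : ∀ᵐ x ∂μ, ‖b*(z x)⁻¹‖ ≤ ρ) :
    Tendsto (fun n : ℕ => ∫ x, g x/symPoch (b*q^n) q (z x) ∂μ) atTop (𝓝 (∫ x, g x ∂μ)) := by
  obtain ⟨M, hM, hMb⟩ := exists_le_norm_qPochInf hq hρ
  have key : ∀ n : ℕ, ∀ w : ℂ, ‖b*w‖ ≤ ρ → M ≤ ‖Π(b*q^n*w;q)‖ := by
    intro n w hw; apply hMb; rw [mul_right_comm, norm_mul, norm_pow]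
    exact (mul_le_of_le_one_right (norm_nonneg _) (pow_le_one₀ (norm_nonneg _) hq.le)).trans hw
  refine tendsto_integral_of_dominated_convergence (fun x => ‖g x‖ * (M*M)⁻¹) (fun n => ?_)
    (hg.norm.mul_const _) (fun n => ?_) ?_
  · have : Measurable fun x => symPoch (b*q^n) q (z x) :=
      ((continuous_qPochInf hq).measurable.comp (hz.const_mul _)).mul
        ((continuous_qPochInf hq).measurable.comp (hz.inv.const_mul _))
    exact hg.aestronglyMeasurable.mul this.inv.aestronglyMeasurable
  · filter_upwards [h1, h2] with x hx1 hx2; rw [norm_div, div_eq_mul_inv, symPoch, norm_mul]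
    have e1 := key n _ hx1; have e2 := key n _ hx2; gcongr
  · refine Eventually.of_forall fun x => ?_
    have t1 : ∀ w : ℂ, Tendsto (fun n : ℕ => Π(b*q^n*w;q)) atTop (𝓝 1) := by
      intro w; refine (tendsto_qPochInf_mul_pow hq (b*w)).congr fun n => ?_; rw [mul_right_comm]
    have := ((t1 (z x)).mul (t1 (z x)⁻¹))
    have h := (tendsto_const_nhds (x := g x)).div this (by simp); simp only [mul_one, div_one] at h
    exact h

/-- `(z², z⁻²; q)_∞ / ∏_{e = a, b, c, d} (e z, e / z; q)_∞`. -/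
def awKernel (a b c d q z:ℂ) : ℂ := Π(z^2;q)*Π((z^2)⁻¹;q) /
    (symPoch a q z*symPoch b q z*symPoch c q z*symPoch d q z)

/-- The integral of the Askey-Wilson kernel over the unit circle. -/
def awCircle (a b c d q:ℂ) : ℂ := ∫ θ in (0:ℝ)..2*π, awKernel a b c d q (exp (θ*I))

lemma norm_exp_mul_I (θ:ℝ) : ‖exp (θ*I)‖ = 1 := by rw [Complex.norm_exp_ofReal_mul_I]

lemma continuous_symPoch_exp {q : ℂ} (hq : ‖q‖ < 1) (e:ℂ) :
    Continuous fun θ : ℝ => symPoch e q (exp (θ*I)) := by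
  have h : Continuous fun θ : ℝ => exp (θ*I) := by fun_prop
  exact (Continuous.qPochInf hq (continuous_const.mul h)).mul
    (Continuous.qPochInf hq (continuous_const.mul (h.inv₀ fun θ => exp_ne_zero _)))

lemma continuous_awKernel_exp {q a b c d : ℂ} (hq : ‖q‖ < 1) (ha : ‖a‖ < 1) (hb : ‖b‖ < 1)
    (hc : ‖c‖ < 1) (hd : ‖d‖ < 1) :
    Continuous fun θ : ℝ => awKernel a b c d q (exp (θ*I)) := by
  have h : Continuous fun θ : ℝ => exp (θ*I) := by fun_prop
  have hn : Continuous fun θ : ℝ => (exp (θ*I)^2)⁻¹ :=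
    (h.pow 2).inv₀ fun θ => pow_ne_zero _ (exp_ne_zero _)
  have hs := continuous_symPoch_exp hq
  refine ((Continuous.qPochInf hq (h.pow 2)).mul (Continuous.qPochInf hq hn)).div
    ((((hs a).mul (hs b)).mul (hs c)).mul (hs d)) fun θ => ?_
  have hz := norm_exp_mul_I θ
  exact mul_ne_zero (mul_ne_zero (mul_ne_zero (symPoch_ne hq ha hz)
    (symPoch_ne hq hb hz)) (symPoch_ne hq hc hz))
    (symPoch_ne hq hd hz)

/-- Integrals of `f` over circles of radius `p` and `p⁻¹` with respect to the angle agree. -/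
lemma integral_circle_eq_of_annulus {p : ℝ} (hp0 : 0 < p) (hp1 : p ≤ 1) {f : ℂ → ℂ}
    (hf : ∀ z : ℂ, p ≤ ‖z‖ → ‖z‖ ≤ p⁻¹ → DifferentiableAt ℂ f z) :
    ∫ θ in (0:ℝ)..2*π, f ((p:ℂ)⁻¹*exp (θ*I)) = ∫ θ in (0:ℝ)..2*π, f (p*exp (θ*I)) := by
  have h := Complex.circleIntegral_sub_center_inv_smul_eq_of_differentiable_on_annulus_off_countable
    (c := 0) (r := p) (R := p⁻¹) hp0 (hp1.trans (one_le_inv₀ hp0 |>.2 hp1)) (f := f) (s := ∅)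
    Set.countable_empty
    (fun z hz => by
      simp only [Set.mem_sdiff, Metric.mem_closedBall, dist_zero_right, Metric.mem_ball, not_lt] at hz
      exact (hf z hz.2 hz.1).continuousAt.continuousWithinAt)
    (fun z hz => by
      simp only [Set.mem_sdiff, Metric.mem_closedBall, dist_zero_right, Metric.mem_ball, not_le] at hz
      exact hf z hz.1.2.le hz.1.1.le)
  have aux : ∀ R : ℝ, 0 < R → (∮ z in C(0, R), (z-0)⁻¹ • f z) =
      I * ∫ θ in (0:ℝ)..2*π, f (R*exp (θ*I)) := by
    intro R hR; rw [circleIntegral, ← intervalIntegral.integral_const_mul]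
    refine intervalIntegral.integral_congr fun θ _ => ?_
    have hR' : (R:ℂ) ≠ 0 := by exact_mod_cast hR.ne'
    simp only [deriv_circleMap, circleMap, zero_add, sub_zero, smul_eq_mul]; field_simp
  rw [aux _ (inv_pos.2 hp0), aux _ hp0] at h; have := mul_left_cancel₀ Complex.I_ne_zero h
  rw [← this]; push_cast; rfl

lemma differentiableAt_symPoch {q e z : ℂ} (hq : ‖q‖ < 1) (hz : z ≠ 0) :
    DifferentiableAt ℂ (fun z => symPoch e q z) z := by
  have h1 : DifferentiableAt ℂ (fun z : ℂ => Π(e*z;q)) z :=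
    DifferentiableAt.comp z (g := fun a => Π(a;q)) (differentiable_qPochInf hq _)
      (differentiableAt_id.const_mul e)
  have h2 : DifferentiableAt ℂ (fun z : ℂ => Π(e*z⁻¹;q)) z :=
    DifferentiableAt.comp z (g := fun a => Π(a;q)) (differentiable_qPochInf hq _)
      ((differentiableAt_inv hz).const_mul e)
  exact h1.mul h2

/-- The first moment of the Askey-Wilson kernel: the integrand is the difference of the values of a
function at `q^{1/2} z` and `q^{-1/2} z`, so it integrates to zero by Cauchy's theorem. -/
lemma integral_awKernel_moment {q : ℝ} (hq0 : 0 < q) (hq1 : q < 1) {a b c d : ℂ} (ha : ‖a‖ < 1)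
    (hb : ‖b‖ < 1) (hc : ‖c‖ < 1) (hd : ‖d‖ < 1) :
    ∫ θ in (0:ℝ)..2*π, awKernel a b c d q (exp (θ*I)) * ((1-a*b*c*d)*(exp (θ*I)+(exp (θ*I))⁻¹) -
        ((a+b+c+d)-(a*b*c+a*b*d+a*c*d+b*c*d))) = 0 := by
  have hq := norm_lt_one hq0 hq1; set p := √q with hp; have hp0 : 0 < p := sqrt_pos.2 hq0
  have hp1 : p < 1 := by rw [hp, Real.sqrt_lt' one_pos]; simpa using hq1
  have hpp : (p:ℂ)^2 = q := by rw [← ofReal_pow, hp, Real.sq_sqrt hq0.le]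
  have hpc := ofReal_ne hp0
  set f : ℂ → ℂ := fun z => (z-z⁻¹)*(Π(q*z^2;q)*Π(q*(z^2)⁻¹;q)) /
    (symPoch (a*p) q z*symPoch (b*p) q z*symPoch (c*p) q z*symPoch (d*p) q z) with hf
  have hdiff : ∀ z : ℂ, p ≤ ‖z‖ → ‖z‖ ≤ p⁻¹ → DifferentiableAt ℂ f z := by
    intro z h1 h2; have hz : z ≠ 0 := norm_pos_iff.1 (hp0.trans_le h1)
    have hn : ∀ e : ℂ, ‖e‖ < 1 → symPoch (e*p) q z ≠ 0 := by
      intro e he; refine symPoch_ne_zero hq ?_ ?_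
      · rw [norm_mul, norm_mul, norm_real, norm_of_nonneg hp0.le, mul_assoc]
        calc ‖e‖ * (p * ‖z‖) ≤ ‖e‖ * (p*p⁻¹) := by gcongr
          _ < 1 := by rw [mul_inv_cancel₀ hp0.ne', mul_one]; exact he
      · rw [norm_mul, norm_mul, norm_inv, norm_real, norm_of_nonneg hp0.le, mul_assoc]
        calc ‖e‖ * (p * ‖z‖⁻¹) ≤ ‖e‖ * (p*p⁻¹) := by gcongr
          _ < 1 := by rw [mul_inv_cancel₀ hp0.ne', mul_one]; exact he
    have hi : DifferentiableAt ℂ (fun z : ℂ => z⁻¹) z := differentiableAt_inv hz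
    have h3 : DifferentiableAt ℂ (fun z : ℂ => Π(q*z^2;q)) z :=
      DifferentiableAt.comp z (g := fun a => Π(a;q)) (differentiable_qPochInf hq _) (by fun_prop)
    have h4 : DifferentiableAt ℂ (fun z : ℂ => Π(q*(z^2)⁻¹;q)) z :=
      DifferentiableAt.comp z (g := fun a => Π(a;q)) (differentiable_qPochInf hq _)
        (((differentiableAt_id.pow 2).inv (pow_ne_zero 2 hz)).const_mul _)
    have hs : ∀ e : ℂ, DifferentiableAt ℂ (fun z => symPoch (e*p) q z) z :=
      fun e => differentiableAt_symPoch hq hz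
    exact (((differentiableAt_id.sub hi).mul (h3.mul h4)).div
      ((((hs a).mul (hs b)).mul (hs c)).mul (hs d))
      (mul_ne_zero (mul_ne_zero (mul_ne_zero (hn a ha) (hn b hb)) (hn c hc)) (hn d hd)))
  have key := integral_circle_eq_of_annulus hp0 hp1.le hdiff
  have hci : ∀ r : ℝ, 0 < r → p ≤ r → r ≤ p⁻¹ → IntervalIntegrable
      (fun θ : ℝ => f (r*exp (θ*I))) volume 0 (2*π) := by
    intro r hr h1 h2; refine Continuous.intervalIntegrable ?_ _ _; rw [continuous_iff_continuousAt]
    intro θ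
    have hz : ‖(r:ℂ)*exp (θ*I)‖ = r := by
      rw [norm_mul, norm_exp_mul_I, mul_one, norm_real, norm_of_nonneg hr.le]
    refine ContinuousAt.comp (f := fun θ : ℝ => (r:ℂ)*exp (θ*I))
      (hdiff _ (by rw [hz]; exact h1) (by rw [hz]; exact h2)).continuousAt ?_
    fun_prop
  have i1 := hci p⁻¹ (inv_pos.2 hp0) (hp1.le.trans (one_le_inv₀ hp0 |>.2 hp1.le)) le_rfl
  have i2 := hci p hp0 le_rfl (hp1.le.trans (one_le_inv₀ hp0 |>.2 hp1.le)); push_cast at i1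
  rw [← sub_eq_zero, ← intervalIntegral.integral_sub i1 i2] at key
  have : ∀ θ : ℝ, awKernel a b c d q (exp (θ*I)) * ((1-a*b*c*d)*(exp (θ*I)+(exp (θ*I))⁻¹) -
        ((a+b+c+d)-(a*b*c+a*b*d+a*c*d+b*c*d))) =
      p*(f ((p:ℂ)⁻¹*exp (θ*I))-f (p*exp (θ*I))) := by
    intro θ; set z := exp (θ*I) with hz; have hz0 : z ≠ 0 := exp_ne_zero _
    have hz1 : ‖z‖ = 1 := norm_exp_mul_I θ
    have hs1 : ∀ e : ℂ, ‖e‖ < 1 → symPoch (e*p) q ((p:ℂ)⁻¹*z) = symPoch e q z/(1-e*z⁻¹) := by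
      intro e he
      have h1 : 1-e*z⁻¹ ≠ 0 := by
        intro h; have : ‖e*z⁻¹‖ = 1 := by rw [← sub_eq_zero.1 h]; simp
        rw [norm_mul, norm_inv, hz1] at this; simp at this; linarith
      rw [eq_div_iff h1, symPoch, symPoch, qPochInf_step hq (e*z⁻¹),
        show e*(p:ℂ)*((p:ℂ)⁻¹*z) = e*z by field_simp,
        show e*(p:ℂ)*((p:ℂ)⁻¹*z)⁻¹ = e*z⁻¹*q by rw [← hpp]; field_simp]
      ring
    have hs2 : ∀ e : ℂ, ‖e‖ < 1 → symPoch (e*p) q (p*z) = symPoch e q z/(1-e*z) := by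
      intro e he
      have h1 : 1-e*z ≠ 0 := by
        intro h; have : ‖e*z‖ = 1 := by rw [← sub_eq_zero.1 h]; simp
        rw [norm_mul, hz1] at this; simp at this; linarith
      rw [eq_div_iff h1, symPoch, symPoch, qPochInf_step hq (e*z)]
      rw [show e*(p:ℂ)*(p*z)⁻¹ = e*z⁻¹ by field_simp,
        show e*(p:ℂ)*(p*z) = e*z*q by rw [← hpp]; ring]
      ring
    have n1 := symPoch_ne hq ha hz1; have n2 := symPoch_ne hq hb hz1
    have n3 := symPoch_ne hq hc hz1; have n4 := symPoch_ne hq hd hz1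
    simp only [hf, hs1 a ha, hs1 b hb, hs1 c hc, hs1 d hd, hs2 a ha, hs2 b hb, hs2 c hc, hs2 d hd,
      awKernel]
    rw [show (q:ℂ)*((p:ℂ)⁻¹*z)^2 = z^2 by rw [← hpp]; field_simp,
      show (q:ℂ)*((p*z)^2)⁻¹ = (z^2)⁻¹ by rw [← hpp]; field_simp,
      show (q:ℂ)*(((p:ℂ)⁻¹*z)^2)⁻¹ = (z^2)⁻¹*q*q by rw [← hpp]; field_simp,
      show (q:ℂ)*(p*z)^2 = z^2*q*q by rw [← hpp]; ring,
      qPochInf_step hq ((z^2)⁻¹), qPochInf_step hq ((z^2)⁻¹*q), qPochInf_step hq (z^2),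
      qPochInf_step hq (z^2*q)]
    generalize Π(z^2*q*q;q) = N1; generalize Π((z^2)⁻¹*q*q;q) = N2
    generalize symPoch a q z = s1 at *
    generalize symPoch b q z = s2 at *
    generalize symPoch c q z = s3 at *
    generalize symPoch d q z = s4 at *
    rw [← hpp]
    clear_value z p
    simp only [div_eq_mul_inv, mul_inv, inv_inv]; field_simp; ring
  rw [intervalIntegral.integral_congr fun θ _ => this θ, intervalIntegral.integral_const_mul, key,
    mul_zero]

/-- `(x, -x, q^{1/2} x, -q^{1/2} x; q)_∞ = (x²; q)_∞`. -/
lemma qPochInf_sq {q p : ℂ} (hq : ‖q‖ < 1) (hp : p^2 = q) (x:ℂ) :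
    Π(x;q)*Π(-x;q)*(Π(p*x;q)*Π(-(p*x);q)) = Π(x^2;q) := by
  have hm := multipliable_qPochInf hq
  have h2 : ‖q^2‖ < 1 := by rw [norm_pow]; exact pow_lt_one₀ (norm_nonneg _) hq two_ne_zero
  have e1 : ∀ j : ℕ, (1-x*q^j)*(1 - -x*q^j) = 1-x^2*q^(2*j) := by intro j; ring
  have e2 : ∀ j : ℕ, (1-p*x*q^j)*(1 - -(p*x)*q^j) = 1-x^2*q^(2*j+1) := by
    intro j; rw [pow_succ (q:ℂ) (2*j)]
    nth_rewrite 4 [← hp]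
    ring
  unfold qPochInf
  rw [← (hm x).tprod_mul (hm (-x)), ← (hm (p*x)).tprod_mul (hm (-(p*x))),
    tprod_congr e1, tprod_congr e2]
  refine tprod_even_mul_odd (f := fun j => 1-x^2*q^j) ?_ ?_
  · refine (multipliable_qPochInf h2 (x^2)).congr fun j => by rw [← pow_mul]
  · refine (multipliable_qPochInf h2 (x^2*q)).congr fun j => by rw [← pow_mul]; ring

/-- The total mass `(abcd; q)_∞ / (q, ab, ac, ad, bc, bd, cd; q)_∞`. -/
def awTotal (q a b c d:ℂ) : ℂ := Π(a*b*c*d;q)/(Π(q;q)*(Π(a*b;q)*Π(a*c;q) *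
    Π(a*d;q)*Π(b*c;q)*Π(b*d;q)*Π(c*d;q)))

lemma awCircle_swap₁ (a b c d q:ℂ) : awCircle a b c d q = awCircle b a c d q := by
  unfold awCircle awKernel; refine intervalIntegral.integral_congr fun θ _ => ?_; ring

lemma awCircle_swap₂ (a b c d q:ℂ) : awCircle a b c d q = awCircle c b a d q := by
  unfold awCircle awKernel; refine intervalIntegral.integral_congr fun θ _ => ?_; ring

lemma awCircle_swap₃ (a b c d q:ℂ) : awCircle a b c d q = awCircle d b c a q := by
  unfold awCircle awKernel; refine intervalIntegral.integral_congr fun θ _ => ?_; ring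

lemma norm_mul_lt_one {x y : ℂ} (hx : ‖x‖ < 1) (hy : ‖y‖ < 1) : ‖x*y‖ < 1 := by
  rw [norm_mul]; exact mul_lt_one_left (norm_nonneg _) hx hy.le

lemma one_sub_ne {x : ℂ} (hx : ‖x‖ < 1) : 1-x ≠ 0 := by
  intro h; rw [← sub_eq_zero.1 h] at hx; simp at hx

/-- The quotient of the integral of the Askey-Wilson kernel and its conjectured value, up to the
factor `(q; q)_∞`. -/
def awRatio (a b c d q:ℂ) : ℂ := awCircle a b c d q*(Π(a*b;q)*Π(a*c;q) *
    Π(a*d;q)*Π(b*c;q)*Π(b*d;q)*Π(c*d;q)) /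
    Π(a*b*c*d;q)

section Small

variable {q : ℝ} (hq0 : 0 < q) (hq1 : q < 1) {a b c d : ℂ} (ha : ‖a‖ < 1)
    (hb : ‖b‖ < 1) (hc : ‖c‖ < 1) (hd : ‖d‖ < 1)

include hq0 hq1 ha hb hc hd

lemma awCircle_shift : awCircle (a*q) b c d q*(1-a*b*c*d) =
      awCircle a b c d q*((1-a*b)*(1-a*c)*(1-a*d)) := by
  have hq := norm_lt_one hq0 hq1; have hi := (continuous_awKernel_exp hq ha hb hc hd)
  have hm := integral_awKernel_moment hq0 hq1 ha hb hc hd; unfold awCircle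
  rw [← intervalIntegral.integral_mul_const, ← intervalIntegral.integral_mul_const,
    ← sub_eq_zero, ← intervalIntegral.integral_sub]
  · rw [← mul_zero (-a), ← hm, ← intervalIntegral.integral_const_mul]
    refine intervalIntegral.integral_congr fun θ _ => ?_; set z := exp (θ*I) with hz
    have hz0 : z ≠ 0 := exp_ne_zero _; have hz1 : ‖z‖ = 1 := norm_exp_mul_I θ
    have haq : ‖a*q‖ < 1 := norm_mul_lt_one ha hq; have n1 := symPoch_ne hq haq hz1
    have n2 := symPoch_ne hq hb hz1; have n3 := symPoch_ne hq hc hz1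
    have n4 := symPoch_ne hq hd hz1; have m1 : 1-a*z ≠ 0 := one_sub_ne (by simp [hz1, ha])
    have m2 : 1-a*z⁻¹ ≠ 0 := one_sub_ne (by simp [hz1, ha])
    have e : awKernel (a*q) b c d q z = awKernel a b c d q z*((1-a*z)*(1-a*z⁻¹)) := by
      unfold awKernel; rw [symPoch_step hq a z]; have m3 := mul_ne_zero m1 m2
      generalize (1-a*z)*(1-a*z⁻¹) = m at *
      field_simp
    rw [e]; have hzz : z*z⁻¹ = 1 := mul_inv_cancel₀ hz0
    linear_combination (awKernel a b c d q z*a^2*(1-a*b*c*d))*hzz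
  · exact ((continuous_awKernel_exp hq (norm_mul_lt_one ha hq) hb hc hd).mul
        continuous_const).intervalIntegrable _ _
  · exact (hi.mul continuous_const).intervalIntegrable _ _

lemma awRatio_shift : awRatio (a*q) b c d q = awRatio a b c d q := by
  have hq := norm_lt_one hq0 hq1; have h := awCircle_shift hq0 hq1 ha hb hc hd
  have h4 : ‖a*b*c*d‖ < 1 := norm_mul_lt_one (norm_mul_lt_one (norm_mul_lt_one ha hb) hc) hd
  have n1 := qPochInf_ne hq (norm_mul_lt_one h4 hq); have n2 := one_sub_ne h4; unfold awRatio
  rw [qPochInf_step hq (a*b), qPochInf_step hq (a*c), qPochInf_step hq (a*d),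
    qPochInf_step hq (a*b*c*d),
    show a*(q:ℂ)*b = a*b*q by ring, show a*(q:ℂ)*c = a*c*q by ring,
    show a*(q:ℂ)*d = a*d*q by ring,
    show a*b*q*c*d = a*b*c*d*q by ring]
  rw [div_eq_div_iff n1 (mul_ne_zero n2 n1)]
  linear_combination (Π(a*b*q;q)*Π(a*c*q;q)*Π(a*d*q;q) * Π(b*c;q)*Π(b*d;q)*Π(c*d;q) *
    Π(a*b*c*d*q;q))*h

lemma awRatio_eq_zero_left : awRatio a b c d q = awRatio 0 b c d q := by
  have hq := norm_lt_one hq0 hq1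
  have hconst : ∀ n : ℕ, awRatio (a*q^n) b c d q = awRatio a b c d q := by
    intro n
    induction n with
    | zero => simp
    | succ n ih =>
      rw [pow_succ, ← mul_assoc, awRatio_shift hq0 hq1 ?_ hb hc hd, ih]; rw [norm_mul, norm_pow]
      exact mul_lt_one_left (norm_nonneg _) ha (pow_le_one₀ (norm_nonneg _) hq.le)
  have hJ : Tendsto (fun n : ℕ => awCircle (a*q^n) b c d q) atTop (𝓝 (awCircle 0 b c d q)) := by
    have hpi : (0:ℝ) ≤ 2*π := by positivity
    have hg := (continuous_awKernel_exp hq (a := 0) (by simp) hb hc hd).intervalIntegrable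
      (μ := volume) 0 (2*π)
    rw [intervalIntegrable_iff_integrableOn_Ioc_of_le hpi] at hg
    have := tendsto_integral_div_symPoch (b := a) hg
      (z := fun θ : ℝ => exp (θ*I)) (by fun_prop) hq ha
      (Eventually.of_forall fun θ => by rw [norm_mul, norm_exp_mul_I, mul_one])
      (Eventually.of_forall fun θ => by rw [norm_mul, norm_inv, norm_exp_mul_I, inv_one, mul_one])
    unfold awCircle; simp only [intervalIntegral.integral_of_le hpi]; refine this.congr fun n => ?_
    refine integral_congr_ae (Eventually.of_forall fun θ => ?_)
    simp only [awKernel, symPoch_zero_left, one_mul]; rw [div_div]; congr 1; ring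
  have hc1 := continuous_qPochInf hq; have ht := tendsto_mul_pow_zero hq a
  have hT : Tendsto (fun n : ℕ => awRatio (a*q^n) b c d q) atTop (𝓝 (awRatio 0 b c d q)) := by
    unfold awRatio
    have f : ∀ x : ℂ, Tendsto (fun n : ℕ => Π(a*q^n*x;q)) atTop
        (𝓝 (Π(0*x;q))) := fun x => (hc1.tendsto _).comp (ht.mul_const x)
    have f4 : Tendsto (fun n : ℕ => Π(a*q^n*b*c*d;q)) atTop (𝓝 (Π(0*b*c*d;q))) :=
      (hc1.tendsto _).comp (((ht.mul_const b).mul_const c).mul_const d)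
    exact (hJ.mul ((((((f b).mul (f c)).mul (f d)).mul tendsto_const_nhds).mul
      tendsto_const_nhds).mul tendsto_const_nhds)).div f4 (by simp)
  exact tendsto_nhds_unique (tendsto_const_nhds.congr fun n => (hconst n).symm) hT

end Small

lemma awRatio_swap₁ (a b c d q:ℂ) : awRatio a b c d q = awRatio b a c d q := by
  unfold awRatio; rw [awCircle_swap₁, mul_comm a b]; ring

lemma awRatio_swap₂ (a b c d q:ℂ) : awRatio a b c d q = awRatio c b a d q := by
  unfold awRatio
  rw [awCircle_swap₂, mul_comm c b, mul_comm b a, mul_comm c a, show b*c*a*d = a*b*c*d by ring]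
  ring

lemma awRatio_swap₃ (a b c d q:ℂ) : awRatio a b c d q = awRatio d b c a q := by
  unfold awRatio
  rw [awCircle_swap₃, mul_comm d b, mul_comm d c, mul_comm d a, mul_comm b a, mul_comm c a,
    show a*b*c*d = b*d*c*a by ring]
  ring

lemma awRatio_eq_const {q : ℝ} (hq0 : 0 < q) (hq1 : q < 1) {a b c d : ℂ} (ha : ‖a‖ < 1)
    (hb : ‖b‖ < 1) (hc : ‖c‖ < 1) (hd : ‖d‖ < 1) :
    awRatio a b c d q = awRatio 0 0 0 0 q := by
  have h0 : ‖(0:ℂ)‖ < 1 := by simp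
  rw [awRatio_eq_zero_left hq0 hq1 ha hb hc hd, awRatio_swap₁,
    awRatio_eq_zero_left hq0 hq1 hb h0 hc hd, awRatio_swap₂,
    awRatio_eq_zero_left hq0 hq1 hc h0 h0 hd, awRatio_swap₃,
    awRatio_eq_zero_left hq0 hq1 hd h0 h0 h0]

lemma integral_two_sub_sq : ∫ θ in (0:ℝ)..2*π, ((1-exp (θ*I)^2) *
      (1-(exp (θ*I)^2)⁻¹)) = (4*π:ℂ) := by
  have h : ∀ θ : ℝ, (1-exp (θ*I)^2) * (1-(exp (θ*I)^2)⁻¹) = ((2-2*cos (2*θ) : ℝ) : ℂ) := by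
    intro θ; push_cast; rw [← Complex.exp_nat_mul, ← exp_neg, Complex.cos]
    have e : exp (((2:ℕ):ℂ)*(θ*I)) * exp (-(((2:ℕ):ℂ)*(θ*I))) = 1 := by rw [← Complex.exp_add]; simp
    push_cast at e ⊢
    rw [show (2*(θ:ℂ)*I) = 2*(θ*I) by ring, show (-(2*(θ:ℂ))*I) = -(2*(θ*I)) by ring]
    linear_combination e
  rw [intervalIntegral.integral_congr fun θ _ => h θ, intervalIntegral.integral_ofReal]
  rw [intervalIntegral.integral_sub (by simp) ((by fun_prop : Continuous _).intervalIntegrable _ _),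
    intervalIntegral.integral_const_mul, intervalIntegral.integral_comp_mul_left _ two_ne_zero]
  have : Real.sin (2*(2*π)) = 0 := by
    rw [show 2*(2*π) = (4:ℕ)*π by push_cast; ring, Real.sin_nat_mul_pi]
  simp [this]; ring

/-- For the parameters `(q, -q, q^{1/2}, -q^{1/2})` the Askey-Wilson kernel is a trigonometric
polynomial. -/
lemma awRatio_zero {q : ℝ} (hq0 : 0 < q) (hq1 : q < 1) : awRatio 0 0 0 0 q*Π(q;q) = 4*π := by
  have hq := norm_lt_one hq0 hq1; set p := √q with hp; have hp0 : 0 < p := sqrt_pos.2 hq0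
  have hp1 : p < 1 := by rw [hp, Real.sqrt_lt' one_pos]; simpa using hq1
  have hpp : (p:ℂ)^2 = q := by rw [← ofReal_pow, hp, Real.sq_sqrt hq0.le]
  have hpn := norm_lt_one hp0 hp1; have hqn : ‖-(q:ℂ)‖ < 1 := by simpa using hq
  have hpn' : ‖-(p:ℂ)‖ < 1 := by simpa using hpn
  rw [← awRatio_eq_const hq0 hq1 hq hqn hpn hpn']
  have hJ : awCircle (q:ℂ) (-q) p (-p) q = 4*π := by
    rw [← integral_two_sub_sq]; refine intervalIntegral.integral_congr fun θ _ => ?_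
    set z := exp (θ*I) with hz; have hz0 : z ≠ 0 := exp_ne_zero _
    have hz1 : ‖z‖ = 1 := norm_exp_mul_I θ; have n1 := symPoch_ne hq hq hz1
    have n2 := symPoch_ne hq hqn hz1; have n3 := symPoch_ne hq hpn hz1
    have n4 := symPoch_ne hq hpn' hz1; have e1 := qPochInf_sq hq hpp z
    have e2 := qPochInf_sq hq hpp z⁻¹; rw [qPochInf_step hq z, qPochInf_step hq (-z)] at e1
    rw [qPochInf_step hq z⁻¹, qPochInf_step hq (-z⁻¹)] at e2; unfold awKernel
    rw [div_eq_iff (mul_ne_zero (mul_ne_zero (mul_ne_zero n1 n2) n3) n4), inv_pow z 2 |>.symm,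
      ← e1, ← e2]
    unfold symPoch; simp only [neg_mul, mul_comm (q:ℂ)]; ring
  unfold awRatio; rw [hJ]; have e := qPochInf_sq hq hpp (p:ℂ)
  rw [hpp, show (p:ℂ)*p = q by rw [← hpp]; ring] at e; have hqq := qPochInf_ne hq hq
  have e' : Π((p:ℂ);q)*Π(-p;q)*Π(-q;q) = 1 := by
    refine mul_right_cancel₀ hqq ?_; linear_combination e
  rw [qPochInf_step hq (p:ℂ), qPochInf_step hq (-p:ℂ), qPochInf_step hq (-q:ℂ)] at e'
  have hn : ‖(q:ℂ) * -q*p * -p‖ < 1 :=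
    norm_mul_lt_one (norm_mul_lt_one (norm_mul_lt_one hq hqn) hpn) hpn'
  have n5 := qPochInf_ne hq hn
  have e3 : Π((q:ℂ);q) = (1-q)*(1-q^2)*Π((q:ℂ) * -q*p * -p;q) := by
    rw [qPochInf_step hq (q:ℂ), qPochInf_step hq ((q:ℂ)*q),
      show (q:ℂ) * -q*p * -p = q*q*q by linear_combination (q:ℂ)*q*hpp]
    ring
  rw [div_mul_eq_mul_div, div_eq_iff n5, e3,
    show (q:ℂ)*p = p*q by ring, show (q:ℂ) * -p = -p*q by ring,
    show -(q:ℂ)*p = -p*q by ring, show -(q:ℂ) * -p = p*q by ring,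
    show (p:ℂ) * -p = -q by rw [← hpp]; ring, show (q:ℂ) * -q = -q*q by ring]
  set P1 := Π((p:ℂ)*q;q); set P2 := Π(-(p:ℂ)*q;q); rw [qPochInf_step hq (-(q:ℂ))]
  set P3 := Π(-(q:ℂ)*q;q); have hp2 : (1-(p:ℂ))*(1+p) = 1-q := by rw [← hpp]; ring
  have e4 : (1-(q:ℂ))*(1+q)*(P1*P2*P3) = 1 := by linear_combination e'-(1+(q:ℂ))*P1*P2*P3*hp2
  set N := Π(-(q:ℂ)*q*p * -p;q)
  linear_combination (4*π*Π(-(q:ℂ)*q*p * -p;q)) * ((1-(q:ℂ))*(1+q)*(P1*P2*P3)+1)*e4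

/-- The **Askey-Wilson integral** over the unit circle. -/
theorem awCircle_eq {q : ℝ} (hq0 : 0 < q) (hq1 : q < 1) {a b c d : ℂ} (ha : ‖a‖ < 1)
    (hb : ‖b‖ < 1) (hc : ‖c‖ < 1) (hd : ‖d‖ < 1) :
    awCircle a b c d q = 4*π*awTotal q a b c d := by
  have hq := norm_lt_one hq0 hq1; have h := awRatio_zero hq0 hq1
  rw [← awRatio_eq_const hq0 hq1 ha hb hc hd, awRatio] at h
  have h4 : ‖a*b*c*d‖ < 1 := norm_mul_lt_one (norm_mul_lt_one (norm_mul_lt_one ha hb) hc) hd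
  have n0 := qPochInf_ne hq h4; have n1 := qPochInf_ne hq (norm_mul_lt_one ha hb)
  have n2 := qPochInf_ne hq (norm_mul_lt_one ha hc)
  have n3 := qPochInf_ne hq (norm_mul_lt_one ha hd)
  have n4 := qPochInf_ne hq (norm_mul_lt_one hb hc)
  have n5 := qPochInf_ne hq (norm_mul_lt_one hb hd)
  have n6 := qPochInf_ne hq (norm_mul_lt_one hc hd); have n7 := qPochInf_ne hq hq; rw [← h, awTotal]
  field_simp

/-! ### Products in the variable `y = (z + z⁻¹) / 2` -/

lemma expArg_mul (y:ℝ) : expArg y*((y:ℂ)-((y:ℂ)^2-1)^(1/2:ℂ)) = 1 := by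
  have h : (((y:ℂ)^2-1)^(1/2:ℂ))^2 = (y:ℂ)^2-1 := by simp
  unfold expArg; grind

lemma expArg_ne_zero (y:ℝ) : expArg y ≠ 0 := left_ne_zero_of_mul_eq_one (expArg_mul y)

lemma expArg_add_inv (y:ℝ) : expArg y+(expArg y)⁻¹ = 2*y := by
  rw [inv_eq_of_mul_eq_one_right (expArg_mul y), expArg]; ring

lemma eq_or_eq_inv_of_add_inv_eq {z w : ℂ} (hz : z ≠ 0) (hw : w ≠ 0)
    (h : z+z⁻¹ = w+w⁻¹) : z = w ∨ z = w⁻¹ := by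
  grind

lemma expArg_eq_or {y : ℝ} {z : ℂ} (hz : z ≠ 0) (h : z+z⁻¹ = 2*y) : expArg y = z ∨ expArg y = z⁻¹ :=
  eq_or_eq_inv_of_add_inv_eq (expArg_ne_zero y) hz ((expArg_add_inv y).trans h.symm)

lemma measurable_expArg : Measurable expArg := by
  have h : Measurable fun y : ℝ => (y:ℂ) := Complex.measurable_ofReal
  exact h.add (((h.pow_const 2).sub_const 1).pow_const _)

lemma exp_add_inv (θ:ℝ) : exp (θ*I)+(exp (θ*I))⁻¹ = 2*(cos θ:ℝ) := by
  rw [← exp_neg, Complex.ofReal_cos, Complex.cos, ← neg_mul]; ring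

/-- The finite product `(e z, e / z; q)_k` as a polynomial in `y = (z + z⁻¹) / 2`. -/
def hFin (e q:ℂ) (k:ℕ) (y:ℝ) : ℂ := ∏ j ∈ range k, (1-2*e*(y:ℂ)*q^j+e^2*q^(2*j))

/-- The infinite product `(e z, e / z; q)_∞` as a function of `y = (z + z⁻¹) / 2`. -/
def hInf (e q:ℂ) (y:ℝ) : ℂ := symPoch e q (expArg y)

lemma hInf_eq {e q z : ℂ} {y : ℝ} (hz : z ≠ 0) (h : z+z⁻¹ = 2*y) : hInf e q y = symPoch e q z := by
  rcases expArg_eq_or hz h with h | h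
  · rw [hInf, h]
  · rw [hInf, h, symPoch_inv]

@[simp] lemma hInf_zero_left (q:ℂ) (y:ℝ) : hInf 0 q y = 1 := symPoch_zero_left _ _

@[simp] lemma hFin_zero (e q:ℂ) (y:ℝ) : hFin e q 0 y = 1 := by simp [hFin]

lemma hFin_succ (e q:ℂ) (k:ℕ) (y:ℝ) :
    hFin e q (k+1) y = hFin e q k y*(1-2*e*(y:ℂ)*q^k+e^2*q^(2*k)) := by
  rw [hFin, prod_range_succ, hFin]

lemma hFin_one (e q:ℂ) (y:ℝ) : hFin e q 1 y = 1-2*e*(y:ℂ)+e^2 := by simp [hFin]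

lemma hFin_add (e q:ℂ) (m n:ℕ) (y:ℝ) : hFin e q (m+n) y = hFin e q m y*hFin (e*q^m) q n y := by
  rw [hFin, Finset.prod_range_add, hFin, hFin]; ring

lemma hFin_succ' (e q:ℂ) (k:ℕ) (y:ℝ) : hFin e q (k+1) y = hFin e q 1 y*hFin (e*q) q k y := by
  rw [add_comm, hFin_add, pow_one]

lemma hFin_eq_qPoch {z : ℂ} {y : ℝ} (hz : z ≠ 0) (h : z+z⁻¹ = 2*y) (e q:ℂ) (k:ℕ) :
    hFin e q k y = qPoch (e*z) q k*qPoch (e*z⁻¹) q k := by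
  rw [hFin, qPoch, qPoch, ← prod_mul_distrib]; refine prod_congr rfl fun j _ => ?_
  have e2 := mul_inv_cancel₀ hz; rw [pow_mul']; grind

lemma hInf_split {q : ℂ} (hq : ‖q‖ < 1) (e:ℂ) (k:ℕ) (y:ℝ) :
    hInf e q y = hFin e q k y*hInf (e*q^k) q y := by
  rw [hFin_eq_qPoch (expArg_ne_zero y) (expArg_add_inv y), hInf, hInf, symPoch, symPoch,
    qPochInf_split hq (e*expArg y) k, qPochInf_split hq (e*(expArg y)⁻¹) k,
    mul_right_comm e (expArg y), mul_right_comm e (expArg y)⁻¹]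
  ring

lemma continuous_hFin (e q:ℂ) (k:ℕ) : Continuous (hFin e q k) := by unfold hFin; fun_prop

lemma measurable_hInf {q : ℂ} (hq : ‖q‖ < 1) (e:ℂ) : Measurable (hInf e q) := by
  have h := measurable_expArg
  exact ((continuous_qPochInf hq).measurable.comp (h.const_mul _)).mul
    ((continuous_qPochInf hq).measurable.comp (h.inv.const_mul _))

/-! ### The reference measure with one parameter -/

/-- The density `(2π)⁻¹ |(e^{2iθ}; q)_∞ / (e e^{iθ}; q)_∞|²`. -/
def refDens (q e:ℝ) (θ:ℝ) : ℝ := 1/(2*π) * ‖Π(exp (θ*I)^2;q) / Π(e*exp (θ*I);q)‖ ^ 2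

/-- The mass at `μ(e q^k)` of the reference measure. -/
def refMass (q e:ℝ) (k:ℕ) : ℂ := Π((((e:ℂ)*q^k)^2)⁻¹;q) /
    (qPoch (e^2*q^k) q k*qPoch ((q:ℂ)^k)⁻¹ q k*Π(q;q))

/-- The absolutely continuous part of the reference measure. -/
def refCircle (q e:ℝ) : Measure ℝ := Measure.map cos ((volume.restrict (Ioc 0 π)).withDensity
    fun θ => ENNReal.ofReal (refDens q e θ))

/-- The Askey-Wilson measure with parameters `e, 0, 0, 0`, without its normalising factor; `N` is
the number of its mass points. Dividing it by `(f z, f / z; q)_∞` for small `f` gives the measures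
with more parameters. -/
def refM (q e:ℝ) (N:ℕ) : Measure ℝ := refCircle q e + ∑ k ∈ range N,
    ENNReal.ofReal (refMass q e k).re • Measure.dirac (mu (e*q^k))

lemma mu_add_inv {v : ℝ} : (v:ℂ)+(v:ℂ)⁻¹ = 2*(mu v:ℝ) := by rw [mu]; push_cast; ring

section Ref

variable {q : ℝ} (hq0 : 0 < q) (hq1 : q < 1)

include hq0 hq1

lemma measurable_refDens (e:ℝ) : Measurable (refDens q e) := by
  have hq := norm_lt_one hq0 hq1; have h : Measurable fun θ : ℝ => exp (θ*I) := by fun_prop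
  have h1 := (continuous_qPochInf hq).measurable.comp (h.pow_const 2)
  have h2 := (continuous_qPochInf hq).measurable.comp (h.const_mul (e:ℂ))
  exact ((h1.div h2).norm.pow_const 2).const_mul _

/-- On the unit circle `|(e z; q)_∞|² = (e z, e / z; q)_∞` for real `e`. -/
lemma sq_norm_qPochInf_exp (e θ:ℝ) : ((‖Π(e*exp (θ*I);q)‖ ^ 2 : ℝ) : ℂ) = hInf e q (cos θ) := by
  have hq := norm_lt_one hq0 hq1
  rw [hInf_eq (exp_ne_zero _) (exp_add_inv θ), symPoch, ← Complex.normSq_eq_norm_sq,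
    ← Complex.mul_conj, conj_qPochInf _ hq]
  congr 2; rw [map_mul, conj_ofReal, ← exp_conj, ← exp_neg]; simp

lemma sq_norm_qPochInf_exp_sq (θ:ℝ) : ((‖Π(exp (θ*I)^2;q)‖ ^ 2 : ℝ) : ℂ) = Π(exp (θ*I)^2;q) *
        Π((exp (θ*I)^2)⁻¹;q) := by
  have hq := norm_lt_one hq0 hq1
  rw [← Complex.normSq_eq_norm_sq, ← Complex.mul_conj, conj_qPochInf _ hq, map_pow,
    ← exp_conj, ← inv_pow, ← exp_neg]
  simp

lemma refDens_shift (e θ:ℝ) (he : Π(e*exp (θ*I);q) ≠ 0) :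
    refDens q (e*q) θ = refDens q e θ*(hFin e q 1 (cos θ)).re := by
  have hq := norm_lt_one hq0 hq1; have h1 := sq_norm_qPochInf_exp hq0 hq1 e θ
  have h2 := sq_norm_qPochInf_exp hq0 hq1 (e*q) θ; rw [hInf_split hq e 1] at h1
  have hr : hFin (e:ℂ) q 1 (cos θ) = ((1-2*e*cos θ+e^2:ℝ):ℂ) := by rw [hFin_one]; push_cast; ring
  rw [pow_one, hr] at h1; rw [hr, ofReal_re]; rw [ofReal_mul] at h2; rw [← h2] at h1
  have h3 : ‖Π(e*exp (θ*I);q)‖ ^ 2 = (1-2*e*cos θ+e^2) * ‖Π(↑(e*q)*exp (θ*I);q)‖ ^ 2 :=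
      by rw [ofReal_mul]; exact_mod_cast h1
  have h4 : ‖Π(e*exp (θ*I);q)‖ ^ 2 ≠ 0 := pow_ne_zero _ (norm_ne_zero_iff.2 he)
  have h6 : (1-2*e*cos θ+e^2) ≠ 0 := by grind
  have h5 : ‖Π(↑(e*q)*exp (θ*I);q)‖ ^ 2 ≠ 0 := by grind
  unfold refDens; rw [norm_div, norm_div, div_pow, div_pow, h3]; field_simp

/-- Points `θ` of `(0, π)` give no zero of `(e e^{iθ}; q)_∞` for real `e`. -/
lemma qPochInf_exp_ne_zero (e:ℝ) {θ : ℝ} (h0 : 0 < θ) (hpi : θ < π) : Π(e*exp (θ*I);q) ≠ 0 := by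
  refine qPochInf_ne_zero (norm_lt_one hq0 hq1) fun j h => ?_
  have hs := Real.sin_pos_of_pos_of_lt_pi h0 hpi
  have h1 : ((e*q^j:ℝ):ℂ)*exp (θ*I) = 1 := by rw [← h]; push_cast; ring
  have h2 := congrArg Complex.im h1
  rw [Complex.im_ofReal_mul, Complex.exp_ofReal_mul_I_im, Complex.one_im] at h2
  rcases mul_eq_zero.1 h2 with h3 | h3
  · rw [h3] at h1; simp at h1
  grind

/-- The singularities of the reference density on the unit circle are removable. -/
lemma exists_refDens_le (e:ℝ) : ∃ C, ∀ θ ∈ Ioo 0 π, refDens q e θ ≤ C := by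
  have hq := norm_lt_one hq0 hq1; have h : Continuous fun θ : ℝ => exp (θ*I) := by fun_prop
  suffices H : ∃ g : ℝ → ℂ, Continuous g ∧ ∀ θ ∈ Ioo 0 π, Π(exp (θ*I)^2;q)/Π(e*exp (θ*I);q) = g θ by
    obtain ⟨g, hg, hgd⟩ := H
    obtain ⟨C, hC⟩ := (isCompact_Icc (a := (0:ℝ)) (b := π)).exists_bound_of_continuousOn
      hg.continuousOn
    refine ⟨1/(2*π)*C^2, fun θ hθ => ?_⟩; rw [refDens, hgd θ hθ]; have := hC θ ⟨hθ.1.le, hθ.2.le⟩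
    have hpi := pi_pos; gcongr
  have hne : ∀ (x:ℝ) (j:ℕ), 0 < x*q^j → x*q^j ≠ 1 → ∀ θ : ℝ, (x:ℂ)*exp (θ*I)*q^j ≠ 1 := by
    intro x j hx0 hx1 θ hh; have := congrArg norm hh
    rw [mul_right_comm, norm_mul, norm_exp_mul_I, mul_one, norm_one] at this
    have h2 : ((x:ℂ)*q^j) = ((x*q^j:ℝ):ℂ) := by simp
    rw [h2, norm_real, norm_of_nonneg hx0.le] at this; grind
  by_cases he : ∀ j : ℕ, ∀ θ : ℝ, (e:ℂ)*exp (θ*I)*q^j ≠ 1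
  · refine ⟨_, ?_, fun θ _ => rfl⟩
    exact (Continuous.qPochInf hq (h.pow 2)).div (Continuous.qPochInf hq (continuous_const.mul h))
      fun θ => qPochInf_ne_zero hq fun j => he j θ
  · push Not at he
    obtain ⟨j, θ₀, hj⟩ := he
    -- at the zero `e q^j = ± 1` the factor `1 ∓ z` cancels against `1 - z²`
    obtain ⟨σ, hσ, hσj⟩ : ∃ σ : ℝ, (σ = 1 ∨ σ = -1) ∧ e*q^j = σ := by
      have := congrArg norm hj
      rw [mul_right_comm, norm_mul, norm_exp_mul_I, mul_one, norm_one] at this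
      have h2 : ((e:ℂ)*q^j) = ((e*q^j:ℝ):ℂ) := by simp
      rw [h2, norm_real, norm_eq_abs] at this; exact ⟨_, eq_or_eq_neg_of_abs_eq this, rfl⟩
    have hqj : (q:ℝ)^j ≠ 0 := pow_ne_zero _ hq0.ne'
    have hσj' : (e:ℂ)*q^j = σ := by rw [← hσj]; push_cast; ring
    have hσ1 : (σ:ℂ)^2 = 1 := by rcases hσ with h | h <;> simp [h]
    have hσn : ‖(σ:ℂ)‖ = 1 := by rcases hσ with h | h <;> simp [h]
    refine ⟨fun θ => (1+σ*exp (θ*I)) * Π(exp (θ*I)^2*q;q) / (qPoch (e*exp (θ*I)) q j *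
        Π(σ*exp (θ*I)*q;q)), ?_, fun θ hθ => ?_⟩
    · refine Continuous.div ((continuous_const.add (continuous_const.mul h)).mul
        (Continuous.qPochInf hq ((h.pow 2).mul_const _))) (Continuous.mul ?_
        (Continuous.qPochInf hq ((continuous_const.mul h).mul_const _))) fun θ =>
          mul_ne_zero (qPoch_ne_zero fun i hi hh => ?_) (qPochInf_ne hq ?_)
      · unfold qPoch; fun_prop
      · have h3 : ‖(e:ℂ)*q^j‖ < ‖(e:ℂ)*q^i‖ := by
          rw [norm_mul, norm_mul, norm_pow, norm_pow]
          have he0 : 0 < ‖(e:ℂ)‖ := by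
            rw [norm_pos_iff]; rintro h0; rw [h0, zero_mul] at hσj'; rw [← hσj'] at hσn; simp at hσn
          have : ‖(q:ℂ)‖ = q := by rw [norm_real, norm_of_nonneg hq0.le]
          rw [this]; exact mul_lt_mul_of_pos_left (pow_lt_pow_right_of_lt_one₀ hq0 hq1 hi) he0
        have h4 := congrArg norm hh
        rw [mul_right_comm, norm_mul, norm_exp_mul_I, mul_one, norm_one] at h4
        rw [h4, hσj', hσn] at h3; exact lt_irrefl _ h3
      · rw [norm_mul, norm_mul, hσn, norm_exp_mul_I]; simpa using hq
    · have h1 := qPochInf_exp_ne_zero hq0 hq1 e hθ.1 hθ.2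
      have e1 : Π(e*exp (θ*I);q) = qPoch (e*exp (θ*I)) q j*((1-σ*exp (θ*I)) *
            Π(σ*exp (θ*I)*q;q)) := by
        rw [qPochInf_split hq _ j, mul_right_comm, hσj', qPochInf_step hq (σ*_)]
      rw [e1] at h1 ⊢
      rw [div_eq_div_iff h1 (mul_ne_zero (left_ne_zero_of_mul h1)
        (right_ne_zero_of_mul (right_ne_zero_of_mul h1))), qPochInf_step hq (_^2)]
      grind

omit hq0 hq1 in
lemma ae_mem_Ioo : ∀ᵐ θ ∂(volume.restrict (Ioc 0 π)), θ ∈ Ioo 0 π := by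
  rw [← restrict_Ioo_eq_restrict_Ioc]; exact ae_restrict_mem measurableSet_Ioo

lemma isFiniteMeasure_refCircle (e:ℝ) : IsFiniteMeasure (refCircle q e) := by
  obtain ⟨C, hC⟩ := exists_refDens_le hq0 hq1 e
  have : IsFiniteMeasure ((volume.restrict (Ioc 0 π)).withDensity
      fun θ => ENNReal.ofReal (refDens q e θ)) := by
    refine isFiniteMeasure_withDensity ?_
    refine ne_top_of_le_ne_top ?_ (lintegral_mono_ae (g := fun _ => ENNReal.ofReal C) ?_)
    · simp [ENNReal.mul_eq_top]
    · filter_upwards [ae_mem_Ioo] with θ hθ; exact ENNReal.ofReal_le_ofReal (hC θ hθ)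
  unfold refCircle; infer_instance

lemma isFiniteMeasure_refM (e:ℝ) (N:ℕ) : IsFiniteMeasure (refM q e N) := by
  have := isFiniteMeasure_refCircle hq0 hq1 e; unfold refM
  have : ∀ s : Finset ℕ, IsFiniteMeasure (∑ k ∈ s,
      ENNReal.ofReal (refMass q e k).re • Measure.dirac (mu (e*q^k))) := by
    intro s; refine ⟨?_⟩; simp
  infer_instance

omit hq0 hq1 in
lemma ae_refM (e:ℝ) (N:ℕ) : ∀ᵐ y ∂refM q e N,
    (∃ θ ∈ Ioo 0 π, y = cos θ) ∨ ∃ k < N, y = mu (e*q^k) := by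
  unfold refM; rw [ae_add_measure_iff, ae_finsetSum_measure_iff]; constructor
  · have h : ∀ᵐ y ∂refCircle q e, y ∈ Ioo (-1:ℝ) 1 := by
      unfold refCircle
      refine (ae_map_iff measurable_cos.aemeasurable (p := fun y => y ∈ Ioo (-1:ℝ) 1)
        measurableSet_Ioo).2 ?_
      refine (withDensity_absolutelyContinuous _ _).ae_le ?_; filter_upwards [ae_mem_Ioo] with θ hθ
      constructor
      · rw [← Real.cos_pi]; exact Real.cos_lt_cos_of_nonneg_of_le_pi hθ.1.le le_rfl hθ.2
      · rw [← Real.cos_zero]; exact Real.cos_lt_cos_of_nonneg_of_le_pi le_rfl hθ.2.le hθ.1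
    filter_upwards [h] with y hy
    exact Or.inl ⟨arccos y, ⟨Real.arccos_pos.2 hy.2, (Real.arccos_lt_pi).2 hy.1⟩,
      (cos_arccos hy.1.le hy.2.le).symm⟩
  · intro k hk; refine Measure.ae_smul_measure ?_ _; rw [ae_dirac_eq, eventually_pure]; grind

end Ref

lemma map_withDensity_comp {α β : Type*} [MeasurableSpace α] [MeasurableSpace β] {μ : Measure α}
    {φ : α → β} (hφ : Measurable φ) {g : β → ENNReal} (hg : Measurable g) :
    (μ.map φ).withDensity g = (μ.withDensity (g ∘ φ)).map φ := by
  ext s hs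
  rw [withDensity_apply _ hs, Measure.map_apply hφ hs, withDensity_apply _ (hφ hs),
    Measure.restrict_map hφ hs, lintegral_map hg hφ]
  rfl

section Ref

variable {q : ℝ} (hq0 : 0 < q) (hq1 : q < 1)

include hq0 hq1

lemma refCircle_shift (e:ℝ) : refCircle q (e*q) =
    (refCircle q e).withDensity fun y => ENNReal.ofReal (hFin e q 1 y).re := by
  have hm : Measurable fun y => ENNReal.ofReal (hFin e q 1 y).re :=
    measurable_ofReal.comp (measurable_re.comp (continuous_hFin e q 1).measurable)
  unfold refCircle
  have h := withDensity_mul (volume.restrict (Ioc 0 π))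
    (measurable_ofReal.comp (measurable_refDens hq0 hq1 e)) (hm.comp measurable_cos)
  rw [map_withDensity_comp measurable_cos hm]; congr 1; refine Eq.trans ?_ h
  refine withDensity_congr_ae ?_; filter_upwards [ae_mem_Ioo] with θ hθ
  rw [refDens_shift hq0 hq1 e θ (qPochInf_exp_ne_zero hq0 hq1 e hθ.1 hθ.2), ENNReal.ofReal_mul]
  · rfl
  · unfold refDens; have := pi_pos; positivity

lemma isPos_refMass {e : ℝ} {k : ℕ} (he0 : 0 < e) (he : 1 < e*q^k) : IsPos (refMass q e k) := by
  have hprod : qPoch ((e:ℂ)^2*q^k) q k*qPoch ((q:ℂ)^k)⁻¹ q k =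
      ((∏ j ∈ range k, (e^2*q^k*q^j-1)*((q^k)⁻¹*q^j-1) : ℝ) : ℂ) := by
    push_cast; rw [qPoch, qPoch, ← prod_mul_distrib]; ring
  have hpos : 0 < ∏ j ∈ range k, (e^2*q^k*q^j-1)*((q^k)⁻¹*q^j-1) := by
    refine Finset.prod_pos fun j hj => ?_; have hj := mem_range.1 hj
    have hlt : q^k < q^j := pow_lt_pow_right_of_lt_one₀ hq0 hq1 hj; have hk := pow_pos hq0 k
    refine mul_pos ?_ ?_
    · have h1 : 1 < (e*q^k)^2 := one_lt_pow₀ he two_ne_zero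
      have : (e*q^k)^2 < e^2*q^k*q^j := by rw [mul_pow, pow_two (q^k), ← mul_assoc]; simp [*]
      linarith
    · have : 1 < (q^k)⁻¹*q^j := by rw [inv_mul_eq_div, one_lt_div hk]; exact hlt
      linarith
  unfold refMass; rw [hprod]; have h2 : (((e:ℂ)*q^k)^2)⁻¹ = ((((e*q^k)^2)⁻¹ : ℝ) : ℂ) := by simp
  rw [h2]
  exact (isPos_qPochInf hq0 hq1 (inv_lt_one_of_one_lt₀ (one_lt_pow₀ he two_ne_zero))).div
    ((IsPos.of_real hpos).mul (isPos_qPochInf hq0 hq1 hq1))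

lemma refMass_shift {e : ℝ} {k : ℕ} (he0 : 0 < e) (he : 1 < e*q^(k+1)) :
    refMass q (e*q) k = refMass q e (k+1)*hFin e q 1 (mu (e*q^(k+1))) := by
  have hp := (isPos_refMass hq0 hq1 he0 he).ne_zero; have hqc := ofReal_ne hq0
  have hec := ofReal_ne he0
  have hz : ((e*q^(k+1) : ℝ) : ℂ) ≠ 0 := by simp [*]
  rw [hFin_eq_qPoch hz mu_add_inv]; unfold refMass at hp ⊢
  have e1 : qPoch ((e:ℂ)^2*q^(k+1)) q (k+1) =
      (1-(e:ℂ)^2*q^(k+1))*qPoch (((e*q:ℝ):ℂ)^2*q^k) q k := by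
    rw [qPoch_succ']; congr 2; push_cast; ring
  have e2 : qPoch ((q:ℂ)^(k+1))⁻¹ q (k+1) = (1-((q:ℂ)^(k+1))⁻¹)*qPoch ((q:ℂ)^k)⁻¹ q k := by
    rw [qPoch_succ']; congr 2; rw [pow_succ]; field_simp
  have e3 : qPoch ((e:ℂ)*((e*q^(k+1) : ℝ) : ℂ)) q 1 = 1-(e:ℂ)^2*q^(k+1) := by simp [qPoch]; ring
  have e4 : qPoch ((e:ℂ)*((e*q^(k+1) : ℝ) : ℂ)⁻¹) q 1 = 1-((q:ℂ)^(k+1))⁻¹ := by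
    simp only [qPoch, Finset.range_one, Finset.prod_singleton, pow_zero, mul_one]
    congr 1; push_cast; field_simp
  have e5 : ((e*q:ℝ):ℂ)*q^k = e*q^(k+1) := by push_cast; ring
  rw [e1, e2] at hp ⊢; rw [e3, e4, e5]; have hp2 := right_ne_zero_of_mul hp; rw [← one_div] at hp2
  have hp3 := (div_ne_zero_iff.1 hp2).2
  have n1 := left_ne_zero_of_mul (left_ne_zero_of_mul (left_ne_zero_of_mul hp3))
  have n2 := left_ne_zero_of_mul (right_ne_zero_of_mul (left_ne_zero_of_mul hp3))
  generalize Π(((e*(q:ℂ)^(k+1))^2)⁻¹;q) = X; grind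

omit hq0 hq1 in
lemma withDensity_finsetSum_measure {ι α : Type*} [MeasurableSpace α] (s : Finset ι)
    (μ : ι → Measure α) (f : α → ENNReal) :
    (∑ i ∈ s, μ i).withDensity f = ∑ i ∈ s, (μ i).withDensity f := by
  classical
  induction s using Finset.induction_on with
  | empty => simp
  | insert a s ha ih => rw [Finset.sum_insert ha, Finset.sum_insert ha, withDensity_add_measure, ih]

lemma refM_shift {e : ℝ} {N : ℕ} (he0 : 0 < e) (he : ∀ k, k < N+1 ↔ 1 < e*q^k) : refM q (e*q) N =
      (refM q e (N+1)).withDensity fun y => ENNReal.ofReal (hFin e q 1 y).re := by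
  have hec := ofReal_ne he0; unfold refM
  rw [withDensity_add_measure, ← refCircle_shift hq0 hq1, withDensity_finsetSum_measure,
    sum_range_succ']
  congr 1; rw [withDensity_smul_measure, dirac_withDensity]
  have h0 : hFin e q 1 (mu (e*q^0)) = 0 := by
    rw [pow_zero, mul_one, hFin_eq_qPoch (z := (e:ℂ)) hec mu_add_inv]; simp [qPoch, hec]
  rw [h0]; simp only [Complex.zero_re, ENNReal.ofReal_zero, zero_smul, smul_zero, add_zero]
  refine sum_congr rfl fun k hk => ?_; have hk1 := (he (k+1)).1 (by grind)
  have hp := isPos_refMass hq0 hq1 he0 hk1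
  rw [withDensity_smul_measure, dirac_withDensity, refMass_shift hq0 hq1 he0 hk1, smul_smul,
    ← ENNReal.ofReal_mul hp.re_pos.le]
  congr 2
  · rw [← hp.coe_re, re_ofReal_mul]; simp
  ring

end Ref

/-! ### The Askey-Wilson integral with at most one large parameter -/

/-- The points of the support of `μ` are of the form `(z + z⁻¹) / 2` with `R⁻¹ ≤ ‖z‖ ≤ R`. -/
def SuppBound (μ : Measure ℝ) (R:ℝ) : Prop := ∀ᵐ y ∂μ, ‖expArg y‖ ≤ R ∧ ‖(expArg y)⁻¹‖ ≤ R

lemma norm_expArg_le {y R : ℝ} {z : ℂ} (hz : z ≠ 0) (h : z+z⁻¹ = 2*y) (h1 : ‖z‖ ≤ R)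
    (h2 : ‖z⁻¹‖ ≤ R) : ‖expArg y‖ ≤ R ∧ ‖(expArg y)⁻¹‖ ≤ R := by
  rcases expArg_eq_or hz h with h | h
  · rw [h]; exact ⟨h1, h2⟩
  · rw [h, inv_inv]; exact ⟨h2, h1⟩

lemma norm_mul_le_of_le {f z : ℂ} {R : ℝ} (h : ‖z‖ ≤ R) : ‖f*z‖ ≤ ‖f‖ * R := by
  rw [norm_mul]; gcongr

lemma hInf_ne_zero {q f : ℂ} (hq : ‖q‖ < 1) {R y : ℝ} (hf : ‖f‖ * R < 1)
    (hy : ‖expArg y‖ ≤ R ∧ ‖(expArg y)⁻¹‖ ≤ R) : hInf f q y ≠ 0 :=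
  symPoch_ne_zero hq ((norm_mul_le_of_le hy.1).trans_lt hf) ((norm_mul_le_of_le hy.2).trans_lt hf)

lemma exists_norm_inv_hInf_le {q f : ℂ} (hq : ‖q‖ < 1) {R : ℝ} (hf : ‖f‖ * R < 1) :
    ∃ C, ∀ y : ℝ, ‖expArg y‖ ≤ R ∧ ‖(expArg y)⁻¹‖ ≤ R → ‖(hInf f q y)⁻¹‖ ≤ C := by
  obtain ⟨M, hM, hMb⟩ := exists_le_norm_qPochInf hq hf; refine ⟨(M*M)⁻¹, fun y hy => ?_⟩
  have h1 := hMb _ (norm_mul_le_of_le (f := f) hy.1)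
  have h2 := hMb _ (norm_mul_le_of_le (f := f) hy.2); rw [hInf, symPoch, norm_inv, norm_mul]; gcongr

lemma exists_norm_hInf_le {q : ℂ} (hq : ‖q‖ < 1) (f:ℂ) (R:ℝ) :
    ∃ C, ∀ y : ℝ, ‖expArg y‖ ≤ R ∧ ‖(expArg y)⁻¹‖ ≤ R → ‖hInf f q y‖ ≤ C := by
  obtain ⟨M, -, hMb⟩ := exists_norm_qPochInf_le hq (‖f‖ * R); refine ⟨M*M, fun y hy => ?_⟩
  have h1 := hMb _ (norm_mul_le_of_le (f := f) hy.1)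
  have h2 := hMb _ (norm_mul_le_of_le (f := f) hy.2); rw [hInf, symPoch, norm_mul]
  exact mul_le_mul h1 h2 (norm_nonneg _) ((norm_nonneg _).trans h1)

lemma abs_le_of_norm_expArg_le {y R : ℝ} (hy : ‖expArg y‖ ≤ R ∧ ‖(expArg y)⁻¹‖ ≤ R) :
    |y| ≤ R := by
  have h := congrArg norm (expArg_add_inv y)
  rw [norm_mul, norm_real, Complex.norm_ofNat, norm_eq_abs] at h
  have := norm_add_le (expArg y) (expArg y)⁻¹; linarith [hy.1, hy.2]

lemma Integrable.div_hInf {μ : Measure ℝ} {R : ℝ} (hμ : SuppBound μ R) {q f : ℂ} (hq : ‖q‖ < 1)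
    (hf : ‖f‖ * R < 1) {D : ℝ → ℂ} (hD : Integrable D μ) :
    Integrable (fun y => D y/hInf f q y) μ := by
  obtain ⟨C, hC⟩ := exists_norm_inv_hInf_le hq hf; simp only [div_eq_mul_inv]
  refine Integrable.mul_bdd (c := C) hD (measurable_hInf hq f).inv.aestronglyMeasurable ?_
  filter_upwards [hμ] with y hy using hC y hy

lemma Integrable.mul_continuous {μ : Measure ℝ} {R : ℝ} (hμ : SuppBound μ R) {D p : ℝ → ℂ}
    (hD : Integrable D μ) (hp : Continuous p) : Integrable (fun y => D y*p y) μ := by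
  obtain ⟨C, hC⟩ := (isCompact_Icc (a := -R) (b := R)).exists_bound_of_continuousOn hp.continuousOn
  refine Integrable.mul_bdd (c := C) hD hp.aestronglyMeasurable ?_
  filter_upwards [hμ] with y hy using hC y (abs_le.1 (abs_le_of_norm_expArg_le hy))

lemma tendsto_integral_div_hInf {μ : Measure ℝ} {R : ℝ} (hμ : SuppBound μ R) {q b : ℂ}
    (hq : ‖q‖ < 1) (hb : ‖b‖ * R < 1) {D : ℝ → ℂ} (hD : Integrable D μ) :
    Tendsto (fun n : ℕ => ∫ y, D y/hInf (b*q^n) q y ∂μ) atTop (𝓝 (∫ y, D y ∂μ)) :=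
  tendsto_integral_div_symPoch hD measurable_expArg hq hb
    (by filter_upwards [hμ] with y hy using norm_mul_le_of_le hy.1)
    (by filter_upwards [hμ] with y hy using norm_mul_le_of_le hy.2)

lemma norm_mul_max_lt {f : ℂ} {e : ℝ} (he0 : 0 < e) (h1 : ‖f‖ < 1) (h2 : ‖(e:ℂ)*f‖ < 1) :
    ‖f‖ * max 1 e < 1 := by
  rw [norm_mul, norm_real, norm_of_nonneg he0.le] at h2
  rcases max_cases 1 e with ⟨h, _⟩ | ⟨h, _⟩ <;> rw [h] <;> linarith

lemma awTotal_shift {q e b c d : ℂ} (hq : ‖q‖ < 1) (hb : 1-e*b ≠ 0) (hc : 1-e*c ≠ 0)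
    (hd : 1-e*d ≠ 0) : awTotal q (e*q) b c d*(1-e*b*c*d) =
      awTotal q e b c d*((1-e*b)*(1-e*c)*(1-e*d)) := by
  unfold awTotal
  rw [qPochInf_step hq (e*b), qPochInf_step hq (e*c), qPochInf_step hq (e*d),
    qPochInf_step hq (e*b*c*d), show e*q*b = e*b*q by ring,
    show e*q*c = e*c*q by ring, show e*q*d = e*d*q by ring,
    show e*b*q*c*d = e*b*c*d*q by ring]
  generalize Π(e*b*q;q) = x1; generalize Π(e*c*q;q) = x2; generalize Π(e*d*q;q) = x3
  rw [div_mul_eq_mul_div, div_mul_eq_mul_div, ← mul_div_mul_right _ _ (mul_ne_zero (mul_ne_zero hb hc) hd)]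
  congr 1 <;> ring

lemma awTotal_swap₁ (q a b c d:ℂ) : awTotal q a b c d = awTotal q b a c d := by
  unfold awTotal; rw [mul_comm a b]; ring

lemma awTotal_swap₂ (q a b c d:ℂ) : awTotal q a b c d = awTotal q a c b d := by
  unfold awTotal; rw [mul_comm c b, mul_right_comm a c b]; ring

lemma awTotal_swap₃ (q a b c d:ℂ) : awTotal q a b c d = awTotal q a b d c := by
  unfold awTotal; rw [mul_comm d c, mul_right_comm _ d c]; ring

section

variable {q : ℝ} (hq0 : 0 < q) (hq1 : q < 1)

omit hq0 hq1 in
include hq0 in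
lemma suppBound_refM (hq1 : q < 1) {e : ℝ} {N : ℕ} (he0 : 0 < e) (he : ∀ k, k < N ↔ 1 < e*q^k) :
    SuppBound (refM q e N) (max 1 e) := by
  filter_upwards [ae_refM e N] with y hy; rcases hy with ⟨θ, -, rfl⟩ | ⟨k, hk, rfl⟩
  · refine norm_expArg_le (exp_ne_zero (θ*I)) (exp_add_inv θ) ?_ ?_
    · rw [norm_exp_mul_I]; exact le_max_left _ _
    · rw [norm_inv, norm_exp_mul_I]; simp
  · have h1 := (he k).1 hk; have h0 : 0 < e*q^k := one_pos.trans h1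
    refine norm_expArg_le (z := ((e*q^k:ℝ):ℂ)) (by exact_mod_cast h0.ne') mu_add_inv ?_ ?_
    · rw [norm_real, norm_of_nonneg h0.le]
      exact (mul_le_of_le_one_right he0.le (pow_le_one₀ hq0.le hq1.le)).trans (le_max_right _ _)
    · rw [norm_inv, norm_real, norm_of_nonneg h0.le]
      exact (inv_le_one_of_one_le₀ h1.le).trans (le_max_left _ _)

include hq0 hq1

/-- The relation between the integrals with parameters `e q, b`, `e, b q` and `e, b`. -/
lemma integral_div_hInf_rec {μ : Measure ℝ} {R : ℝ} (hμ : SuppBound μ R) (hR : 1 ≤ R) {b : ℂ}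
    (hb : ‖b‖ * R < 1) {D : ℝ → ℂ} (hD : Integrable D μ) (e:ℂ) :
    b * ∫ y, hFin e q 1 y*(D y/hInf b q y) ∂μ-e * ∫ y, D y/hInf (b*q) q y ∂μ =
      (b-e)*(1-b*e) * ∫ y, D y/hInf b q y ∂μ := by
  have hq := norm_lt_one hq0 hq1
  have hbq : ‖b*q‖ * R < 1 := by
    refine lt_of_le_of_lt ?_ hb; rw [norm_mul]
    have : ‖b‖ * ‖(q:ℂ)‖ ≤ ‖b‖ := mul_le_of_le_one_right (norm_nonneg _) hq.le; gcongr
  have i1 := Integrable.div_hInf hμ hq hb hD; have i2 := Integrable.div_hInf hμ hq hbq hD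
  have i3 := Integrable.mul_continuous hμ i1 (continuous_hFin e q 1)
  have i3' : Integrable (fun y => hFin e q 1 y*(D y/hInf b q y)) μ :=
    i3.congr (Eventually.of_forall fun y => mul_comm _ _)
  rw [← integral_const_mul, ← integral_const_mul, ← integral_const_mul,
    ← integral_sub (i3'.const_mul _) (i2.const_mul _)]
  refine integral_congr_ae ?_; filter_upwards [hμ] with y hy; have n1 := hInf_ne_zero hq hb hy
  have n2 := hInf_ne_zero hq hbq hy; have e1 := hInf_split hq b 1 y; rw [pow_one] at e1
  have e2 : D y/hInf (b*q) q y = hFin b q 1 y*(D y/hInf b q y) := by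
    rw [e1] at n1 ⊢; have n3 := left_ne_zero_of_mul n1; field_simp
  rw [e2, hFin_one, hFin_one]; ring

lemma integral_refM_shift {e : ℝ} {N : ℕ} (he0 : 0 < e)
    (he : ∀ k, k < N+1 ↔ 1 < e*q^k) (f : ℝ → ℂ) :
    ∫ y, f y ∂refM q (e*q) N = ∫ y, hFin e q 1 y*f y ∂refM q e (N+1) := by
  have hm : Measurable fun y => ENNReal.ofReal (hFin e q 1 y).re :=
    measurable_ofReal.comp (measurable_re.comp (continuous_hFin e q 1).measurable)
  rw [refM_shift hq0 hq1 he0 he, integral_withDensity_eq_integral_toReal_smul hm (by simp)]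
  refine integral_congr_ae ?_; filter_upwards [ae_refM e (N+1)] with y hy
  have hr : hFin (e:ℂ) q 1 y = ((1-2*e*y+e^2:ℝ):ℂ) := by rw [hFin_one]; push_cast; ring
  have hpos : 0 ≤ 1-2*e*y+e^2 := by
    rcases hy with ⟨θ, -, rfl⟩ | ⟨k, hk, rfl⟩
    · nlinarith [Real.cos_le_one θ, sq_nonneg (1-e)]
    · have h1 := (he k).1 hk; have h0 : 0 < e*q^k := one_pos.trans h1
      have : 1-2*e*mu (e*q^k)+e^2 = (e*(e*q^k)-1)*(e/(e*q^k)-1) := by rw [mu]; field_simp; ring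
      rw [this]; have h2 : e*q^k ≤ e := mul_le_of_le_one_right he0.le (pow_le_one₀ hq0.le hq1.le)
      refine mul_nonneg ?_ ?_
      · nlinarith
      · rw [sub_nonneg, one_le_div h0]; exact h2
  simp only [hr, ofReal_re, toReal_ofReal hpos, real_smul]

/-- Integration over the absolutely continuous part. -/
lemma integral_refCircle (e:ℝ) (f : ℝ → ℂ) (hf : Measurable f) : ∫ y, f y ∂refCircle q e =
      ∫ θ in (0:ℝ)..Real.pi, (refDens q e θ:ℂ)*f (cos θ) := by
  unfold refCircle; rw [integral_map measurable_cos.aemeasurable hf.aestronglyMeasurable]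
  have hm : Measurable fun θ => ENNReal.ofReal (refDens q e θ) :=
    measurable_ofReal.comp (measurable_refDens hq0 hq1 e)
  rw [integral_withDensity_eq_integral_toReal_smul hm (by simp),
    intervalIntegral.integral_of_le pi_pos.le]
  refine integral_congr_ae (Eventually.of_forall fun θ => ?_)
  have : 0 ≤ refDens q e θ := by unfold refDens; have := pi_pos; positivity
  simp only [toReal_ofReal this, real_smul]

omit hq0 hq1 in
lemma awKernel_inv (a b c d:ℂ) (q:ℂ) (z:ℂ) : awKernel a b c d q z⁻¹ = awKernel a b c d q z := by
  unfold awKernel; simp only [symPoch_inv, inv_pow, inv_inv]; rw [mul_comm (Π((z^2)⁻¹;q))]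

lemma awCircle_eq_half {a b c d : ℂ} (ha : ‖a‖ < 1)
    (hb : ‖b‖ < 1) (hc : ‖c‖ < 1) (hd : ‖d‖ < 1) : awCircle a b c d q =
      2 * ∫ θ in (0:ℝ)..Real.pi, awKernel a b c d q (exp (θ*I)) := by
  have hcont := continuous_awKernel_exp (norm_lt_one hq0 hq1) ha hb hc hd
  have h := intervalIntegral.integral_comp_sub_left (a := 0) (b := π)
    (fun θ : ℝ => awKernel a b c d q (exp (θ*I))) (2*π)
  have h2 : ∀ θ : ℝ, awKernel a b c d q (exp ((2*π-θ:ℝ)*I)) = awKernel a b c d q (exp (θ*I)) := by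
    intro θ; rw [← awKernel_inv, ← exp_neg]; congr 1; rw [Complex.exp_eq_exp_iff_exists_int]
    exact ⟨-1, by push_cast; ring⟩
  rw [intervalIntegral.integral_congr fun θ _ => h2 θ, sub_zero, show 2*π-π = π by ring] at h
  unfold awCircle
  rw [← intervalIntegral.integral_add_adjacent_intervals (hcont.intervalIntegrable 0 π)
    (hcont.intervalIntegrable π (2*π)), ← h]
  ring

lemma refDens_mul_eq_awKernel (e θ:ℝ) (b c d:ℂ) :
    (refDens q e θ:ℂ)*(1/hInf b q (cos θ)/hInf c q (cos θ) / hInf d q (cos θ)) =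
      1/(2*π)*awKernel e b c d q (exp (θ*I)) := by
  have h1 := sq_norm_qPochInf_exp hq0 hq1 e θ; have h2 := sq_norm_qPochInf_exp_sq hq0 hq1 θ
  have h3 : (refDens q e θ:ℂ) = 1/(2*π) * (((‖Π(exp (θ*I)^2;q)‖ ^ 2 : ℝ) : ℂ) /
    ((‖Π(e*exp (θ*I);q)‖ ^ 2 : ℝ) : ℂ)) := by
    unfold refDens; rw [norm_div, div_pow]; push_cast; ring
  have hh : ∀ f : ℂ, hInf f q (cos θ) = symPoch f q (exp (θ*I)) :=
    fun f => hInf_eq (exp_ne_zero _) (exp_add_inv θ)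
  rw [h3, h1, h2, awKernel, hh, hh, hh, hh]; simp only [div_eq_mul_inv, mul_inv]; ring

lemma integral_refM_zero {e : ℝ} (he0 : 0 < e) (he1 : e < 1) {b c d : ℂ}
    (hb : ‖b‖ < 1) (hc : ‖c‖ < 1) (hd : ‖d‖ < 1) :
    ∫ y, 1/hInf b q y/hInf c q y/hInf d q y ∂refM q e 0 = awTotal q e b c d := by
  have hq := norm_lt_one hq0 hq1; have hen : ‖(e:ℂ)‖ < 1 := norm_lt_one he0 he1
  rw [refM, Finset.sum_range_zero, add_zero, integral_refCircle hq0 hq1]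
  · simp only [refDens_mul_eq_awKernel hq0 hq1]; rw [intervalIntegral.integral_const_mul]
    have h := awCircle_eq hq0 hq1 hen hb hc hd; rw [awCircle_eq_half hq0 hq1 hen hb hc hd] at h
    have hpi : (π:ℂ) ≠ 0 := by exact_mod_cast Real.pi_ne_zero
    field_simp; linear_combination h/2
  · exact (((measurable_const.div (measurable_hInf hq b)).div (measurable_hInf hq c)).div
      (measurable_hInf hq d))

omit hq1 in
lemma awTotal_rec (hq1 : q < 1) {e b c d : ℂ} (hb : ‖b‖ < 1) (hc : ‖c‖ < 1) (hd : ‖d‖ < 1)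
    (heb : ‖e*b‖ < 1) (hec : ‖e*c‖ < 1) (hed : ‖e*d‖ < 1) :
    b*awTotal q (e*q) b c d-e*awTotal q e (b*q) c d = (b-e)*(1-b*e)*awTotal q e b c d := by
  have hq := norm_lt_one hq0 hq1
  have n := fun x y hx hy => one_sub_ne (norm_mul_lt_one (x := x) (y := y) hx hy)
  have h1 := awTotal_shift (c := c) (d := d) hq (one_sub_ne heb) (one_sub_ne hec) (one_sub_ne hed)
  have h2 := awTotal_shift (e := b) (b := e) (c := c) (d := d) hq
    (by rw [mul_comm]; exact one_sub_ne heb) (n _ _ hb hc) (n _ _ hb hd)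
  rw [awTotal_swap₁ q (b*q), awTotal_swap₁ q b e] at h2
  have h4 : 1-e*b*c*d ≠ 0 := one_sub_ne (norm_mul_lt_one (norm_mul_lt_one heb hc) hd)
  refine mul_right_cancel₀ h4 ?_; linear_combination b*h1-e*h2

end

section

variable {q : ℝ} (hq0 : 0 < q) (hq1 : q < 1)

include hq0 hq1

/-- If the value of the Askey-Wilson integral is known for the parameter `e q`, then the error for
`e` is determined, up to an explicit factor, by its value at `x = 0`. -/
lemma awError_eq {e : ℝ} (he0 : 0 < e) {μ : Measure ℝ} (hμ : SuppBound μ (max 1 e)) {c d : ℂ}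
    {D : ℝ → ℂ} (hD : Integrable D μ) (hc : ‖c‖ < 1) (hd : ‖d‖ < 1) (hec : ‖e*c‖ < 1)
    (hed : ‖e*d‖ < 1)
    (hint : ∀ x : ℂ, ‖x‖ < 1 → ‖e*x‖ < 1 →
      ∫ y, hFin e q 1 y*(D y/hInf x q y) ∂μ = awTotal q (e*q) x c d)
    {x : ℂ} (hx : ‖x‖ < 1) (hex : ‖e*x‖ < 1) :
    Π(x/e;q)*Π(x*e;q)*(∫ y, D y/hInf x q y ∂μ-awTotal q e x c d) =
      ∫ y, D y ∂μ-awTotal q e 0 c d := by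
  have hq := norm_lt_one hq0 hq1; have hec0 := ofReal_ne he0
  have hsm : ∀ n : ℕ, ‖x*q^n‖ < 1 ∧ ‖e*(x*q^n)‖ < 1 := by
    intro n; have : ‖(q:ℂ)^n‖ ≤ 1 := by rw [norm_pow]; exact pow_le_one₀ (norm_nonneg _) hq.le
    constructor
    · rw [norm_mul]; exact (mul_le_of_le_one_right (norm_nonneg _) this).trans_lt hx
    · rw [← mul_assoc, norm_mul]; exact (mul_le_of_le_one_right (norm_nonneg _) this).trans_lt hex
  have hrec : ∀ n : ℕ, ∫ y, D y/hInf (x*q^n) q y ∂μ-awTotal q e (x*q^n) c d =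
      qPoch (x/e) q n*qPoch (x*e) q n * (∫ y, D y/hInf x q y ∂μ-awTotal q e x c d) := by
    intro n
    induction n with
    | zero => simp
    | succ n ih =>
      have h1 := integral_div_hInf_rec hq0 hq1 hμ (le_max_left _ _)
        (norm_mul_max_lt he0 (hsm n).1 (hsm n).2) hD e
      have h2 := awTotal_rec hq0 hq1 (hsm n).1 hc hd (hsm n).2 hec hed
      rw [hint _ (hsm n).1 (hsm n).2] at h1; rw [qPoch_succ, qPoch_succ, pow_succ, ← mul_assoc]
      have h3 : qPoch (x/e) q n*(1-x/e*q^n)*(qPoch (x*e) q n*(1-x*e*q^n)) *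
        (∫ y, D y/hInf x q y ∂μ-awTotal q e x c d) = (1-x/e*q^n)*(1-x*e*q^n) *
        (∫ y, D y/hInf (x*q^n) q y ∂μ-awTotal q e (x*q^n) c d) := by rw [ih]; ring
      rw [h3]; refine mul_left_cancel₀ hec0 ?_
      have h4 : (e:ℂ)*(1-x/e*q^n) = e-x*q^n := by field_simp
      linear_combination h2-h1-(1-x*e*q^n) *
        (∫ y, D y/hInf (x*q^n) q y ∂μ-awTotal q e (x*q^n) c d)*h4
  have hcq := continuous_qPochInf hq
  have t1 := tendsto_integral_div_hInf hμ hq (norm_mul_max_lt he0 hx hex) hD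
  have t2 : Tendsto (fun n : ℕ => awTotal q e (x*q^n) c d) atTop (𝓝 (awTotal q e 0 c d)) := by
    have ht := tendsto_mul_pow_zero hq x
    have f1 : Tendsto (fun n : ℕ => Π(e*(x*q^n)*c*d;q)) atTop (𝓝 (Π(e*0*c*d;q))) :=
      (hcq.tendsto _).comp (((ht.const_mul (e:ℂ)).mul_const c).mul_const d)
    have f2 : Tendsto (fun n : ℕ => Π(e*(x*q^n);q)) atTop (𝓝 (Π(e*0;q))) :=
      (hcq.tendsto _).comp (ht.const_mul (e:ℂ))
    have f3 : ∀ f : ℂ, Tendsto (fun n : ℕ => Π(x*q^n*f;q)) atTop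
        (𝓝 (Π(0*f;q))) := fun f => (hcq.tendsto _).comp (ht.mul_const f)
    refine f1.div (((((((f2.mul_const _).mul_const _).mul (f3 c)).mul (f3 d)).mul_const
      _)).const_mul _) ?_
    have n1 := qPochInf_ne hq hq; have n2 := qPochInf_ne hq hec; have n3 := qPochInf_ne hq hed
    have n4 := qPochInf_ne hq (norm_mul_lt_one hc hd); simp [n1, n2, n3, n4]
  have t3 := ((tendsto_qPoch hq (x/e)).mul (tendsto_qPoch hq (x*e))).mul_const
    (∫ y, D y/hInf x q y ∂μ-awTotal q e x c d)
  exact tendsto_nhds_unique t3 ((t1.sub t2).congr fun n => hrec n)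

lemma integral_refM_zero_shift (e:ℝ) (f : ℝ → ℂ) :
    ∫ y, f y ∂refM q (e*q) 0 = ∫ y, hFin e q 1 y*f y ∂refM q e 0 := by
  have hm : Measurable fun y => ENNReal.ofReal (hFin e q 1 y).re :=
    measurable_ofReal.comp (measurable_re.comp (continuous_hFin e q 1).measurable)
  have h : refM q (e*q) 0 = (refM q e 0).withDensity fun y => ENNReal.ofReal (hFin e q 1 y).re := by
    simp only [refM, Finset.sum_range_zero, add_zero, refCircle_shift hq0 hq1]
  rw [h, integral_withDensity_eq_integral_toReal_smul hm (by simp)]; refine integral_congr_ae ?_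
  filter_upwards [ae_refM e 0] with y hy
  have hr : hFin (e:ℂ) q 1 y = ((1-2*e*y+e^2:ℝ):ℂ) := by rw [hFin_one]; push_cast; ring
  have hpos : 0 ≤ 1-2*e*y+e^2 := by
    rcases hy with ⟨θ, -, rfl⟩ | ⟨k, hk, rfl⟩
    · nlinarith [Real.cos_le_one θ, Real.neg_one_le_cos θ, sq_nonneg (e-cos θ),
        Real.sin_sq_add_cos_sq θ, sq_nonneg (Real.sin θ)]
    · omega
  simp only [hr, ofReal_re, toReal_ofReal hpos, real_smul]

lemma integrable_inv_hInf {e : ℝ} {N : ℕ} (he0 : 0 < e) (he : ∀ k, k < N ↔ 1 < e*q^k)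
    {b c d : ℂ} (hb : ‖b‖ < 1) (hc : ‖c‖ < 1) (hd : ‖d‖ < 1) (heb : ‖e*b‖ < 1)
    (hec : ‖e*c‖ < 1) (hed : ‖e*d‖ < 1) :
    Integrable (fun y => 1/hInf b q y/hInf c q y/hInf d q y) (refM q e N) := by
  have hq := norm_lt_one hq0 hq1; have := isFiniteMeasure_refM hq0 hq1 e N
  have hμ := suppBound_refM hq0 hq1 he0 he
  exact Integrable.div_hInf hμ hq (norm_mul_max_lt he0 hd hed) (Integrable.div_hInf hμ hq
    (norm_mul_max_lt he0 hc hec) (Integrable.div_hInf hμ hq (norm_mul_max_lt he0 hb heb)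
      (integrable_const 1)))

/-- The boundary case `e = 1`: the error vanishes since `(x; q)_∞² / (x z, x / z; q)_∞` tends
boundedly to `0` for `x → 1`. -/
lemma awError_zero_of_eq_one {c d : ℂ} (hc : ‖c‖ < 1) (hd : ‖d‖ < 1) {D : ℝ → ℂ}
    (hD : Integrable D (refM q 1 0))
    (hint : ∀ x : ℂ, ‖x‖ < 1 → Π(x;q)*Π(x;q)*(∫ y, D y/hInf x q y ∂refM q 1 0-awTotal q 1 x c d) =
      ∫ y, D y ∂refM q 1 0-awTotal q 1 0 c d) :
    ∫ y, D y ∂refM q 1 0-awTotal q 1 0 c d = 0 := by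
  have hq := norm_lt_one hq0 hq1; have hcq := continuous_qPochInf hq
  set b : ℕ → ℝ := fun n => 1-1/((n:ℝ)+2) with hb
  have hbt : Tendsto (fun n => (b n:ℂ)) atTop (𝓝 1) := by
    have h1 : Tendsto (fun n : ℕ => 1/((n:ℝ)+2)) atTop (𝓝 0) := by
      have := (tendsto_add_atTop_iff_nat 2).2 (tendsto_one_div_atTop_nhds_zero_nat (𝕜 := ℝ))
      simpa using this
    have h2 : Tendsto b atTop (𝓝 (1-0)) := tendsto_const_nhds.sub h1; rw [sub_zero] at h2
    have := (Complex.continuous_ofReal.tendsto 1).comp h2; simpa [Function.comp_def] using this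
  have hb01 : ∀ n, 0 < b n ∧ b n < 1 := by
    intro n; have h1 : (0:ℝ) < 1/((n:ℝ)+2) := by positivity
    have h2 : 1/((n:ℝ)+2) < 1 := by rw [div_lt_one (by positivity)]; linarith [n.cast_nonneg (α := ℝ)]
    simp only [hb]; constructor <;> linarith
  have hbn : ∀ n, ‖(b n:ℂ)‖ < 1 := fun n => norm_lt_one (hb01 n).1 (hb01 n).2
  have h10 : Π(1;q) = 0 := qPochInf_eq_zero hq (j := 0) (by simp)
  obtain ⟨C, hC0, hC⟩ := exists_norm_qPochInf_le hq 1
  obtain ⟨M, hM0, hM⟩ := exists_le_norm_qPochInf hq (R := q) hq1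
  have hquot : ∀ n, ∀ z : ℂ, ‖z‖ = 1 → ‖Π(b n;q)/Π(b n*z;q)‖ ≤ C/M := by
    intro n z hz; have hbz : ‖(b n:ℂ)*z‖ < 1 := by rw [norm_mul, hz, mul_one]; exact hbn n
    rw [qPochInf_step hq (b n:ℂ), qPochInf_step hq (b n*z), mul_div_mul_comm, norm_mul,
      norm_div, norm_div]
    have h1 : ‖1-(b n:ℂ)‖ ≤ ‖1-b n*z‖ := by
      have := norm_sub_norm_le 1 ((b n:ℂ)*z)
      rw [norm_mul, hz, mul_one, norm_one, norm_real, norm_of_nonneg (hb01 n).1.le] at this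
      refine le_trans (le_of_eq ?_) this
      rw [← ofReal_one, ← Complex.ofReal_sub, norm_real, norm_of_nonneg]; linarith [(hb01 n).2]
    have h0 : 0 < ‖1-b n*z‖ := norm_pos_iff.2 (one_sub_ne hbz)
    have h2 := hC (b n*q) (norm_mul_lt_one (hbn n) hq).le
    have h3 := hM (b n*z*q) (by
      rw [norm_mul, norm_real, norm_of_nonneg hq0.le]; exact mul_le_of_le_one_left hq0.le hbz.le)
    calc _ ≤ 1*(C/M) := by
          refine mul_le_mul ((div_le_one h0).2 h1) ?_ (by positivity) zero_le_one; gcongr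
      _ = C/M := one_mul _
  have hae : ∀ᵐ y ∂refM q 1 0, ∃ θ ∈ Ioo 0 π, y = cos θ := by
    filter_upwards [ae_refM 1 0] with y hy; rcases hy with h | ⟨k, hk, _⟩
    · exact h
    · omega
  have T1 : Tendsto (fun n => ∫ y, Π(b n;q)*Π(b n;q) *
      (D y/hInf (b n) q y) ∂refM q 1 0) atTop (𝓝 (∫ y, 0 ∂refM q 1 0)) := by
    refine tendsto_integral_of_dominated_convergence (fun y => C/M*(C/M) * ‖D y‖)
      (fun n => ?_) (hD.norm.const_mul _) (fun n => ?_) ?_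
    · exact (hD.aestronglyMeasurable.mul
        (measurable_hInf hq (b n)).inv.aestronglyMeasurable).const_mul _
    · filter_upwards [hae] with y hy; obtain ⟨θ, -, rfl⟩ := hy; have h1 := norm_exp_mul_I θ
      have h2 : ‖(exp (θ*I))⁻¹‖ = 1 := by rw [norm_inv, h1, inv_one]
      rw [hInf_eq (exp_ne_zero _) (exp_add_inv θ), symPoch]; have e1 := hquot n _ h1
      have e2 := hquot n _ h2; set z := exp (θ*I)
      have : Π(b n;q)*Π(b n;q)*(D (cos θ) / (Π(b n*z;q)*Π(b n*z⁻¹;q))) =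
          (Π(b n;q)/Π(b n*z;q))*(Π(b n;q)/Π(b n*z⁻¹;q)) * D (cos θ) := by
        simp only [div_eq_mul_inv, mul_inv]; ring
      rw [this, norm_mul, norm_mul]; gcongr
    · filter_upwards [hae] with y hy; obtain ⟨θ, hθ, rfl⟩ := hy
      have e1 : ∀ f : ℂ, hInf f q (cos θ) = Π(f*exp (θ*I);q) * Π(f*(exp (θ*I))⁻¹;q) :=
        fun f => hInf_eq (exp_ne_zero _) (exp_add_inv θ)
      have hne : hInf 1 q (cos θ) ≠ 0 := by
        have := sq_norm_qPochInf_exp hq0 hq1 1 θ; rw [ofReal_one] at this; rw [← this]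
        have h2 := qPochInf_exp_ne_zero hq0 hq1 1 hθ.1 hθ.2; rw [ofReal_one] at h2
        exact_mod_cast pow_ne_zero 2 (norm_ne_zero_iff.2 h2)
      have t0 : Tendsto (fun n => Π(b n;q)) atTop (𝓝 0) := by
        rw [← h10]; exact (hcq.tendsto _).comp hbt
      have t1 : Tendsto (fun n => hInf (b n) q (cos θ)) atTop (𝓝 (hInf 1 q (cos θ))) := by
        simp only [e1]
        exact ((hcq.tendsto _).comp (hbt.mul_const _)).mul ((hcq.tendsto _).comp (hbt.mul_const _))
      have := (t0.mul t0).mul ((tendsto_const_nhds (x := D (cos θ))).div t1 hne); simpa using this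
  have T2 : Tendsto (fun n => Π(b n;q)*Π(b n;q)*awTotal q 1 (b n) c d) atTop (𝓝 0) := by
    have e1 : ∀ n, Π(b n;q)*Π(b n;q)*awTotal q 1 (b n) c d =
        Π(b n;q)*(Π(b n*c*d;q)/(Π(q;q)*(Π(c;q) *
        Π(d;q)*Π(b n*c;q)*Π(b n*d;q)*Π(c*d;q)))) := by
      intro n; have := qPochInf_ne hq (hbn n); unfold awTotal; simp only [one_mul]
      simp only [div_eq_mul_inv, mul_inv]; field_simp
    have f3 : ∀ f : ℂ, Tendsto (fun n => Π(b n*f;q)) atTop (𝓝 (Π(1*f;q))) :=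
      fun f => (hcq.tendsto _).comp (hbt.mul_const f)
    have f4 : Tendsto (fun n => Π(b n*c*d;q)) atTop (𝓝 (Π(1*c*d;q))) :=
      (hcq.tendsto _).comp ((hbt.mul_const c).mul_const d)
    have t0 : Tendsto (fun n => Π(b n;q)) atTop (𝓝 0) := by
      rw [← h10]; exact (hcq.tendsto _).comp hbt
    have n1 := qPochInf_ne hq hq; have n2 := qPochInf_ne hq hc; have n3 := qPochInf_ne hq hd
    have n4 := qPochInf_ne hq (norm_mul_lt_one hc hd)
    have := t0.mul (f4.div ((((f3 c).const_mul (Π(c;q)*Π(d;q))).mul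
      (f3 d)).mul_const (Π(c*d;q)) |>.const_mul (Π(q;q)))
      (by simp [n1, n2, n3, n4]))
    rw [zero_mul] at this; exact this.congr fun n => (e1 n).symm
  rw [integral_zero] at T1; have T3 := T1.sub T2; rw [sub_zero] at T3
  refine tendsto_nhds_unique (tendsto_const_nhds.congr fun n => ?_) T3
  rw [← hint _ (hbn n), mul_sub, ← integral_const_mul]

/-- The case `x = q / e` of the Askey-Wilson integral for `e > 1`. The product `(x z, x / z; q)_∞`
with `x = e⁻¹` vanishes at the mass point `μ(e)`, so removing this point relates the integral to
the one with parameters `e q, e⁻¹`. -/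
lemma awIntegral_of_mul_eq {e : ℝ} {N : ℕ} (he : ∀ k, k < N+1 ↔ 1 < e*q^k)
    {c d : ℂ} (hc : ‖c‖ < 1) (hd : ‖d‖ < 1) (hec : ‖e*c‖ < 1) (hed : ‖e*d‖ < 1)
    (hint : ∫ y, 1/hInf c q y/hInf d q y/hInf (e:ℂ)⁻¹ q y ∂refM q (e*q) N =
      awTotal q (e*q) (e:ℂ)⁻¹ c d) :
    ∫ y, 1/hInf c q y/hInf d q y/hInf (q/e) q y ∂refM q e (N+1) = awTotal q e (q/e) c d := by
  have hq := norm_lt_one hq0 hq1; have he1 : 1 < e := by simpa using (he 0).1 (by omega)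
  have he0 : 0 < e := one_pos.trans he1; have hec0 := ofReal_ne he0
  have hei : ‖(e:ℂ)⁻¹‖ < 1 := by
    rw [norm_inv, norm_real, norm_of_nonneg he0.le]; exact inv_lt_one_of_one_lt₀ he1
  have hx : ‖(q/e:ℂ)‖ < 1 := by rw [div_eq_mul_inv]; exact norm_mul_lt_one hq hei
  have hex : ‖e*(q/e:ℂ)‖ < 1 := by grind
  set μ' : Measure ℝ := refCircle q e + ∑ k ∈ range N,
    ENNReal.ofReal (refMass q e (k+1)).re • Measure.dirac (mu (e*q^(k+1))) with hμ'
  have hsplit : refM q e (N+1) = μ'+ENNReal.ofReal (refMass q e 0).re • Measure.dirac (mu e) := by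
    rw [refM, sum_range_succ', hμ', add_assoc, pow_zero, mul_one]
  have hpos := isPos_refMass hq0 hq1 he0 (k := 0) (by linarith)
  have hi1 := integrable_inv_hInf hq0 hq1 he0 he hc hd hx hec hed hex
  -- all points of `μ'` differ from `μ(e)`
  have hae : ∀ᵐ y ∂μ', hFin (e:ℂ)⁻¹ q 1 y ≠ 0 := by
    have hinj : ∀ v : ℝ, 1 ≤ v → v < e → hFin (e:ℂ)⁻¹ q 1 (mu v) ≠ 0 := by
      intro v hv hve
      have hv0 : (v:ℂ) ≠ 0 := by
        have : v ≠ 0 := by positivity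
        simp [*]
      rw [hFin_eq_qPoch hv0 mu_add_inv]
      simp only [qPoch, Finset.range_one, Finset.prod_singleton, pow_zero, mul_one]
      have h1 : (1:ℝ)-e⁻¹*v ≠ 0 := by
        rw [inv_mul_eq_div]; exact (sub_pos.2 ((div_lt_one he0).2 hve)).ne'
      have h2 : (1:ℝ)-e⁻¹*v⁻¹ ≠ 0 := by
        rw [← mul_inv]; exact (sub_pos.2 (inv_lt_one_of_one_lt₀ (by nlinarith))).ne'
      exact mul_ne_zero (by exact_mod_cast h1) (by exact_mod_cast h2)
    rw [hμ', ae_add_measure_iff, ae_finsetSum_measure_iff]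
    refine ⟨?_, fun k hk => Measure.ae_smul_measure ?_ _⟩
    · have h0 := ae_refM (q := q) e 0; rw [refM, Finset.sum_range_zero, add_zero] at h0
      filter_upwards [h0] with y hy; rcases hy with ⟨θ, hθ, rfl⟩ | ⟨k, hk, _⟩
      · rw [hFin_one]
        have h1 : (1-2*e⁻¹*cos θ+e⁻¹^2:ℝ) ≠ 0 := by
          have : e⁻¹ < 1 := inv_lt_one_of_one_lt₀ he1; have h3 : 0 < e⁻¹ := inv_pos.2 he0
          nlinarith [Real.cos_le_one θ, sq_pos_of_pos (sub_pos.2 this)]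
        exact_mod_cast h1
      · omega
    · rw [ae_dirac_eq, eventually_pure]; have hk1 := (he (k+1)).1 (by simpa using hk)
      refine hinj _ hk1.le ?_; have : q^(k+1) < 1 := pow_lt_one₀ hq0.le hq1 (by omega); nlinarith
  have hstep : ∀ y : ℝ, hInf (e:ℂ)⁻¹ q y = hFin (e:ℂ)⁻¹ q 1 y*hInf (q/e) q y := by
    intro y; rw [hInf_split hq (e:ℂ)⁻¹ 1 y, pow_one, div_eq_inv_mul]
  have hhe : ∀ y : ℝ, hFin e q 1 y = e^2*hFin (e:ℂ)⁻¹ q 1 y := by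
    intro y; rw [hFin_one, hFin_one]; field_simp; ring
  have hm0 : hFin (e:ℂ)⁻¹ q 1 (mu e) = 0 := by
    rw [hFin_eq_qPoch hec0 mu_add_inv]; simp [qPoch, hec0]
  rw [integral_refM_shift hq0 hq1 he0 he, hsplit, integral_add_measure, integral_smul_measure,
    integral_dirac, hhe (mu e), hm0, mul_zero, zero_mul, smul_zero, add_zero] at hint
  · rw [hsplit] at hi1 ⊢; rw [integrable_add_measure] at hi1
    rw [integral_add_measure hi1.1 hi1.2, integral_smul_measure, integral_dirac]
    have e1 : ∫ y, hFin e q 1 y*(1/hInf c q y/hInf d q y/hInf (e:ℂ)⁻¹ q y) ∂μ' =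
        e^2 * ∫ y, 1/hInf c q y/hInf d q y/hInf (q/e) q y ∂μ' := by
      rw [← integral_const_mul]; refine integral_congr_ae ?_; filter_upwards [hae] with y hy
      rw [hhe, hstep, mul_assoc]; congr 1
      rw [← div_div _ (hFin (e:ℂ)⁻¹ q 1 y), div_right_comm _ (hFin (e:ℂ)⁻¹ q 1 y),
        mul_div_cancel₀ _ hy]
    rw [e1] at hint
    have hI : ∫ y, 1/hInf c q y/hInf d q y/hInf (q/e) q y ∂μ' =
        awTotal q (e*q) (e:ℂ)⁻¹ c d/e^2 := by
      rw [← hint]; field_simp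
    rw [hI, toReal_ofReal hpos.re_pos.le, real_smul, hpos.coe_re]
    simp only [hInf_eq (y := mu e) hec0 mu_add_inv, symPoch, refMass, awTotal, pow_zero, mul_one,
      qPoch_zero, one_mul]
    have ce : ∀ f : ℂ, ‖f‖ < 1 → 1-f*(e:ℂ)⁻¹ ≠ 0 ∧ Π(f*(e:ℂ)⁻¹*q;q) ≠ 0 := by
      intro f hf; have h := norm_mul_lt_one hf hei
      exact ⟨one_sub_ne h, qPochInf_ne hq (norm_mul_lt_one h hq)⟩
    have ne : ∀ f : ℂ, ‖e*f‖ < 1 → 1-e*f ≠ 0 ∧ Π(e*f*q;q) ≠ 0 := fun f hf =>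
      ⟨one_sub_ne hf, qPochInf_ne hq (norm_mul_lt_one hf hq)⟩
    obtain ⟨c1, c2⟩ := ce c hc; obtain ⟨d1, d2⟩ := ce d hd; obtain ⟨c3, c4⟩ := ne c hec
    obtain ⟨d3, d4⟩ := ne d hed; have hcd := norm_mul_lt_one hc hd; have cd1 := one_sub_ne hcd
    have cd2 := qPochInf_ne hq (norm_mul_lt_one hcd hq); have q1 := qPochInf_ne hq hq
    have hee := norm_mul_lt_one hei hei; have ee1 := one_sub_ne hee
    have ee2 := qPochInf_ne hq (norm_mul_lt_one hee hq)
    rw [show (q:ℂ)/e*e = q by field_simp, show (e:ℂ)*(q/e) = q by field_simp,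
      show (q:ℂ)/e*(e:ℂ)⁻¹ = (e:ℂ)⁻¹*(e:ℂ)⁻¹*q by field_simp,
      show ((e:ℂ)^2)⁻¹ = (e:ℂ)⁻¹*(e:ℂ)⁻¹ by ring,
      show (e:ℂ)*q*(e:ℂ)⁻¹ = q by field_simp, show (q:ℂ)*c*d = c*d*q by ring,
      show (e:ℂ)⁻¹*c = c*(e:ℂ)⁻¹ by ring, show (e:ℂ)⁻¹*d = d*(e:ℂ)⁻¹ by ring,
      show (e:ℂ)*q*c = e*c*q by ring, show (e:ℂ)*q*d = e*d*q by ring,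
      show (q:ℂ)/e*c = c*(e:ℂ)⁻¹*q by field_simp,
      show (q:ℂ)/e*d = d*(e:ℂ)⁻¹*q by field_simp,
      mul_comm c (e:ℂ), mul_comm d (e:ℂ),
      qPochInf_step hq (e*c:ℂ), qPochInf_step hq (e*d:ℂ),
      qPochInf_step hq (c*(e:ℂ)⁻¹), qPochInf_step hq (d*(e:ℂ)⁻¹),
      qPochInf_step hq (c*d), qPochInf_step hq ((e:ℂ)⁻¹*(e:ℂ)⁻¹)]
    generalize Π(e*c*q;q) = x1 at *
    generalize Π(e*d*q;q) = x2 at *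
    generalize Π(c*(e:ℂ)⁻¹*q;q) = x3 at *
    generalize Π(d*(e:ℂ)⁻¹*q;q) = x4 at *
    generalize Π(c*d*q;q) = x5 at *
    generalize Π((e:ℂ)⁻¹*(e:ℂ)⁻¹*q;q) = x6 at *
    generalize Π((q:ℂ);q) = x7 at *
    have key : (1-e*c)*(1-e*d)/(e:ℂ)^2+(1-(e:ℂ)⁻¹*(e:ℂ)⁻¹)*(1-c*d) =
        (1-c*(e:ℂ)⁻¹)*(1-d*(e:ℂ)⁻¹) := by field_simp; ring
    generalize hu1 : (1-c*(e:ℂ)⁻¹) = u1 at *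
    generalize hu2 : (1-d*(e:ℂ)⁻¹) = u2 at *
    generalize hu3 : (1-(e:ℂ)*c) = u3 at *
    generalize hu4 : (1-(e:ℂ)*d) = u4 at *
    generalize hu5 : (1-c*d) = u5 at *
    generalize hu6 : (1-(e:ℂ)⁻¹*(e:ℂ)⁻¹) = u6 at *
    clear hI hint e1 hi1 hae hm0 hhe hstep; field_simp at key ⊢; omega
  · have := (Integrable.mul_continuous (suppBound_refM hq0 hq1 he0 he) hi1
      (p := fun y => (e:ℂ)^2) continuous_const)
    rw [hsplit, integrable_add_measure] at this; refine this.1.congr ?_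
    filter_upwards [hae] with y hy
    rw [hhe, hstep, ← div_div _ (hFin (e:ℂ)⁻¹ q 1 y), div_right_comm _ (hFin (e:ℂ)⁻¹ q 1 y),
        mul_assoc, mul_div_cancel₀ _ hy, mul_comm]
  · refine Integrable.smul_measure ?_ (by simp); exact integrable_dirac (by finiteness)

/-- The **Askey-Wilson integral** in the presence of mass points: one parameter `e > 0` is
arbitrary, the other three are small. -/
theorem awIntegral {e : ℝ} {N : ℕ} (he0 : 0 < e) (he : ∀ k, k < N ↔ 1 < e*q^k)
    {b c d : ℂ} (hb : ‖b‖ < 1) (hc : ‖c‖ < 1) (hd : ‖d‖ < 1) (heb : ‖e*b‖ < 1)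
    (hec : ‖e*c‖ < 1) (hed : ‖e*d‖ < 1) :
    ∫ y, 1/hInf b q y/hInf c q y/hInf d q y ∂refM q e N = awTotal q e b c d := by
  have hq := norm_lt_one hq0 hq1; rw [awTotal_swap₃ q e b c d, awTotal_swap₂ q e b d c]
  induction N generalizing e b c d with
  | zero =>
    have he1 : e ≤ 1 := by have := (he 0).not; simp at this; exact this
    rcases he1.lt_or_eq with he1 | rfl
    · rw [integral_refM_zero hq0 hq1 he0 he1 hb hc hd, awTotal_swap₃ q e b c d,
        awTotal_swap₂ q e b d c]
    · have hD := (integrable_inv_hInf hq0 hq1 he0 he hb hc (d := 0) (by simp) heb hec (by simp))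
      simp only [hInf_zero_left, div_one] at hD
      have key : ∀ x : ℂ, ‖x‖ < 1 → _ := fun x hx =>
        awError_eq hq0 hq1 he0 (suppBound_refM hq0 hq1 he0 he) hD hb hc heb hec (fun x hx _ => ?_)
          hx (by simpa using hx)
      · have h0 := awError_zero_of_eq_one hq0 hq1 hb hc hD fun x hx => by
          have := key x hx; simpa using this
        have h1 := key d hd; have n1 := qPochInf_ne hq hd
        simp only [ofReal_one, div_one, mul_one] at h1 h0 ⊢; rw [h0] at h1
        have := (mul_eq_zero.1 h1).resolve_left (mul_ne_zero n1 n1); exact sub_eq_zero.1 this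
      · have hsh := integral_refM_zero_shift hq0 hq1 1 (fun y => 1/hInf b q y/hInf c q y/hInf x q y)
        rw [one_mul] at hsh
        rw [← hsh, ofReal_one, one_mul, integral_refM_zero hq0 hq1 hq0 hq1 hb hc hx,
          awTotal_swap₃ _ _ b c x, awTotal_swap₂ _ _ b x c]
  | succ N ih =>
    have he1 : 1 < e := by simpa using (he 0).1 (by omega)
    have hec0 := ofReal_ne he0
    have hei : ‖(e:ℂ)⁻¹‖ < 1 := by
      rw [norm_inv, norm_real, norm_of_nonneg he0.le]; exact inv_lt_one_of_one_lt₀ he1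
    have hxq : ‖(q/e:ℂ)‖ < 1 := by rw [div_eq_mul_inv]; exact norm_mul_lt_one hq hei
    have hexq : ‖e*(q/e:ℂ)‖ < 1 := by rw [mul_div_cancel₀ _ hec0]; exact hq
    have heq : ∀ f : ℂ, ‖e*f‖ < 1 → ‖((e*q:ℝ):ℂ)*f‖ < 1 := by
      intro f hf; push_cast; rw [mul_right_comm]; exact norm_mul_lt_one hf hq
    have he' : ∀ k, k < N ↔ 1 < e*q*q^k := by intro k; rw [mul_assoc, ← pow_succ', ← he]; omega
    have hD := (integrable_inv_hInf hq0 hq1 he0 he hb hc (d := 0) (by simp) heb hec (by simp))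
    simp only [hInf_zero_left, div_one] at hD
    have key : ∀ x : ℂ, ‖x‖ < 1 → ‖e*x‖ < 1 → _ := fun x hx hex =>
      awError_eq hq0 hq1 he0 (suppBound_refM hq0 hq1 he0 he) hD hb hc heb hec (fun x hx hex => by
          rw [← integral_refM_shift hq0 hq1 he0 he]
          have := ih (e := e*q) (by positivity) he' hb hc hx (heq _ heb) (heq _ hec) (heq _ hex)
          push_cast at this; exact this) hx hex
    have h0 := key _ hxq hexq
    rw [sub_eq_zero.2 (awIntegral_of_mul_eq hq0 hq1 he hb hc heb hec ?_), mul_zero] at h0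
    · have h1 := key d hd hed; rw [← h0] at h1
      have n1 : Π(d/e;q) ≠ 0 := by
        rw [div_eq_mul_inv]; exact qPochInf_ne hq (norm_mul_lt_one hd hei)
      have n2 : Π(d*e;q) ≠ 0 := by rw [mul_comm]; exact qPochInf_ne hq hed
      exact sub_eq_zero.1 ((mul_eq_zero.1 h1).resolve_left (mul_ne_zero n1 n2))
    · have := ih (e := e*q) (by positivity) he' hb hc hei (heq _ heb) (heq _ hec) (by
        push_cast; rw [mul_right_comm, mul_inv_cancel₀ hec0, one_mul]; exact hq)
      push_cast at this; exact this

end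

/-! ### Moments of Askey-Wilson weights -/

/-- The complex weight `D` on the measure `μ` has the generalised moments of the Askey-Wilson weight
with parameters `e, f, g, h`. -/
structure AWMoments (q:ℂ) (μ : Measure ℝ) (D : ℝ → ℂ) (e f g h:ℂ) : Prop where
  integrable : Integrable D μ
  bound : ∃ R, SuppBound μ R
  moment : ∀ k i n j : ℕ, ∫ y, hFin e q k y*hFin f q i y*hFin g q n y*hFin h q j y*D y ∂μ =
    awTotal q (e*q^k) (f*q^i) (g*q^n) (h*q^j)

namespace AWMoments

variable {q : ℂ} {μ : Measure ℝ} {D : ℝ → ℂ} {e f g h : ℂ}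

lemma swap₁ (H : AWMoments q μ D e f g h) : AWMoments q μ D f e g h := by
  refine ⟨H.integrable, H.bound, fun k i n j => ?_⟩; rw [awTotal_swap₁, ← H.moment]; grind

lemma swap₂ (H : AWMoments q μ D e f g h) : AWMoments q μ D e g f h := by
  refine ⟨H.integrable, H.bound, fun k i n j => ?_⟩; rw [awTotal_swap₂, ← H.moment]; grind

lemma swap₃ (H : AWMoments q μ D e f g h) : AWMoments q μ D e f h g := by
  refine ⟨H.integrable, H.bound, fun k i n j => ?_⟩; rw [awTotal_swap₃, ← H.moment]; grind

lemma mul_continuous (H : AWMoments q μ D e f g h) {p : ℝ → ℂ} (hp : Continuous p) :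
    Integrable (fun y => p y*D y) μ := by
  obtain ⟨R, hR⟩ := H.bound
  exact (Integrable.mul_continuous hR H.integrable hp).congr
    (Eventually.of_forall fun y => mul_comm _ _)

lemma shift₁ (H : AWMoments q μ D e f g h) (N:ℕ) :
    AWMoments q μ (fun y => hFin e q N y*D y) (e*q^N) f g h := by
  refine ⟨H.mul_continuous (continuous_hFin e q N), H.bound, fun k i n j => ?_⟩
  rw [mul_assoc e, ← pow_add, ← H.moment]
  refine integral_congr_ae (Eventually.of_forall fun y => ?_); simp only [hFin_add]; ring

lemma shift₂ (H : AWMoments q μ D e f g h) (N:ℕ) :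
    AWMoments q μ (fun y => hFin f q N y*D y) e (f*q^N) g h :=
  (H.swap₁.shift₁ N).swap₁

lemma shift₃ (H : AWMoments q μ D e f g h) (N:ℕ) :
    AWMoments q μ (fun y => hFin g q N y*D y) e f (g*q^N) h :=
  (H.swap₂.shift₂ N).swap₂

lemma shift₄ (H : AWMoments q μ D e f g h) (N:ℕ) :
    AWMoments q μ (fun y => hFin h q N y*D y) e f g (h*q^N) :=
  (H.swap₃.shift₃ N).swap₃

end AWMoments

section

variable {q : ℝ} (hq0 : 0 < q) (hq1 : q < 1)

include hq0 hq1

lemma integral_hFin_mul_refM {e : ℝ} {N : ℕ} (he0 : 0 < e) (he : ∀ k, k < N ↔ 1 < e*q^k)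
    (k:ℕ) (F : ℝ → ℂ) : ∃ N' : ℕ, (∀ j, j < N' ↔ 1 < e*q^k*q^j) ∧
      ∫ y, hFin e q k y*F y ∂refM q e N = ∫ y, F y ∂refM q (e*q^k) N' := by
  induction k generalizing e N with
  | zero => exact ⟨N, by grind, by simp⟩
  | succ k ih =>
    have h1 : ∀ y, hFin e q (k+1) y*F y = hFin e q 1 y*(hFin (e*q:ℝ) q k y*F y) := by
      intro y; rw [hFin_succ', mul_assoc]; push_cast; rfl
    simp only [h1]; have h2 : e*q^(k+1) = e*q*q^k := by ring
    rw [h2]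
    cases N with
    | zero =>
      rw [← integral_refM_zero_shift hq0 hq1]
      refine ih (by positivity) fun j => ⟨fun h => by omega, fun h => ?_⟩
      refine (he j).2 (h.trans_le ?_); have : e*q*q^j = e*q^j*q := by ring
      rw [this]; exact mul_le_of_le_one_right (by positivity) hq1.le
    | succ N =>
      rw [← integral_refM_shift hq0 hq1 he0 he]; refine ih (by positivity) fun j => ?_
      rw [mul_assoc, ← pow_succ', ← he]; omega

lemma hFin_div_hInf {f : ℂ} (i:ℕ) {y : ℝ} (h : hInf f q y ≠ 0) (z:ℂ) :
    hFin f q i y*(z/hInf f q y) = z/hInf (f*q^i) q y := by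
  rw [hInf_split (norm_lt_one hq0 hq1) f i] at h ⊢; grind

/-- The moments of the Askey-Wilson measure with one arbitrary positive parameter. -/
theorem awMoments_refM {e : ℝ} {N : ℕ} (he0 : 0 < e) (he : ∀ k, k < N ↔ 1 < e*q^k)
    {b c d : ℂ} (hb : ‖b‖ < 1) (hc : ‖c‖ < 1) (hd : ‖d‖ < 1) (heb : ‖e*b‖ < 1)
    (hec : ‖e*c‖ < 1) (hed : ‖e*d‖ < 1) :
    AWMoments q (refM q e N) (fun y => 1/hInf b q y/hInf c q y/hInf d q y) e b c d := by
  have hq := norm_lt_one hq0 hq1; have hμ := suppBound_refM hq0 hq1 he0 he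
  refine ⟨integrable_inv_hInf hq0 hq1 he0 he hb hc hd heb hec hed, ⟨_, hμ⟩, fun k i n j => ?_⟩
  have hpow : ∀ (f:ℂ) (i:ℕ), ‖f*q^i‖ ≤ ‖f‖ := fun f i => by
    rw [norm_mul, norm_pow]
    exact mul_le_of_le_one_right (norm_nonneg _) (pow_le_one₀ (norm_nonneg _) hq.le)
  have h1 : ∫ y, hFin e q k y*hFin b q i y*hFin c q n y*hFin d q j y *
      (1/hInf b q y/hInf c q y/hInf d q y) ∂refM q e N =
      ∫ y, hFin e q k y*(1/hInf (b*q^i) q y/hInf (c*q^n) q y / hInf (d*q^j) q y) ∂refM q e N := by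
    refine integral_congr_ae ?_; filter_upwards [hμ] with y hy
    rw [← hFin_div_hInf hq0 hq1 j (hInf_ne_zero hq (norm_mul_max_lt he0 hd hed) hy),
      div_right_comm _ (hInf (c*q^n) q y),
      ← hFin_div_hInf hq0 hq1 n (hInf_ne_zero hq (norm_mul_max_lt he0 hc hec) hy),
      div_right_comm 1 (hInf (b*q^i) q y), div_right_comm _ (hInf (b*q^i) q y),
      ← hFin_div_hInf hq0 hq1 i (hInf_ne_zero hq (norm_mul_max_lt he0 hb heb) hy)]
    ring
  rw [h1]
  obtain ⟨N', hN', e1⟩ := integral_hFin_mul_refM hq0 hq1 he0 he k fun y =>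
    1/hInf (b*q^i) q y/hInf (c*q^n) q y/hInf (d*q^j) q y
  have hee : ∀ (f:ℂ) (i:ℕ), ‖e*f‖ < 1 → ‖((e*q^k:ℝ):ℂ)*(f*q^i)‖ < 1 := by
    intro f i hf; have : ((e*q^k:ℝ):ℂ)*(f*q^i) = e*f*q^(k+i) := by push_cast; ring
    grind
  rw [e1, awIntegral hq0 hq1 (by positivity) hN' ((hpow b i).trans_lt hb) ((hpow c n).trans_lt hc)
    ((hpow d j).trans_lt hd) (hee b i heb) (hee c n hec) (hee d j hed)]
  push_cast; rfl

end

/-! ### The little q-Jacobi function as a `₂φ₂` series -/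

lemma exists_norm_hFin_le {q : ℂ} (hq : ‖q‖ < 1) (e:ℂ) (r:ℝ) :
    ∃ M, 0 ≤ M ∧ ∀ (y:ℝ) (k:ℕ), |y| ≤ r → ‖hFin e q k y‖ ≤ M := by
  have hq' : ‖((‖q‖:ℝ):ℂ)‖ < 1 := by simp [*]
  set R := 2 * ‖e‖ * |r| + ‖e‖ ^ 2 with hR; obtain ⟨M, hM⟩ := exists_norm_qPoch_le hq' (-R)
  refine ⟨M, (norm_nonneg _).trans (hM.2 0), fun y k hy => ?_⟩; have hy' := hy.trans (le_abs_self r)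
  have h1 : ‖hFin e q k y‖ ≤ ∏ j ∈ range k, (1+R * ‖q‖ ^ j) := by
    rw [hFin, norm_prod]; refine Finset.prod_le_prod (fun _ _ => norm_nonneg _) fun j _ => ?_
    have e1 : ‖2*e*(y:ℂ)*q^j‖ ≤ 2 * ‖e‖ * |r| * ‖q‖ ^ j := by
      rw [norm_mul, norm_mul, norm_mul, norm_pow, norm_real, Complex.norm_ofNat, norm_eq_abs]
      gcongr
    have e2 : ‖e^2*q^(2*j)‖ ≤ ‖e‖ ^ 2 * ‖q‖ ^ j := by
      rw [norm_mul, norm_pow, norm_pow]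
      exact mul_le_mul_of_nonneg_left (pow_le_pow_of_le_one (norm_nonneg _) hq.le (by omega))
        (by positivity)
    calc _ ≤ ‖1-2*e*(y:ℂ)*q^j‖ + ‖e^2*q^(2*j)‖ := norm_add_le _ _
      _ ≤ (1 + ‖2*e*(y:ℂ)*q^j‖) + ‖e^2*q^(2*j)‖ := by
        have := norm_sub_le 1 (2*e*(y:ℂ)*q^j); rw [norm_one] at this; gcongr
      _ ≤ _ := by grind
  refine h1.trans (le_trans (le_of_eq ?_) (hM.2 k))
  have : qPoch (-(R:ℂ)) ((‖q‖:ℝ):ℂ) k = ((∏ j ∈ range k, (1+R * ‖q‖ ^ j) : ℝ) : ℂ) := by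
    rw [qPoch]; push_cast; simp
  rw [this, norm_real, norm_of_nonneg]; positivity

lemma pow_choose_succ {R : Type*} [CommMonoid R] (q : R) (k:ℕ) :
    q^((k+1).choose 2) = q^k*q^(k.choose 2) := by
  rw [← pow_add, choose_succ_succ' k 1, choose_one_right]

lemma summable_pow_mul_pow_choose {q : ℝ} (hq0 : 0 < q) (hq1 : q < 1) (r:ℝ) (hr : 0 ≤ r) :
    Summable fun k : ℕ => r^k*q^(k.choose 2) := by
  rcases hr.eq_or_lt with rfl | hr
  · refine summable_of_ne_finset_zero (s := {0}) fun k hk => ?_; rw [zero_pow (by grind), zero_mul]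
  · refine summable_of_ratio_test_tendsto_lt_one (l := 0) zero_lt_one
      (Eventually.of_forall fun k => by positivity) ?_
    have : ∀ k : ℕ, ‖r^(k+1)*q^((k+1).choose 2)‖ / ‖r^k*q^(k.choose 2)‖ = r*q^k := by
      intro k
      rw [norm_of_nonneg (by positivity), norm_of_nonneg (by positivity), pow_choose_succ, pow_succ]
      field_simp
    simp only [this]; simpa using (tendsto_pow_atTop_nhds_zero_of_lt_one hq0.le hq1).const_mul r

/-- The terms of `gSer`. -/
def gTerm (q:ℂ) (c : ℕ → ℂ) (x β z:ℂ) (k:ℕ) : ℂ := c k*((-(z*β))^k*q^(k.choose 2))*Π(x*z*q^k;q)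

/-- The series `∑_k c_k (-β z)^k q^{k(k-1)/2} (x z q^k; q)_∞`. -/
def gSer (q:ℂ) (c : ℕ → ℂ) (x β z:ℂ) : ℂ := ∑' k, gTerm q c x β z k

section

variable {q : ℝ} (hq0 : 0 < q) (hq1 : q < 1)

include hq0 hq1

lemma exists_gTerm_bound (x β:ℂ) (r:ℝ) (hr : 0 ≤ r) {M : ℝ} :
    ∃ u : ℕ → ℝ, Summable u ∧ ∀ (c : ℕ → ℂ) (z:ℂ) (k:ℕ), (∀ k, ‖c k‖ ≤ M) →
      ‖z‖ ≤ r → ‖gTerm q c x β z k‖ ≤ u k := by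
  have hq := norm_lt_one hq0 hq1; obtain ⟨M1, h10, h1⟩ := exists_norm_qPochInf_le hq (‖x‖ * r)
  refine ⟨fun k => |M| * ((r * ‖β‖)^k*q^(k.choose 2))*M1,
    ((summable_pow_mul_pow_choose hq0 hq1 (r * ‖β‖) (by positivity)).mul_left _).mul_right _,
    fun c z k hM hz => ?_⟩
  unfold gTerm
  rw [norm_mul, norm_mul, norm_mul, norm_pow, norm_pow, norm_neg, norm_mul,
    norm_real, norm_of_nonneg hq0.le]
  have e1 : ‖Π(x*z*q^k;q)‖ ≤ M1 := by
    refine h1 _ ?_; rw [norm_mul, norm_mul, norm_pow]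
    exact (mul_le_of_le_one_right (by positivity) (pow_le_one₀ (norm_nonneg _) hq.le)).trans
      (by gcongr)
  have e2 := (hM k).trans (le_abs_self M); beta_reduce; gcongr

variable {c : ℕ → ℂ} {M : ℝ} (hc : ∀ k, ‖c k‖ ≤ M)

include hc

lemma summable_gTerm (x β z:ℂ) : Summable (gTerm q c x β z) := by
  obtain ⟨u, hu, h⟩ := exists_gTerm_bound hq0 hq1 (M := M) x β ‖z‖ (norm_nonneg _)
  exact Summable.of_norm_bounded hu fun k => h c z k hc le_rfl

lemma differentiable_gSer (x β:ℂ) : Differentiable ℂ (gSer q c x β) := by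
  have hq := norm_lt_one hq0 hq1; intro z
  obtain ⟨u, hu, h⟩ := exists_gTerm_bound hq0 hq1 (M := M) x β (‖z‖ + 1) (by positivity)
  have := Complex.differentiableOn_tsum_of_summable_norm hu
    (F := fun k z => gTerm q c x β z k) (U := Metric.ball 0 (‖z‖ + 1))
    (fun k => by
      have hd := differentiable_qPochInf hq; unfold gTerm
      have h2 : Differentiable ℂ fun z : ℂ => Π(x*z*q^k;q) :=
        hd.comp (g := fun a => Π(a;(q:ℂ))) (f := fun z : ℂ => x*z*(q:ℂ)^k) (by fun_prop)
      exact (Differentiable.mul (by fun_prop) h2).differentiableOn)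
    Metric.isOpen_ball
    (fun k w hw => h c w k hc (by rw [Metric.mem_ball, dist_zero_right] at hw; exact hw.le))
  refine (this z ?_).differentiableAt (Metric.isOpen_ball.mem_nhds ?_) <;>
  · rw [Metric.mem_ball, dist_zero_right]; linarith

omit hq0 hq1 hc in
lemma gSer_zero (q:ℂ) (c : ℕ → ℂ) (x β:ℂ) : gSer q c x β 0 = c 0 := by
  unfold gSer; rw [tsum_eq_single 0]
  · simp [gTerm]
  · intro k hk; simp [gTerm, hk]

lemma tendsto_gCoeff (x β z:ℂ) : Tendsto (fun k : ℕ => c k*((-(z*β))^k*(q:ℂ)^(k.choose 2)) *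
      Π(x*z*q^k*q;q)) atTop (𝓝 0) := by
  have hq := norm_lt_one hq0 hq1; have h1 := (summable_gTerm hq0 hq1 hc 0 β z).tendsto_atTop_zero
  have h2 := tendsto_qPochInf_mul_pow hq (x*z*q); have := h1.mul h2; rw [zero_mul] at this
  refine this.congr fun k => ?_; simp only [gTerm, zero_mul, qPochInf_zero_left, mul_one]; ring

end

/-- A telescoping series whose primitive vanishes at `0` and at infinity has sum zero. -/
lemma tsum_eq_zero_of_telescope {t U : ℕ → ℂ} (ht : Summable t)
    (h : ∀ k, t k = U (k+1)-U k) (h0 : U 0 = 0) (hU : Tendsto U atTop (𝓝 0)) :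
    ∑' k, t k = 0 := by
  have h1 := ht.hasSum.tendsto_sum_nat
  have h2 : ∀ n, ∑ k ∈ range n, t k = U n := by
    intro n; rw [sum_congr rfl fun k _ => h k, Finset.sum_range_sub, h0, sub_zero]
  simp only [h2] at h1; exact tendsto_nhds_unique h1 hU

/-- The series `∑_k (A a q^k; q)_∞ (-a B)^k q^{k(k-1)/2} (A z, A / z; q)_k / (q, A B; q)_k`, where
`y = (z + z⁻¹) / 2`. As a function of `a / z` it is the product of `(a / z; q)_∞` and the analytic
continuation of `₂φ₁(A z, B z; A B; q, a / z)`. -/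
def wFun (q A B a:ℂ) (y:ℝ) : ℂ := gSer q (fun k => hFin A q k y/(qPoch q q k*qPoch (A*B) q k)) A B a

section

variable {q : ℝ} (hq0 : 0 < q) (hq1 : q < 1) 

include hq0 hq1

lemma exists_wCoeff_bound {A B : ℂ} (hAB : ∀ j : ℕ, A*B*q^j ≠ 1) (R:ℝ) : ∃ M : ℝ, ∀ (y:ℝ) (k:ℕ),
    |y| ≤ R → ‖hFin A q k y/(qPoch q q k*qPoch (A*B) q k)‖ ≤ M := by
  have hq := norm_lt_one hq0 hq1
  obtain ⟨M2, h20, h2⟩ := exists_le_norm_qPoch hq (a := (q:ℂ)) (mul_pow_ne_one hq hq)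
  obtain ⟨M3, h30, h3⟩ := exists_le_norm_qPoch hq hAB
  obtain ⟨M4, h40, h4⟩ := exists_norm_hFin_le hq A R; refine ⟨M4*(M2*M3), fun y k hy => ?_⟩
  rw [div_eq_mul_inv, mul_inv, norm_mul, norm_mul]; have e2 := h2 k; have e3 := h3 k
  have e4 := h4 y k hy; gcongr

lemma exists_wCoeff_bound' {A B : ℂ} (hAB : ∀ j : ℕ, A*B*q^j ≠ 1) (y:ℝ) : ∃ M : ℝ, ∀ k : ℕ,
      ‖hFin A q k y/(qPoch q q k*qPoch (A*B) q k)‖ ≤ M := by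
  obtain ⟨M, hM⟩ := exists_wCoeff_bound hq0 hq1 hAB |y|; exact ⟨M, fun k => hM y k le_rfl⟩

/-- The three-term `q`-difference equation of `wFun` in the variable `a`. -/
lemma wFun_rec {A B : ℂ} (hAB : ∀ j : ℕ, A*B*q^j ≠ 1) (a:ℂ) (y:ℝ) :
    wFun q A B a y-(1+A*B/q-(A+B)*a)*wFun q A B (a*q) y +
      A*B/q*hFin (a*q) q 1 y*wFun q A B (a*q^2) y = 0 := by
  have hq := norm_lt_one hq0 hq1; have hqc := ofReal_ne hq0
  obtain ⟨M, hM⟩ := exists_wCoeff_bound' hq0 hq1 hAB y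
  set c : ℕ → ℂ := fun k => hFin A q k y/(qPoch q q k*qPoch (A*B) q k) with hcdef
  have s := fun a => summable_gTerm hq0 hq1 hM A B a
  have hc : ∀ k, c (k+1)*((1-(q:ℂ)*q^k)*(1-A*B*q^k)) = c k*(1-2*A*(y:ℂ)*q^k+A^2*q^(2*k)) := by
    intro k; have n1 : qPoch (q:ℂ) q (k+1) ≠ 0 := qPoch_ne hq hq _
    have n2 : qPoch (A*B) q (k+1) ≠ 0 := qPoch_ne_zero fun j _ => hAB j; rw [qPoch_succ] at n1 n2
    have m1 := left_ne_zero_of_mul n1; have m2 := right_ne_zero_of_mul n1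
    have m3 := left_ne_zero_of_mul n2; have m4 := right_ne_zero_of_mul n2
    simp only [hcdef, qPoch_succ, hFin_succ]; generalize (1-(q:ℂ)*q^k) = w1 at *
    generalize 1-A*B*q^k = w2 at *
    field_simp
  set U : ℕ → ℂ := fun k => -(c k*((-(a*B))^k*(q:ℂ)^(k.choose 2)) *
    Π(A*a*q^k*q;q))*((1-(q:ℂ)^k)*(1-A*B*q^k/q)) with hU
  have hT : ∀ k, gTerm q c A B a k-(1+A*B/q-(A+B)*a)*gTerm q c A B (a*q) k +
      A*B/q*hFin (a*q) q 1 y*gTerm q c A B (a*q^2) k = U (k+1)-U k := by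
    intro k; have hck := hc k; have p1 : (-(a*(q:ℂ)*B))^k = (-(a*B))^k*q^k := by ring
    have p2 : (-(a*(q:ℂ)^2*B))^k = (-(a*B))^k*(q^k)^2 := by ring
    simp only [hU, gTerm]
    rw [pow_choose_succ, hFin_one, p1, p2, show A*a*(q:ℂ)^(k+1)*q = A*a*q^k*q*q by ring,
      show A*(a*(q:ℂ))*q^k = A*a*q^k*q by ring,
      show A*(a*(q:ℂ)^2)*q^k = A*a*q^k*q*q by ring,
      qPochInf_step hq (A*a*q^k), qPochInf_step hq (A*a*q^k*q), pow_succ (q:ℂ) k,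
      pow_succ (-(a*B)) k]
    rw [pow_mul' (q:ℂ) 2 k] at hck; grind
  have hs := (((s a).sub ((s (a*q)).mul_left (1+A*B/q-(A+B)*a))).add
    ((s (a*q^2)).mul_left (A*B/q*hFin (a*q) q 1 y)))
  have e : wFun q A B a y-(1+A*B/q-(A+B)*a)*wFun q A B (a*q) y +
      A*B/q*hFin (a*q) q 1 y*wFun q A B (a*q^2) y = ∑' k, (gTerm q c A B a k -
        (1+A*B/q-(A+B)*a)*gTerm q c A B (a*q) k +
        A*B/q*hFin (a*q) q 1 y*gTerm q c A B (a*q^2) k) := by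
    unfold wFun gSer
    rw [← tsum_mul_left, ← tsum_mul_left, ← (s a).tsum_sub ((s (a*q)).mul_left _),
      ← ((s a).sub ((s (a*q)).mul_left _)).tsum_add ((s (a*q^2)).mul_left _)]
  rw [e]; refine tsum_eq_zero_of_telescope hs hT (by simp [hU]) ?_
  have t1 := tendsto_gCoeff hq0 hq1 hM A B a
  have t2 : Tendsto (fun k : ℕ => (q:ℂ)^k) atTop (𝓝 0) := tendsto_pow_atTop_nhds_zero_of_norm_lt_one hq
  have := t1.neg.mul ((t2.const_sub 1).mul (((t2.const_mul (A*B)).div_const (q:ℂ)).const_sub 1))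
  simpa [hU] using this

/-- The sum of a `₁φ₁` series: `∑_k (α; q)_k (α z q^k; q)_∞ (-z)^k q^{k(k-1)/2} / (q; q)_k`
equals `(z; q)_∞`. -/
lemma gSer_eq_qPochInf (α z:ℂ) : gSer q (fun k => qPoch α q k/qPoch q q k) α 1 z = Π(z;q) := by
  have hq := norm_lt_one hq0 hq1; have hqc := ofReal_ne hq0
  obtain ⟨M, hM⟩ : ∃ M, ∀ k, ‖qPoch α q k/qPoch q q k‖ ≤ M := by
    obtain ⟨M2, h20, h2⟩ := exists_le_norm_qPoch hq (a := (q:ℂ)) (mul_pow_ne_one hq hq)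
    obtain ⟨M4, h40, h4⟩ := exists_norm_qPoch_le hq α; refine ⟨M4*M2, fun k => ?_⟩
    rw [div_eq_mul_inv, norm_mul]; have e2 := h2 k; have e4 := h4 k; gcongr
  set c : ℕ → ℂ := fun k => qPoch α q k/qPoch q q k with hcdef
  have s := fun a => summable_gTerm hq0 hq1 hM α 1 a
  have hc : ∀ k, c (k+1)*(1-(q:ℂ)*q^k) = c k*(1-α*q^k) := by
    intro k; have n1 : qPoch (q:ℂ) q (k+1) ≠ 0 := qPoch_ne hq hq _; rw [qPoch_succ] at n1
    have m1 := left_ne_zero_of_mul n1; have m2 := right_ne_zero_of_mul n1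
    simp only [hcdef, qPoch_succ]; grind
  have hrec : ∀ z, gSer q c α 1 z = (1-z)*gSer q c α 1 (z*q) := by
    intro z
    set U : ℕ → ℂ := fun k => -(c k*((-(z*1))^k*(q:ℂ)^(k.choose 2)) *
      Π(α*z*q^k;q))*(1-(q:ℂ)^k) with hU
    have hT : ∀ k, gTerm q c α 1 z k-(1-z)*gTerm q c α 1 (z*q) k = U (k+1)-U k := by
      intro k; have hck := hc k; have p1 : (-(z*(q:ℂ)))^k = (-z)^k*q^k := by ring
      simp only [hU, gTerm, mul_one]
      rw [pow_choose_succ, p1, show α*(z*(q:ℂ))*q^k = α*z*q^k*q by ring,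
        show α*z*(q:ℂ)^(k+1) = α*z*q^k*q by ring,
        qPochInf_step hq (α*z*q^k), pow_succ (q:ℂ) k, pow_succ (-z) k]
      grind
    rw [← sub_eq_zero]; unfold gSer; rw [← tsum_mul_left, ← (s z).tsum_sub ((s (z*q)).mul_left _)]
    refine tsum_eq_zero_of_telescope ((s z).sub ((s (z*q)).mul_left _)) hT (by simp [hU]) ?_
    have t1 := (s z).tendsto_atTop_zero
    have t2 : Tendsto (fun k : ℕ => (q:ℂ)^k) atTop (𝓝 0) :=
      tendsto_pow_atTop_nhds_zero_of_norm_lt_one hq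
    have := t1.neg.mul (t2.const_sub 1); simpa [hU, gTerm] using this
  have hiter : ∀ n : ℕ, gSer q c α 1 z = qPoch z q n*gSer q c α 1 (z*q^n) := by
    intro n
    induction n with
    | zero => simp
    | succ n ih => rw [ih, hrec, qPoch_succ, pow_succ]; ring_nf
  have hcont := (differentiable_gSer hq0 hq1 hM α 1).continuous
  have t := (tendsto_qPoch hq z).mul ((hcont.tendsto 0).comp (tendsto_mul_pow_zero hq z))
  rw [gSer_zero] at t; have := tendsto_nhds_unique (tendsto_const_nhds.congr hiter) t
  simpa [hcdef] using this

end

section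

variable {q : ℝ} (hq0 : 0 < q) (hq1 : q < 1)

include hq0 hq1

lemma continuous_wFun {A B : ℂ} (hAB : ∀ j : ℕ, A*B*q^j ≠ 1) (a:ℂ) : Continuous (wFun q A B a) := by
  rw [continuous_iff_continuousAt]; intro y
  obtain ⟨M, hM⟩ := exists_wCoeff_bound hq0 hq1 hAB (|y| + 1)
  obtain ⟨u, hu, h⟩ := exists_gTerm_bound hq0 hq1 (M := max M 0) A B ‖a‖ (norm_nonneg _)
  have hb : ∀ (k:ℕ) (t:ℝ), t ∈ Metric.ball (0:ℝ) (|y| + 1) →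
      ‖gTerm q (fun k => hFin A q k t/(qPoch q q k*qPoch (A*B) q k)) A B a k‖ ≤ u k := by
    intro k t ht; rw [Metric.mem_ball, dist_zero_right, norm_eq_abs] at ht; grind
  have := continuousOn_tsum (f := fun (k:ℕ) (t:ℝ) =>
    gTerm q (fun k => hFin A q k t/(qPoch q q k*qPoch (A*B) q k)) A B a k)
    (s := Metric.ball (0:ℝ) (|y| + 1)) (fun k => by
      unfold gTerm
      exact ((((continuous_hFin A q k).div_const _).mul continuous_const).mul
        continuous_const).continuousOn) hu hb
  refine this.continuousAt (Metric.isOpen_ball.mem_nhds ?_)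
  rw [Metric.mem_ball, dist_zero_right, norm_eq_abs]; linarith

/-- The Askey-Wilson type integral of a little `q`-Jacobi function. Termwise integration leads to
a `₁φ₁` series. -/
theorem integral_wFun {μ : Measure ℝ} {D : ℝ → ℂ} {A B a b : ℂ} (H : AWMoments q μ D A B a b)
    (hAB : ‖A*B‖ < 1) (hAa : ‖A*a‖ < 1) (hAb : ‖A*b‖ < 1) (hBa : ‖B*a‖ < 1) :
    ∫ y, wFun q A B a y*D y ∂μ = 1/(Π(q;q)*Π(A*B;q)*Π(A*b;q) * Π(B*b;q)*Π(a*b;q)) := by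
  have hq := norm_lt_one hq0 hq1; have hAB' := mul_pow_ne_one hq hAB; obtain ⟨R, hR⟩ := H.bound
  obtain ⟨M, hM⟩ := exists_wCoeff_bound hq0 hq1 hAB' R
  obtain ⟨u, hu, h⟩ := exists_gTerm_bound hq0 hq1 (M := max M 0) A B ‖a‖ (norm_nonneg _)
  set F : ℕ → ℝ → ℂ := fun k y =>
    gTerm q (fun k => hFin A q k y/(qPoch q q k*qPoch (A*B) q k)) A B a k*D y with hF
  have hb : ∀ k, ∀ᵐ y ∂μ, ‖F k y‖ ≤ u k * ‖D y‖ := by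
    intro k; filter_upwards [hR] with y hy; rw [hF, norm_mul]
    have := h _ a k (fun k => (hM y k (abs_le_of_norm_expArg_le hy)).trans (le_max_left _ _)) le_rfl
    gcongr
  have hi : ∀ k, Integrable (F k) μ := by
    intro k; refine H.mul_continuous ?_; unfold gTerm
    exact (((continuous_hFin A q k).div_const _).mul continuous_const).mul continuous_const
  have hs := hasSum_integral_of_summable_integral_norm hi (by
    refine Summable.of_nonneg_of_le (fun k => integral_nonneg fun y => norm_nonneg _) (fun k => ?_)
      (hu.mul_right (∫ y, ‖D y‖ ∂μ))
    rw [← integral_const_mul]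
    exact integral_mono_ae (hi k).norm (H.integrable.norm.const_mul _) (hb k))
  have e1 : ∀ y, ∑' k, F k y = wFun q A B a y*D y := fun y => by simp only [hF, tsum_mul_right]; rfl
  simp only [e1] at hs; rw [← hs.tsum_eq]
  set K := Π(q;q)*Π(A*B;q)*Π(A*b;q) * Π(B*b;q)*Π(a*b;q) with hK
  have e2 : ∀ k, ∫ y, F k y ∂μ = 1/(K*Π(a*B;q)) *
      gTerm q (fun k => qPoch (A*b) q k/qPoch q q k) (A*b) 1 (a*B) k := by
    intro k; have n1 := qPochInf_ne hq hAB; have n2 := qPochInf_ne hq hAa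
    have n3 := qPochInf_ne hq hAb; have hm := H.moment k 0 0 0
    simp only [hFin_zero, mul_one, pow_zero] at hm
    have e3 : ∫ y, F k y ∂μ = (1/(qPoch q q k*qPoch (A*B) q k)*((-(a*B))^k *
        q^(k.choose 2))*Π(A*a*q^k;q)) * ∫ y, hFin A q k y*D y ∂μ := by
      rw [← integral_const_mul]; refine integral_congr_ae (Eventually.of_forall fun y => ?_)
      simp only [hF, gTerm]; ring
    rw [e3, hm]; unfold gTerm awTotal; beta_reduce; rw [hK]; rw [qPochInf_split hq (A*B) k] at n1 ⊢
    rw [qPochInf_split hq (A*a) k] at n2; rw [qPochInf_split hq (A*b) k] at n3 ⊢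
    rw [show A*(q:ℂ)^k*B = A*B*q^k by ring, show A*(q:ℂ)^k*a = A*a*q^k by ring,
      show A*(q:ℂ)^k*b = A*b*q^k by ring, mul_comm B a,
      show A*B*(q:ℂ)^k*a*b = A*b*(a*B)*q^k by ring, mul_one]
    have m1 := left_ne_zero_of_mul n1; have m3 := right_ne_zero_of_mul n2
    have m4 := left_ne_zero_of_mul n3; clear hm e3 hs e1 hi hb h hu hR hM hAB' n1 n2 n3
    clear_value K F
    generalize Π(A*a*q^k;q) = z1 at *
    generalize Π(A*B*q^k;q) = z2 at *
    generalize Π(A*b*q^k;q) = z3 at *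
    generalize Π(A*b*(a*B)*q^k;q) = z4 at *
    generalize qPoch (A*B) q k = z5 at *
    generalize qPoch (A*b) q k = z6 at *
    generalize qPoch q q k = z7 at *
    generalize Π(B*b;q) = z8 at *
    generalize Π(a*b;q) = z9 at *
    generalize Π(a*B;q) = z10 at *
    generalize Π((q:ℂ);q) = z11 at *
    generalize (-(a*B))^k*(q:ℂ)^(k.choose 2) = z12 at *
    clear hK; field_simp
  rw [tsum_congr e2, tsum_mul_left]; have e4 := gSer_eq_qPochInf hq0 hq1 (A*b) (a*B)
  unfold gSer at e4; rw [e4]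
  have n : Π(a*B;q) ≠ 0 := by rw [mul_comm]; exact qPochInf_ne hq hBa
  rw [one_div, mul_inv, mul_assoc, inv_mul_cancel₀ n, mul_one, one_div]

/-! ### The analytic continuation of the `₂φ₁` series -/

/-- A solution of the `q`-difference equation of `(z; q)_∞ ₂φ₁(α, β; γ; q, z)` that is analytic at
`0` and vanishes there is zero. -/
lemma eq_zero_of_qDifference {Δ P T : ℂ → ℂ} {g : ℂ} (hg : ∀ j : ℕ, g*q^j ≠ 1)
    (hΔ : DifferentiableOn ℂ Δ (Metric.ball 0 1)) (h0 : Δ 0 = 0) (hP : Continuous P)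
    (hT : Continuous T) (hP0 : P 0 = 1+g/q) (hT0 : T 0 = g/q)
    (h : ∀ z : ℂ, ‖z‖ < 1 → Δ z-P z*Δ (z*q)+T z*Δ (z*q^2) = 0) {z : ℂ}
    (hz : ‖z‖ < 1) : Δ z = 0 := by
  have hq := norm_lt_one hq0 hq1; have hqc := ofReal_ne hq0
  have hball : Metric.ball (0:ℂ) 1 ∈ 𝓝 (0:ℂ) := Metric.ball_mem_nhds _ one_pos
  have hA : AnalyticOnNhd ℂ Δ (Metric.ball 0 1) := hΔ.analyticOnNhd Metric.isOpen_ball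
  have hA0 : AnalyticAt ℂ Δ 0 := hA 0 (Metric.mem_ball_self one_pos)
  by_cases hev : ∀ᶠ z in 𝓝 (0:ℂ), Δ z = 0
  · exact hA.eqOn_zero_of_preconnected_of_eventuallyEq_zero (convex_ball _ _).isPreconnected
      (Metric.mem_ball_self one_pos) hev (by simp [*])
  · exfalso
    obtain ⟨n, ψ, hψ, hψ0, hn⟩ := hA0.exists_eventuallyEq_pow_smul_nonzero_iff.2 hev
    simp only [sub_zero, smul_eq_mul] at hn
    have hn0 : n ≠ 0 := by rintro rfl; have := hn.self_of_nhds; grind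
    have tq : ∀ m : ℕ, Tendsto (fun z : ℂ => z*(q:ℂ)^m) (𝓝 0) (𝓝 0) := fun m => by
      have : Continuous fun z : ℂ => z*(q:ℂ)^m := by fun_prop
      simpa using this.tendsto 0
    have hn1 := (tq 1).eventually hn; have hn2 := (tq 2).eventually hn
    have hev2 : ∀ᶠ z in 𝓝[≠] (0:ℂ), ψ z-P z*(q^n*ψ (z*q^1)) + T z*(q^(2*n)*ψ (z*q^2)) = 0 := by
      filter_upwards [nhdsWithin_le_nhds hn, nhdsWithin_le_nhds hn1, nhdsWithin_le_nhds hn2,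
        nhdsWithin_le_nhds hball, self_mem_nhdsWithin] with z a1 a2 a3 a4 a5
      have e := h z (by simpa using a4); rw [pow_one] at a2 ⊢
      rw [a1, a2, a3, mul_pow, mul_pow, ← pow_mul] at e; have : z^n ≠ 0 := pow_ne_zero _ a5; grind
    have hc := hψ.continuousAt
    have cq : ∀ m : ℕ, Tendsto (fun z : ℂ => ψ (z*(q:ℂ)^m)) (𝓝 0) (𝓝 (ψ 0)) :=
      fun m => hc.tendsto.comp (tq m)
    have tt := (hc.tendsto.sub ((hP.tendsto 0).mul ((cq 1).const_mul ((q:ℂ)^n)))).add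
      ((hT.tendsto 0).mul ((cq 2).const_mul ((q:ℂ)^(2*n))))
    have := tendsto_nhds_unique (tendsto_const_nhds.congr' (hev2.mono fun z hz => hz.symm))
      (tt.mono_left nhdsWithin_le_nhds)
    rw [hP0, hT0] at this; obtain ⟨j, rfl⟩ := Nat.exists_eq_succ_of_ne_zero hn0
    have e : ψ 0*((1-(q:ℂ)^(j+1))*(1-g*q^j)) = 0 := by
      rw [Nat.succ_eq_add_one, mul_comm 2 (j+1), pow_mul] at this; grind
    rcases mul_eq_zero.1 e with e | e
    · grind
    · rcases mul_eq_zero.1 e with e | e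
      · have h3 : ‖(q:ℂ)^(j+1)‖ < 1 := by
          rw [norm_pow]; exact pow_lt_one₀ (norm_nonneg _) hq (by omega)
        exact one_sub_ne h3 e
      grind

end

section

variable {q : ℝ} (hq0 : 0 < q) (hq1 : q < 1) {α β γ : ℂ} (hγ : ∀ j : ℕ, γ*q^j ≠ 1)

include hq0 hq1 hγ

lemma exists_phi21_bound : ∃ M, ∀ k, ‖qPochs [α, β] q k/qPochs [(q:ℂ), γ] q k‖ ≤ M := by
  have hq := norm_lt_one hq0 hq1; obtain ⟨M1, h10, h1⟩ := exists_norm_qPoch_le hq α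
  obtain ⟨M2, h20, h2⟩ := exists_norm_qPoch_le hq β
  obtain ⟨M3, h30, h3⟩ := exists_le_norm_qPoch hq (a := (q:ℂ)) (mul_pow_ne_one hq hq)
  obtain ⟨M4, h40, h4⟩ := exists_le_norm_qPoch hq hγ; refine ⟨M1*M2*(M3*M4), fun k => ?_⟩
  simp only [qPochs_cons, qPochs_nil, mul_one]
  rw [div_eq_mul_inv, mul_inv, norm_mul, norm_mul, norm_mul]; have e1 := h1 k; have e2 := h2 k
  have e3 := h3 k; have e4 := h4 k; gcongr

lemma summable_phi21 {z : ℂ} (hz : ‖z‖ < 1) :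
    Summable fun k => qPochs [α, β] q k/qPochs [(q:ℂ), γ] q k*z^k := by
  obtain ⟨M, hM⟩ := exists_phi21_bound hq0 hq1 hγ (α := α) (β := β)
  refine Summable.of_norm_bounded ((summable_geometric_of_lt_one (norm_nonneg _) hz).mul_left M)
    fun k => ?_
  rw [norm_mul, norm_pow]; have := hM k; gcongr

lemma differentiableOn_phi21 : DifferentiableOn ℂ (phi21Series α β γ q) (Metric.ball 0 1) := by
  obtain ⟨M, hM⟩ := exists_phi21_bound hq0 hq1 hγ (α := α) (β := β)
  have hM0 : 0 ≤ M := (norm_nonneg _).trans (hM 0); intro z hz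
  rw [Metric.mem_ball, dist_zero_right] at hz; obtain ⟨r, hr1, hr2⟩ := exists_between hz
  have hr0 : 0 ≤ r := (norm_nonneg _).trans hr1.le
  have := Complex.differentiableOn_tsum_of_summable_norm
    ((summable_geometric_of_lt_one hr0 hr2).mul_left M)
    (F := fun k z => qPochs [α, β] q k/qPochs [(q:ℂ), γ] q k*z^k) (U := Metric.ball 0 r)
    (fun k => by fun_prop) Metric.isOpen_ball
    (fun k w hw => by
      rw [Metric.mem_ball, dist_zero_right] at hw; rw [norm_mul, norm_pow]; have := hM k; gcongr)
  exact ((this z (by simp [*])).differentiableAt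
    (Metric.isOpen_ball.mem_nhds (by simp [*]))).differentiableWithinAt

/-- The `q`-difference equation of `₂φ₁`. -/
lemma phi21Series_rec {z : ℂ} (hz : ‖z‖ < 1) :
    (1-z)*phi21Series α β γ q z-(1+γ/q-(α+β)*z)*phi21Series α β γ q (z*q) +
      (γ/q-α*β*z)*phi21Series α β γ q (z*q^2) = 0 := by
  have hq := norm_lt_one hq0 hq1; have hqc := ofReal_ne hq0
  obtain ⟨c, hcdef⟩ : ∃ c : ℕ → ℂ, ∀ k, qPochs [α, β] q k/qPochs [(q:ℂ), γ] q k = c k :=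
    ⟨_, fun k => rfl⟩
  have hc : ∀ k, c (k+1)*((1-(q:ℂ)*q^k)*(1-γ*q^k)) = c k*((1-α*q^k)*(1-β*q^k)) := by
    intro k; have n1 : qPoch (q:ℂ) q (k+1) ≠ 0 := qPoch_ne hq hq _
    have n2 : qPoch γ q (k+1) ≠ 0 := qPoch_ne_zero fun j _ => hγ j; rw [qPoch_succ] at n1 n2
    have m1 := left_ne_zero_of_mul n1; have m2 := right_ne_zero_of_mul n1
    have m3 := left_ne_zero_of_mul n2; have m4 := right_ne_zero_of_mul n2
    simp only [← hcdef, qPochs, List.map_cons, List.map_nil, List.prod_cons, List.prod_nil, mul_one,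
      qPoch_succ]
    generalize (1-(q:ℂ)*q^k) = w1 at *
    generalize 1-γ*q^k = w2 at *
    field_simp
  have hz1 : ‖z*q‖ < 1 := norm_mul_lt_one hz hq
  have hz2 : ‖z*q^2‖ < 1 := by rw [pow_two, ← mul_assoc]; exact norm_mul_lt_one hz1 hq
  have s0 := (summable_phi21 hq0 hq1 hγ (α := α) (β := β) hz).mul_left (1-z)
  have s1 := (summable_phi21 hq0 hq1 hγ (α := α) (β := β) hz1).mul_left (1+γ/q-(α+β)*z)
  have s2 := (summable_phi21 hq0 hq1 hγ (α := α) (β := β) hz2).mul_left (γ/q-α*β*z)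
  unfold phi21Series
  rw [← tsum_mul_left, ← tsum_mul_left, ← tsum_mul_left, ← s0.tsum_sub s1, ← (s0.sub s1).tsum_add s2]
  refine tsum_eq_zero_of_telescope (U := fun k => -(c k*z^k)*((1-(q:ℂ)^k) *
    (1-γ*q^k/q))) ((s0.sub s1).add s2) (fun k => ?_) (by simp) ?_
  · have hck := hc k; simp only [hcdef]
    rw [mul_pow, mul_pow, pow_right_comm (q:ℂ) 2 k, pow_succ z k, pow_succ (q:ℂ) k]; grind
  · have t1 := (summable_phi21 hq0 hq1 hγ (α := α) (β := β) hz).tendsto_atTop_zero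
    simp only [hcdef] at t1
    have t2 : Tendsto (fun k : ℕ => (q:ℂ)^k) atTop (𝓝 0) :=
      tendsto_pow_atTop_nhds_zero_of_norm_lt_one hq
    have := t1.neg.mul ((t2.const_sub 1).mul (((t2.const_mul γ).div_const (q:ℂ)).const_sub 1))
    grind

end

section

variable {q : ℝ} (hq0 : 0 < q) (hq1 : q < 1)

include hq0 hq1

/-- The product of `(w; q)_∞` and the analytic continuation of `₂φ₁` as an explicit entire
series. -/
theorem phi21Entire_eq_wFun {A B a Y : ℂ} {y : ℝ} (hAB : ∀ j : ℕ, A*B*q^j ≠ 1)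
    (hY : Y ≠ 0) (hy : Y+Y⁻¹ = 2*y) :
    phi21Entire (A*Y) (B*Y) (A*B) q (a/Y) = wFun q A B a y := by
  have hq := norm_lt_one hq0 hq1; obtain ⟨M, hM⟩ := exists_wCoeff_bound' hq0 hq1 hAB y
  set V : ℂ → ℂ := fun w => wFun q A B (w*Y) y with hV
  have hVd : Differentiable ℂ V :=
    (differentiable_gSer hq0 hq1 hM A B).comp (f := fun w : ℂ => w*Y) (by fun_prop)
  have hVe : ∀ t : ℂ, ‖t‖ < 1 → V t = Π(t;q)*phi21Series (A*Y) (B*Y) (A*B) q t := by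
    intro t ht; rw [← sub_eq_zero]
    refine eq_zero_of_qDifference hq0 hq1 (g := A*B)
      (Δ := fun t => V t-Π(t;q)*phi21Series (A*Y) (B*Y) (A*B) q t)
      (P := fun z => 1+A*B/q-(A*Y+B*Y)*z)
      (T := fun z => (A*B/q-A*Y*(B*Y)*z)*(1-z*q)) hAB ?_ ?_ (by fun_prop)
      (by fun_prop) (by simp) (by simp) ?_ ht
    · exact hVd.differentiableOn.sub ((differentiable_qPochInf hq).differentiableOn.mul
        (differentiableOn_phi21 hq0 hq1 hAB))
    · have e1 : phi21Series (A*Y) (B*Y) (A*B) q 0 = 1 := by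
        unfold phi21Series; rw [tsum_eq_single 0]
        · simp [qPochs]
        · intro k hk; simp [hk]
      simp only [hV, zero_mul, wFun, gSer_zero, e1, qPochInf_zero_left]; simp
    · intro z hz; have r1 := phi21Series_rec hq0 hq1 hAB (α := A*Y) (β := B*Y) hz
      have r2 := wFun_rec hq0 hq1 hAB (z*Y) y; rw [hFin_eq_qPoch hY hy] at r2
      simp only [qPoch, Finset.range_one, Finset.prod_singleton, pow_zero, mul_one] at r2
      simp only [hV]
      rw [show z*(q:ℂ)*Y = z*Y*q by ring, show z*(q:ℂ)^2*Y = z*Y*q^2 by ring,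
        qPochInf_step hq z, qPochInf_step hq (z*q), show z*(q:ℂ)*q = z*q^2 by ring]
      have hYY : Y*Y⁻¹ = 1 := mul_inv_cancel₀ hY
      have e3 : A*B/(q:ℂ)*((1-z*Y*q*Y)*(1-z*Y*q*Y⁻¹)) = (A*B/q-A*Y*(B*Y)*z)*(1-z*q) := by
        have hqc := ofReal_ne hq0; field_simp
      rw [e3] at r2; grind
  have hex : ∃ E : ℂ → ℂ, Differentiable ℂ E ∧
      ∀ t : ℂ, ‖t‖ < 1 → E t = Π(t;q)*phi21Series (A*Y) (B*Y) (A*B) q t :=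
    ⟨V, hVd, hVe⟩
  unfold phi21Entire; rw [dif_pos hex]; have h1 := hex.choose_spec
  have : hex.choose = V := by
    refine AnalyticOnNhd.eq_of_eventuallyEq (z₀ := 0)
      (h1.1.differentiableOn.analyticOnNhd isOpen_univ |>.mono (Set.subset_univ _))
      (hVd.differentiableOn.analyticOnNhd isOpen_univ |>.mono (Set.subset_univ _)) ?_
    filter_upwards [Metric.ball_mem_nhds (0:ℂ) one_pos] with t ht
    rw [Metric.mem_ball, dist_zero_right] at ht; grind
  grind

/-- A symmetry of the little `q`-Jacobi functions: if `A a = q^{1-M}`, then the first `M` terms of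
the series for `wFun q A B a` vanish. -/
lemma wFun_symm {A B a : ℂ} (hAB : ∀ j : ℕ, A*B*q^j ≠ 1) {M : ℕ} (hM : A*a*q^M = q) (y:ℝ) :
    wFun q A B a y = (-(a*B))^M*q^(M.choose 2)*Π(q;q) / (qPoch q q M*Π(A*B;q))*hFin A q M y *
        wFun q (A*q^M) (a*q^M) B y := by
  have hq := norm_lt_one hq0 hq1; have hqc := ofReal_ne hq0
  obtain ⟨R, hR⟩ := exists_wCoeff_bound' hq0 hq1 hAB y; have hs := summable_gTerm hq0 hq1 hR A B a
  unfold wFun gSer; rw [← hs.sum_add_tsum_nat_add M, sum_eq_zero, zero_add, ← tsum_mul_left]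
  · refine tsum_congr fun j => ?_
    have hfac : Π((q:ℂ);q) = qPoch q q j*Π(q*q^j;q) := qPochInf_split hq q j
    have hz : A*a*(q:ℂ)^(j+M) = q*q^j := by grind
    have hAB2 := qPochInf_split hq (A*B) (M+j)
    have hch : (j+M).choose 2 = M.choose 2+j.choose 2+M*j := by
      have h : ∀ n : ℕ, (M+n).choose 2 = M.choose 2+n.choose 2+M*n := by
        intro n
        induction n with
        | zero => simp
        | succ n ih =>
          rw [← add_assoc, choose_succ_succ' _ 1, choose_succ_succ' n 1, ih,
            choose_one_right, choose_one_right]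
          ring
      rw [add_comm j, h]
    have hqM : A*(q:ℂ)^M*(a*q^M) = q*q^M := by linear_combination (q:ℂ)^M*hM
    have hn1 : Π(A*B;q) ≠ 0 := qPochInf_ne_zero hq hAB
    have hn2 : qPoch (q:ℂ) q (M+j) ≠ 0 := qPoch_ne hq hq _
    have hn3 : qPoch (q:ℂ) q j ≠ 0 := qPoch_ne hq hq _; rw [hAB2] at hn1
    have hn4 := left_ne_zero_of_mul hn1; have hn5 := right_ne_zero_of_mul hn1; simp only [gTerm]
    rw [hz, hqM, hfac, hAB2, hch, add_comm j M, hFin_add, qPoch_add]; rw [qPoch_add] at hn2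
    rw [show A*(q:ℂ)^M*B*q^j = A*B*q^(M+j) by rw [pow_add]; ring,
      show -(B*(a*(q:ℂ)^M)) = -(a*B)*q^M by ring, mul_pow, pow_add, pow_add, pow_add,
      pow_mul]
    have hn6 := left_ne_zero_of_mul hn2; have hn7 := right_ne_zero_of_mul hn2
    generalize Π(A*B*(q:ℂ)^(M+j);q) = z1 at *
    generalize Π((q:ℂ)*q^j;q) = z2 at *
    generalize qPoch (A*B) q (M+j) = z3 at *
    generalize qPoch (q:ℂ) q M = z4 at *
    generalize qPoch (q:ℂ) q j = z5 at *
    generalize qPoch ((q:ℂ)*q^M) q j = z6 at *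
    generalize hFin A q M y = z7 at *
    generalize hFin (A*(q:ℂ)^M) q j y = z8 at *
    clear hs hR hAB hM hz hqM hAB2; field_simp
  · intro k hk; rw [mem_range] at hk; simp only [gTerm]
    rw [qPochInf_eq_zero hq (j := M-1-k), mul_zero]
    obtain ⟨i, rfl⟩ : ∃ i, M = k+i+1 := ⟨M-1-k, by omega⟩; rw [show k+i+1-1-k = i by omega]
    refine mul_right_cancel₀ hqc ?_; rw [one_mul]; linear_combination hM

end

/-! ### The three-term recurrence of the Askey-Wilson polynomials -/

/-- The coefficients of the `₄φ₃` series of an Askey-Wilson polynomial, with `N` in place of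
`q ^ n`. -/
def awCoeff (a b c d q N:ℂ) (k:ℕ) : ℂ := qPoch N⁻¹ q k*qPoch (a*b*c*d*N/q) q k*q^k /
    (qPoch (a*b) q k*qPoch (a*c) q k*qPoch (a*d) q k*qPoch q q k)

lemma div_add_div_of_mul_eq {l p x s y a u v w : ℂ} (ha : a ≠ 0) (hu : u ≠ 0) (hv : v ≠ 0)
    (hw : w ≠ 0) (h : l*(a*u*v*w) = p*x*u+a*(s*y*w)) :
    l = p/(a*v*w)*x+s/(u*v)*y := by
  grind

lemma awCoeff_rec_aux {a e1 e2 e3 q N κ : ℂ} (ha : a ≠ 0) (hq : q ≠ 0) (hN : N ≠ 0) (hκ : κ ≠ 0)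
    (h0 : 1-a*e3*N^2/q^2 ≠ 0) (h1 : 1-a*e3*N^2/q ≠ 0)
    (h2 : 1-a*e3*N^2 ≠ 0) :
    (1-κ/N)*(1-a*e3*N/q*κ)*q*κ * ((1+a^2*(κ*q)^2)/(a*(κ*q))-a-1/a) -
      κ/(a*κ)*((1-a*e1*κ+a^2*e2*κ^2-a^3*e3*κ^3)*(1-q*κ)) =
    (1-a*e1*N+a^2*e2*N^2-a^3*e3*N^3) / (a*(1-a*e3*N^2/q)*(1-a*e3*N^2)) *
      ((1-(N*q)⁻¹)*((1-a*e3*N/q*κ)*(1-a*e3*N*κ))*q*κ - (1-a*e3*N/q)*((1-κ/N)*(1-a*e3*N/q*κ)*q*κ)) +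
    a*(-N)*(1-e2*(N/q)+e1*e3*(N/q)^2-e3^2*(N/q)^3) / ((1-a*e3*N^2/q^2)*(1-a*e3*N^2/q)) *
      ((1-κ/N)*(1-κ*q/N)*(1-a*e3*N/q^2)*q*κ - (1-N⁻¹)*((1-κ/N)*(1-a*e3*N/q*κ)*q*κ)) := by
  refine div_add_div_of_mul_eq ha h0 h1 h2 ?_; clear h0 h1 h2; field_simp; ring

/-- Conditions under which the Askey-Wilson polynomials and the coefficients of their three-term
recurrence have no vanishing denominators. -/
structure AWRegular (a b c d q:ℂ) : Prop where
  base_ne : q ≠ 0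
  base : ∀ j : ℕ, q*q^j ≠ 1
  total : ∀ j : ℕ, a*b*c*d*q^j ≠ q^2
  ab : ∀ j : ℕ, a*b*q^j ≠ 1
  ac : ∀ j : ℕ, a*c*q^j ≠ 1
  ad : ∀ j : ℕ, a*d*q^j ≠ 1
  bc : ∀ j : ℕ, b*c*q^j ≠ 1
  bd : ∀ j : ℕ, b*d*q^j ≠ 1
  cd : ∀ j : ℕ, c*d*q^j ≠ 1

namespace AWRegular

variable {a b c d q : ℂ}

lemma swap₁ (H : AWRegular a b c d q) : AWRegular b a c d q where
  base_ne := H.base_ne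
  base := H.base
  total := by rw [mul_comm b a]; exact H.total
  ab := by rw [mul_comm b a]; exact H.ab
  ac := H.bc
  ad := H.bd
  bc := H.ac
  bd := H.ad
  cd := H.cd

lemma swap₂ (H : AWRegular a b c d q) : AWRegular a c b d q where
  base_ne := H.base_ne
  base := H.base
  total := by rw [mul_right_comm a c b]; exact H.total
  ab := H.ac
  ac := H.ab
  ad := H.ad
  bc := by rw [mul_comm c b]; exact H.bc
  bd := H.cd
  cd := H.bd

lemma swap₃ (H : AWRegular a b c d q) : AWRegular a b d c q where
  base_ne := H.base_ne
  base := H.base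
  total := by rw [mul_right_comm (a*b) d c]; exact H.total
  ab := H.ab
  ac := H.ad
  ad := H.ac
  bc := H.bd
  bd := H.bc
  cd := by rw [mul_comm d c]; exact H.cd

lemma total_ne_zero (H : AWRegular a b c d q) (n:ℕ) :
    1-a*b*c*d*(q^n)^2/q^2 ≠ 0 ∧ 1-a*b*c*d*(q^n)^2/q ≠ 0 ∧
      1-a*b*c*d*(q^n)^2 ≠ 0 ∧ 1-a*b*c*d*q^n/q ≠ 0 := by
  have hq := H.base_ne
  refine ⟨fun h => H.total (2*n) ?_, fun h => H.total (2*n+1) ?_,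
    fun h => H.total (2*n+2) ?_, fun h => H.total (n+1) ?_⟩
  · field_simp at h; rw [mul_comm 2, pow_mul]; linear_combination -h
  · field_simp at h; rw [pow_succ, mul_comm 2, pow_mul]; linear_combination -q*h
  · rw [pow_add, mul_comm 2, pow_mul]; linear_combination -q^2*h
  grind

end AWRegular

/-- A coefficient of the three-term recurrence, with `N = q ^ n`. -/
def awUp (a b c d q N:ℂ) : ℂ := (1-a*b*N)*(1-a*c*N)*(1-a*d*N) /
    (a*(1-a*b*c*d*N^2/q)*(1-a*b*c*d*N^2))

/-- A coefficient of the three-term recurrence, with `N = q ^ n`. -/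
def awDown (a b c d q N:ℂ) : ℂ := a*(-N)*((1-b*c*(N/q))*(1-b*d*(N/q))*(1-c*d*(N/q))) /
    ((1-a*b*c*d*N^2/q^2)*(1-a*b*c*d*N^2/q))

lemma awCoeff_rec {a b c d q : ℂ} (ha : a ≠ 0) (H : AWRegular a b c d q) (n k:ℕ) :
    awCoeff a b c d q (q^n) (k+1) * ((1+a^2*(q^(k+1))^2)/(a*q^(k+1))-a-1/a) -
      awCoeff a b c d q (q^n) k/(a*q^k) =
    awUp a b c d q (q^n)*(1-a*b*c*d*q^n/q) *
      (awCoeff a b c d q (q^(n+1)) (k+1)-awCoeff a b c d q (q^n) (k+1)) +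
    awDown a b c d q (q^n)*(1-(q^n)⁻¹) *
      (awCoeff a b c d q (q^n/q) (k+1)-awCoeff a b c d q (q^n) (k+1)) := by
  have hq := H.base_ne; obtain ⟨h0, h1, h2, h3⟩ := H.total_ne_zero n
  have hN : q^n ≠ 0 := pow_ne_zero _ hq; have hκ : q^k ≠ 0 := pow_ne_zero _ hq
  have d1 : qPoch (a*b) q (k+1) ≠ 0 := qPoch_ne_zero fun j _ => H.ab j
  have d2 : qPoch (a*c) q (k+1) ≠ 0 := qPoch_ne_zero fun j _ => H.ac j
  have d3 : qPoch (a*d) q (k+1) ≠ 0 := qPoch_ne_zero fun j _ => H.ad j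
  have d4 : qPoch q q (k+1) ≠ 0 := qPoch_ne_zero fun j _ => H.base j
  rw [pow_succ q n, pow_succ q k]
  have aux := awCoeff_rec_aux (e1 := b+c+d) (e2 := b*c+b*d+c*d) (e3 := b*c*d) ha hq
    hN hκ (by grind) (by grind) (by grind)
  rw [show a*(b*c*d) = a*b*c*d by ring] at aux; unfold awUp awDown awCoeff; rw [pow_succ q k]
  generalize hNe : q^n = N at *
  generalize hX : a*b*c*d = X at *
  have p1 : qPoch N⁻¹ q (k+1) = qPoch N⁻¹ q k*(1-q^k/N) := by rw [qPoch_succ]; ring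
  have p2 : qPoch (N*q)⁻¹ q (k+1) = (1-(N*q)⁻¹)*qPoch N⁻¹ q k := by
    rw [qPoch_succ']; congr 2; field_simp
  have p3 : (1-N⁻¹)*qPoch (N/q)⁻¹ q (k+1) = qPoch N⁻¹ q k*((1-q^k/N)*(1-q^k*q/N)) := by
    have : (1-N⁻¹)*qPoch (N/q)⁻¹ q (k+1) = qPoch N⁻¹ q (k+2) := by
      rw [qPoch_succ' N⁻¹ q (k+1)]; congr 2; field_simp
    rw [this, qPoch_succ, qPoch_succ, pow_succ]; ring
  have p4 : qPoch (X*N/q) q (k+1) = qPoch (X*N/q) q k*(1-X*N/q*q^k) := qPoch_succ _ _ _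
  have p5 : (1-X*N/q)*qPoch (X*(N*q)/q) q (k+1) =
      qPoch (X*N/q) q k*((1-X*N/q*q^k)*(1-X*N*q^k)) := by
    have : (1-X*N/q)*qPoch (X*(N*q)/q) q (k+1) = qPoch (X*N/q) q (k+2) := by
      rw [qPoch_succ' (X*N/q) q (k+1)]; congr 2; field_simp
    rw [this, qPoch_succ, qPoch_succ, pow_succ]; field_simp
  have p6 : qPoch (X*(N/q)/q) q (k+1) = (1-X*N/q^2)*qPoch (X*N/q) q k := by
    rw [qPoch_succ']; field_simp
  rw [qPoch_succ] at d1 d2 d3 d4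
  rw [p1, p2, p4, p6, qPoch_succ (a*b), qPoch_succ (a*c), qPoch_succ (a*d), qPoch_succ q q]
  generalize qPoch (N/q)⁻¹ q (k+1) = t1 at *
  generalize qPoch (X*(N*q)/q) q (k+1) = t2 at *
  generalize qPoch N⁻¹ q k = g at *
  generalize qPoch (X*N/q) q k = G at *
  generalize qPoch (a*b) q k = f1 at *
  generalize qPoch (a*c) q k = f2 at *
  generalize qPoch (a*d) q k = f3 at *
  generalize qPoch q q k = f4 at *
  generalize q^k = κ at *
  have n1 := left_ne_zero_of_mul d1; have n2 := left_ne_zero_of_mul d2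
  have n3 := left_ne_zero_of_mul d3; have n4 := left_ne_zero_of_mul d4
  set F := g*G/(f1*(1-a*b*κ)*(f2*(1-a*c*κ))*(f3*(1-a*d*κ)) * (f4*(1-q*κ))) with hF
  have e1 : g*(1-κ/N)*(G*(1-X*N/q*κ))*(κ*q)/(f1*(1-a*b*κ) *
      (f2*(1-a*c*κ))*(f3*(1-a*d*κ))*(f4*(1-q*κ))) =
      F*((1-κ/N)*(1-X*N/q*κ)*q*κ) := by rw [hF]; ring
  have e2 : g*G*κ/(f1*f2*f3*f4) = F*(κ*((1-a*b*κ)*(1-a*c*κ) * (1-a*d*κ)*(1-q*κ))) := by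
    have m1 := right_ne_zero_of_mul d1; have m2 := right_ne_zero_of_mul d2
    have m3 := right_ne_zero_of_mul d3; have m4 := right_ne_zero_of_mul d4; rw [hF]
    generalize 1-a*b*κ = w1 at *
    generalize 1-a*c*κ = w2 at *
    generalize 1-a*d*κ = w3 at *
    generalize 1-q*κ = w4 at *
    field_simp
  have e3 : (1-X*N/q)*((1-(N*q)⁻¹)*g*t2*(κ*q)/(f1*(1-a*b*κ) *
      (f2*(1-a*c*κ))*(f3*(1-a*d*κ))*(f4*(1-q*κ)))) =
      F*((1-(N*q)⁻¹)*((1-X*N/q*κ)*(1-X*N*κ))*q*κ) := by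
    rw [hF]
    linear_combination (1-(N*q)⁻¹)*g*(κ*q)/(f1*(1-a*b*κ) *
      (f2*(1-a*c*κ))*(f3*(1-a*d*κ))*(f4*(1-q*κ)))*p5
  have e4 : (1-N⁻¹)*(t1*((1-X*N/q^2)*G)*(κ*q)/(f1*(1-a*b*κ) *
      (f2*(1-a*c*κ))*(f3*(1-a*d*κ))*(f4*(1-q*κ)))) =
      F*((1-κ/N)*(1-κ*q/N)*(1-X*N/q^2)*q*κ) := by
    rw [hF]
    linear_combination ((1-X*N/q^2)*G)*(κ*q)/(f1*(1-a*b*κ) *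
      (f2*(1-a*c*κ))*(f3*(1-a*d*κ))*(f4*(1-q*κ)))*p3
  rw [e1, e2]
  rw [mul_assoc (_/_) (1-X*N/q), mul_sub (1-X*N/q), e3, mul_assoc (_/_) (1-N⁻¹),
    mul_sub (1-N⁻¹), e4]
  have c1 : 1-a*(b+c+d)*N+a^2*(b*c+b*d+c*d)*N^2-a^3*(b*c*d)*N^3
      = (1-a*b*N)*(1-a*c*N)*(1-a*d*N) := by ring
  have c2 : 1-(b*c+b*d+c*d)*(N/q)+(b+c+d)*(b*c*d)*(N/q)^2 -
      (b*c*d)^2*(N/q)^3 = (1-b*c*(N/q))*(1-b*d*(N/q)) *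
      (1-c*d*(N/q)) := by ring
  have c3 : 1-a*(b+c+d)*κ+a^2*(b*c+b*d+c*d)*κ^2-a^3*(b*c*d)*κ^3
      = (1-a*b*κ)*(1-a*c*κ)*(1-a*d*κ) := by ring
  rw [c1, c2, c3] at aux; linear_combination F*aux

lemma awCoeff_zero (a b c d q N:ℂ) : awCoeff a b c d q N 0 = 1 := by simp [awCoeff]

lemma awCoeff_eq_zero {a b c d q : ℂ} (hq : q ≠ 0) {n k : ℕ} (h : n < k) :
    awCoeff a b c d q (q^n) k = 0 := by
  unfold awCoeff; rw [qPoch_eq_zero h (inv_mul_cancel₀ (pow_ne_zero _ hq))]; simp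

/-- The `₄φ₃` series of an Askey-Wilson polynomial. -/
def awSer (a b c d q:ℂ) (n:ℕ) (y:ℝ) : ℂ := ∑ k ∈ range (n+1), awCoeff a b c d q (q^n) k*hFin a q k y

lemma awPoly_eq_awSer {a b c d q : ℂ} (hq : q ≠ 0) (n:ℕ) (y:ℝ) :
    awPoly a b c d q n y = a⁻¹^n*qPochs [a*b, a*c, a*d] q n*awSer a b c d q n y := by
  unfold awPoly awSer; congr 1; refine sum_congr rfl fun k _ => ?_
  rw [zpow_neg, zpow_sub₀ hq, zpow_natCast, zpow_one]
  simp only [awCoeff, qPochs_cons, qPochs_nil, mul_one, hFin]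
  ring

lemma awSer_eq_sum_range {a b c d q : ℂ} (hq : q ≠ 0) {n m : ℕ} (h : n ≤ m) (y:ℝ) :
    awSer a b c d q n y = ∑ k ∈ range m, awCoeff a b c d q (q^n) (k+1)*hFin a q (k+1) y + 1 := by
  have h1 : awSer a b c d q n y = ∑ k ∈ range (m+1), awCoeff a b c d q (q^n) k*hFin a q k y := by
    refine Finset.sum_subset (Finset.range_subset_range.2 (by omega)) fun k _ hk => ?_
    rw [mem_range, not_lt] at hk; rw [awCoeff_eq_zero hq (by omega), zero_mul]
  rw [h1, sum_range_succ', awCoeff_zero, hFin_zero, mul_one]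

lemma two_mul_mul_hFin {a q : ℂ} (ha : a ≠ 0) (hq : q ≠ 0) (k:ℕ) (y:ℝ) :
    2*(y:ℂ)*hFin a q k y = (1+a^2*(q^k)^2)/(a*q^k)*hFin a q k y - hFin a q (k+1) y/(a*q^k) := by
  have : q^k ≠ 0 := pow_ne_zero _ hq; rw [hFin_succ, pow_mul']; grind

lemma awSer_rec {a b c d q : ℂ} (ha : a ≠ 0) (H : AWRegular a b c d q) (n:ℕ) (y:ℝ) :
    (2*y-a-1/a)*awSer a b c d q n y = awUp a b c d q (q^n)*(1-a*b*c*d*q^n/q) *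
        (awSer a b c d q (n+1) y-awSer a b c d q n y) +
      awDown a b c d q (q^n)*(1-(q^n)⁻¹) * (awSer a b c d q (n-1) y-awSer a b c d q n y) := by
  have hq := H.base_ne
  have h1 : (2*y-a-1/a)*awSer a b c d q n y = ∑ k ∈ range (n+1), (awCoeff a b c d q (q^n) (k+1) *
        ((1+a^2*(q^(k+1))^2)/(a*q^(k+1))-a-1/a) -
      awCoeff a b c d q (q^n) k/(a*q^k))*hFin a q (k+1) y := by
    have e : (2*y-a-1/a)*awSer a b c d q n y = ∑ k ∈ range (n+1),
        (awCoeff a b c d q (q^n) k*((1+a^2*(q^k)^2)/(a*q^k)-a-1/a) *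
          hFin a q k y-awCoeff a b c d q (q^n) k/(a*q^k)*hFin a q (k+1) y) := by
      rw [awSer, mul_sum]; refine sum_congr rfl fun k _ => ?_
      linear_combination awCoeff a b c d q (q^n) k*two_mul_mul_hFin ha hq k y
    rw [e, sum_sub_distrib, sum_range_succ']; simp only [sub_mul, sum_sub_distrib]
    rw [sum_range_succ (fun k => awCoeff a b c d q (q^n) (k+1)*_*_) n,
      awCoeff_eq_zero hq (Nat.lt_succ_self n)]
    grind
  have h2 : awDown a b c d q (q^n)*(1-(q^n)⁻¹) *
        (awSer a b c d q (n-1) y-awSer a b c d q n y) = ∑ k ∈ range (n+1),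
      awDown a b c d q (q^n)*(1-(q^n)⁻¹) *
        (awCoeff a b c d q (q^n/q) (k+1)-awCoeff a b c d q (q^n) (k+1)) * hFin a q (k+1) y := by
    cases n with
    | zero => simp
    | succ m =>
      rw [Nat.add_sub_cancel, awSer_eq_sum_range hq (m := m+1+1) (by omega) y,
        awSer_eq_sum_range hq (m := m+1+1) (by omega) y, add_sub_add_right_eq_sub,
        ← sum_sub_distrib, mul_sum, pow_succ q m, mul_div_cancel_right₀ _ hq]
      exact sum_congr rfl fun k _ => by ring
  rw [h1, h2, awSer_eq_sum_range hq (m := n+1) (by omega) y,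
    awSer_eq_sum_range hq (m := n+1) (by omega) y, add_sub_add_right_eq_sub,
    ← sum_sub_distrib, mul_sum, ← sum_add_distrib]
  refine sum_congr rfl fun k _ => ?_; rw [awCoeff_rec ha H]; ring

/-- The middle coefficient of the three-term recurrence of the Askey-Wilson polynomials. -/
def awMid (a b c d q N:ℂ) : ℂ := a+1/a-awUp a b c d q N*(1-a*b*c*d*N/q)-awDown a b c d q N*(1-N⁻¹)

/-- The three-term recurrence of the Askey-Wilson polynomials. -/
theorem awPoly_rec {a b c d q : ℂ} (ha : a ≠ 0) (H : AWRegular a b c d q) (n:ℕ) (y:ℝ) :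
    2*y*awPoly a b c d q n y = (1-a*b*c*d*q^n/q)/((1-a*b*c*d*(q^n)^2/q) *
        (1-a*b*c*d*(q^n)^2))*awPoly a b c d q (n+1) y +
      awMid a b c d q (q^n)*awPoly a b c d q n y +
      (1-q^n)*((1-a*b*(q^n/q))*(1-a*c*(q^n/q))*(1-a*d*(q^n/q)) *
        ((1-b*c*(q^n/q))*(1-b*d*(q^n/q))*(1-c*d*(q^n/q)))) /
        ((1-a*b*c*d*(q^n)^2/q^2)*(1-a*b*c*d*(q^n)^2/q)) * awPoly a b c d q (n-1) y := by
  have hq := H.base_ne; have h := awSer_rec ha H n y; simp only [awPoly_eq_awSer hq]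
  have e1 : awUp a b c d q (q^n)*(1-a*b*c*d*q^n/q) * (a⁻¹^n*qPochs [a*b, a*c, a*d] q n) =
      (1-a*b*c*d*q^n/q)/((1-a*b*c*d*(q^n)^2/q) * (1-a*b*c*d*(q^n)^2))*(a⁻¹^(n+1) *
          qPochs [a*b, a*c, a*d] q (n+1)) := by
    simp only [qPochs_cons, qPochs_nil, qPoch_succ, awUp]; rw [pow_succ a⁻¹]
    generalize 1-a*b*c*d*(q^n)^2/q = v; generalize 1-a*b*c*d*(q^n)^2 = w; ring
  have e2 : awDown a b c d q (q^n)*(1-(q^n)⁻¹) *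
      (a⁻¹^n*qPochs [a*b, a*c, a*d] q n) = (1-q^n)*((1-a*b*(q^n/q)) *
        (1-a*c*(q^n/q))*(1-a*d*(q^n/q)) *
        ((1-b*c*(q^n/q))*(1-b*d*(q^n/q))*(1-c*d*(q^n/q)))) /
        ((1-a*b*c*d*(q^n)^2/q^2)*(1-a*b*c*d*(q^n)^2/q)) *
          (a⁻¹^(n-1)*qPochs [a*b, a*c, a*d] q (n-1)) := by
    cases n with
    | zero => simp
    | succ m =>
      have hN : q^m ≠ 0 := pow_ne_zero _ hq; rw [Nat.add_sub_cancel]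
      simp only [qPochs_cons, qPochs_nil, qPoch_succ, awDown]
      rw [pow_succ a⁻¹, pow_succ q m, mul_div_cancel_right₀ _ hq]
      have : a*(-(q^m*q))*(1-(q^m*q)⁻¹)*a⁻¹ = 1-q^m*q := by field_simp; ring
      rw [← this]; ring
  rw [awMid]
  linear_combination (a⁻¹^n*qPochs [a*b, a*c, a*d] q n)*h +
    awSer a b c d q (n+1) y*e1+awSer a b c d q (n-1) y*e2

lemma awMid_swap_aux {a b s p t : ℂ} {u v w x y z1 z2 z3 z4 : ℂ} (ha : a ≠ 0) (hb : b ≠ 0)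
    (hu : u ≠ 0) (hv : v ≠ 0) (hw : w ≠ 0)
    (h : ((a+1/a)-(b+1/b))*(a*b*(u*v*w)) = (z1*b-z2*a)*x*u+a*b*w*(a*s*z3-b*s*z4)*y)
    (hp : p = z1/(a*v*w)*x+a*s*z3/(u*v)*y)
    (ht : t = z2/(b*v*w)*x+b*s*z4/(u*v)*y) :
    a+1/a-p = b+1/b-t := by
  rw [hp, ht]; rw [← sub_eq_zero]
  have h2 : (a+1/a-(z1/(a*v*w)*x+a*s*z3/(u*v)*y) -
    (b+1/b-(z2/(b*v*w)*x+b*s*z4/(u*v)*y)))*(a*b*(u*v*w)) = 0 := by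
    have e1 : (z1/(a*v*w)*x+a*s*z3/(u*v)*y)*(a*b*(u*v*w)) =
      z1*b*x*u+a*b*w*(a*s*z3)*y := by field_simp
    have e2 : (z2/(b*v*w)*x+b*s*z4/(u*v)*y)*(a*b*(u*v*w)) =
      z2*a*x*u+a*b*w*(b*s*z4)*y := by field_simp
    linear_combination h-e1+e2
  grind

lemma awMid_swap {a b c d q : ℂ} (ha : a ≠ 0) (hb : b ≠ 0) (H : AWRegular a b c d q) (n:ℕ) :
    awMid a b c d q (q^n) = awMid b a c d q (q^n) := by
  have hq := H.base_ne; have hN : q^n ≠ 0 := pow_ne_zero _ hq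
  obtain ⟨h0, h1, h2, h3⟩ := H.total_ne_zero n; unfold awMid awUp awDown; rw [sub_sub, sub_sub]
  generalize q^n = N at *
  rw [mul_comm b a]; refine awMid_swap_aux (s := -N) ha hb h0 h1 h2 ?_ rfl rfl; clear h0 h1 h2 h3
  field_simp; ring

/-- The Askey-Wilson polynomials are symmetric in their parameters. -/
theorem awPoly_swap {a b c d q : ℂ} (ha : a ≠ 0) (hb : b ≠ 0) (H : AWRegular a b c d q) (n:ℕ)
    (y:ℝ) : awPoly a b c d q n y = awPoly b a c d q n y := by
  have hq := H.base_ne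
  induction n using Nat.strong_induction_on with
  | _ n ih =>
    cases n with
    | zero => simp [awPoly, qPochs]
    | succ n =>
      have r1 := awPoly_rec ha H n y; have r2 := awPoly_rec hb H.swap₁ n y
      rw [ih n (by omega), ih (n-1) (by omega), awMid_swap ha hb H] at r1
      obtain ⟨h0, h1, h2, h3⟩ := H.total_ne_zero n; rw [mul_comm b a] at r2
      have h4 : (1-a*b*c*d*q^n/q)/((1-a*b*c*d*(q^n)^2/q) *
        (1-a*b*c*d*(q^n)^2)) ≠ 0 := div_ne_zero h3 (mul_ne_zero h1 h2)
      refine mul_left_cancel₀ h4 ?_; linear_combination r2-r1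

/-- The three-term recurrence of the Al-Salam-Chihara polynomials. -/
theorem awPoly_rec_zero_zero {a b q : ℂ} (ha : a ≠ 0) (hq : q ≠ 0) (hqq : ∀ j : ℕ, q*q^j ≠ 1)
    (hab : ∀ j : ℕ, a*b*q^j ≠ 1) (n:ℕ) (y:ℝ) :
    2*y*awPoly a b 0 0 q n y = awPoly a b 0 0 q (n+1) y + (a+b)*q^n*awPoly a b 0 0 q n y +
      (1-q^n)*(1-a*b*(q^n/q))*awPoly a b 0 0 q (n-1) y := by
  have H : AWRegular a b 0 0 q :=
    ⟨hq, hqq, fun j => by grind, hab, by simp, by simp, by simp, by simp, by simp⟩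
  have h := awPoly_rec ha H n y; have hN : q^n ≠ 0 := pow_ne_zero _ hq
  have e : awMid a b 0 0 q (q^n) = (a+b)*q^n := by
    simp only [awMid, awUp, awDown, mul_zero, zero_mul, sub_zero, zero_div, mul_one, div_one]; grind
  grind

/-! ### Terminating sums -/

/-- The coefficient `(q^{-n}; q)_j q^j / (q; q)_j`. -/
def eCoeff (q:ℂ) (n j:ℕ) : ℂ := qPoch (q^n)⁻¹ q j*q^j/qPoch q q j

@[simp] lemma eCoeff_zero (q:ℂ) (n:ℕ) : eCoeff q n 0 = 1 := by simp [eCoeff]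

section

variable {q : ℂ} (hq : q ≠ 0) 

include hq

lemma eCoeff_eq_zero {n j : ℕ} (h : n < j) : eCoeff q n j = 0 := by
  rw [eCoeff, qPoch_eq_zero h (inv_mul_cancel₀ (pow_ne_zero _ hq))]; simp

variable (hqq : ∀ j : ℕ, q*q^j ≠ 1)

include hqq

omit hq in
lemma qPoch_self_ne_zero (n:ℕ) : qPoch q q n ≠ 0 := qPoch_ne_zero fun j _ => hqq j

omit hq in
lemma one_sub_pow_ne_zero (n:ℕ) : 1-q*q^n ≠ 0 := sub_ne_zero.2 (hqq n).symm

omit hq in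
lemma eCoeff_succ (n j:ℕ) : eCoeff q n (j+1)*(1-q*q^j) = eCoeff q n j*(q*(1-q^j/q^n)) := by
  have h := qPoch_self_ne_zero hqq (j+1); have h2 := qPoch_self_ne_zero hqq j
  simp only [eCoeff, qPoch_succ] at h ⊢; grind

lemma eCoeff_succ_succ (n j:ℕ) : eCoeff q (n+1) (j+1)*(1-q*q^j) = eCoeff q n j*(q-(q^n)⁻¹) := by
  have h := qPoch_self_ne_zero hqq (j+1); have h2 := qPoch_self_ne_zero hqq j
  have h3 := one_sub_pow_ne_zero hqq j; have hN := pow_ne_zero n hq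
  have e : (q^(n+1))⁻¹*q = (q^n)⁻¹ := by grind
  simp only [eCoeff, qPoch_succ' (q^(n+1))⁻¹, e]; rw [qPoch_succ] at h ⊢; grind

lemma eCoeff_pascal₁ (n j:ℕ) :
    eCoeff q (n+1) (j+1) = eCoeff q n (j+1)/q^(j+1)-eCoeff q n j/q^j := by
  have h3 := one_sub_pow_ne_zero hqq j; have h4 := pow_ne_zero j hq; have h5 := pow_ne_zero n hq
  refine mul_right_cancel₀ h3 ?_
  rw [eCoeff_succ_succ hq hqq, sub_mul, div_mul_eq_mul_div, eCoeff_succ hqq, pow_succ]; grind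

lemma eCoeff_pascal₂ (n j:ℕ) : eCoeff q (n+1) (j+1) = eCoeff q n (j+1)-eCoeff q n j/q^n := by
  have h3 := one_sub_pow_ne_zero hqq j; have h5 := pow_ne_zero n hq; refine mul_right_cancel₀ h3 ?_
  rw [eCoeff_succ_succ hq hqq, sub_mul, eCoeff_succ hqq]; ring

lemma eCoeff_pred (n j:ℕ) : eCoeff q n j*(1-q*q^n) = eCoeff q (n+1) j*(q^j-q*q^n) := by
  cases j with
  | zero => simp
  | succ j =>
    have h3 := one_sub_pow_ne_zero hqq j; have h5 := pow_ne_zero n hq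
    refine mul_right_cancel₀ h3 ?_
    rw [mul_right_comm, eCoeff_succ hqq, mul_right_comm (eCoeff q (n+1) (j+1)),
      eCoeff_succ_succ hq hqq, pow_succ]
    field_simp; ring

lemma eCoeff_self (n:ℕ) : eCoeff q n n = (-1)^n*(q^(n.choose 2))⁻¹ := by
  induction n with
  | zero => simp
  | succ n ih =>
    rw [eCoeff_pascal₁ hq hqq, eCoeff_eq_zero hq (Nat.lt_succ_self n), ih, pow_choose_succ]
    field_simp; ring

lemma eCoeff_add_add (j i D:ℕ) : eCoeff q (D+(j+i)) (D+j)*qPoch (q*q^j) q i =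
    (-1)^D*(q^(D.choose 2))⁻¹*(q^D)⁻¹^(j+i) * (eCoeff q (j+i) j*qPoch (q*q^D*q^j) q i) := by
  induction D with
  | zero => simp
  | succ D ih =>
    have h1 := eCoeff_succ_succ hq hqq (D+(j+i)) (D+j)
    have h2 : (1-q*q^(D+j))*qPoch (q*q^(D+1)*q^j) q i =
        qPoch (q*q^D*q^j) q i*(1-q*q^(D+(j+i))) := by
      rw [show q*q^(D+(j+i)) = q*q^D*q^j*q^i by ring, ← qPoch_succ, qPoch_succ',
        show q*q^D*q^j*q = q*q^(D+1)*q^j by ring,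
        show q*q^(D+j) = q*q^D*q^j by ring]
    have hD := pow_ne_zero D hq; have hn := pow_ne_zero (j+i) hq
    rw [show D+1+(j+i) = D+(j+i)+1 by ring, show D+1+j = D+j+1 by ring, pow_choose_succ]
    refine mul_right_cancel₀ (one_sub_pow_ne_zero hqq (D+j)) ?_
    have h3 : (q^(D+1))⁻¹^(j+i) = (q^D)⁻¹^(j+i)*(q^(j+i))⁻¹ := by ring
    have h4 : q-(q^(D+(j+i)))⁻¹ = -((q^D)⁻¹*(q^(j+i))⁻¹*(1-q*q^(D+(j+i)))) := by
      rw [pow_add q D]; field_simp; ring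
    rw [h3, mul_inv, pow_succ (-1:ℂ)]; grind

/-- The `q`-Chu-Vandermonde sum with a vanishing lower parameter. -/
lemma sum_eCoeff_mul_qPoch (x:ℂ) (n:ℕ) : ∑ j ∈ range (n+1), eCoeff q n j*qPoch x q j = x^n := by
  induction n with
  | zero => simp
  | succ n ih =>
    have e1 : ∑ j ∈ range (n+1), eCoeff q n (j+1)/q^(j+1)*qPoch x q (j+1) =
        ∑ j ∈ range (n+1), eCoeff q n j/q^j*qPoch x q j-1 := by
      rw [sum_range_succ' (fun j => eCoeff q n j/q^j*qPoch x q j), sum_range_succ,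
        eCoeff_eq_zero hq (Nat.lt_succ_self n)]
      simp
    rw [sum_range_succ']; simp only [eCoeff_pascal₁ hq hqq, sub_mul, sum_sub_distrib, e1]
    rw [pow_succ', ← ih, mul_sum]; simp only [eCoeff_zero, qPoch_zero, mul_one]
    rw [sub_right_comm, sub_add_cancel, ← sum_sub_distrib]; refine sum_congr rfl fun j _ => ?_
    have := pow_ne_zero j hq; rw [qPoch_succ]; grind

/-- A form of the `q`-Chu-Vandermonde sum. -/
lemma qPoch_eq_sum_eCoeff (w g:ℂ) (n:ℕ) : qPoch w q n = ∑ k ∈ range (n+1), eCoeff q n k*(q^n/q)^k *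
      (∏ j ∈ range k, (w-g*q^j))*qPoch (g*q^k) q (n-k) := by
  induction n generalizing w g with
  | zero => simp
  | succ n ih =>
    have hN := pow_ne_zero n hq
    have hprod : ∀ k, ∏ j ∈ range k, (w*q-g*q*q^j) = q^k * ∏ j ∈ range k, (w-g*q^j) := by
      intro k
      induction k with
      | zero => simp
      | succ k ih => rw [prod_range_succ, ih, prod_range_succ]; ring
    have e1 : ∑ k ∈ range (n+1), eCoeff q n (k+1)*(q^n)^(k+1) *
        (∏ j ∈ range (k+1), (w-g*q^j))*qPoch (g*q^(k+1)) q (n+1-(k+1)) =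
        ∑ k ∈ range (n+1), eCoeff q n k*(q^n)^k *
        (∏ j ∈ range k, (w-g*q^j))*qPoch (g*q^k) q (n+1-k) - qPoch g q (n+1) := by
      rw [sum_range_succ' (fun k => eCoeff q n k*(q^n)^k *
        (∏ j ∈ range k, (w-g*q^j))*qPoch (g*q^k) q (n+1-k)),
        sum_range_succ, eCoeff_eq_zero hq (Nat.lt_succ_self n)]
      simp
    rw [qPoch_succ', ih (w*q) (g*q), sum_range_succ' _ (n+1), pow_succ, mul_div_cancel_right₀ _ hq]
    simp only [eCoeff_pascal₂ hq hqq, sub_mul, sum_sub_distrib, e1, eCoeff_zero, pow_zero,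
      Finset.range_zero, Finset.prod_empty, mul_one, one_mul, Nat.sub_zero]
    rw [sub_right_comm, sub_add_cancel, ← sum_sub_distrib, ← one_mul (Finset.sum _ _),
      ← mul_assoc, ← sub_mul, mul_one, mul_sum]
    refine sum_congr rfl fun k hk => ?_; rw [mem_range] at hk
    obtain ⟨i, rfl⟩ : ∃ i, n = k+i := ⟨n-k, by omega⟩
    rw [hprod, Nat.add_sub_add_right, show k+i-k = i by omega, show k+i+1-k = i+1 by omega,
      qPoch_succ', prod_range_succ, div_pow, mul_assoc g q, ← pow_succ', mul_assoc g _ q,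
      ← pow_succ, pow_succ (q^(k+i)) k]
    have hk := pow_ne_zero k hq; field_simp; ring

/-- A transformation of a terminating `₃φ₂` series, obtained by expanding `(w; q)_i / (g; q)_i`. -/
lemma sum_eCoeff_transform (x w g:ℂ) (hg : ∀ j : ℕ, g*q^j ≠ 1) (M:ℕ) :
    ∑ i ∈ range (M+1), eCoeff q M i*qPoch x q i*(qPoch w q i/qPoch g q i) =
      ∑ k ∈ range (M+1), eCoeff q M k*qPoch x q k *
        (∏ j ∈ range k, (w-g*q^j))/qPoch g q k*((-1)^k*q^(k.choose 2)) * (x*q^k)^(M-k) := by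
  have hg' : ∀ n, qPoch g q n ≠ 0 := fun n => qPoch_ne_zero fun j _ => hg j
  have e1 : ∀ i k, k ≤ i → qPoch (g*q^k) q (i-k)/qPoch g q i = 1/qPoch g q k := by
    intro i k h; obtain ⟨r, rfl⟩ := exists_eq_add_of_le h; have h1 := hg' (k+r)
    rw [qPoch_add] at h1 ⊢; grind
  have e2 : ∀ i ∈ range (M+1), eCoeff q M i*qPoch x q i*(qPoch w q i/qPoch g q i) =
      ∑ k ∈ range (M+1), eCoeff q M i*qPoch x q i*(eCoeff q i k*(q^i/q)^k *
        (∏ j ∈ range k, (w-g*q^j))/qPoch g q k) := by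
    intro i hi; rw [mem_range] at hi; rw [qPoch_eq_sum_eCoeff hq hqq w g i, Finset.sum_div, mul_sum]
    refine (sum_congr rfl fun k hk => ?_).trans (Finset.sum_subset
      (Finset.range_subset_range.2 (by grind)) fun k _ hk => ?_)
    · grind
    · rw [mem_range, not_lt] at hk; rw [eCoeff_eq_zero hq (by omega : i < k)]; ring
  rw [sum_congr rfl e2, Finset.sum_comm]; refine sum_congr rfl fun k hk => ?_; rw [mem_range] at hk
  obtain ⟨m, rfl⟩ : ∃ m, M = k+m := ⟨M-k, by omega⟩
  rw [show k+m+1 = k+(m+1) by ring, Finset.sum_range_add, sum_eq_zero, zero_add,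
    Nat.add_sub_cancel_left, ← sum_eCoeff_mul_qPoch hq hqq (x*q^k) m, mul_sum]
  · refine sum_congr rfl fun r hr => ?_; clear hr
    have e3 : eCoeff q (k+m) (k+r)*(eCoeff q (k+r) k*(q^(k+r)/q)^k) =
        eCoeff q (k+m) k*eCoeff q m r*((-1)^k*q^(k.choose 2)) := by
      induction r with
      | zero =>
        rw [add_zero, eCoeff_self hq hqq, eCoeff_zero, mul_one, div_pow]
        have h1 : (q^k)^k = q^(k.choose 2)*q^(k.choose 2)*q^k := by
          rw [← pow_mul, ← pow_add, ← pow_add]; congr 1; have := choose_two_right k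
          have h2 : k*(k-1) = 2*k.choose 2 := by
            rw [this, Nat.mul_div_cancel' (Nat.even_mul_pred_self k).two_dvd]
          cases k with
          | zero => simp
          | succ k => rw [Nat.add_sub_cancel] at h2; linarith
        rw [h1]; have h3 := pow_ne_zero k hq; have h4 := pow_ne_zero (k.choose 2) hq; field_simp
      | succ r ih =>
        have n1 := one_sub_pow_ne_zero hqq (k+r); have n2 := one_sub_pow_ne_zero hqq r
        have a1 := eCoeff_succ hqq (k+m) (k+r); have a2 := eCoeff_pred hq hqq (k+r) k
        have a3 := eCoeff_succ hqq m r; have hk := pow_ne_zero k hq; have hr := pow_ne_zero r hq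
        have hm := pow_ne_zero m hq; rw [← add_assoc]
        rw [pow_succ q (k+r), mul_div_cancel_right₀ _ hq]
        refine mul_right_cancel₀ (mul_ne_zero n2 n1) ?_; rw [pow_add q k r, pow_add q k m] at *
        rw [div_pow] at ih
        have a1' : eCoeff q (k+m) (k+r+1)*(1-q*(q^k*q^r)) =
            eCoeff q (k+m) (k+r)*(q*(1-q^r/q^m)) := by
          rw [a1]; field_simp
        have a2' : eCoeff q (k+r+1) k*(1-q*q^r) = eCoeff q (k+r) k*(1-q*(q^k*q^r))/q^k := by
          rw [a2]; field_simp
        linear_combination eCoeff q (k+r+1) k*(q^k*q^r)^k*(1-q*q^r)*a1' +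
          eCoeff q (k+m) (k+r)*(q*(1-q^r/q^m))*(q^k*q^r)^k*a2' +
          (q*(1-q^r/q^m))*(1-q*(q^k*q^r))*ih -
          eCoeff q (k+m) k*((-1)^k*q^(k.choose 2))*(1-q*(q^k*q^r))*a3
    rw [qPoch_add]
    linear_combination (qPoch x q k*qPoch (x*q^k) q r*(∏ j ∈ range k, (w-g*q^j)) / qPoch g q k)*e3
  · intro i hi; rw [mem_range] at hi; rw [eCoeff_eq_zero hq hi]; ring

end

/-! ### Polynomials interpolating between continuous dual `q`-Hahn polynomials -/

/-- The polynomials `C⁻ⁿ ∑_j (q⁻ⁿ; q)_j q^j / (q; q)_j (C b q^j, η q^j; q)_{n-j} (C z, C / z; q)_j`. For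
`η = q^{1+D}` these are continuous dual `q`-Hahn polynomials of degree `n`, for `η = q^{1-D}` they
are products of continuous dual `q`-Hahn polynomials of degree `n - D` with an explicit factor. -/
def sPoly (C b q:ℂ) (n:ℕ) (η:ℂ) (y:ℝ) : ℂ := C⁻¹^n * ∑ j ∈ range (n+1),
    eCoeff q n j*qPoch (C*b*q^j) q (n-j)*qPoch (η*q^j) q (n-j)*hFin C q j y

@[simp] lemma sPoly_zero (C b q η:ℂ) (y:ℝ) : sPoly C b q 0 η y = 1 := by simp [sPoly]

lemma continuous_sPoly (C b q:ℂ) (n:ℕ) (η:ℂ) : Continuous (sPoly C b q n η) := by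
  unfold sPoly
  exact continuous_const.mul (continuous_finsetSum _ fun j _ =>
    continuous_const.mul (continuous_hFin C q j))

section

variable {q C : ℂ} (hq : q ≠ 0) (hqq : ∀ j : ℕ, q*q^j ≠ 1) (hC : C ≠ 0)

include hq hqq hC

/-- Lowering of the degree. -/
lemma sPoly_sub (b η:ℂ) (n:ℕ) (y:ℝ) : sPoly C b q n η y = sPoly C b q n (η*q) y -
      η/C*(1-q^n)*(1-C*b*(q^n/q))*sPoly C b q (n-1) (η*q) y := by
  cases n with
  | zero => simp
  | succ n =>
    unfold sPoly
    rw [Nat.add_sub_cancel, pow_succ q n, mul_div_cancel_right₀ _ hq, sum_range_succ _ (n+1),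
      sum_range_succ _ (n+1)]
    simp only [Nat.sub_self, qPoch_zero]
    have e : ∑ j ∈ range (n+1), eCoeff q (n+1) j*qPoch (C*b*q^j) q (n+1-j) *
        qPoch (η*q^j) q (n+1-j)*hFin C q j y =
      ∑ j ∈ range (n+1), eCoeff q (n+1) j*qPoch (C*b*q^j) q (n+1-j) *
        qPoch (η*q*q^j) q (n+1-j)*hFin C q j y-η*(1-q^n*q) *
          (1-C*b*q^n) * ∑ j ∈ range (n+1), eCoeff q n j*qPoch (C*b*q^j) q (n-j) *
        qPoch (η*q*q^j) q (n-j)*hFin C q j y := by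
      rw [mul_sum, ← sum_sub_distrib]; refine sum_congr rfl fun j hj => ?_; rw [mem_range] at hj
      obtain ⟨i, rfl⟩ : ∃ i, n = j+i := ⟨n-j, by omega⟩
      rw [show j+i+1-j = i+1 by omega, Nat.add_sub_cancel_left, qPoch_succ' (η*q^j),
        qPoch_succ (η*q*q^j), qPoch_succ (C*b*q^j), mul_right_comm η (q^j),
        mul_assoc (C*b), ← pow_add]
      have h := eCoeff_pred hq hqq (j+i) j; grind
    grind

/-- Raising of the degree. -/
lemma hFin_mul_sPoly (b:ℂ) {η : ℂ} (hη : η ≠ 0) (n:ℕ) (y:ℝ) :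
    hFin (C/η) q 1 y*sPoly C b q n (η*q) y = -(C/η)*sPoly C b q (n+1) η y +
      (C/η)^2*(1-η*q^n)*(1-b*η/C*q^n)*sPoly C b q n η y := by
  unfold sPoly
  have e0 : ∀ j, hFin (C/η) q 1 y*hFin C q j y = (1-C^2*q^j/η)*(1-(η*q^j)⁻¹) *
      hFin C q j y+(η*q^j)⁻¹*hFin C q (j+1) y := by
    intro j; have hj := pow_ne_zero j hq; rw [hFin_one]; have h := two_mul_mul_hFin hC hq j y
    have e : (1-2*(C/η)*(y:ℂ)+(C/η)^2)*hFin C q j y =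
      (1+(C/η)^2)*hFin C q j y-C/η*(2*y*hFin C q j y) := by ring
    rw [e, h]; field_simp; ring
  have e1 : hFin (C/η) q 1 y * ∑ j ∈ range (n+1), eCoeff q n j *
      qPoch (C*b*q^j) q (n-j)*qPoch (η*q*q^j) q (n-j)*hFin C q j y =
      ∑ j ∈ range (n+1), (eCoeff q n (j+1) *
      qPoch (C*b*q^(j+1)) q (n-(j+1))*qPoch (η*q*q^(j+1)) q (n-(j+1)) *
        ((1-C^2*q^(j+1)/η)*(1-(η*q^(j+1))⁻¹))+eCoeff q n j *
      qPoch (C*b*q^j) q (n-j)*qPoch (η*q*q^j) q (n-j)*(η*q^j)⁻¹) *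
        hFin C q (j+1) y+qPoch (C*b) q n*qPoch (η*q) q n * ((1-C^2/η)*(1-η⁻¹)) := by
    have h : hFin (C/η) q 1 y * ∑ j ∈ range (n+1), eCoeff q n j *
      qPoch (C*b*q^j) q (n-j)*qPoch (η*q*q^j) q (n-j)*hFin C q j y =
      ∑ j ∈ range (n+1), (eCoeff q n j *
      qPoch (C*b*q^j) q (n-j)*qPoch (η*q*q^j) q (n-j) *
        ((1-C^2*q^j/η)*(1-(η*q^j)⁻¹))*hFin C q j y+eCoeff q n j *
      qPoch (C*b*q^j) q (n-j)*qPoch (η*q*q^j) q (n-j)*(η*q^j)⁻¹ * hFin C q (j+1) y) := by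
      rw [mul_sum]; refine sum_congr rfl fun j _ => ?_
      linear_combination (eCoeff q n j * qPoch (C*b*q^j) q (n-j)*qPoch (η*q*q^j) q (n-j))*e0 j
    rw [h, sum_add_distrib, sum_range_succ']; simp only [add_mul, sum_add_distrib]
    rw [sum_range_succ (fun j => eCoeff q n (j+1)*_*_*_*_) n,
      eCoeff_eq_zero hq (Nat.lt_succ_self n)]
    simp only [eCoeff_zero, pow_zero, mul_one, Nat.sub_zero, hFin_zero, zero_mul, add_zero, one_mul]
    ring
  have e2 : ∑ j ∈ range (n+1), eCoeff q n j*qPoch (C*b*q^j) q (n-j) *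
      qPoch (η*q^j) q (n-j)*hFin C q j y = ∑ j ∈ range (n+1), eCoeff q n (j+1) *
      qPoch (C*b*q^(j+1)) q (n-(j+1))*qPoch (η*q^(j+1)) q (n-(j+1)) *
        hFin C q (j+1) y+qPoch (C*b) q n*qPoch η q n := by
    rw [sum_range_succ', sum_range_succ (fun j => eCoeff q n (j+1)*_*_*_) n,
      eCoeff_eq_zero hq (Nat.lt_succ_self n)]
    simp
  have hfac : qPoch η q n*(1-η*q^n) = (1-η)*qPoch (η*q) q n := by rw [← qPoch_succ, qPoch_succ']
  rw [mul_left_comm, e1, e2, sum_range_succ' _ (n+1)]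
  simp only [eCoeff_zero, pow_zero, mul_one, Nat.sub_zero, hFin_zero, one_mul]
  have e3 : ∀ j ∈ range (n+1), (eCoeff q n (j+1) *
      qPoch (C*b*q^(j+1)) q (n-(j+1))*qPoch (η*q*q^(j+1)) q (n-(j+1)) *
        ((1-C^2*q^(j+1)/η)*(1-(η*q^(j+1))⁻¹))+eCoeff q n j *
      qPoch (C*b*q^j) q (n-j)*qPoch (η*q*q^j) q (n-j)*(η*q^j)⁻¹) *
        hFin C q (j+1) y = -(1/η)*(eCoeff q (n+1) (j+1) *
      qPoch (C*b*q^(j+1)) q (n+1-(j+1))*qPoch (η*q^(j+1)) q (n+1-(j+1)) *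
        hFin C q (j+1) y)+(C/η)^2*(1-η*q^n)*(1-b*η/C*q^n) *
      (eCoeff q n (j+1) *
      qPoch (C*b*q^(j+1)) q (n-(j+1))*qPoch (η*q^(j+1)) q (n-(j+1)) * hFin C q (j+1) y) := by
    intro j hj; rw [mem_range] at hj; have hj0 := pow_ne_zero j hq
    have P1 := eCoeff_pascal₁ hq hqq n j; have P2 := eCoeff_pascal₂ hq hqq n j
    have key : -eCoeff q n (j+1)*(1-C^2*q^(j+1)/η)*(η*q*q^j)⁻¹ +
        eCoeff q n j*(1-C*b*q^j)*(η*q^j)⁻¹ =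
        -(1/η)*eCoeff q (n+1) (j+1)*(1-C*b*q^n)+(C/η)^2 * (1-b*η/C*q^n)*eCoeff q n (j+1) := by
      have P2' : eCoeff q (n+1) (j+1)*q^n = q^n*eCoeff q n (j+1)-eCoeff q n j := by
        have := pow_ne_zero n hq; rw [P2]; field_simp
      have e : -eCoeff q n (j+1)*(1-C^2*q^(j+1)/η)*(η*q*q^j)⁻¹ +
        eCoeff q n j*(1-C*b*q^j)*(η*q^j)⁻¹ = -(1/η) *
          (eCoeff q n (j+1)/q^(j+1)-eCoeff q n j/q^j)+C^2/η^2*eCoeff q n (j+1) -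
          C*b/η*eCoeff q n j := by
        rw [pow_succ]; field_simp; ring
      have e' : (C/η)^2*(1-b*η/C*q^n)*eCoeff q n (j+1) =
          C^2/η^2*eCoeff q n (j+1)-C*b/η*(q^n*eCoeff q n (j+1)) := by
        field_simp
      rw [e, e', ← P1]; linear_combination (-C*b/η)*P2'
    rw [show C*b*q^(j+1) = C*b*q^j*q by ring, show η*q*q^(j+1) =
      η*q*q^j*q by ring, show η*q^(j+1) = η*q*q^j by ring]
    obtain ⟨i, rfl⟩ : ∃ i, n = j+i := ⟨n-j, by omega⟩
    rw [show j+i+1-(j+1) = i by omega, Nat.add_sub_cancel_left]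
    cases i with
    | zero =>
      simp only [add_zero] at *
      rw [eCoeff_eq_zero hq (Nat.lt_succ_self j)] at *
      rw [P1]; simp only [qPoch_zero]; field_simp; ring
    | succ i =>
      rw [show j+(i+1)-(j+1) = i by omega, qPoch_succ' (C*b*q^j), qPoch_succ (C*b*q^j*q)]
      have hZ : (1-(η*q*q^j)⁻¹)*qPoch (η*q*q^j*q) q i = -(η*q*q^j)⁻¹*qPoch (η*q*q^j) q (i+1) := by
        rw [qPoch_succ']; field_simp; ring
      have hZ2 : (1-η*q^(j+(i+1)))*qPoch (η*q*q^j) q i = qPoch (η*q*q^j) q (i+1) := by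
        rw [qPoch_succ]; ring
      rw [show 1-C*b*q^j*q*q^i = 1-C*b*q^(j+(i+1)) by ring]
      linear_combination (eCoeff q (j+(i+1)) (j+1)*qPoch (C*b*q^j*q) q i *
        (1-C^2*q^(j+1)/η)*hFin C q (j+1) y)*hZ-((C/η)^2 *
        (1-b*η/C*q^(j+(i+1)))*eCoeff q (j+(i+1)) (j+1) *
        qPoch (C*b*q^j*q) q i*hFin C q (j+1) y)*hZ2 +
        (qPoch (C*b*q^j*q) q i*qPoch (η*q*q^j) q (i+1)*hFin C q (j+1) y)*key
  rw [sum_congr rfl e3, sum_add_distrib, ← mul_sum, ← mul_sum, qPoch_succ (C*b), qPoch_succ' η]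
  have e4 : qPoch (C*b) q n*qPoch (η*q) q n*((1-C^2/η)*(1-η⁻¹)) =
      -(1/η)*(qPoch (C*b) q n*(1-C*b*q^n)*((1-η)*qPoch (η*q) q n)) +
      (C/η)^2*(1-η*q^n)*(1-b*η/C*q^n)*(qPoch (C*b) q n*qPoch η q n) := by
    have : (C/η)^2*(1-η*q^n)*(1-b*η/C*q^n)*(qPoch (C*b) q n*qPoch η q n) =
      (C/η)^2*(1-b*η/C*q^n)*qPoch (C*b) q n*((1-η)*qPoch (η*q) q n) := by
      rw [← hfac]; ring
    rw [this]; field_simp; ring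
  rw [e4, pow_succ C⁻¹]; field_simp; ring

omit hqq hC in
lemma awPoly_zero_eq {a b c : ℂ} (n:ℕ) (y:ℝ) (hab : ∀ j : ℕ, a*b*q^j ≠ 1)
    (hac : ∀ j : ℕ, a*c*q^j ≠ 1) :
    awPoly a b c 0 q n y = a⁻¹^n * ∑ j ∈ range (n+1),
      eCoeff q n j*qPoch (a*b*q^j) q (n-j)*qPoch (a*c*q^j) q (n-j) * hFin a q j y := by
  rw [awPoly_eq_awSer hq, awSer, mul_assoc, mul_sum]; congr 1; refine sum_congr rfl fun j hj => ?_
  rw [mem_range] at hj; obtain ⟨i, rfl⟩ : ∃ i, n = j+i := ⟨n-j, by omega⟩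
  have h1 : qPoch (a*b) q j ≠ 0 := qPoch_ne_zero fun j _ => hab j
  have h2 : qPoch (a*c) q j ≠ 0 := qPoch_ne_zero fun j _ => hac j
  simp only [  awCoeff, eCoeff, qPochs_cons, qPochs_nil, mul_one, mul_zero, zero_mul, zero_div, qPoch_zero_left, Nat.add_sub_cancel_left, qPoch_add _ _ j i]
  field_simp

omit hC in
/-- The case `n₁ ≥ n₂`, with `D = n₁ - n₂`. -/
lemma sPoly_eq_awPoly {b c : ℂ} (hc : C*c = q) (hCb : ∀ j : ℕ, C*b*q^j ≠ 1) (n D:ℕ) (y:ℝ) :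
    sPoly C b q n (q*q^D) y = awPoly C b (c*q^D) 0 q n y := by
  have h : C*(c*q^D) = q*q^D := by grind
  rw [awPoly_zero_eq hq n y hCb (by intro j; rw [h, mul_assoc, ← pow_add]; exact hqq _), h, sPoly]

omit hC in
/-- The case `n₁ ≤ n₂`, with `D = n₂ - n₁`. -/
lemma sPoly_eq_hFin_mul_awPoly {b c η : ℂ} (hc : C*c = q) (hCb : ∀ j : ℕ, C*b*q^j ≠ 1)
    (n D:ℕ) (hη : η*q^D = q) (y:ℝ) :
    sPoly C b q (n+D) η y = (-1)^D*C⁻¹^D*(q^(D.choose 2))⁻¹*hFin C q D y *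
      awPoly (C*q^D) b c 0 q n y := by
  have h : C*q^D*c = q*q^D := by grind
  have hD := pow_ne_zero D hq
  rw [awPoly_zero_eq hq n y (by intro j; rw [mul_right_comm C, mul_assoc, ← pow_add]; exact hCb _)
    (by intro j; rw [h, mul_assoc, ← pow_add]; exact hqq _), h, sPoly, add_comm n D, add_assoc,
    Finset.sum_range_add, sum_eq_zero, zero_add, mul_sum, mul_sum, mul_sum]
  · refine sum_congr rfl fun j hj => ?_; rw [mem_range] at hj
    obtain ⟨i, rfl⟩ : ∃ i, n = j+i := ⟨n-j, by omega⟩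
    rw [show D+(j+i)-(D+j) = i by omega, Nat.add_sub_cancel_left, hFin_add,
      show η*q^(D+j) = q*q^j by grind,
      show C*b*q^(D+j) = C*q^D*b*q^j by ring]
    have e : eCoeff q (D+(j+i)) (D+j)*qPoch (q*q^j) q i*(C⁻¹^(D+(j+i))) =
        (-1)^D*C⁻¹^D*(q^(D.choose 2))⁻¹*(C*q^D)⁻¹^(j+i) *
          (eCoeff q (j+i) j*qPoch (q*q^D*q^j) q i) := by
      have e0 := eCoeff_add_add hq hqq j i D; rw [e0, mul_inv, mul_pow, pow_add C⁻¹ D]; ring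
    grind
  · intro j hj; rw [mem_range] at hj; obtain ⟨i, rfl⟩ : ∃ i, D = j+i+1 := ⟨D-j-1, by omega⟩
    rw [qPoch_eq_zero (a := η*q^j) (j := i) (by omega)]
    · ring
    grind

end

/-! ### The recurrence of the Clebsch-Gordan coefficients -/

/-- The recurrence in `n₁` and `n₂` of the Clebsch-Gordan coefficients, up to normalisation. -/
def CGRec (q C b P S:ℂ) (X : ℕ → ℕ → ℂ) : Prop := ∀ n₁ n₂ : ℕ, X (n₁+1) n₂ =
    q/(C*(q^n₂/q^n₁))*((1-q^n₂)*(1-C*b*(q^n₂/q)))*X n₁ (n₂-1) +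
    (1+P-S*(C*(q^n₂/q^n₁))/q)*X n₁ n₂ +
    P*(C*(q^n₂/q^n₁))*X n₁ (n₂+1) -
    P*(C*(q^n₂/q^n₁))^2*((1-q^n₁)*(1-b/C*q^n₁))*X (n₁-1) n₂

namespace CGRec

variable {q C b P S : ℂ} {X Y : ℕ → ℕ → ℂ}

lemma const_mul (hX : CGRec q C b P S X) (k:ℂ) : CGRec q C b P S fun n₁ n₂ => k*X n₁ n₂ := by
  intro n₁ n₂; beta_reduce; rw [hX n₁ n₂]; ring

/-- A solution of the recurrence is determined by its values at `n₁ = 0`. -/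
lemma eq_of_left (hX : CGRec q C b P S X) (hY : CGRec q C b P S Y) (h : ∀ n, X 0 n = Y 0 n)
    (n₁ n₂:ℕ) : X n₁ n₂ = Y n₁ n₂ := by
  induction n₁ using Nat.strong_induction_on generalizing n₂ with
  | _ n ih =>
    cases n with
    | zero => exact h n₂
    | succ n =>
      rw [hX n n₂, hY n n₂, ih n (by omega), ih n (by omega), ih n (by omega), ih (n-1) (by omega)]

/-- A solution of the recurrence is determined by its values at `n₂ = 0`. -/
lemma eq_of_right (hq : q ≠ 0) (hC : C ≠ 0) (hP : P ≠ 0) (hX : CGRec q C b P S X)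
    (hY : CGRec q C b P S Y) (h : ∀ n, X n 0 = Y n 0) (n₁ n₂:ℕ) : X n₁ n₂ = Y n₁ n₂ := by
  induction n₂ using Nat.strong_induction_on generalizing n₁ with
  | _ n ih =>
    cases n with
    | zero => exact h n₁
    | succ n =>
      have r1 := hX n₁ n; have r2 := hY n₁ n
      rw [ih n (by omega), ih n (by omega), ih (n-1) (by omega), ih n (by omega)] at r1
      have h0 : P*(C*(q^n/q^n₁)) ≠ 0 :=
        mul_ne_zero hP (mul_ne_zero hC (div_ne_zero (pow_ne_zero _ hq) (pow_ne_zero _ hq)))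
      refine mul_left_cancel₀ h0 ?_; linear_combination r2-r1

end CGRec

/-- The product of a little `q`-Jacobi function and a continuous dual `q`-Hahn polynomial, up to
normalisation. -/
def cgFun (q A B C b:ℂ) (n₁ n₂:ℕ) (y:ℝ) : ℂ :=
  wFun q A B (C*(q^n₂/q^n₁)) y*sPoly C b q n₂ (q*(q^n₁/q^n₂)) y

section

variable {q : ℝ} (hq0 : 0 < q) (hq1 : q < 1)

include hq0 hq1

lemma ofReal_mul_pow_ne_one (j:ℕ) : (q:ℂ)*q^j ≠ 1 :=
  mul_pow_ne_one (norm_lt_one hq0 hq1) (norm_lt_one hq0 hq1) j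

lemma cgRec_cgFun {A B C b : ℂ} (hAB : ∀ j : ℕ, A*B*q^j ≠ 1) (hC : C ≠ 0) (y:ℝ) :
    CGRec q C b (A*B/q) (A+B) fun n₁ n₂ => cgFun q A B C b n₁ n₂ y := by
  have hqc := ofReal_ne hq0; have hqq := ofReal_mul_pow_ne_one hq0 hq1; intro n₁ n₂
  have h1 := pow_ne_zero n₁ hqc; have h2 := pow_ne_zero n₂ hqc
  have hη : (q:ℂ)^n₁/q^n₂ ≠ 0 := div_ne_zero h1 h2; set η : ℂ := q^n₁/q^n₂ with hηd
  set a : ℂ := C*(q^n₂/q^n₁) with had; have ha : a = C/η := by rw [had, hηd]; field_simp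
  have W := wFun_rec hq0 hq1 hAB (a/q) y
  rw [div_mul_cancel₀ _ hqc, pow_two, ← mul_assoc, div_mul_cancel₀ _ hqc] at W
  have U := sPoly_sub hqc hqq hC b (η*q) n₂ y; have L := hFin_mul_sPoly hqc hqq hC b hη n₂ y
  have e1 : cgFun q A B C b (n₁+1) n₂ y = wFun q A B (a/q) y*sPoly C b q n₂ (η*q*q) y := by
    unfold cgFun; congr 2
    · rw [had, pow_succ]; field_simp
    · rw [hηd, pow_succ]; field_simp
  have e2 : (1-(q:ℂ)^n₂)*cgFun q A B C b n₁ (n₂-1) y =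
      (1-(q:ℂ)^n₂)*(wFun q A B (a/q) y*sPoly C b q (n₂-1) (η*q*q) y) := by
    cases n₂ with
    | zero => simp
    | succ n₂ =>
      have := pow_ne_zero n₂ hqc; congr 1; unfold cgFun; rw [Nat.add_sub_cancel]; congr 2
      · rw [had, pow_succ]; field_simp
      · rw [hηd, pow_succ]; field_simp
  have e3 : cgFun q A B C b n₁ (n₂+1) y = wFun q A B (a*q) y*sPoly C b q (n₂+1) η y := by
    unfold cgFun; congr 2
    · rw [had, pow_succ]; field_simp
    · rw [hηd, pow_succ]; field_simp
  have e4 : (1-(q:ℂ)^n₁)*cgFun q A B C b (n₁-1) n₂ y =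
      (1-(q:ℂ)^n₁)*(wFun q A B (a*q) y*sPoly C b q n₂ η y) := by
    cases n₁ with
    | zero => simp
    | succ n₁ =>
      have := pow_ne_zero n₁ hqc; congr 1; unfold cgFun; rw [Nat.add_sub_cancel]; congr 2
      · rw [had, pow_succ]; field_simp
      · rw [hηd, pow_succ]; field_simp
  have e5 : cgFun q A B C b n₁ n₂ y = wFun q A B a y*sPoly C b q n₂ (η*q) y := by
    unfold cgFun; rw [mul_comm (q:ℂ)]
  have hc1 : (q:ℂ)/a = η*q/C := by rw [ha]; field_simp
  have hc2 : η*(q:ℂ)^n₂ = q^n₁ := by rw [hηd]; field_simp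
  have hc3 : b*η/C*(q:ℂ)^n₂ = b/C*q^n₁ := by rw [← hc2]; ring
  rw [← ha, hc2, hc3] at L; beta_reduce; rw [e1, e3, e5, hc1]
  linear_combination sPoly C b q n₂ (η*q) y*W-wFun q A B (a/q) y*U -
    A*B/q*wFun q A B (a*q) y*L-η*q/C*(1-C*b*(q^n₂/q))*e2 +
    A*B/q*a^2*(1-b/C*q^n₁)*e4

end

/-- The factor that relates the coefficients to products of Al-Salam-Chihara polynomials. -/
def cgTau (q t₁ t₂:ℂ) (n₁ n₂:ℕ) : ℂ := t₁^n₁*t₂^n₂*(q^(n₁*n₂)*(q^(n₁.choose 2))⁻¹)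

/-- Products of Al-Salam-Chihara polynomials in base `q` and in base `q⁻¹` satisfy the recurrence. -/
lemma cgRec_mul {q r κ₁ κ₂ s x E : ℂ} (hr : r^2 = q) (hr0 : r ≠ 0) (hκ₁ : κ₁ ≠ 0) (hκ₂ : κ₂ ≠ 0)
    (hs : s ≠ 0) {f g : ℕ → ℂ}
    (hf : ∀ n, 2*x*f n = f (n+1)+κ₁*(2*E)*q^n*f n + (1-q^n)*(1-κ₁^2*(q^n/q))*f (n-1))
    (hg : ∀ n, 2*E*g n = g (n+1)+(s/κ₂+1/(κ₂*s))*q⁻¹^n*g n +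
      (1-q⁻¹^n)*(1-s/κ₂*(1/(κ₂*s))*(q⁻¹^n/q⁻¹))*g (n-1)) :
    CGRec q (κ₂*r/κ₁) (κ₁*κ₂/r) (1/s^2) (2*r*x/s) fun n₁ n₂ =>
      cgTau q (-(κ₂/(κ₁*s))) (s*κ₁/r) n₁ n₂*f n₁*g n₂ := by
  have hq : q ≠ 0 := hr ▸ pow_ne_zero 2 hr0; intro n₁ n₂; have h1 := pow_ne_zero n₁ hq
  have h2 := pow_ne_zero n₂ hq; have hf' := hf n₁; have hg' := hg n₂
  have t1 : cgTau q (-(κ₂/(κ₁*s))) (s*κ₁/r) (n₁+1) n₂ =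
      -(κ₂/(κ₁*s))*(q^n₂/q^n₁)*cgTau q (-(κ₂/(κ₁*s))) (s*κ₁/r) n₁ n₂ := by
    unfold cgTau; rw [pow_succ, pow_choose_succ, add_mul, one_mul, pow_add, mul_inv]; ring
  have t2 : cgTau q (-(κ₂/(κ₁*s))) (s*κ₁/r) n₁ (n₂+1) =
      s*κ₁/r*q^n₁*cgTau q (-(κ₂/(κ₁*s))) (s*κ₁/r) n₁ n₂ := by
    unfold cgTau; ring
  have t3 : (1-q^n₁)*cgTau q (-(κ₂/(κ₁*s))) (s*κ₁/r) (n₁-1) n₂ =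
      (1-q^n₁)*(-(κ₁*s/κ₂)*(q^n₁/(q*q^n₂)) * cgTau q (-(κ₂/(κ₁*s))) (s*κ₁/r) n₁ n₂) := by
    cases n₁ with
    | zero => simp
    | succ n₁ =>
      have h3 := pow_ne_zero n₁ hq; congr 1; rw [Nat.add_sub_cancel]; unfold cgTau
      rw [pow_succ (-(κ₂/(κ₁*s))), pow_choose_succ, add_mul, one_mul, pow_add, mul_inv, pow_succ]
      field_simp; rw [pow_add]; ring
  have t4 : (1-q^n₂)*cgTau q (-(κ₂/(κ₁*s))) (s*κ₁/r) n₁ (n₂-1) = (1-q^n₂)*(r/(s*κ₁)/q^n₁ *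
        cgTau q (-(κ₂/(κ₁*s))) (s*κ₁/r) n₁ n₂) := by
    cases n₂ with
    | zero => simp
    | succ n₂ =>
      congr 1; rw [Nat.add_sub_cancel]; unfold cgTau
      rw [pow_succ (s*κ₁/r), mul_add, mul_one, pow_add]; field_simp
  beta_reduce; rw [t1, t2]; rw [inv_pow] at hg'
  generalize cgTau q (-(κ₂/(κ₁*s))) (s*κ₁/r) n₁ n₂ = τ at *
  generalize cgTau q (-(κ₂/(κ₁*s))) (s*κ₁/r) (n₁-1) n₂ = τ3 at *
  generalize cgTau q (-(κ₂/(κ₁*s))) (s*κ₁/r) n₁ (n₂-1) = τ4 at *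
  generalize q^n₁ = N₁ at *
  generalize q^n₂ = N₂ at *
  have u3 : 1/s^2*(κ₂*r/κ₁*(N₂/N₁))^2*((1-N₁)*(1-κ₁*κ₂/r /
      (κ₂*r/κ₁)*N₁))*(τ3*f (n₁-1)*g n₂) = -(κ₂/(κ₁*s))*(N₂/N₁) *
      ((1-N₁)*(1-κ₁^2*(N₁/q)))*(τ*f (n₁-1)*g n₂) := by
    have : 1/s^2*(κ₂*r/κ₁*(N₂/N₁))^2*((1-N₁)*(1-κ₁*κ₂/r /
      (κ₂*r/κ₁)*N₁))*(τ3*f (n₁-1)*g n₂) = 1/s^2*(κ₂*r/κ₁*(N₂/N₁))^2 *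
      (1-κ₁*κ₂/r/(κ₂*r/κ₁)*N₁)*(f (n₁-1)*g n₂)*((1-N₁)*τ3) := by ring
    rw [this, t3, ← hr]; field_simp
  have u4 : q/(κ₂*r/κ₁*(N₂/N₁))*((1-N₂)*(1-κ₂*r/κ₁*(κ₁*κ₂/r)*(N₂/q))) *
      (τ4*f n₁*g (n₂-1)) = κ₂*N₂/s*((1-N₂⁻¹) *
        (1-s/κ₂*(1/(κ₂*s))*(N₂⁻¹/q⁻¹)))*(τ*f n₁*g (n₂-1)) := by
    have : q/(κ₂*r/κ₁*(N₂/N₁))*((1-N₂)*(1-κ₂*r/κ₁*(κ₁*κ₂/r)*(N₂/q))) *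
      (τ4*f n₁*g (n₂-1)) = q/(κ₂*r/κ₁*(N₂/N₁)) *
        (1-κ₂*r/κ₁*(κ₁*κ₂/r)*(N₂/q))*(f n₁*g (n₂-1))*((1-N₂)*τ4) := by ring
    rw [this, t4]; clear this t4 t3 u3 hf' hg' hf hg t1 t2; field_simp; ring
  rw [u3, u4]
  have u5 : 1/s^2*(κ₂*r/κ₁*(N₂/N₁))*(s*κ₁/r*N₁*τ*f n₁*g (n₂+1)) =
    κ₂*N₂/s*(τ*f n₁*g (n₂+1)) := by field_simp
  have u6 : 2*r*x/s*(κ₂*r/κ₁*(N₂/N₁))/q = κ₂/(κ₁*s)*(N₂/N₁)*(2*x) := by rw [← hr]; field_simp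
  have u7 : κ₂/(κ₁*s)*(N₂/N₁)*(κ₁*(2*E)*N₁) = κ₂*N₂/s*(2*E) := by field_simp
  have u8 : κ₂*N₂/s*((s/κ₂+1/(κ₂*s))*N₂⁻¹) = 1+1/s^2 := by field_simp
  rw [u5, u6, ← u8]
  linear_combination (κ₂/(κ₁*s)*(N₂/N₁)*τ*g n₂)*hf'+(κ₂*N₂/s*τ*f n₁)*hg' + τ*f n₁*g n₂*u7

/-! ### Initial values -/

/-- The terminating series `₃φ₂(q^{-m}, x, γ q^d; γ, 0; q, q)`. -/
def termSum (q x γ:ℂ) (m d:ℕ) : ℂ :=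
  ∑ i ∈ range (m+1), eCoeff q m i*qPoch x q i*(qPoch (γ*q^d) q i/qPoch γ q i)

section

variable {q : ℂ} (hq : q ≠ 0) (hqq : ∀ j : ℕ, q*q^j ≠ 1)

include hq

lemma qPoch_inv_base {z : ℂ} (hz : z ≠ 0) (k:ℕ) :
    qPoch z q⁻¹ k = (-z)^k*(q^(k.choose 2))⁻¹*qPoch z⁻¹ q k := by
  induction k with
  | zero => simp
  | succ k ih =>
    have := pow_ne_zero k hq; rw [qPoch_succ, qPoch_succ, ih, pow_choose_succ, inv_pow]; field_simp
    ring

lemma qPoch_inv_base' {γ : ℂ} (hγ : γ ≠ 0) (k:ℕ) : qPoch γ⁻¹ q⁻¹ k =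
    (-γ⁻¹)^k*(q^(k.choose 2))⁻¹*qPoch γ q k := by
  rw [qPoch_inv_base hq (inv_ne_zero hγ), inv_inv]

lemma qPoch_pow_inv (m k:ℕ) : qPoch (q^m)⁻¹ q k = (q^m)⁻¹^k * ∏ j ∈ range k, (q^m-q^j) := by
  have := pow_ne_zero m hq
  induction k with
  | zero => simp
  | succ k ih => rw [qPoch_succ, ih, prod_range_succ, pow_succ]; field_simp

lemma qPoch_pow_inv_base (m k:ℕ) : qPoch (q^m) q⁻¹ k =
    (-1)^k*(q^(k.choose 2))⁻¹ * ∏ j ∈ range k, (q^m-q^j) := by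
  have hm := pow_ne_zero m hq; have := pow_ne_zero k hm
  rw [qPoch_inv_base hq hm, qPoch_pow_inv hq, neg_pow, inv_pow]; field_simp

include hqq

/-- The transformed series is symmetric in `m` and `d`, apart from a power of `x`. -/
lemma termSum_eq {x γ : ℂ} (hx : x ≠ 0) (hγ : ∀ j : ℕ, γ*q^j ≠ 1) (m d:ℕ) :
    termSum q x γ m d = x^m * ∑ k ∈ range (m+1), (-1)^k*(q^(k.choose 2))⁻¹ *
      (∏ j ∈ range k, (q^m-q^j))*(∏ j ∈ range k, (q^d-q^j)) *
      (qPoch x q k*(γ/x)^k/(qPoch γ q k*qPoch q q k)) := by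
  rw [termSum, sum_eCoeff_transform hq hqq x _ γ hγ, mul_sum]; refine sum_congr rfl fun k hk => ?_
  rw [mem_range] at hk; obtain ⟨i, rfl⟩ : ∃ i, m = k+i := ⟨m-k, by omega⟩
  rw [eCoeff, qPoch_pow_inv hq, Nat.add_sub_cancel_left]
  have h1 : ∏ j ∈ range k, (γ*q^d-γ*q^j) = γ^k * ∏ j ∈ range k, (q^d-q^j) := by
    induction k with
    | zero => simp
    | succ k ih => rw [prod_range_succ, ih (by omega), prod_range_succ]; ring
  have h2 : (q^(k+i))⁻¹^k*q^k*q^(k.choose 2)*(q^k)^i = (q^(k.choose 2))⁻¹ := by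
    have h3 : q^k*q^(k.choose 2)*(q^k)^i*q^(k.choose 2) = (q^(k+i))^k := by
      rw [← pow_mul, ← pow_mul, ← pow_add, ← pow_add, ← pow_add]; congr 1
      have h2 : k*(k-1) = 2*k.choose 2 := by
        rw [choose_two_right, Nat.mul_div_cancel' (Nat.even_mul_pred_self k).two_dvd]
      cases k with
      | zero => simp
      | succ k => rw [Nat.add_sub_cancel] at h2; linarith
    have h4 := pow_ne_zero (k.choose 2) hq; have h5 := pow_ne_zero k (pow_ne_zero (k+i) hq)
    rw [inv_pow, ← h3]; rw [← h3] at h5; field_simp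
  rw [h1, ← h2]
  have h5 : x^(k+i)*(γ/x)^k = x^i*γ^k := by rw [pow_add, div_pow]; field_simp
  have h6 : (x*q^k)^i = x^i*(q^k)^i := mul_pow _ _ _; rw [h6]
  linear_combination (-(-1)^k*((q^(k+i))⁻¹^k*q^k*q^(k.choose 2)*(q^k)^i) *
      (∏ j ∈ range k, (q^(k+i)-q^j))*(∏ j ∈ range k, (q^d-q^j)) *
      (qPoch x q k/(qPoch γ q k*qPoch q q k)))*h5

lemma termSum_comm {x γ : ℂ} (hx : x ≠ 0) (hγ : ∀ j : ℕ, γ*q^j ≠ 1) (m d:ℕ) :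
    x^d*termSum q x γ m d = x^m*termSum q x γ d m := by
  have key : ∀ m d : ℕ, ∑ k ∈ range (m+1), (-1)^k*(q^(k.choose 2))⁻¹ *
      (∏ j ∈ range k, (q^m-q^j))*(∏ j ∈ range k, (q^d-q^j)) *
      (qPoch x q k*(γ/x)^k/(qPoch γ q k*qPoch q q k)) =
      ∑ k ∈ range (m+d+1), (-1)^k*(q^(k.choose 2))⁻¹ *
      (∏ j ∈ range k, (q^m-q^j))*(∏ j ∈ range k, (q^d-q^j)) *
      (qPoch x q k*(γ/x)^k/(qPoch γ q k*qPoch q q k)) := by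
    intro m d; refine Finset.sum_subset (Finset.range_subset_range.2 (by omega)) fun k _ hk => ?_
    rw [mem_range, not_lt] at hk
    rw [Finset.prod_eq_zero (f := fun j => q^m-q^j) (mem_range.2 (by omega : m < k)) (sub_self _)]
    ring
  have sym : ∑ k ∈ range (m+d+1), (-1)^k*(q^(k.choose 2))⁻¹ *
      (∏ j ∈ range k, (q^m-q^j))*(∏ j ∈ range k, (q^d-q^j)) *
      (qPoch x q k*(γ/x)^k/(qPoch γ q k*qPoch q q k)) =
      ∑ k ∈ range (d+m+1), (-1)^k*(q^(k.choose 2))⁻¹ *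
      (∏ j ∈ range k, (q^d-q^j))*(∏ j ∈ range k, (q^m-q^j)) *
      (qPoch x q k*(γ/x)^k/(qPoch γ q k*qPoch q q k)) := by
    grind
  rw [termSum_eq hq hqq hx hγ, termSum_eq hq hqq hx hγ, key, key d m, sym]; ring

omit hqq in
/-- An Al-Salam-Chihara polynomial as a terminating series. -/
lemma awPoly_eq_termSum {a b z : ℂ} {y : ℝ} (hz : z ≠ 0) (hy : z+z⁻¹ = 2*y)
    (hab : ∀ j : ℕ, a*b*q^j ≠ 1) (d m:ℕ) (h : a*z = a*b*q^m) :
    awPoly a b 0 0 q d y = a⁻¹^d*qPoch (a*b) q d*termSum q (a*z⁻¹) (a*b) d m := by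
  rw [awPoly_zero_eq hq d y hab (by simp), mul_assoc]; congr 1; rw [termSum, mul_sum]
  refine sum_congr rfl fun j hj => ?_; rw [mem_range] at hj
  obtain ⟨i, rfl⟩ : ∃ i, d = j+i := ⟨d-j, by omega⟩
  have h1 : qPoch (a*b) q j ≠ 0 := qPoch_ne_zero fun j _ => hab j
  rw [hFin_eq_qPoch hz hy, h, Nat.add_sub_cancel_left, qPoch_add _ _ j i, mul_zero, zero_mul,
    qPoch_zero_left]
  field_simp

/-- An Al-Salam-Chihara polynomial in base `q⁻¹` as a terminating series in base `q`. -/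
lemma awPoly_inv_eq_termSum {a b z γ x : ℂ} {y : ℝ} (ha : a ≠ 0) (hz : z ≠ 0) (hy : z+z⁻¹ = 2*y)
    (hγ : ∀ j : ℕ, γ*q^j ≠ 1) (hγ0 : γ ≠ 0) (hab : a*b = γ⁻¹) (d m:ℕ) (h : a*z = q^m)
    (hx : a*z⁻¹ = x⁻¹) :
    x^m*awPoly a b 0 0 q⁻¹ d y =
      a⁻¹^d*((-γ⁻¹)^d*(q^(d.choose 2))⁻¹*qPoch γ q d)*termSum q x γ m d := by
  have hx0 : x ≠ 0 := by grind
  have hxd := pow_ne_zero d hx0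
  have hT : termSum q x γ m d = x^m * ∑ k ∈ range (d+1), (-1)^k *
      (q^(k.choose 2))⁻¹*(∏ j ∈ range k, (q^d-q^j)) *
      (∏ j ∈ range k, (q^m-q^j)) *
      (qPoch x q k*(γ/x)^k/(qPoch γ q k*qPoch q q k)) := by
    refine mul_left_cancel₀ hxd ?_
    rw [termSum_comm hq hqq hx0 hγ, termSum_eq hq hqq hx0 hγ, mul_left_comm]
  have hab' : ∀ j : ℕ, a*b*q⁻¹^j ≠ 1 := by
    intro j; rw [hab, inv_pow, ← mul_inv]; exact inv_ne_one.2 (hγ j)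
  have hS : ∑ j ∈ range (d+1), eCoeff q⁻¹ d j*qPoch (a*b*q⁻¹^j) q⁻¹ (d-j) *
      qPoch (a*0*q⁻¹^j) q⁻¹ (d-j)*hFin a q⁻¹ j y = qPoch γ⁻¹ q⁻¹ d *
      ∑ k ∈ range (d+1), (-1)^k*(q^(k.choose 2))⁻¹ *
      (∏ j ∈ range k, (q^d-q^j))*(∏ j ∈ range k, (q^m-q^j)) *
      (qPoch x q k*(γ/x)^k/(qPoch γ q k*qPoch q q k)) := by
    rw [mul_sum]; refine sum_congr rfl fun k hk => ?_; rw [mem_range] at hk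
    obtain ⟨i, rfl⟩ : ∃ i, d = k+i := ⟨d-k, by omega⟩
    have h1 : qPoch (a*b) q⁻¹ k ≠ 0 := qPoch_ne_zero fun j _ => hab' j
    rw [hFin_eq_qPoch hz hy, h, hx, Nat.add_sub_cancel_left, mul_zero, zero_mul, qPoch_zero_left,
      eCoeff, inv_pow q (k+i), inv_inv, qPoch_pow_inv_base hq, qPoch_pow_inv_base hq,
      qPoch_inv_base' hq hx0, qPoch_inv_base' hq hq, ← hab, qPoch_add _ _ k i]
    rw [hab, qPoch_inv_base' hq hγ0] at h1 ⊢; have h2 := pow_ne_zero k hq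
    have h3 := pow_ne_zero (k.choose 2) hq; have h4 := right_ne_zero_of_mul h1
    have h5 : qPoch q q k ≠ 0 := qPoch_self_ne_zero hqq k
    rw [neg_pow γ⁻¹, neg_pow q⁻¹, neg_pow x⁻¹, inv_pow, inv_pow, inv_pow, div_pow]
    have h6 : ((-1:ℂ)^k)*(-1)^k = 1 := by rw [← mul_pow]; simp
    have h7 := pow_ne_zero k hγ0; have h8 := pow_ne_zero k hx0
    have h9 := left_ne_zero_of_mul_eq_one h6; field_simp
  rw [awPoly_zero_eq (inv_ne_zero hq) d y hab' (by simp), hT, ← qPoch_inv_base' hq hγ0, hS]; ring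

end

lemma awPoly_comm₂ (a b c d q:ℂ) (n:ℕ) (y:ℝ) : awPoly a b c d q n y = awPoly a c b d q n y := by
  simp only [awPoly, qPochs_cons, qPochs_nil, mul_one, mul_right_comm a b c]
  grind

lemma awPoly_comm₃ (a b c d q:ℂ) (n:ℕ) (y:ℝ) : awPoly a b c d q n y = awPoly a b d c q n y := by
  simp only [awPoly, qPochs_cons, qPochs_nil, mul_one, mul_right_comm (a*b) c d]
  grind

lemma continuous_awPoly {a b c d q : ℂ} (hq : q ≠ 0) (n:ℕ) :
    Continuous fun y => awPoly a b c d q n y := by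
  simp only [awPoly_eq_awSer hq, awSer]
  exact continuous_const.mul (continuous_finsetSum _ fun j _ =>
    continuous_const.mul (continuous_hFin a q j))

lemma awPoly_rotate {a b c d q : ℂ} (ha : a ≠ 0) (hd : d ≠ 0) (H : AWRegular a b c d q) (n:ℕ)
    (y:ℝ) : awPoly a b c d q n y = awPoly d a b c q n y := by
  rw [awPoly_comm₃, awPoly_comm₂, awPoly_swap ha hd H.swap₃.swap₂]

section

variable {q : ℝ} (hq0 : 0 < q) (hq1 : q < 1)

include hq0 hq1

lemma continuous_cgFun {A B : ℂ} (hAB : ∀ j : ℕ, A*B*q^j ≠ 1) (C b:ℂ) (n₁ n₂:ℕ) :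
    Continuous (cgFun q A B C b n₁ n₂) := by
  unfold cgFun; exact (continuous_wFun hq0 hq1 hAB _).mul (continuous_sPoly _ _ _ _ _)

/-- The integral of an Askey-Wilson polynomial, expanded in a basis adapted to the parameter `b`,
against a little `q`-Jacobi function. -/
lemma integral_awPoly_mul_wFun {μ : Measure ℝ} {D : ℝ → ℂ} {A B a b : ℂ}
    (H : AWMoments q μ D A B a b) (hAB : ‖A*B‖ < 1) (hAa : ‖A*a‖ < 1) (hAb : ‖A*b‖ < 1)
    (hBa : ‖B*a‖ < 1) (e f g:ℂ) (m:ℕ) :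
    ∫ y, awPoly b e f g q m y*(wFun q A B a y*D y) ∂μ =
      b⁻¹^m*qPochs [b*e, b*f, b*g] q m * ∑ i ∈ range (m+1),
        awCoeff b e f g q (q^m) i*(1/(Π(q;q)*Π(A*B;q) *
          Π(A*b*q^i;q)*Π(B*b*q^i;q)*Π(a*b*q^i;q))) := by
  have hq := norm_lt_one hq0 hq1; have hqc := ofReal_ne hq0; have hAB' := mul_pow_ne_one hq hAB
  have h1 : ∀ y, awPoly b e f g q m y*(wFun q A B a y*D y) =
      b⁻¹^m*qPochs [b*e, b*f, b*g] q m * ∑ i ∈ range (m+1),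
        awCoeff b e f g q (q^m) i*(wFun q A B a y*(hFin b q i y*D y)) := by
    intro y; rw [awPoly_eq_awSer hqc, awSer, mul_assoc _ (Finset.sum _ _), Finset.sum_mul]; grind
  have hi : ∀ i, Integrable (fun y => wFun q A B a y*(hFin b q i y*D y)) μ := fun i =>
    (H.shift₄ i).mul_continuous (continuous_wFun hq0 hq1 hAB' a)
  simp only [h1]; rw [integral_const_mul, integral_finsetSum _ fun i _ => (hi i).const_mul _]
  congr 1; refine sum_congr rfl fun i _ => ?_
  have hb : ‖A*(b*q^i)‖ < 1 := by
    rw [← mul_assoc, norm_mul, norm_pow]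
    exact (mul_le_of_le_one_right (norm_nonneg _) (pow_le_one₀ (norm_nonneg _) hq.le)).trans_lt hAb
  rw [integral_const_mul, integral_wFun hq0 hq1 (H.shift₄ i) hAB hAa hb hBa, mul_assoc A b,
    mul_assoc B b, mul_assoc a b]

/-- Evaluation of the sum in `integral_awPoly_mul_wFun`. -/
lemma sum_awCoeff_div {b e f g : ℂ} (hbe : ‖b*e‖ < 1) (hbf : ‖b*f‖ < 1) (hbg : ‖b*g‖ < 1)
    (K:ℂ) (m d:ℕ) :
    ∑ i ∈ range (m+1), awCoeff b e f g q (q^m) i*(1/(K*Π(b*e*q^i;q) *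
      Π(b*f*q^i;q)*Π(b*g*q^d*q^i;q))) =
      1/(K*Π(b*e;q)*Π(b*f;q)*Π(b*g;q))*qPoch (b*g) q d * termSum q (b*e*f*g*q^m/q) (b*g) m d := by
  have hq := norm_lt_one hq0 hq1; rw [termSum, mul_sum]; refine sum_congr rfl fun i _ => ?_
  have n1 : ∀ {z : ℂ}, ‖z‖ < 1 → ∀ n : ℕ, qPoch z q n ≠ 0 := fun hz n => qPoch_ne hq hz n
  have n2 : ∀ {z : ℂ}, ‖z‖ < 1 → Π(z;q) ≠ 0 := fun hz => qPochInf_ne hq hz; have a1 := n1 hbe i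
  have a2 := n1 hbf i; have a3 := n1 hbg i; have a4 := n1 hbg d; have a5 := n2 hbe
  have a6 := n2 hbf; have a7 := n2 hbg
  have a8 : qPoch (b*g*q^d) q i ≠ 0 := by have := n1 hbg (d+i); rw [qPoch_add] at this; grind
  rw [qPochInf_split hq _ i] at a5 a6; rw [qPochInf_split hq _ d, qPochInf_split hq _ i] at a7
  rw [qPochInf_split hq (b*e) i, qPochInf_split hq (b*f) i, qPochInf_split hq (b*g) d,
    qPochInf_split hq (b*g*q^d) i]
  have b1 := right_ne_zero_of_mul a5; have b2 := right_ne_zero_of_mul a6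
  have b3 := right_ne_zero_of_mul (right_ne_zero_of_mul a7); unfold awCoeff eCoeff
  generalize Π(b*g*q^d*q^i;q) = z1 at *
  generalize Π(b*e*q^i;q) = z2 at *
  generalize Π(b*f*q^i;q) = z3 at *
  generalize qPoch (b*g*q^d) q i = z4 at *
  generalize qPoch (b*g) q i = z5 at *
  generalize qPoch (b*g) q d = z6 at *
  generalize qPoch (b*e) q i = z7 at *
  generalize qPoch (b*f) q i = z8 at *
  generalize qPoch (b*e*f*g*q^m/q) q i = z9 at *
  generalize qPoch (q:ℂ) q i = z10 at *
  clear n1 n2 a5 a6 a7; field_simp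

end

/-! ### The integrals of products of three functions -/

lemma choose_two_add (m n:ℕ) : (m+n).choose 2 = m.choose 2+n.choose 2+m*n := by
  induction n with
  | zero => simp
  | succ n ih =>
    rw [← add_assoc, choose_succ_succ' (m+n) 1, ih, choose_succ_succ' n 1]
    simp only [choose_one_right]; ring

lemma hFin_reflect {q A C : ℂ} (hA : A ≠ 0) (hq : q ≠ 0) {N : ℕ} (hc : A*q^N*C = q)
    (y:ℝ) : hFin A q N y = A^(2*N)*(q^(N.choose 2))^2*hFin C q N y := by
  have h1 : ∏ j ∈ range N, (A*q^j)^2 = A^(2*N)*(q^(N.choose 2))^2 := by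
    rw [Finset.prod_pow, prod_mul_distrib, Finset.prod_const, Finset.card_range,
      Finset.prod_pow_eq_pow_sum, Finset.sum_range_id, ← choose_two_right]
    ring
  rw [← h1, hFin, hFin, ← Finset.prod_range_reflect (fun j => 1-2*C*(y:ℂ)*q^j+_),
    ← prod_mul_distrib]
  refine prod_congr rfl fun j hj => ?_; rw [mem_range] at hj
  have h2 : C*q^(N-1-j) = (A*q^j)⁻¹ := by
    refine eq_inv_of_mul_eq_one_left (mul_left_cancel₀ hq ?_); rw [mul_one]
    nth_rewrite 4 [← hc]
    have : N = N-1-j+j+1 := by omega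
    grind
  have h3 := pow_ne_zero j hq
  have h4 : 1-2*C*(y:ℂ)*q^(N-1-j)+C^2*q^(2*(N-1-j)) = 1-2*y*(C*q^(N-1-j))+(C*q^(N-1-j))^2 := by ring
  rw [h4, h2, pow_mul' q 2]; grind


section

variable {q : ℝ} (hq0 : 0 < q) (hq1 : q < 1)

include hq0 hq1

lemma cgRec_integral {μ : Measure ℝ} {D : ℝ → ℂ} {A B C b e f g h : ℂ}
    (H : AWMoments q μ D e f g h) (hAB : ∀ j : ℕ, A*B*q^j ≠ 1) (hC : C ≠ 0) {w : ℝ → ℂ}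
    (hw : Continuous w) : CGRec q C b (A*B/q) (A+B) fun n₁ n₂ =>
      ∫ y, w y*(cgFun q A B C b n₁ n₂ y*D y) ∂μ := by
  intro n₁ n₂
  have hi : ∀ i j, Integrable (fun y => w y*(cgFun q A B C b i j y*D y)) μ := fun i j =>
    (H.mul_continuous (hw.mul (continuous_cgFun hq0 hq1 hAB C b i j))).congr
      (Eventually.of_forall fun y => mul_assoc _ _ _)
  beta_reduce
  rw [← integral_const_mul, ← integral_const_mul, ← integral_const_mul, ← integral_const_mul,
    ← integral_add, ← integral_add, ← integral_sub]
  · refine integral_congr_ae (Eventually.of_forall fun y => ?_)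
    have := cgRec_cgFun (b := b) hq0 hq1 hAB hC y n₁ n₂; grind
  · fun_prop
  fun_prop
  · fun_prop
  fun_prop; fun_prop; fun_prop

variable {r κ₁ κ₂ s u A B C b : ℂ} {x E : ℝ} {p : ℕ} (hr : r^2 = q) (hκ₁ : κ₁ ≠ 0) (hκ₂ : κ₂ ≠ 0)
  (hs : s ≠ 0) (hu : u ≠ 0) (hx : u+u⁻¹ = 2*x) (hA : A = r*u/s) (hB : B = r/(u*s))
  (hC : C = κ₂*r/κ₁) (hb : b = κ₁*κ₂/r)

include hr hκ₁ hκ₂ hs hu hx hA hB hC hb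

lemma cgRec_awPoly_mul (hE : κ₂*q^p/s+(κ₂*q^p/s)⁻¹ = 2*E)
    (h1 : ∀ j : ℕ, κ₁^2*(q:ℂ)^j ≠ 1) (h2 : ∀ j : ℕ, κ₂^2*(q:ℂ)^j ≠ 1) :
    CGRec q C b (A*B/q) (A+B) fun n₁ n₂ => cgTau q (-(κ₂/(κ₁*s))) (s*κ₁/r) n₁ n₂ *
        awPoly (s*κ₁/(κ₂*q^p)) (κ₁*κ₂*q^p/s) 0 0 q n₁ x *
        awPoly (s/κ₂) (1/(κ₂*s)) 0 0 q⁻¹ n₂ E := by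
  have hqc := ofReal_ne hq0; have hqq := ofReal_mul_pow_ne_one hq0 hq1; have hr0 : r ≠ 0 := by grind
  have hqp := pow_ne_zero p hqc; have e1 : A*B/q = 1/s^2 := by rw [hA, hB, ← hr]; field_simp
  have e2 : A+B = 2*r*x/s := by rw [mul_right_comm, ← hx, hA, hB]; field_simp
  rw [hC, hb, e1, e2]
  refine cgRec_mul hr hr0 hκ₁ hκ₂ hs (x := x) (E := E) (fun n => ?_) fun n => ?_
  · have e3 : s*κ₁/(κ₂*q^p)*(κ₁*κ₂*q^p/s) = κ₁^2 := by field_simp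
    have := awPoly_rec_zero_zero (a := s*κ₁/(κ₂*q^p)) (b := κ₁*κ₂*q^p/s)
      (div_ne_zero (mul_ne_zero hs hκ₁) (mul_ne_zero hκ₂ hqp)) hqc hqq (by rwa [e3]) n x
    rw [this, e3]; congr 3; rw [← hE]; field_simp; ring
  · have e3 : s/κ₂*(1/(κ₂*s)) = (κ₂^2)⁻¹ := by field_simp
    exact awPoly_rec_zero_zero (div_ne_zero hs hκ₂) (inv_ne_zero hqc)
      (fun j => by rw [← pow_succ', inv_pow, inv_ne_one, pow_succ']; exact hqq j)
      (fun j => by rw [e3, inv_pow, ← mul_inv]; exact inv_ne_one.2 (h2 j)) n E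

/-- The integral that gives the Clebsch-Gordan coefficients. The two sides satisfy the same
recurrence, and for `n₁ = 0` the integral is a terminating series that is summed by
`awPoly_inv_eq_termSum`. -/
theorem integral_awPoly_mul_cgFun {μ : Measure ℝ} {D : ℝ → ℂ} (H : AWMoments q μ D A B C b)
    (hR : AWRegular A B C b q)
    (hE : κ₂*q^p/s+(κ₂*q^p/s)⁻¹ = 2*E)
    (hAB : ‖A*B‖ < 1) (hAC : ‖A*C‖ < 1) (hAb : ‖A*b‖ < 1) (hBC : ‖B*C‖ < 1)
    (hBb : ‖B*b‖ < 1) (hCb : ‖C*b‖ < 1)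
    (h1 : ∀ j : ℕ, κ₁^2*(q:ℂ)^j ≠ 1) (n₁ n₂:ℕ) :
    ∫ y, awPoly A B C b q p y*(cgFun q A B C b n₁ n₂ y*D y) ∂μ =
      b⁻¹^p*qPochs [b*A, b*B, b*C] q p*(κ₂^2*q^p/s^2)^p / (Π(q;q)*Π(A*B;q)*Π(b*A;q)*Π(b*B;q) *
          Π(b*C;q)) *
      (cgTau q (-(κ₂/(κ₁*s))) (s*κ₁/r) n₁ n₂ * awPoly (s*κ₁/(κ₂*q^p)) (κ₁*κ₂*q^p/s) 0 0 q n₁ x *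
        awPoly (s/κ₂) (1/(κ₂*s)) 0 0 q⁻¹ n₂ E) := by
  have hqc := ofReal_ne hq0; have hq := norm_lt_one hq0 hq1
  have hqq := ofReal_mul_pow_ne_one hq0 hq1; have hr0 : r ≠ 0 := by grind
  have hqp := pow_ne_zero p hqc; have hC0 : C ≠ 0 := by grind
  have hb0 : b ≠ 0 := by grind
  have hA0 : A ≠ 0 := by grind
  have hAB' := mul_pow_ne_one hq hAB; have hCb' := mul_pow_ne_one hq hCb
  have hγ : C*b = κ₂^2 := by grind
  have h2 : ∀ j : ℕ, κ₂^2*(q:ℂ)^j ≠ 1 := by rwa [← hγ]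
  refine CGRec.eq_of_left (cgRec_integral hq0 hq1 H hAB' hC0 (continuous_awPoly hqc p))
    ((cgRec_awPoly_mul hq0 hq1 hr hκ₁ hκ₂ hs hu hx hA hB hC hb hE h1 h2).const_mul _)
    (fun d => ?_) n₁ n₂
  have hqd := pow_ne_zero d hqc; have hc : C*(q/C) = q := mul_div_cancel₀ _ hC0
  have f1 : ∀ y, cgFun q A B C b 0 d y = (-1)^d*C⁻¹^d*((q:ℂ)^(d.choose 2))⁻¹ *
      (wFun q A B (C*q^d) y*hFin C q d y) := by
    intro y
    have := sPoly_eq_hFin_mul_awPoly hqc hqq hc hCb' 0 d (η := q*(q^0/q^d)) (by field_simp) y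
    rw [zero_add] at this; rw [cgFun, pow_zero, div_one, ← pow_zero (q:ℂ), this]
    simp only [awPoly, qPochs, qPoch]; simp; ring
  have f2 : ∀ y, awPoly A B C b q p y*(cgFun q A B C b 0 d y*D y) =
      (-1)^d*C⁻¹^d*((q:ℂ)^(d.choose 2))⁻¹ *
        (awPoly b A B C q p y*(wFun q A B (C*q^d) y*(hFin C q d y*D y))) := by
    intro y; rw [f1, awPoly_rotate hA0 hb0 hR]; ring
  have lt : ∀ {z : ℂ}, ‖z‖ < 1 → ‖z*q^d‖ < 1 := fun hz => by
    rw [norm_mul, norm_pow]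
    exact (mul_le_of_le_one_right (norm_nonneg _) (pow_le_one₀ (norm_nonneg _) hq.le)).trans_lt hz
  have f3 := integral_awPoly_mul_wFun hq0 hq1 (H.shift₃ d) hAB (by rw [← mul_assoc]; exact lt hAC)
    hAb (by rw [← mul_assoc]; exact lt hBC) A B C p
  have f4 := sum_awCoeff_div hq0 hq1 (b := b) (e := A) (f := B) (g := C) (by rwa [mul_comm])
    (by rwa [mul_comm]) (by rwa [mul_comm]) (Π(q;q)*Π(A*B;q)) p d
  have f5 : C*q^d*b = b*C*q^d := by ring
  have f6 : b*A*B*C*q^p/q = κ₂^2*q^p/s^2 := by rw [hA, hB, hC, hb, ← hr]; field_simp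
  rw [mul_comm A b, mul_comm B b, f5, f4, f6, mul_comm b C, hγ] at f3
  have f7 := awPoly_inv_eq_termSum (b := 1/(κ₂*s)) hqc hqq (div_ne_zero hs hκ₂) (div_ne_zero
    (mul_ne_zero hκ₂ hqp) hs) hE h2 (pow_ne_zero 2 hκ₂) (by field_simp) d p (by field_simp)
    (x := κ₂^2*q^p/s^2) (by field_simp)
  simp only [f2]; rw [integral_const_mul, f3, cgTau, pow_zero, zero_mul, pow_zero, mul_comm b C, hγ]
  have f8 : awPoly (s*κ₁/(κ₂*q^p)) (κ₁*κ₂*q^p/s) 0 0 q 0 x = 1 := by simp [awPoly, qPochs, qPoch]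
  have f9 : C⁻¹^d = (s*κ₁/r)^d*(s/κ₂)⁻¹^d*(κ₂^2)⁻¹^d := by
    rw [← mul_pow, ← mul_pow, hC]; congr 1; field_simp
  have f10 : (-1:ℂ)^d*(κ₂^2)⁻¹^d = (-(κ₂^2)⁻¹)^d := by ring
  rw [f8, f9]; simp only [one_mul, Nat.choose_zero_succ, pow_zero, inv_one, mul_one]
  linear_combination (-b⁻¹^p*qPochs [b*A, b*B, κ₂^2] q p / (Π(q;q)*Π(A*B;q)*Π(b*A;q)*Π(b*B;q) *
          Π(κ₂^2;q))*(s*κ₁/r)^d)*f7+(b⁻¹^p*qPochs [b*A, b*B, κ₂^2] q p /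
        (Π(q;q)*Π(A*B;q)*Π(b*A;q)*Π(b*B;q) * Π(κ₂^2;q))*(s*κ₁/r)^d*(s/κ₂)⁻¹^d*(q^(d.choose 2))⁻¹ *
          qPoch (κ₂^2) q d*termSum q (κ₂^2*q^p/s^2) (κ₂^2) p d)*f10

/-- The integral that gives the Clebsch-Gordan coefficients, when the first parameter `A` of the
little `q`-Jacobi functions is `q ^ (-N)` times the parameter `c` with `c * C = q`. By `wFun_symm` the
little `q`-Jacobi functions are then multiples of others with small parameters. The two sides
satisfy the same recurrence, and for `n₂ = 0` the integral is a terminating series that is summed by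
`awPoly_eq_termSum`. -/
theorem integral_awPoly_mul_cgFun' {μ : Measure ℝ} {D : ℝ → ℂ} {c : ℂ} {N m : ℕ}
    (hc : c = κ₁*r/κ₂) (hAc : A*q^N = c) (hp : p = N+m) (H : AWMoments q μ D c B C b)
    (hR : AWRegular c B (C*q^N) b q)
    (hE : κ₂*q^p/s+(κ₂*q^p/s)⁻¹ = 2*E)
    (hAB : ‖A*B‖ < 1) (hcB : ‖c*B‖ < 1) (hcb : ‖c*b‖ < 1) (hBC : ‖B*C‖ < 1)
    (hBb : ‖B*b‖ < 1) (hCb : ‖C*b‖ < 1) (n₁ n₂:ℕ) :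
    ∫ y, awPoly c B (C*q^N) b q m y*(cgFun q A B C b n₁ n₂ y*D y) ∂μ =
      (-(C*B))^N*(q:ℂ)^(N.choose 2)*(A^(2*N)*((q:ℂ)^(N.choose 2))^2) *
        (b⁻¹^m*qPochs [b*B, b*(C*q^N), b*c] q m) *
        (κ₂^2*(q^N)^2*q^m/s^2)^m /
        (Π(q;q)*Π(A*B;q)*Π(b*B;q)*Π(b*(C*q^N);q) * Π(b*c;q)) *
      (cgTau q (-(κ₂/(κ₁*s))) (s*κ₁/r) n₁ n₂ * awPoly (s*κ₁/(κ₂*q^p)) (κ₁*κ₂*q^p/s) 0 0 q n₁ x *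
        awPoly (s/κ₂) (1/(κ₂*s)) 0 0 q⁻¹ n₂ E) := by
  have hqc := ofReal_ne hq0; have hq := norm_lt_one hq0 hq1
  have hqq := ofReal_mul_pow_ne_one hq0 hq1; have hr0 : r ≠ 0 := by grind
  have hqp := pow_ne_zero p hqc; have hqN := pow_ne_zero N hqc; have hqm := pow_ne_zero m hqc
  have hC0 : C ≠ 0 := by grind
  have hb0 : b ≠ 0 := by grind
  have hA0 : A ≠ 0 := by grind
  have hB0 : B ≠ 0 := by simp [*]
  have hc0 : c ≠ 0 := by grind
  have hAB' := mul_pow_ne_one hq hAB; have hγ : c*b = κ₁^2 := by grind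
  have h1 : ∀ j : ℕ, κ₁^2*(q:ℂ)^j ≠ 1 := by rw [← hγ]; exact mul_pow_ne_one hq hcb
  have h2 : ∀ j : ℕ, κ₂^2*(q:ℂ)^j ≠ 1 := by
    have : C*b = κ₂^2 := by grind
    rw [← this]; exact mul_pow_ne_one hq hCb
  have hcC : c*C = q := by grind
  have hu' : u = κ₁*s/(κ₂*q^N) := by rw [hA, hc] at hAc; field_simp at hAc ⊢; grind
  refine CGRec.eq_of_right hqc hC0 (div_ne_zero (mul_ne_zero hA0 hB0) hqc)
    (cgRec_integral hq0 hq1 H hAB' hC0 (continuous_awPoly hqc m))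
    ((cgRec_awPoly_mul hq0 hq1 hr hκ₁ hκ₂ hs hu hx hA hB hC hb hE h1 h2).const_mul _)
    (fun d => ?_) n₁ n₂
  have hqd := pow_ne_zero d hqc
  have hM : A*(C*(1/q^d))*q^(N+d) = q := by
    have : A*(C*(1/q^d))*q^(N+d) = A*q^N*C := by rw [pow_add]; field_simp
    grind
  have e1 : A*(q:ℂ)^(N+d) = c*q^d := by grind
  have e2 : C*(1/(q:ℂ)^d)*q^(N+d) = C*q^N := by rw [pow_add]; field_simp
  have f1 : ∀ y, cgFun q A B C b d 0 y = (-(C*(1/(q:ℂ)^d)*B))^(N+d) *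
      q^((N+d).choose 2)*Π(q;q)/(qPoch q q (N+d)*Π(A*B;q)) *
      (A^(2*N)*((q:ℂ)^(N.choose 2))^2) *
      (wFun q (c*q^d) (C*q^N) B y*(hFin c q d y*hFin C q N y)) := by
    intro y
    rw [cgFun, sPoly_zero, mul_one, pow_zero, wFun_symm hq0 hq1 hAB' hM, e1, e2, hFin_add, hAc,
      hFin_reflect hA0 hqc (by rw [hAc, hcC])]
    ring
  have f2 : ∀ y, awPoly c B (C*q^N) b q m y*(cgFun q A B C b d 0 y*D y) =
      (-(C*(1/(q:ℂ)^d)*B))^(N+d) *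
      q^((N+d).choose 2)*Π(q;q)/(qPoch q q (N+d)*Π(A*B;q)) *
      (A^(2*N)*((q:ℂ)^(N.choose 2))^2) * (awPoly b B (C*q^N) c q m y*(wFun q (c*q^d) (C*q^N) B y *
          (hFin c q d y*(hFin C q N y*D y)))) := by
    intro y; rw [f1, awPoly_rotate hc0 hb0 hR, awPoly_comm₂, awPoly_comm₃]; ring
  have lt : ∀ {z : ℂ}, ‖z‖ < 1 → ∀ j : ℕ, ‖z*q^j‖ < 1 := fun hz j => by
    rw [norm_mul, norm_pow]
    exact (mul_le_of_le_one_right (norm_nonneg _) (pow_le_one₀ (norm_nonneg _) hq.le)).trans_lt hz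
  have e3 : c*q^d*(C*q^N) = q*(q:ℂ)^(N+d) := by rw [pow_add]; linear_combination (q:ℂ)^N*q^d*hcC
  have f3 := integral_awPoly_mul_wFun hq0 hq1 ((H.shift₃ N).shift₁ d).swap₂
    (by rw [e3]; exact lt hq _) (by rw [mul_right_comm]; exact lt hcB d)
    (by rw [mul_right_comm]; exact lt hcb d)
    (by rw [mul_right_comm, mul_comm C]; exact lt hBC N) B (C*q^N) c m
  have hbCN : ‖b*(C*q^N)‖ < 1 := by rw [← mul_assoc, mul_comm b]; exact lt hCb N
  have f4 := sum_awCoeff_div hq0 hq1 (b := b) (e := B) (f := C*q^N) (g := c) (by rwa [mul_comm])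
    hbCN (by rwa [mul_comm]) (Π(q;q)*Π(q*q^(N+d);q)) m d
  have f5 : ∀ i ∈ range (m+1), awCoeff b B (C*q^N) c q (q^m) i * (1/(Π(q;q)*Π(c*q^d*(C*q^N);q) *
          Π(c*q^d*b*q^i;q)*Π(C*q^N*b*q^i;q) * Π(B*b*q^i;q))) = awCoeff b B (C*q^N) c q (q^m) i *
      (1/(Π(q;q)*Π(q*q^(N+d);q)*Π(b*B*q^i;q) * Π(b*(C*q^N)*q^i;q)*Π(b*c*q^d*q^i;q))) := by
    intro i _; rw [e3, mul_comm B b, mul_comm (C*(q:ℂ)^N) b, mul_right_comm c, mul_comm c b]; ring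
  have f6 : b*B*(C*q^N)*c*q^m/q = κ₂^2*(q^N)^2*q^m/s^2 := by
    rw [hB, hC, hb, hc, hu', ← hr]; field_simp
  rw [sum_congr rfl f5, f4, f6, mul_comm b c, hγ] at f3
  have hx0 : κ₂^2*(q^N)^2*q^m/s^2 ≠ 0 := by positivity
  have f7 := termSum_comm hqc hqq hx0 h1 m d
  have g1 : κ₁*κ₂*q^p/s*(s*κ₁/(κ₂*q^p)) = κ₁^2 := by field_simp
  have hβ : κ₁*κ₂*q^p/s ≠ 0 := by positivity
  have f8 := awPoly_eq_termSum hqc (a := κ₁*κ₂*q^p/s) (b := s*κ₁/(κ₂*q^p)) hu hx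
    (by rwa [g1]) d m (by rw [g1, hu', hp, pow_add]; field_simp)
  have g2 : κ₁*κ₂*q^p/s*u⁻¹ = κ₂^2*(q^N)^2*q^m/s^2 := by rw [hu', hp, pow_add]; field_simp
  have f9 : awPoly (s*κ₁/(κ₂*q^p)) (κ₁*κ₂*q^p/s) 0 0 q d x =
      awPoly (κ₁*κ₂*q^p/s) (s*κ₁/(κ₂*q^p)) 0 0 q d x := by
    refine awPoly_swap (div_ne_zero (mul_ne_zero hs hκ₁) (mul_ne_zero hκ₂ hqp)) hβ
      ⟨hqc, hqq, fun j => ?_, fun j => ?_, by simp, by simp, by simp, by simp, by simp⟩ d x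
    · rw [mul_zero, zero_mul]; positivity
    · rw [mul_comm (s*κ₁/_), g1]; exact h1 j
  rw [g1, g2] at f8
  have k1 : (-(C*(1/(q:ℂ)^d)*B))^(N+d)*q^((N+d).choose 2) =
      (-(C*B))^N*q^(N.choose 2)*((-(C*B/q))^d*((q:ℂ)^(d.choose 2))⁻¹) := by
    have h3 : C*(1/(q:ℂ)^d)*B = C*B*((q:ℂ)^d)⁻¹ := by ring
    have h4 := pow_ne_zero (d.choose 2) hqc
    have h5 : ((q:ℂ)^d)^d = q^(d.choose 2)*q^(d.choose 2)*q^d := by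
      rw [← pow_mul, ← pow_add, ← pow_add]; congr 1; have := Nat.triangle_succ d
      rw [choose_two_right, ← mul_two, Nat.div_mul_cancel (Nat.even_mul_pred_self d).two_dvd]
      cases d with
      | zero => rfl
      | succ d => rw [Nat.add_sub_cancel]; ring
    rw [h3, neg_pow, neg_pow (C*B) N, neg_pow (C*B/q), mul_pow, inv_pow, pow_add (_^d) N d,
      choose_two_add, h5, pow_add _ (_+_), pow_add _ (_:ℕ) (d.choose 2), mul_comm N d, pow_mul,
      div_pow]
    field_simp; ring
  have k2 : (-(C*B/q))^d = (-(κ₂/(κ₁*s)))^d*(κ₁*κ₂*q^p/s)⁻¹^d * (κ₂^2*(q^N)^2*q^m/s^2)^d := by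
    rw [← mul_pow, ← mul_pow, hC, hB, hu', hp, pow_add, ← hr]; congr 1; field_simp
  have nz : ∀ {z : ℂ}, ‖z‖ < 1 → Π(z;q) ≠ 0 := fun hz => qPochInf_ne hq hz
  have z1 := nz (lt hq (N+d)); have z2 := qPoch_self_ne_zero hqq (N+d)
  have k3 : Π(q;q)/(qPoch q q (N+d)*Π(A*B;q))*(1/(Π(q;q) * Π(q*q^(N+d);q)*Π(b*B;q)*Π(b*(C*q^N);q) *
      Π(κ₁^2;q))) = 1/(Π(q;q)*Π(A*B;q)*Π(b*B;q) * Π(b*(C*q^N);q)*Π(κ₁^2;q)) := by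
    rw [qPochInf_split hq (q:ℂ) (N+d)]; have z3 := nz hAB
    have z4 : Π(b*B;q) ≠ 0 := nz (by rwa [mul_comm]); have z5 := nz hbCN
    have z6 : Π(κ₁^2;q) ≠ 0 := hγ ▸ nz hcb; field_simp
  have k4 : awPoly (s/κ₂) (1/(κ₂*s)) 0 0 (q:ℂ)⁻¹ 0 E = 1 := by simp [awPoly, qPochs, qPoch]
  simp only [f2]
  rw [integral_const_mul, f3, cgTau, mul_zero, pow_zero, pow_zero, f9, f8, k1, k2, k4, mul_comm b c,
    hγ]
  generalize qPochs [b*B, b*(C*q^N), κ₁^2] (q:ℂ) m = w1 at *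
  generalize qPoch (κ₁^2) (q:ℂ) d = w2 at *
  generalize hX : κ₂^2*(q^N)^2*q^m/s^2 = X at *
  generalize (κ₁*κ₂*q^p/s)⁻¹^d = w4 at *
  generalize (-(κ₂/(κ₁*s)))^d = w5 at *
  linear_combination ((-(C*B))^N*q^(N.choose 2)*(w5*w4*X^d *
    ((q:ℂ)^(d.choose 2))⁻¹)*(A^(2*N)*((q:ℂ)^(N.choose 2))^2)*b⁻¹^m*w1*w2 *
    termSum q X (κ₁^2) m d)*k3+((-(C*B))^N*q^(N.choose 2)*(w5*w4 *
    ((q:ℂ)^(d.choose 2))⁻¹)*(A^(2*N)*((q:ℂ)^(N.choose 2))^2)*b⁻¹^m*w1*w2 *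
    (1/(Π(q;q)*Π(A*B;q)*Π(b*B;q) * Π(b*(C*q^N);q)*Π(κ₁^2;q))))*f7

end

/-! ### The masses of the Askey-Wilson measure -/

lemma qPoch_mul_inv_pow {q : ℂ} (hq : q ≠ 0) (x:ℂ) (k:ℕ) :
    qPoch (x*(q^k)⁻¹) q k = ∏ j ∈ range k, (1-x*(q^(j+1))⁻¹) := by
  rw [qPoch, ← Finset.prod_range_reflect]; refine prod_congr rfl fun j hj => ?_
  rw [mem_range] at hj; obtain ⟨i, rfl⟩ : ∃ i, k = i+(j+1) := ⟨k-(j+1), by omega⟩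
  have h1 := pow_ne_zero i hq; have h2 := pow_ne_zero (j+1) hq; have e : i+(j+1)-1-j = i := by omega
  rw [e, pow_add]; field_simp

lemma two_mul_choose_two (n:ℕ) : 2*(n+1).choose 2 = (n+1)*n := by
  rw [choose_two_right, Nat.mul_div_cancel' (Nat.even_mul_pred_self (n+1)).two_dvd,
    Nat.add_sub_cancel]

lemma prod_pow_succ (q:ℂ) (k:ℕ) : ∏ j ∈ range k, q^(j+1) = q^((k+1).choose 2) := by
  induction k with
  | zero => simp
  | succ k ih =>
    rw [prod_range_succ, ih, ← pow_add, choose_succ_succ' (k+1) 1]; simp only [choose_one_right]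
    ring_nf

lemma prod_sub_mul_pow {q e : ℂ} (hq : q ≠ 0) (he : e ≠ 0) (f:ℂ) (k:ℕ) :
    ∏ j ∈ range k, (f-e*q^(j+1)) = (-e)^k*q^((k+1).choose 2)*qPoch (f*(e*q^k)⁻¹) q k := by
  rw [mul_inv, ← mul_assoc f, qPoch_mul_inv_pow hq, ← prod_pow_succ]
  have : (-e)^k = ∏ j ∈ range k, (-e) := by simp
  rw [this, ← prod_mul_distrib, ← prod_mul_distrib]; refine prod_congr rfl fun j _ => ?_
  have := pow_ne_zero (j+1) hq; field_simp; ring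

lemma qPoch_inv_mul_inv_pow {q x : ℂ} (hq : q ≠ 0) (hx : x ≠ 0) (k:ℕ) :
    (-x)^k*q^((k+1).choose 2)*qPoch (x⁻¹*(q^k)⁻¹) q k = qPoch (x*q) q k := by
  rw [qPoch_mul_inv_pow hq, ← prod_pow_succ, qPoch]; have : (-x)^k = ∏ j ∈ range k, (-x) := by simp
  rw [this, ← prod_mul_distrib, ← prod_mul_distrib]; refine prod_congr rfl fun j _ => ?_
  have := pow_ne_zero j hq; field_simp; ring

section

variable {q : ℝ} (hq0 : 0 < q) (hq1 : q < 1)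

include hq0 hq1

lemma one_lt_norm_mul_pow {e : ℂ} {j k : ℕ} (h : 1 < ‖e*q^k‖) (hj : j ≤ k) : 1 < ‖e*q^j‖ := by
  refine h.trans_le ?_; rw [norm_mul, norm_mul, norm_pow, norm_pow]
  exact mul_le_mul_of_nonneg_left (pow_le_pow_of_le_one (norm_nonneg _)
    (norm_lt_one hq0 hq1).le hj) (norm_nonneg _)

lemma qPochInf_div_mul_prod {e f : ℂ} {k : ℕ} (he : e ≠ 0) :
    Π(f/e;q) * ∏ j ∈ range k, (f-e*q^(j+1)) = (-e)^k*q^((k+1).choose 2)*Π(f*(e*q^k)⁻¹;q) := by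
  have hqc := ofReal_ne hq0; have hk := pow_ne_zero k hqc
  rw [prod_sub_mul_pow hqc he, qPochInf_split (norm_lt_one hq0 hq1) (f*(e*q^k)⁻¹) k]
  have : f*(e*(q:ℂ)^k)⁻¹*q^k = f/e := by field_simp
  rw [this]; ring

lemma qPoch_div_qPochInf_mul_prod {e f : ℂ} {k : ℕ} (he0 : e ≠ 0) (hf : ‖e*f‖ < 1) :
    qPoch (e*f) q k/(Π(f/e;q) * ∏ j ∈ range k, (f-e*(q:ℂ)^(j+1))) = Π(e*f;q) /
        (symPoch f q (e*q^k)*((-e)^k*q^((k+1).choose 2))) := by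
  have hq := norm_lt_one hq0 hq1; have hqc := ofReal_ne hq0; have hk := pow_ne_zero k hqc
  have h0 := qPochInf_ne hq hf; rw [qPochInf_split hq _ k] at h0; have h1 := right_ne_zero_of_mul h0
  rw [qPochInf_div_mul_prod hq0 hq1 he0, symPoch, qPochInf_split hq (e*f) k]
  have e1 : f*(e*(q:ℂ)^k) = e*f*q^k := by ring
  rw [e1]; field_simp

lemma awMass_aux {e : ℂ} {k : ℕ} (he : 1 < ‖e*q^k‖) : (1-e^2*(q:ℂ)^(2*k))/(1-e^2)*Π((e^2)⁻¹;q) *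
      qPoch (e^2) q k*(q/e)^k/qPoch q q k/((-e)^k*q^((k+1).choose 2))^3 =
      Π(((e*q^k)^2)⁻¹;q)/(qPoch (e^2*q^k) q k*qPoch ((q:ℂ)^k)⁻¹ q k) := by
  have hq := norm_lt_one hq0 hq1; have hqc := ofReal_ne hq0
  have hqq := ofReal_mul_pow_ne_one hq0 hq1; have hk := pow_ne_zero k hqc
  have he1 : 1 < ‖e‖ := by simpa using one_lt_norm_mul_pow hq0 hq1 he (Nat.zero_le k)
  have he0 : e ≠ 0 := by rintro rfl; simp at he1; linarith
  have hsq : ∀ j ≤ 2*k, e^2*(q:ℂ)^j ≠ 1 := by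
    intro j hj h
    have h2 : ‖e^2*(q:ℂ)^(2*k)‖ ≤ ‖e^2*(q:ℂ)^j‖ := by
      rw [norm_mul, norm_mul, norm_pow _ (2*k), norm_pow _ j]
      exact mul_le_mul_of_nonneg_left (pow_le_pow_of_le_one (norm_nonneg _) hq.le hj) (norm_nonneg _)
    rw [h, norm_one, pow_mul', ← mul_pow, norm_pow] at h2; nlinarith [norm_nonneg (e*(q:ℂ)^k)]
  have hT := pow_ne_zero ((k+1).choose 2) hqc; have hT2 := pow_ne_zero ((2*k+1).choose 2) hqc
  have m1 : 1-e^2 ≠ 0 := fun h => hsq 0 (Nat.zero_le _) (by linear_combination -h)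
  have m2 : qPoch (e^2*q^k) q k ≠ 0 := qPoch_ne_zero fun j hj => by
    rw [mul_assoc, ← pow_add]; exact hsq _ (by omega)
  have m3 := qPoch_inv_mul_inv_pow hqc one_ne_zero k; rw [inv_one, one_mul, one_mul] at m3
  have m4 := qPoch_self_ne_zero hqq k
  have m5 := qPoch_inv_mul_inv_pow hqc (pow_ne_zero 2 he0) (2*k)
  have m6 : qPoch (e^2) q k*qPoch (e^2*q^k) q k*(1-e^2*q^(2*k)) =
      (1-e^2)*qPoch (e^2*q) q (2*k) := by
    rw [← qPoch_add, ← qPoch_succ', qPoch_succ, two_mul]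
  have m7 : Π(((e*(q:ℂ)^k)^2)⁻¹;q) = qPoch ((e^2)⁻¹*((q:ℂ)^(2*k))⁻¹) q (2*k)*Π((e^2)⁻¹;q) := by
    have e1 : ((e*(q:ℂ)^k)^2)⁻¹ = (e^2)⁻¹*((q:ℂ)^(2*k))⁻¹ := by
      rw [← mul_inv, mul_pow, ← pow_mul, mul_comm k]
    have e2 : (e^2)⁻¹*((q:ℂ)^(2*k))⁻¹*q^(2*k) = (e^2)⁻¹ := by field_simp
    rw [e1, qPochInf_split hq _ (2*k), e2]
  have m8 : ((q:ℂ)^((k+1).choose 2))^4 = q^k*q^((2*k+1).choose 2) := by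
    rw [← pow_mul, ← pow_add]; congr 1; have h3 := two_mul_choose_two k
    have h4 := two_mul_choose_two (2*k); nlinarith
  have n1 : qPoch ((q:ℂ)^k)⁻¹ q k ≠ 0 := fun h => m4 (by rw [← m3, h, mul_zero]); rw [m7, ← m3]
  generalize qPoch ((e^2)⁻¹*((q:ℂ)^(2*k))⁻¹) q (2*k) = v1 at *
  generalize qPoch ((q:ℂ)^k)⁻¹ q k = v2 at *
  generalize qPoch (e^2) (q:ℂ) k = v3 at *
  generalize qPoch (e^2*q^k) (q:ℂ) k = v4 at *
  generalize Π((e^2)⁻¹;(q:ℂ)) = v5 at *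
  generalize (q:ℂ)^((2*k+1).choose 2) = T2 at *
  generalize (q:ℂ)^((k+1).choose 2) = T at *
  have n2 : (-e)^k = (-1)^k*e^k := by rw [neg_pow]
  have n3 : ((-1:ℂ)^k)*(-1)^k = 1 := by rw [← mul_pow]; simp
  have n4 : (-e^2)^(2*k) = (e^k)^4 := by
    rw [neg_pow, pow_mul (-1:ℂ) 2 k]; simp; rw [← pow_mul, ← pow_mul]; ring_nf
  have n5 := left_ne_zero_of_mul_eq_one n3; have n6 := pow_ne_zero k he0; rw [n4] at m5
  rw [← m5] at m6; rw [n2, div_pow]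
  have n7 : ((-1:ℂ)^k)^4 = 1 := by rw [show ((-1:ℂ)^k)^4 = ((-1:ℂ)^k*(-1)^k)^2 by ring, n3, one_pow]
  generalize (-1:ℂ)^k = w at *
  generalize (q:ℂ)^(2*k) = Qk at *
  generalize e^k = ek at *
  generalize (q:ℂ)^k = qk at *
  have n8 : (1-e^2*Qk)/(1-e^2)*v5*v3*(qk/ek)/(w*T*v2) / (w*ek*T)^3 = (1-e^2*Qk)*v5*v3*qk /
        ((1-e^2)*ek*(w*T*v2)*(w*ek*T)^3) := by
    field_simp
  rw [n8, div_eq_div_iff (by positivity) (mul_ne_zero m2 n1)]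
  linear_combination (v5*qk*v2)*m6 - (1-e^2)*ek^4*v2*v1*v5*(T^4*n7+m8)

/-- The masses of the Askey-Wilson measure, as the product of the masses of the measure with one
parameter and of the values of the remaining factors of the weight. -/
lemma awMass_eq {e f g h : ℂ} {k : ℕ} (he : 1 < ‖e*q^k‖) (hef : ‖e*f‖ < 1)
    (heg : ‖e*g‖ < 1) (heh : ‖e*h‖ < 1) :
    awMass e f g h q k = qPochInfs [q, e*f, e*g, e*h, f*g, f*h, g*h] q / Π(e*f*g*h;q) *
      (Π(((e*q^k)^2)⁻¹;q) / (qPoch (e^2*q^k) q k*qPoch ((q:ℂ)^k)⁻¹ q k*Π(q;q))) /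
      (symPoch f q (e*q^k)*symPoch g q (e*q^k)*symPoch h q (e*q^k)) := by
  have hq := norm_lt_one hq0 hq1; have hqc := ofReal_ne hq0
  have he1 : 1 < ‖e‖ := by simpa using one_lt_norm_mul_pow hq0 hq1 he (Nat.zero_le k)
  have he0 : e ≠ 0 := by rintro rfl; simp at he1; linarith
  have hl : awMass e f g h q k = (1-e^2*(q:ℂ)^(2*k))/(1-e^2) *
      Π((e^2)⁻¹;q)*qPoch (e^2) q k*(q/e)^k/qPoch q q k *
      (Π(f*g;q)*Π(f*h;q)*Π(g*h;q)/Π(e*f*g*h;q)) *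
      ((qPoch (e*f) q k/(Π(f/e;q) * ∏ j ∈ range k, (f-e*(q:ℂ)^(j+1)))) *
      (qPoch (e*g) q k/(Π(g/e;q) * ∏ j ∈ range k, (g-e*(q:ℂ)^(j+1)))) *
      (qPoch (e*h) q k/(Π(h/e;q) * ∏ j ∈ range k, (h-e*(q:ℂ)^(j+1))))) := by
    simp only [awMass, qPochInfs_cons, qPochInfs_nil, qPochs_cons, qPochs_nil, mul_one, prod_mul_distrib]
    ring
  rw [hl, qPoch_div_qPochInf_mul_prod hq0 hq1 he0 hef,
    qPoch_div_qPochInf_mul_prod hq0 hq1 he0 heg, qPoch_div_qPochInf_mul_prod hq0 hq1 he0 heh,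
    ← div_div _ _ (Π(q;q)), ← awMass_aux hq0 hq1 he]
  simp only [qPochInfs_cons, qPochInfs_nil, mul_one]; have hQ : Π((q:ℂ);q) ≠ 0 := qPochInf_ne hq hq
  generalize (1-e^2*(q:ℂ)^(2*k))/(1-e^2)*Π((e^2)⁻¹;q) * qPoch (e^2) q k*(q/e)^k/qPoch q q k = M
  generalize (-e)^k*(q:ℂ)^((k+1).choose 2) = w; generalize Π((q:ℂ);q) = z at hQ ⊢
  linear_combination (-M*(Π(f*g;q)*Π(f*h;q)*Π(g*h;q) /
    Π(e*f*g*h;q))*(Π(e*f;q)/(symPoch f q (e*q^k)*w) *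
    (Π(e*g;q)/(symPoch g q (e*q^k)*w)) *
    (Π(e*h;q)/(symPoch h q (e*q^k)*w))))*mul_inv_cancel₀ hQ

end

/-! ### The Askey-Wilson measure as a measure with a density -/

lemma conj_hInf (f:ℂ) {q : ℝ} (hq : ‖(q:ℂ)‖ < 1) (y:ℝ) : conj (hInf f q y) = hInf (conj f) q y := by
  have h1 : conj (expArg y) ≠ 0 := (map_ne_zero _).2 (expArg_ne_zero y)
  have h2 : conj (expArg y)+(conj (expArg y))⁻¹ = 2*y := by
    rw [← map_inv₀, ← map_add, expArg_add_inv, map_mul, conj_ofReal, Complex.conj_ofNat]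
  rw [hInf_eq (e := conj f) h1 h2, hInf, symPoch, symPoch, map_mul, conj_qPochInf _ hq, conj_qPochInf _ hq,
    map_mul, map_mul, map_inv₀]

lemma isPos_hInf_mul_hInf_conj (f:ℂ) {q : ℝ} (hq : ‖(q:ℂ)‖ < 1) {y : ℝ} (h : hInf f q y ≠ 0) :
    IsPos (hInf f q y*hInf (conj f) q y) := by
  rw [← conj_hInf f hq]; exact .mul_conj h

/-- The set that carries the measure `refM q e N`. -/
def OnSupp (q e:ℝ) (N:ℕ) (y:ℝ) : Prop := (∃ θ ∈ Ioo 0 π, y = cos θ) ∨ ∃ k < N, y = mu (e*q^k)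

section

variable {q : ℝ} (hq0 : 0 < q) (hq1 : q < 1)

include hq0 hq1

lemma OnSupp.hInf_ne_zero {e : ℝ} {N : ℕ} (he0 : 0 < e) (he : ∀ k, k < N ↔ 1 < e*q^k) {y : ℝ}
    (hy : OnSupp q e N y) {f : ℂ} (hf : ‖f‖ < 1) (hef : ‖e*f‖ < 1) : hInf f q y ≠ 0 := by
  have hq := norm_lt_one hq0 hq1; rcases hy with ⟨θ, -, rfl⟩ | ⟨k, hk, rfl⟩
  · rw [hInf_eq (exp_ne_zero _) (exp_add_inv θ)]; exact symPoch_ne hq hf (norm_exp_mul_I θ)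
  · have h1 := (he k).1 hk
    have h2 : ((e*q^k:ℝ):ℂ) ≠ 0 := by exact_mod_cast (by positivity : e*q^k ≠ 0)
    rw [hInf_eq h2 mu_add_inv]; refine symPoch_ne_zero hq ?_ ?_
    · have : f*((e*q^k:ℝ):ℂ) = e*f*q^k := by push_cast; ring
      rw [this, norm_mul, norm_pow]
      exact (mul_le_of_le_one_right (norm_nonneg _) (pow_le_one₀ (norm_nonneg _) hq.le)).trans_lt hef
    · rw [norm_mul, norm_inv, norm_real, norm_of_nonneg (by positivity)]
      exact (mul_le_of_le_one_right (norm_nonneg _) (inv_le_one_of_one_le₀ h1.le)).trans_lt hf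

lemma OnSupp.isPos_hInf {e : ℝ} {N : ℕ} (he0 : 0 < e) (he : ∀ k, k < N ↔ 1 < e*q^k) {y : ℝ}
    (hy : OnSupp q e N y) {f : ℝ} (hf : |f| < 1) (hef : |e*f| < 1) : IsPos (hInf f q y) := by
  have hne := hy.hInf_ne_zero hq0 hq1 he0 he (f := f) (by simpa using hf) (by simpa using hef)
  rcases hy with ⟨θ, -, rfl⟩ | ⟨k, hk, rfl⟩
  · rw [← sq_norm_qPochInf_exp hq0 hq1] at hne ⊢
    refine .of_real (lt_of_le_of_ne (by positivity) fun h => hne ?_); rw [← h]; simp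
  · have h1 := (he k).1 hk
    have h2 : ((e*q^k:ℝ):ℂ) ≠ 0 := by exact_mod_cast (by positivity : e*q^k ≠ 0)
    have hk1 : q^k ≤ 1 := pow_le_one₀ hq0.le hq1.le
    rw [hInf_eq h2 mu_add_inv, symPoch, ← Complex.ofReal_inv, ← ofReal_mul, ← ofReal_mul]
    refine (isPos_qPochInf hq0 hq1 ?_).mul (isPos_qPochInf hq0 hq1 ?_)
    · refine (le_abs_self _).trans_lt ?_
      rw [show f*(e*q^k) = e*f*q^k by ring, abs_mul, abs_of_pos (pow_pos hq0 k)]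
      exact (mul_le_of_le_one_right (abs_nonneg _) hk1).trans_lt hef
    · refine (le_abs_self _).trans_lt ?_; rw [abs_mul, abs_of_pos (a := (e*q^k)⁻¹) (by positivity)]
      exact (mul_le_of_le_one_right (abs_nonneg _) (inv_le_one_of_one_le₀ h1.le)).trans_lt hf

/-- The density of an Askey-Wilson measure that has mass points for one parameter only. -/
theorem awMeasure_eq {e : ℝ} {N : ℕ} (he0 : 0 < e) (he : ∀ k, k < N ↔ 1 < e*q^k) {f g h : ℂ}
    (hf : ‖f‖ < 1) (hg : ‖g‖ < 1) (hh : ‖h‖ < 1) (hef : ‖e*f‖ < 1) (heg : ‖e*g‖ < 1)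
    (heh : ‖e*h‖ < 1)
    (hconj : ∀ z, Π(conj f*z;q)*Π(conj g*z;q) * Π(conj h*z;q) = Π(f*z;q)*Π(g*z;q) * Π(h*z;q)) :
    awMeasure e f g h q = (refM q e N).withDensity fun y => ENNReal.ofReal
      (qPochInfs [q, e*f, e*g, e*h, f*g, f*h, g*h] q /
        Π(e*f*g*h;q)/(hInf f q y*hInf g q y*hInf h q y)).re := by
  have hq := norm_lt_one hq0 hq1
  set c := qPochInfs [q, e*f, e*g, e*h, f*g, f*h, g*h] q / Π(e*f*g*h;q) with hcd
  have hm : Measurable fun y => ENNReal.ofReal (c/(hInf f q y*hInf g q y*hInf h q y)).re :=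
    measurable_ofReal.comp (measurable_re.comp (((measurable_hInf hq f).mul
      (measurable_hInf hq g)).mul (measurable_hInf hq h) |>.const_div c))
  have small : ∀ a b c d : ℂ, ‖a‖ < 1 → awAtoms a b c d q = 0 := by
    intro a b c d ha
    have : ∀ k : ℕ, ¬ 1 < ‖a*(q:ℂ)^k‖ := fun k => not_lt.2 <| by
      rw [norm_mul, norm_pow]
      exact mul_le_one₀ ha.le (by positivity) (pow_le_one₀ (norm_nonneg _) hq.le)
    simp only [awAtoms, this, if_false, Measure.sum_zero]
  rw [awMeasure, small f _ _ _ hf, small g _ _ _ hg, small h _ _ _ hh, add_zero, add_zero, add_zero,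
    refM, withDensity_add_measure, withDensity_finsetSum_measure]
  congr 1
  · unfold refCircle
    have h1 := withDensity_mul (volume.restrict (Ioc 0 π))
      (measurable_ofReal.comp (measurable_refDens hq0 hq1 e)) (hm.comp measurable_cos)
    rw [map_withDensity_comp measurable_cos hm]; congr 1; refine Eq.trans ?_ h1
    refine withDensity_congr_ae ?_; refine Eventually.of_forall fun θ => ?_
    have hH : hInf f q (cos θ)*hInf g q (cos θ)*hInf h q (cos θ) =
        ((‖Π(f*exp (θ*I);q)*Π(g*exp (θ*I);q) * Π(h*exp (θ*I);q)‖ ^ 2 : ℝ) : ℂ) := by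
      have hE : conj (exp (θ*I)) = (exp (θ*I))⁻¹ := by rw [← exp_conj, ← exp_neg]; simp
      rw [← Complex.normSq_eq_norm_sq, ← Complex.mul_conj, map_mul, map_mul, conj_qPochInf _ hq,
        conj_qPochInf _ hq, conj_qPochInf _ hq, map_mul, map_mul, map_mul, hE, hconj,
        hInf_eq (exp_ne_zero _) (exp_add_inv θ), hInf_eq (exp_ne_zero _)
        (exp_add_inv θ), hInf_eq (exp_ne_zero _) (exp_add_inv θ), symPoch, symPoch, symPoch]
      ring
    have hw : awWeight e f g h q θ = refDens q e θ *
        (c/(hInf f q (cos θ)*hInf g q (cos θ)*hInf h q (cos θ))).re := by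
      rw [hH, Complex.div_ofReal_re, awWeight, refDens, ← hcd]
      have e1 : exp (2*I*θ) = exp (θ*I)^2 := by rw [← Complex.exp_nat_mul]; congr 1; push_cast; ring
      rw [e1, mul_comm I]
      simp only [qPochInfs_cons, qPochInfs_nil, mul_one, norm_div, norm_mul]
      ring
    simp only [Function.comp, Pi.mul_apply]; rw [hw, ENNReal.ofReal_mul]
    unfold refDens; have := pi_pos; positivity
  · ext s hs; rw [awAtoms, Measure.sum_apply _ hs, Measure.finsetSum_apply]
    rw [tsum_eq_sum (s := range N)]
    · refine sum_congr rfl fun k hk => ?_; have hk1 := (he k).1 (mem_range.1 hk)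
      have hn : (‖(e:ℂ)*q^k‖ : ℝ) = e*q^k := by
        rw [← ofReal_pow, ← ofReal_mul, norm_real, norm_of_nonneg (by positivity)]
      have hz : ((e*q^k:ℝ):ℂ) ≠ 0 := by exact_mod_cast (by positivity : e*q^k ≠ 0)
      have hp := isPos_refMass hq0 hq1 he0 hk1
      rw [if_pos (by rw [hn]; exact hk1), withDensity_smul_measure, dirac_withDensity, smul_smul,
        ← ENNReal.ofReal_mul hp.re_pos.le, awMass_eq hq0 hq1 (by rw [hn]; exact hk1) hef heg heh,
        ← hcd, hInf_eq hz mu_add_inv, hInf_eq hz mu_add_inv, hInf_eq hz mu_add_inv]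
      congr 4
      · rw [← re_ofReal_mul, hp.coe_re, refMass]; push_cast; ring_nf
      · rw [mu, ← ofReal_re ((e*q^k+(e*q^k)⁻¹)/2)]; push_cast; rfl
    · intro k hk
      have h1 : ¬ 1 < ‖(e:ℂ)*q^k‖ := by
        rw [← ofReal_pow, ← ofReal_mul, norm_real, norm_of_nonneg (by positivity), ← he k]
        simpa using hk
      rw [if_neg h1]; rfl

end

lemma awAtoms_congr {a b c d b' c' d' q : ℂ} (h : ∀ k, awMass a b c d q k = awMass a b' c' d' q k) :
    awAtoms a b c d q = awAtoms a b' c' d' q := by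
  simp only [awAtoms, h]

lemma awMass_swap₁ (a b c d q:ℂ) (k:ℕ) : awMass a b c d q k = awMass a c b d q k := by
  simp only [awMass, qPochInfs_cons, qPochInfs_nil, qPochs_cons, qPochs_nil, mul_comm c b, mul_right_comm a c b]
  congr 2
  · congr 1; ring
  · congr 1
    · ring
    · congr 1; exact prod_congr rfl fun j _ => by ring

lemma awMass_swap₂ (a b c d q:ℂ) (k:ℕ) : awMass a b c d q k = awMass a b d c q k := by
  simp only [awMass, qPochInfs_cons, qPochInfs_nil, qPochs_cons, qPochs_nil, mul_comm d c, mul_right_comm (a*b) d c]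
  congr 2
  · congr 1; ring
  · congr 1
    · ring
    · congr 1; exact prod_congr rfl fun j _ => by ring

lemma awMeasure_swap₁ (a b c d q:ℂ) : awMeasure a b c d q = awMeasure b a c d q := by
  have hw : awWeight a b c d q = awWeight b a c d q := by
    funext θ; simp only [awWeight, qPochInfs_cons, qPochInfs_nil, mul_comm b a]; ring_nf
  rw [awMeasure, awMeasure, hw, awAtoms_congr (a := c) (b := a) (b' := b) (c' := a) (d' := d)
    fun k => awMass_swap₁ _ _ _ _ _ _, awAtoms_congr (a := d) (b := a) (b' := b) (c' := a) (d' := c)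
    fun k => awMass_swap₁ _ _ _ _ _ _]
  abel

lemma awMeasure_swap₂ (a b c d q:ℂ) : awMeasure a b c d q = awMeasure a c b d q := by
  have hw : awWeight a b c d q = awWeight a c b d q := by
    funext θ
    simp only [awWeight, qPochInfs_cons, qPochInfs_nil, mul_comm c b, mul_right_comm a c b]; ring_nf
  rw [awMeasure, awMeasure, hw, awAtoms_congr (a := a) (b := b) (b' := c) (c' := b) (d' := d)
    fun k => awMass_swap₁ _ _ _ _ _ _, awAtoms_congr (a := d) (b := a) (b' := a) (c' := c) (d' := b)
    fun k => awMass_swap₂ _ _ _ _ _ _]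
  abel

lemma awMeasure_swap₃ (a b c d q:ℂ) : awMeasure a b c d q = awMeasure a b d c q := by
  have hw : awWeight a b c d q = awWeight a b d c q := by
    funext θ
    simp only [awWeight, qPochInfs_cons, qPochInfs_nil, mul_comm d c, mul_right_comm (a*b) d c]
    ring_nf
  rw [awMeasure, awMeasure, hw, awAtoms_congr (a := a) (b := b) (b' := b) (c' := d) (d' := c)
    fun k => awMass_swap₂ _ _ _ _ _ _, awAtoms_congr (a := b) (b := a) (b' := a) (c' := d) (d' := c)
    fun k => awMass_swap₂ _ _ _ _ _ _]
  abel

/-! ### The geometric mean of two measures with densities -/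

lemma geomMean_withDensity {Λ : Measure ℝ} [SigmaFinite Λ] {f g : ℝ → ℝ} (hf : Measurable f)
    (hg : Measurable g) (hf0 : ∀ᵐ y ∂Λ, 0 ≤ f y) (hg0 : ∀ᵐ y ∂Λ, 0 ≤ g y) :
    geomMean (Λ.withDensity fun y => ENNReal.ofReal (f y))
      (Λ.withDensity fun y => ENNReal.ofReal (g y)) =
      Λ.withDensity fun y => ENNReal.ofReal (√(f y*g y)) := by
  set F : ℝ → ENNReal := fun y => ENNReal.ofReal (f y) with hF
  set G : ℝ → ENNReal := fun y => ENNReal.ofReal (g y) with hG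
  have mF : Measurable F := hf.ennreal_ofReal; have mG : Measurable G := hg.ennreal_ofReal
  have hsum : Λ.withDensity F+Λ.withDensity G = Λ.withDensity (F+G) :=
    (withDensity_add_left mF G).symm
  have hfin : ∀ y, (F+G) y ≠ ⊤ := fun y =>
    ENNReal.add_ne_top.2 ⟨ENNReal.ofReal_ne_top, ENNReal.ofReal_ne_top⟩
  have : SigmaFinite (Λ.withDensity (F+G)) :=
    SigmaFinite.withDensity_of_ne_top (Eventually.of_forall hfin)
  have key : ∀ H : ℝ → ENNReal, Measurable H → (∀ y, H y ≤ (F+G) y) →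
      (Λ.withDensity H).rnDeriv (Λ.withDensity (F+G)) =ᵐ[Λ.withDensity (F+G)]
        fun y => H y/(F+G) y := by
    intro H mH hH
    have h1 : Λ.withDensity H = (Λ.withDensity (F+G)).withDensity fun y => H y/(F+G) y := by
      refine Eq.trans ?_ (withDensity_mul _ (mF.add mG) (mH.div (mF.add mG))); congr 1; funext y
      rw [Pi.mul_apply, ENNReal.mul_div_cancel' (fun h => le_antisymm (h ▸ hH y) (zero_le))
        fun h => absurd h (hfin y)]
    rw [h1]; exact Measure.rnDeriv_withDensity _ (mH.div (mF.add mG))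
  rw [geomMean, hsum]
  have h2 : (Λ.withDensity (F+G)).withDensity (fun y =>
      ((Λ.withDensity F).rnDeriv (Λ.withDensity (F+G)) y *
        (Λ.withDensity G).rnDeriv (Λ.withDensity (F+G)) y)^(1/2:ℝ)) =
      (Λ.withDensity (F+G)).withDensity fun y => (F y/(F+G) y*(G y/(F+G) y))^(1/2:ℝ) := by
    refine withDensity_congr_ae ?_
    filter_upwards [key F mF fun y => by
        rw [Pi.add_apply]; exact le_self_add, key G mG fun y => by
        rw [Pi.add_apply]; exact le_add_self] with y h3 h4
    rw [h3, h4]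
  refine h2.trans ((withDensity_mul _ (mF.add mG)
    (((mF.div (mF.add mG)).mul (mG.div (mF.add mG))).pow_const _)).symm.trans ?_)
  refine withDensity_congr_ae ?_; filter_upwards [hf0, hg0] with y h3 h4
  simp only [Pi.mul_apply, Pi.add_apply, Pi.div_apply]; simp only [hF, hG]
  rw [← ENNReal.ofReal_add h3 h4]; rcases (add_nonneg h3 h4).eq_or_lt with h5 | h5
  · have h6 : f y = 0 := by linarith
    rw [← h5, h6]; simp
  · rw [← ENNReal.ofReal_div_of_pos h5, ← ENNReal.ofReal_div_of_pos h5, ← ENNReal.ofReal_mul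
      (by positivity), ENNReal.ofReal_rpow_of_nonneg (by positivity) (by norm_num),
      ← ENNReal.ofReal_mul h5.le, ← Real.sqrt_eq_rpow, div_mul_div_comm,
      Real.sqrt_div' _ (by positivity), Real.sqrt_mul_self h5.le, mul_div_cancel₀ _ h5.ne']

/-- Integration with respect to the geometric mean of two measures with densities. -/
lemma integral_geomMean {Λ m M : Measure ℝ} [SigmaFinite Λ] {f g : ℝ → ℝ} (hf : Measurable f)
    (hg : Measurable g) (hf0 : ∀ᵐ y ∂Λ, 0 ≤ f y) (hg0 : ∀ᵐ y ∂Λ, 0 ≤ g y)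
    (hm : m = Λ.withDensity fun y => ENNReal.ofReal (f y))
    (hM : M = Λ.withDensity fun y => ENNReal.ofReal (g y)) {Φ Ψ : ℝ → ℂ}
    (h : ∀ᵐ y ∂Λ, (√(f y*g y) : ℂ)*Φ y = Ψ y) (hΨ : Integrable Ψ Λ) :
    Integrable Φ (geomMean m M) ∧ ∫ y, Φ y ∂geomMean m M = ∫ y, Ψ y ∂Λ := by
  have hmeas : Measurable fun y => ENNReal.ofReal (√(f y*g y)) := (hf.mul hg).sqrt.ennreal_ofReal
  have h1 : ∀ᵐ y ∂Λ, (ENNReal.ofReal (√(f y*g y))).toReal • Φ y = Ψ y := by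
    filter_upwards [h] with y hy; rw [toReal_ofReal (Real.sqrt_nonneg _), real_smul, hy]
  rw [hm, hM, geomMean_withDensity hf hg hf0 hg0]; constructor
  · rw [integrable_withDensity_iff_integrable_smul' hmeas (by simp)]
    exact hΨ.congr (h1.mono fun y hy => hy.symm)
  · rw [integral_withDensity_eq_integral_toReal_smul hmeas (by simp)]; exact integral_congr_ae h1

/-! ### Changing the parameter of the reference measure -/

section

variable {q : ℝ} (hq0 : 0 < q) (hq1 : q < 1)

omit hq0 hq1 in
lemma ofReal_hFin (e q:ℝ) (k:ℕ) (y:ℝ) : hFin e q k y =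
    ((∏ j ∈ range k, (1-2*e*y*q^j+e^2*q^(2*j)) : ℝ) : ℂ) := by
  rw [hFin]; push_cast; rfl

include hq0 hq1

lemma OnSupp.hFin_nonneg {e : ℝ} {N : ℕ} (he0 : 0 < e) (he : ∀ k, k < N ↔ 1 < e*q^k) {y : ℝ}
    (hy : OnSupp q e N y) (D:ℕ) : ∃ t : ℝ, 0 ≤ t ∧ hFin e q D y = t := by
  rcases hy with ⟨θ, -, rfl⟩ | ⟨k, hk, rfl⟩
  · refine ⟨_, ?_, ofReal_hFin e q D _⟩; refine Finset.prod_nonneg fun j _ => ?_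
    have := Real.sin_sq_add_cos_sq θ
    have h2 : 1-2*e*cos θ*q^j+e^2*q^(2*j) = (1-e*q^j*cos θ)^2+(e*q^j*Real.sin θ)^2 := by
      rw [pow_mul']; linear_combination (-(e*q^j)^2)*this
    rw [h2]; positivity
  · have h1 := (he k).1 hk
    have hz : ((e*q^k:ℝ):ℂ) ≠ 0 := by exact_mod_cast (by positivity : e*q^k ≠ 0)
    have hqk := pow_pos hq0 k
    have h2 : hFin e q D (mu (e*q^k)) = ((∏ j ∈ range D, (e^2*q^(k+j)-1)*(q^j/q^k-1) : ℝ) : ℂ) := by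
      rw [hFin_eq_qPoch hz mu_add_inv, qPoch, qPoch, ← prod_mul_distrib]; push_cast
      refine prod_congr rfl fun j _ => ?_; have : (e:ℂ) ≠ 0 := by exact_mod_cast he0.ne'
      have : (q:ℂ) ≠ 0 := by exact_mod_cast hq0.ne'
      field_simp; ring
    refine ⟨_, ?_, h2⟩; rcases lt_or_ge k D with h3 | h3
    · rw [Finset.prod_eq_zero (mem_range.2 h3)]; rw [div_self hqk.ne']; ring
    · refine Finset.prod_nonneg fun j hj => ?_; rw [mem_range] at hj
      have h4 : q^k ≤ q^j := pow_le_pow_of_le_one hq0.le hq1.le (by omega)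
      refine mul_nonneg ?_ (sub_nonneg.2 ((one_le_div hqk).2 h4))
      have : 1 < (e*q^k)^2 := one_lt_pow₀ h1 two_ne_zero; rw [pow_add]
      nlinarith [mul_le_mul_of_nonneg_left h4 (by positivity : 0 ≤ e^2*q^k)]

lemma refM_mul_pow {e : ℝ} {N : ℕ} (he0 : 0 < e) (he : ∀ k, k < N ↔ 1 < e*q^k) (j:ℕ) :
    refM q (e*q^j) (N-j) = (refM q e N).withDensity fun y => ENNReal.ofReal (hFin e q j y).re := by
  have hm : ∀ (e:ℝ) (j:ℕ), Measurable fun y => ENNReal.ofReal (hFin e q j y).re := fun e j =>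
    measurable_ofReal.comp (measurable_re.comp (continuous_hFin e q j).measurable)
  induction j with
  | zero => simp
  | succ j ih =>
    have he' : ∀ k, k < N-j ↔ 1 < e*q^j*q^k := fun k => by
      rw [mul_assoc, ← pow_add, ← he, Nat.lt_sub_iff_add_lt, add_comm]
    have h1 : refM q (e*q^j*q) (N-j-1) = (refM q (e*q^j) (N-j)).withDensity
        fun y => ENNReal.ofReal (hFin (e*q^j:ℝ) q 1 y).re := by
      cases hN : N-j with
      | zero => simp [refM, refCircle_shift hq0 hq1]
      | succ M => rw [hN] at he'; exact refM_shift hq0 hq1 (by positivity) he'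
    rw [pow_succ, ← mul_assoc, Nat.sub_add_eq, h1, ih, ← withDensity_mul _ (hm _ _) (hm _ _)]
    refine withDensity_congr_ae ?_; filter_upwards [ae_refM e N] with y hy
    obtain ⟨t, ht, hty⟩ := OnSupp.hFin_nonneg hq0 hq1 he0 he hy j
    rw [Pi.mul_apply, hty, ofReal_re, ← ENNReal.ofReal_mul ht, hFin_add, hty, re_ofReal_mul]
    push_cast; rfl

lemma refM_withDensity_hInf {e : ℝ} {N : ℕ} (he0 : 0 < e) :
    (refM q e N).withDensity (fun y => ENNReal.ofReal (hInf e q y).re) = refCircle q 0 := by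
  have hq := norm_lt_one hq0 hq1
  have hm : Measurable fun y => ENNReal.ofReal (hInf e q y).re :=
    measurable_ofReal.comp (measurable_re.comp (measurable_hInf hq e))
  rw [refM, withDensity_add_measure, withDensity_finsetSum_measure, sum_eq_zero, add_zero]
  · unfold refCircle; rw [map_withDensity_comp measurable_cos hm]; congr 1
    have h1 := withDensity_mul (volume.restrict (Ioc 0 π))
      (measurable_ofReal.comp (measurable_refDens hq0 hq1 e)) (hm.comp measurable_cos)
    refine h1.symm.trans (withDensity_congr_ae ?_); filter_upwards [ae_mem_Ioo] with θ hθ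
    have h2 := norm_ne_zero_iff.2 (qPochInf_exp_ne_zero hq0 hq1 e hθ.1 hθ.2); have hpi := pi_pos
    simp only [Function.comp, Pi.mul_apply]
    rw [← sq_norm_qPochInf_exp hq0 hq1, ofReal_re, ← ENNReal.ofReal_mul
      (by unfold refDens; positivity)]
    congr 1; simp only [refDens, norm_div, ofReal_zero, zero_mul, qPochInf_zero_left, norm_one]
    generalize ‖qPochInf (↑e*exp (↑θ*I)) ↑q‖ = t at h2 ⊢; field_simp
  · intro k _; have hz : ((e*q^k:ℝ):ℂ) ≠ 0 := by exact_mod_cast (by positivity : e*q^k ≠ 0)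
    have h0 : hInf e q (mu (e*q^k)) = 0 := by
      rw [hInf_eq hz mu_add_inv, symPoch, qPochInf_eq_zero hq (a := e*((e*q^k:ℝ):ℂ)⁻¹) (j := k),
        mul_zero]
      have : (e:ℂ) ≠ 0 := by exact_mod_cast he0.ne'
      have : (q:ℂ) ≠ 0 := by exact_mod_cast hq0.ne'
      push_cast; field_simp
    rw [withDensity_smul_measure, dirac_withDensity, h0]; simp

end

/-! ### Densities with respect to a common reference measure -/

/-- The normalising constant of the Askey-Wilson measure. -/
def awConst (q a b c d:ℂ) : ℂ := qPochInfs [q, a*b, a*c, a*d, b*c, b*d, c*d] q/Π(a*b*c*d;q)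

lemma awConst_swap₁ (q a b c d:ℂ) : awConst q a b c d = awConst q b a c d := by
  simp only [awConst, qPochInfs_cons, qPochInfs_nil, mul_comm b a]; ring

lemma awConst_swap₂ (q a b c d:ℂ) : awConst q a b c d = awConst q a c b d := by
  simp only [awConst, qPochInfs_cons, qPochInfs_nil, mul_comm c b, mul_right_comm a c b]; ring

lemma awConst_swap₃ (q a b c d:ℂ) : awConst q a b c d = awConst q a b d c := by
  simp only [awConst, qPochInfs_cons, qPochInfs_nil, mul_comm d c, mul_right_comm (a*b) d c]; ring

/-- The Askey-Wilson measure with parameters `a, b, c, d` has, up to its normalising constant, the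
density `φ` with respect to `Λ`. -/
structure AWDensity (q:ℂ) (Λ : Measure ℝ) (φ : ℝ → ℂ) (a b c d:ℂ) : Prop where
  measurable : Measurable φ
  nonneg : ∀ᵐ y ∂Λ, ∃ t : ℝ, 0 ≤ t ∧ φ y = t
  eq : awMeasure a b c d q =
    Λ.withDensity fun y => ENNReal.ofReal (awConst q a b c d*φ y).re

namespace AWDensity

variable {q : ℂ} {Λ : Measure ℝ} {φ : ℝ → ℂ} {a b c d : ℂ}

lemma swap₁ (H : AWDensity q Λ φ a b c d) : AWDensity q Λ φ b a c d :=
  ⟨H.measurable, H.nonneg, by rw [← awMeasure_swap₁, ← awConst_swap₁, H.eq]⟩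

lemma swap₂ (H : AWDensity q Λ φ a b c d) : AWDensity q Λ φ a c b d :=
  ⟨H.measurable, H.nonneg, by rw [← awMeasure_swap₂, ← awConst_swap₂, H.eq]⟩

lemma swap₃ (H : AWDensity q Λ φ a b c d) : AWDensity q Λ φ a b d c :=
  ⟨H.measurable, H.nonneg, by rw [← awMeasure_swap₃, ← awConst_swap₃, H.eq]⟩

lemma congr {φ' : ℝ → ℂ} (H : AWDensity q Λ φ a b c d) (hm : Measurable φ')
    (h : ∀ᵐ y ∂Λ, φ y = φ' y) : AWDensity q Λ φ' a b c d := by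
  refine ⟨hm, ?_, ?_⟩
  · filter_upwards [H.nonneg, h] with y h1 h2; rwa [← h2]
  · rw [H.eq]; refine withDensity_congr_ae ?_; filter_upwards [h] with y h1; rw [h1]

end AWDensity

lemma AWMoments.congr {q : ℂ} {μ : Measure ℝ} {D D' : ℝ → ℂ} {e f g h : ℂ}
    (H : AWMoments q μ D e f g h) (hD : ∀ᵐ y ∂μ, D y = D' y) : AWMoments q μ D' e f g h := by
  refine ⟨H.integrable.congr hD, H.bound, fun k i n j => ?_⟩; rw [← H.moment]
  refine integral_congr_ae ?_; filter_upwards [hD] with y hy; rw [hy]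

section Transfer

variable {q : ℂ} {μ μ' : Measure ℝ} {w w' G : ℝ → ℂ} (hw : Measurable w) (hw' : Measurable w')
  (hw0 : ∀ᵐ y ∂μ, ∃ t : ℝ, 0 ≤ t ∧ w y = t) (hw0' : ∀ᵐ y ∂μ', ∃ t : ℝ, 0 ≤ t ∧ w' y = t)
  (h : μ.withDensity (fun y => ENNReal.ofReal (w y).re) =
    μ'.withDensity fun y => ENNReal.ofReal (w' y).re) (hG : Measurable G)

include hw hw0

omit hw' hw0' h hG hw0 in
lemma measurable_ofReal_re : Measurable fun y => ENNReal.ofReal (w y).re :=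
  measurable_ofReal.comp (measurable_re.comp hw)

include hG in
lemma withDensity_ofReal_re_mul (K:ℂ) : (μ.withDensity fun y => ENNReal.ofReal (K*(w y*G y)).re) =
      (μ.withDensity fun y => ENNReal.ofReal (w y).re).withDensity
        fun y => ENNReal.ofReal (K*G y).re := by
  refine Eq.trans ?_ (withDensity_mul _ (measurable_ofReal_re hw)
    (measurable_ofReal_re (hG.const_mul K)))
  refine withDensity_congr_ae ?_; filter_upwards [hw0] with y hy; obtain ⟨t, ht, hty⟩ := hy
  rw [Pi.mul_apply, hty, ofReal_re, ← ENNReal.ofReal_mul ht, ← re_ofReal_mul]; congr 2; ring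

lemma integral_withDensity_ofReal_re (F : ℝ → ℂ) :
    ∫ y, F y ∂(μ.withDensity fun y => ENNReal.ofReal (w y).re) = ∫ y, w y*F y ∂μ := by
  rw [integral_withDensity_eq_integral_toReal_smul (measurable_ofReal_re hw) (by simp)]
  refine integral_congr_ae ?_; filter_upwards [hw0] with y hy; obtain ⟨t, ht, hty⟩ := hy
  rw [hty, ofReal_re, toReal_ofReal ht, real_smul]

lemma integrable_withDensity_ofReal_re (F : ℝ → ℂ) :
    Integrable F (μ.withDensity fun y => ENNReal.ofReal (w y).re) ↔
      Integrable (fun y => w y*F y) μ := by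
  rw [integrable_withDensity_iff_integrable_smul' (measurable_ofReal_re hw) (by simp)]
  refine integrable_congr ?_; filter_upwards [hw0] with y hy; obtain ⟨t, ht, hty⟩ := hy
  rw [hty, ofReal_re, toReal_ofReal ht, real_smul]

include hw' hw0' h

/-- The moments are not affected if the measure and the weight change in such a way that the
weighted measure stays the same. -/
lemma AWMoments.transfer {e f g z : ℂ} (H : AWMoments q μ (fun y => w y*G y) e f g z)
    (hb : ∃ R, SuppBound μ' R) : AWMoments q μ' (fun y => w' y*G y) e f g z := by
  refine ⟨?_, hb, fun k i n j => ?_⟩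
  · rw [← integrable_withDensity_ofReal_re hw' hw0', ← h, integrable_withDensity_ofReal_re hw hw0]
    exact H.integrable
  · have key := integral_withDensity_ofReal_re hw hw0 fun y =>
      hFin e q k y*hFin f q i y*hFin g q n y*hFin z q j y*G y
    rw [h, integral_withDensity_ofReal_re hw' hw0'] at key; rw [← H.moment]
    refine Eq.trans (integral_congr_ae (Eventually.of_forall fun y => ?_)) (key.trans
      (integral_congr_ae (Eventually.of_forall fun y => ?_)))
    · ring
    · ring

include hG

lemma AWDensity.transfer {a b c d : ℂ} (H : AWDensity q μ (fun y => w y*G y) a b c d)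
    (hn : ∀ᵐ y ∂μ', ∃ t : ℝ, 0 ≤ t ∧ w' y*G y = t) :
    AWDensity q μ' (fun y => w' y*G y) a b c d := by
  refine ⟨hw'.mul hG, hn, ?_⟩
  rw [H.eq, withDensity_ofReal_re_mul hw hw0 hG, withDensity_ofReal_re_mul hw' hw0' hG, h]

end Transfer

section

variable {q : ℝ} (hq0 : 0 < q) (hq1 : q < 1) {e : ℝ} {N : ℕ} (he0 : 0 < e)
  (he : ∀ k, k < N ↔ 1 < e*q^k)

include hq0 hq1 he0 he

omit he in
lemma OnSupp.hInf_nonneg {y : ℝ} (hy : OnSupp q e N y) : ∃ t : ℝ, 0 ≤ t ∧ hInf e q y = t := by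
  have hq := norm_lt_one hq0 hq1; rcases hy with ⟨θ, -, rfl⟩ | ⟨k, hk, rfl⟩
  · exact ⟨_, by positivity, (sq_norm_qPochInf_exp hq0 hq1 e θ).symm⟩
  · refine ⟨0, le_rfl, ?_⟩
    have hz : ((e*q^k:ℝ):ℂ) ≠ 0 := by exact_mod_cast (by positivity : e*q^k ≠ 0)
    rw [hInf_eq hz mu_add_inv, symPoch, qPochInf_eq_zero hq (a := e*((e*q^k:ℝ):ℂ)⁻¹) (j := k),
      mul_zero, ofReal_zero]
    have : (e:ℂ) ≠ 0 := by exact_mod_cast he0.ne'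
    have : (q:ℂ) ≠ 0 := by exact_mod_cast hq0.ne'
    push_cast; field_simp

lemma awDensity_refM {f g h : ℂ}
    (hf : ‖f‖ < 1) (hg : ‖g‖ < 1) (hh : ‖h‖ < 1) (hef : ‖e*f‖ < 1) (heg : ‖e*g‖ < 1)
    (heh : ‖e*h‖ < 1)
    (hconj : ∀ z, Π(conj f*z;q)*Π(conj g*z;q) * Π(conj h*z;q) = Π(f*z;q)*Π(g*z;q) * Π(h*z;q))
    (hpos : ∀ y, OnSupp q e N y → IsPos (hInf f q y*hInf g q y*hInf h q y)) (j:ℕ) :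
    AWDensity q (refM q e N) (fun y => hFin e q j y*(1/(hInf f q y*hInf g q y*hInf h q y)))
      ((e*q^j:ℝ):ℂ) f g h := by
  have hq := norm_lt_one hq0 hq1
  have hmG : Measurable fun y => 1/(hInf f q y*hInf g q y*hInf h q y) :=
    ((measurable_hInf hq f).mul (measurable_hInf hq g)).mul (measurable_hInf hq h) |>.const_div 1
  have hm := (continuous_hFin e q j).measurable
  have hn : ∀ᵐ y ∂refM q e N, ∃ t : ℝ, 0 ≤ t ∧ hFin e q j y = t := by
    filter_upwards [ae_refM e N] with y hy; exact OnSupp.hFin_nonneg hq0 hq1 he0 he hy j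
  refine ⟨hm.mul hmG, ?_, ?_⟩
  · filter_upwards [hn, ae_refM e N] with y h1 h2; obtain ⟨t, ht, hty⟩ := h1
    obtain ⟨v, hv, hvy⟩ := hpos y h2; refine ⟨t*(1/v), by positivity, ?_⟩
    rw [hty, hvy]; push_cast; rfl
  · have he' : ∀ k, k < N-j ↔ 1 < e*q^j*q^k := fun k => by
      rw [mul_assoc, ← pow_add, ← he, Nat.lt_sub_iff_add_lt, add_comm]
    have lt : ∀ {z : ℂ}, ‖e*z‖ < 1 → ‖((e*q^j:ℝ):ℂ)*z‖ < 1 := fun {z} hz => by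
      have : ((e*q^j:ℝ):ℂ)*z = e*z*q^j := by push_cast; ring
      rw [this, norm_mul, norm_pow]
      exact (mul_le_of_le_one_right (norm_nonneg _) (pow_le_one₀ (norm_nonneg _) hq.le)).trans_lt hz
    rw [awMeasure_eq hq0 hq1 (by positivity) he' hf hg hh (lt hef) (lt heg) (lt heh) hconj,
      refM_mul_pow hq0 hq1 he0 he, withDensity_ofReal_re_mul hm hn hmG]
    simp only [mul_one_div, awConst]

lemma awDensity_refM_real {f g h : ℝ}
    (hf : |f| < 1) (hg : |g| < 1) (hh : |h| < 1) (hef : |e*f| < 1) (heg : |e*g| < 1)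
    (heh : |e*h| < 1) (j:ℕ) : AWDensity q (refM q e N)
      (fun y => hFin e q j y*(1/(hInf f q y*hInf g q y*hInf h q y)))
      ((e*q^j:ℝ):ℂ) f g h := by
  have c : ∀ {t : ℝ}, |t| < 1 → ‖(t:ℂ)‖ < 1 := fun ht => by simpa using ht
  have c' : ∀ {t : ℝ}, |e*t| < 1 → ‖(e:ℂ)*(t:ℂ)‖ < 1 := fun ht => by rw [← ofReal_mul]; exact c ht
  refine awDensity_refM hq0 hq1 he0 he (c hf) (c hg) (c hh) (c' hef) (c' heg) (c' heh)
    (fun z => by simp only [conj_ofReal]) (fun y hy => ?_) j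
  exact ((hy.isPos_hInf hq0 hq1 he0 he hf hef).mul (hy.isPos_hInf hq0 hq1 he0 he hg heg)).mul
    (hy.isPos_hInf hq0 hq1 he0 he hh heh)

lemma awMoments_refM_real {f g h : ℝ}
    (hf : |f| < 1) (hg : |g| < 1) (hh : |h| < 1) (hef : |e*f| < 1) (heg : |e*g| < 1)
    (heh : |e*h| < 1) : AWMoments q (refM q e N)
      (fun y => 1/(hInf f q y*hInf g q y*hInf h q y)) e f g h := by
  have c : ∀ {t : ℝ}, |t| < 1 → ‖(t:ℂ)‖ < 1 := fun ht => by simpa using ht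
  have c' : ∀ {t : ℝ}, |e*t| < 1 → ‖(e:ℂ)*(t:ℂ)‖ < 1 := fun ht => by rw [← ofReal_mul]; exact c ht
  have := awMoments_refM hq0 hq1 he0 he (c hf) (c hg) (c hh) (c' hef) (c' heg) (c' heh)
  simpa only [div_div, mul_assoc] using this

end

/-! ### The measures of the Clebsch-Gordan integral -/

section

variable {q : ℝ} (hq0 : 0 < q) (hq1 : q < 1) {C c b e o : ℝ} {N : ℕ}
  (hC0 : 0 < C) (hC1 : C < 1) (hc0 : 0 < c) (hb0 : 0 < b) (hCc : C*c = q) (hCb : C*b < 1)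
  (hcb : c*b < 1) (heo : (e = b ∧ o = c) ∨ (e = c ∧ o = b)) (ho : o < 1)
  (he : ∀ k, k < N ↔ 1 < e*q^k)

lemma awDensity_real_zero {e : ℝ} {N : ℕ} (hq0 : 0 < q) (hq1 : q < 1) (he0 : 0 < e)
    (he : ∀ k, k < N ↔ 1 < e*q^k) {f g h : ℝ}
    (hf : |f| < 1) (hg : |g| < 1) (hh : |h| < 1) (hef : |e*f| < 1) (heg : |e*g| < 1)
    (heh : |e*h| < 1) : AWDensity q (refM q e N)
      (fun y => 1/(hInf f q y*hInf g q y*hInf h q y)) e f g h := by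
  simpa using awDensity_refM_real hq0 hq1 he0 he hf hg hh hef heg heh 0

lemma abs_mul_pow_lt_one (hq0 : 0 < q) (hq1 : q < 1) {x : ℝ} (hx : |x| < 1) (d:ℕ) :
    |x*q^d| < 1 := by
  rw [abs_mul, abs_of_pos (pow_pos hq0 d)]
  exact (mul_le_of_le_one_right (abs_nonneg _) (pow_le_one₀ hq0.le hq1.le)).trans_lt hx

lemma abs_lt_one {x : ℝ} (h0 : 0 < x) (h1 : x < 1) : |x| < 1 := by rwa [abs_of_pos h0]

lemma measurable_one_div_hInf₂ (hq0 : 0 < q) (hq1 : q < 1) (f g:ℂ) :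
    Measurable fun y => 1/(hInf f q y*hInf g q y) :=
  have hq := norm_lt_one hq0 hq1
  ((measurable_hInf hq f).mul (measurable_hInf hq g)).const_div 1

lemma measurable_one_div_hInf₃ (hq0 : 0 < q) (hq1 : q < 1) (f g h:ℂ) :
    Measurable fun y => 1/(hInf f q y*hInf g q y*hInf h q y) :=
  have hq := norm_lt_one hq0 hq1
  (((measurable_hInf hq f).mul (measurable_hInf hq g)).mul (measurable_hInf hq h)).const_div 1

include hq0 hq1 hC0 hC1 hc0 hb0 hCc hCb hcb heo ho he

omit hC0 hC1 hCb hCc hcb in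
/-- Splitting off finitely many factors of `(c z, c / z; q)_∞` when `c` is the small one of the two
parameters. -/
lemma one_div_hInf_mul_pow (hec : o = c) (hecb : |e*c| < 1) (j:ℕ) {y : ℝ}
    (hy : OnSupp q e N y) (x:ℂ) :
    1/(x*hInf ((c*q^j:ℝ):ℂ) q y) = hFin c q j y*(1/(x*hInf c q y)) := by
  have hq := norm_lt_one hq0 hq1
  have he0 : 0 < e := by rcases heo with ⟨rfl, -⟩ | ⟨rfl, -⟩ <;> assumption
  have h1 : hInf c q y ≠ 0 := hy.hInf_ne_zero hq0 hq1 he0 he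
    (by rw [norm_real]; exact abs_lt_one hc0 (hec ▸ ho))
    (by rw [← ofReal_mul, norm_real]; exact hecb)
  have h3 := hInf_split hq (c:ℂ) j y; have h2 : hFin c q j y ≠ 0 := left_ne_zero_of_mul (h3 ▸ h1)
  rw [h3, ofReal_mul, ofReal_pow, one_div, one_div, mul_inv, mul_inv, mul_inv]; field_simp

lemma awDensity_cdh_of_le (d:ℕ) : AWDensity q (refM q e N)
    (fun y => 1/(hInf ((C*q^d:ℝ):ℂ) q y*hInf o q y)) ((C*q^d:ℝ):ℂ) b c 0 := by
  have h1 := abs_mul_pow_lt_one hq0 hq1 (abs_lt_one hC0 hC1) d; rw [← ofReal_zero]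
  rcases heo with ⟨rfl, rfl⟩ | ⟨rfl, rfl⟩
  · have := awDensity_real_zero hq0 hq1 hb0 he (f := C*q^d) (g := o) (h := 0) h1
      (abs_lt_one hc0 ho) (by simp)
      (by rw [← mul_assoc, mul_comm e]
          exact abs_mul_pow_lt_one hq0 hq1 (abs_lt_one (by positivity) hCb) d)
      (by rw [mul_comm]; exact abs_lt_one (by positivity) hcb) (by simp)
    simpa using this.swap₁
  · have := awDensity_real_zero hq0 hq1 hc0 he (f := C*q^d) (g := o) (h := 0) h1
      (abs_lt_one hb0 ho) (by simp)
      (by rw [← mul_assoc, mul_comm e, hCc]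
          exact abs_mul_pow_lt_one hq0 hq1 (abs_lt_one hq0 hq1) d)
      (abs_lt_one (by positivity) hcb) (by simp)
    simpa using this.swap₁.swap₂

lemma awDensity_cdh_of_ge (D:ℕ) : AWDensity q (refM q e N)
    (fun y => hFin c q D y*(1/(hInf C q y*hInf o q y))) ((c*q^D:ℝ):ℂ) b C 0 := by
  have heo' := heo; have hq := norm_lt_one hq0 hq1; rw [← ofReal_zero]
  have hC := abs_lt_one hC0 hC1; rcases heo' with ⟨rfl, rfl⟩ | ⟨rfl, rfl⟩
  · have hcb' : |e*o| < 1 := by rw [mul_comm]; exact abs_lt_one (by positivity) hcb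
    have := awDensity_real_zero hq0 hq1 hb0 he (f := o*q^D) (g := C) (h := 0)
      (abs_mul_pow_lt_one hq0 hq1 (abs_lt_one hc0 ho) D) hC (by simp)
      (by rw [← mul_assoc]; exact abs_mul_pow_lt_one hq0 hq1 hcb' D)
      (by rw [mul_comm]; exact abs_lt_one (by positivity) hCb) (by simp)
    refine this.swap₁.congr ((continuous_hFin _ _ _).measurable.mul
      (measurable_one_div_hInf₂ hq0 hq1 _ _)) ?_
    filter_upwards [ae_refM e N] with y hy
    rw [← one_div_hInf_mul_pow hq0 hq1 hc0 hb0 heo ho he rfl hcb' D hy]; simp [mul_comm]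
  · have := awDensity_refM_real hq0 hq1 hc0 he (f := o) (g := C) (h := 0)
      (abs_lt_one hb0 ho) hC (by simp)
      (abs_lt_one (by positivity) hcb)
      (by rw [mul_comm, hCc]; exact abs_lt_one hq0 hq1) (by simp) D
    simpa [mul_comm] using this

omit hq1 hC0 hC1 hc0 hb0 hCc hCb hcb heo ho he in
lemma hFin_mu_eq_zero (hc : c ≠ 0) {k j : ℕ} (hkj : k < j) : hFin c q j (mu (c*q^k)) = 0 := by
  have hz : ((c*q^k:ℝ):ℂ) ≠ 0 := by exact_mod_cast mul_ne_zero hc (pow_ne_zero _ hq0.ne')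
  have h1 : (c:ℂ) ≠ 0 := by exact_mod_cast hc
  have h2 := ofReal_ne hq0
  rw [hFin_eq_qPoch hz mu_add_inv, qPoch_eq_zero hkj (a := c*((c*q^k:ℝ):ℂ)⁻¹), mul_zero]; push_cast
  field_simp

/-- The measure and the moments at a mass point `x` for which the first parameter is `c q^j`. -/
lemma aw_disc {B : ℝ} {j : ℕ} (hB : |B| < 1) (hcB : |c*q^j*B| < 1) (hbB : |b*B| < 1) :
    AWDensity q (refM q e N) (fun y => hFin c q j y*(1/(hInf B q y*hInf C q y*hInf o q y)))
      ((c*q^j:ℝ):ℂ) B C b ∧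
    AWMoments q (refM q e N) (fun y => hFin c q j y*(1/(hInf B q y*hInf C q y*hInf o q y)))
      ((c*q^j:ℝ):ℂ) B C b := by
  have heo' := heo; have hC := abs_lt_one hC0 hC1; rcases heo' with ⟨rfl, rfl⟩ | ⟨rfl, rfl⟩
  · have hcb' : |e*o| < 1 := by rw [mul_comm]; exact abs_lt_one (by positivity) hcb
    have hf : |o*q^j| < 1 := abs_mul_pow_lt_one hq0 hq1 (abs_lt_one hc0 ho) j
    have hef : |e*(o*q^j)| < 1 := by rw [← mul_assoc]; exact abs_mul_pow_lt_one hq0 hq1 hcb' j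
    have heC : |e*C| < 1 := by rw [mul_comm]; exact abs_lt_one (by positivity) hCb
    have key : ∀ᵐ y ∂refM q e N, 1/(hInf ((o*q^j:ℝ):ℂ) q y*hInf B q y*hInf C q y) =
          hFin o q j y*(1/(hInf B q y*hInf C q y*hInf o q y)) := by
      filter_upwards [ae_refM e N] with y hy
      rw [← one_div_hInf_mul_pow hq0 hq1 hc0 hb0 heo ho he rfl hcb' j hy]; congr 1; ring
    exact ⟨(awDensity_real_zero hq0 hq1 hb0 he hf hB hC hef hbB heC).swap₁.swap₂.swap₃.congr
      ((continuous_hFin _ _ _).measurable.mul (measurable_one_div_hInf₃ hq0 hq1 _ _ _)) key,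
      (awMoments_refM_real hq0 hq1 hb0 he hf hB hC hef hbB heC).swap₁.swap₂.swap₃.congr key⟩
  · -- The points `e q^k`, `k < j`, carry no mass, so that the base may be replaced by `e q^j`.
    have hqj := pow_le_one₀ hq0.le hq1.le (n := j); have hqj0 := pow_pos hq0 j
    have he' : ∀ k, k < N-j ↔ 1 < e*q^j*q^k := fun k => by
      rw [mul_assoc, ← pow_add, ← he, Nat.lt_sub_iff_add_lt, add_comm]
    have h1 : |e*q^j*o| < 1 := by
      rw [mul_right_comm]; exact abs_mul_pow_lt_one hq0 hq1 (abs_lt_one (by positivity) hcb) j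
    have h2 : |e*q^j*C| < 1 := by
      rw [mul_right_comm, mul_comm e, hCc]; exact abs_mul_pow_lt_one hq0 hq1 (abs_lt_one hq0 hq1) j
    have h3 : |o| < 1 := abs_lt_one hb0 ho; have he0' : 0 < e*q^j := by positivity
    have hD := awDensity_real_zero hq0 hq1 he0' he' hB hC h3 hcB h2 h1
    have hM := awMoments_refM_real hq0 hq1 he0' he' hB hC h3 hcB h2 h1
    have hw0 : ∀ᵐ y ∂refM q (e*q^j) (N-j), ∃ t : ℝ, 0 ≤ t ∧ (1:ℂ) = t :=
      Eventually.of_forall fun _ => ⟨1, zero_le_one, by simp⟩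
    have hw0' : ∀ᵐ y ∂refM q e N, ∃ t : ℝ, 0 ≤ t ∧ hFin e q j y = t := by
      filter_upwards [ae_refM e N] with y hy using OnSupp.hFin_nonneg hq0 hq1 hc0 he hy j
    have h : (refM q (e*q^j) (N-j)).withDensity (fun _ => ENNReal.ofReal (1:ℂ).re) =
        (refM q e N).withDensity fun y => ENNReal.ofReal (hFin e q j y).re := by
      rw [← refM_mul_pow hq0 hq1 hc0 he]; simp
    have mw : Measurable fun y : ℝ => hFin e q j y := (continuous_hFin _ _ _).measurable
    refine ⟨AWDensity.transfer measurable_const mw hw0 hw0' h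
      (measurable_one_div_hInf₃ hq0 hq1 _ _ _) (by simpa only [one_mul] using hD) ?_,
      AWMoments.transfer measurable_const mw hw0 hw0' h (by simpa only [one_mul] using hM)
        ⟨_, suppBound_refM hq0 hq1 hc0 he⟩⟩
    filter_upwards [hw0', ae_refM e N] with y h4 hy; obtain ⟨t, ht, hty⟩ := h4
    rcases eq_or_ne (hFin e q j y) 0 with h0 | h0
    · exact ⟨0, le_rfl, by rw [h0, zero_mul, ofReal_zero]⟩
    · have hy' : OnSupp q (e*q^j) (N-j) y := by
        rcases hy with ⟨θ, hθ, rfl⟩ | ⟨k, hk, rfl⟩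
        · exact Or.inl ⟨θ, hθ, rfl⟩
        · rcases lt_or_ge k j with hkj | hkj
          · exact absurd (hFin_mu_eq_zero hq0 hc0.ne' hkj) h0
          · obtain ⟨i, rfl⟩ := exists_eq_add_of_le hkj
            exact Or.inr ⟨i, by omega, by rw [mul_assoc, ← pow_add]⟩
      obtain ⟨v, hv, hvy⟩ := ((hy'.isPos_hInf hq0 hq1 he0' he' hB hcB).mul
        (hy'.isPos_hInf hq0 hq1 he0' he' hC h2)).mul (hy'.isPos_hInf hq0 hq1 he0' he' h3 h1)
      refine ⟨t*(1/v), by positivity, ?_⟩; rw [hty, hvy]; push_cast; rfl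

/-- The measure at a mass point `x` for which the first parameter is `c`. -/
lemma awDensity_disc {B : ℝ} (hB : |B| < 1) (hcB : |c*B| < 1) (hbB : |b*B| < 1) (M:ℕ) :
    AWDensity q (refM q e N)
      (fun y => 1/(hInf B q y*hInf ((C*q^M:ℝ):ℂ) q y*hInf o q y))
      c B ((C*q^M:ℝ):ℂ) b := by
  have hC := abs_mul_pow_lt_one hq0 hq1 (abs_lt_one hC0 hC1) M
  rcases heo with ⟨rfl, rfl⟩ | ⟨rfl, rfl⟩
  · have hcb' : |e*o| < 1 := by rw [mul_comm]; exact abs_lt_one (by positivity) hcb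
    have heC : |e*(C*q^M)| < 1 := by
      rw [← mul_assoc, mul_comm e]
      exact abs_mul_pow_lt_one hq0 hq1 (abs_lt_one (by positivity) hCb) M
    have := (awDensity_real_zero hq0 hq1 hb0 he (abs_lt_one hc0 ho) hB hC hcb' hbB
      heC).swap₁.swap₂.swap₃
    refine this.congr (measurable_one_div_hInf₃ hq0 hq1 _ _ _) (Eventually.of_forall fun y => ?_)
    congr 1; ring
  · exact awDensity_real_zero hq0 hq1 hc0 he hB hC (abs_lt_one hb0 ho) hcB
      (by rw [← mul_assoc, mul_comm e, hCc]
          exact abs_mul_pow_lt_one hq0 hq1 (abs_lt_one hq0 hq1) M)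
      (abs_lt_one (by positivity) hcb)

/-- The measure and the moments for `x` in the continuous spectrum. -/
lemma aw_cont {A : ℂ} (hA : ‖A‖ < 1) (hbA : b * ‖A‖ < 1) :
    AWDensity q (refM q e N) (fun y => hInf c q y *
      (1/(hInf A q y*hInf (conj A) q y*hInf C q y*hInf o q y)))
      A (conj A) C b ∧
    AWMoments q (refM q e N) (fun y => hInf c q y *
      (1/(hInf A q y*hInf (conj A) q y*hInf C q y*hInf o q y)))
      A (conj A) C b := by
  have hq := norm_lt_one hq0 hq1; have hA' : ‖conj A‖ < 1 := by rwa [RCLike.norm_conj]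
  have hC : ‖(C:ℂ)‖ < 1 := by rw [norm_real]; exact abs_lt_one hC0 hC1
  have nb : ∀ t : ℝ, 0 < t → t * ‖A‖ < 1 → ‖(t:ℂ)*A‖ < 1 := fun t h0 h1 => by
    rwa [norm_mul, norm_real, norm_of_nonneg h0.le]
  have nb' : ∀ t : ℝ, 0 < t → t * ‖A‖ < 1 → ‖(t:ℂ)*conj A‖ < 1 := fun t h0 h1 => by
    rwa [norm_mul, norm_real, norm_of_nonneg h0.le, RCLike.norm_conj]
  have hbC : ‖(b:ℂ)*C‖ < 1 := by
    rw [← ofReal_mul, norm_real, mul_comm]; exact abs_lt_one (by positivity) hCb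
  have hcC : ‖(c:ℂ)*C‖ < 1 := by
    rw [← ofReal_mul, norm_real, mul_comm, hCc]; exact abs_lt_one hq0 hq1
  have hconj : ∀ z, Π(conj A*z;q) * Π(conj (conj A)*z;q)*Π(conj (C:ℂ)*z;q) =
      Π(A*z;q)*Π(conj A*z;q)*Π(C*z;q) := fun z => by
    rw [Complex.conj_conj, conj_ofReal]; ring
  have hpos : ∀ {e : ℝ} {N : ℕ}, 0 < e → (∀ k, k < N ↔ 1 < e*q^k) → e * ‖A‖ < 1 → e*C < 1 →
      ∀ y, OnSupp q e N y → IsPos (hInf A q y*hInf (conj A) q y*hInf C q y) := by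
    intro e N he0 he hA1 hC2 y hy
    exact (isPos_hInf_mul_hInf_conj A hq (hy.hInf_ne_zero hq0 hq1 he0 he hA (nb e he0 hA1))).mul
      (hy.isPos_hInf hq0 hq1 he0 he (abs_lt_one hC0 hC1) (abs_lt_one (by positivity) hC2))
  have d₁ : ∀ {N : ℕ}, (∀ k, k < N ↔ 1 < b*q^k) → AWDensity q (refM q b N)
      (fun y => 1/(hInf A q y*hInf (conj A) q y*hInf C q y))
      A (conj A) C b := by
    intro N he
    have := awDensity_refM hq0 hq1 hb0 he hA hA' hC (nb b hb0 hbA) (nb' b hb0 hbA) hbC hconj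
      (hpos hb0 he hbA (by rwa [mul_comm])) 0
    simpa using this.swap₁.swap₂.swap₃
  have m₁ : ∀ {N : ℕ}, (∀ k, k < N ↔ 1 < b*q^k) → AWMoments q (refM q b N)
      (fun y => 1/(hInf A q y*hInf (conj A) q y*hInf C q y))
      A (conj A) C b := by
    intro N he; have := awMoments_refM hq0 hq1 hb0 he hA hA' hC (nb b hb0 hbA) (nb' b hb0 hbA) hbC
    simpa only [div_div, mul_assoc] using this.swap₁.swap₂.swap₃
  have hmG : ∀ o : ℝ, Measurable fun y =>
      1/(hInf A q y*hInf (conj A) q y*hInf C q y*hInf o q y) := fun o =>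
    ((((measurable_hInf hq A).mul (measurable_hInf hq _)).mul (measurable_hInf hq C)).mul
      (measurable_hInf hq o)).const_div 1
  rcases heo with ⟨rfl, rfl⟩ | ⟨rfl, rfl⟩
  · have key : ∀ᵐ y ∂refM q e N, 1/(hInf A q y*hInf (conj A) q y*hInf C q y) = hInf o q y *
          (1/(hInf A q y*hInf (conj A) q y*hInf C q y*hInf o q y)) := by
      filter_upwards [ae_refM e N] with y hy
      have := (OnSupp.isPos_hInf hq0 hq1 hb0 he hy (f := o) (abs_lt_one hc0 ho)
        (by rw [mul_comm]; exact abs_lt_one (by positivity) hcb)).ne_zero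
      rw [mul_one_div, div_mul_cancel_right₀ this, one_div]
    exact ⟨(d₁ he).congr ((measurable_hInf hq _).mul (hmG _)) key, (m₁ he).congr key⟩
  · -- The points of the support outside the interval carry no mass, so that a different reference
    -- measure may be used.
    have hN0 : ∀ k, k < 0 ↔ 1 < o*q^k := fun k => by
      simp only [not_lt_zero, false_iff, not_lt]
      exact mul_le_one₀ ho.le (by positivity) (pow_le_one₀ hq0.le hq1.le)
    have hw0 : ∀ᵐ y ∂refM q o 0, ∃ t : ℝ, 0 ≤ t ∧ hInf o q y = t := by
      filter_upwards [ae_refM o 0] with y hy using OnSupp.hInf_nonneg hq0 hq1 hb0 hy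
    have hw0' : ∀ᵐ y ∂refM q e N, ∃ t : ℝ, 0 ≤ t ∧ hInf e q y = t := by
      filter_upwards [ae_refM e N] with y hy using OnSupp.hInf_nonneg hq0 hq1 hc0 hy
    have h : (refM q o 0).withDensity (fun y => ENNReal.ofReal (hInf o q y).re) =
        (refM q e N).withDensity fun y => ENNReal.ofReal (hInf e q y).re := by
      rw [refM_withDensity_hInf hq0 hq1 hb0, refM_withDensity_hInf hq0 hq1 hc0]
    have key : ∀ᵐ y ∂refM q o 0, 1/(hInf A q y*hInf (conj A) q y*hInf C q y) = hInf o q y *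
          (1/(hInf A q y*hInf (conj A) q y*hInf C q y*hInf o q y)) := by
      filter_upwards [ae_refM o 0] with y hy
      have := (OnSupp.isPos_hInf hq0 hq1 hb0 hN0 hy (f := o) (abs_lt_one hb0 ho)
        (abs_lt_one (by positivity) (by nlinarith))).ne_zero
      rw [mul_one_div, div_mul_cancel_right₀ this, one_div]
    have mo := measurable_hInf hq o; have me := measurable_hInf hq e
    refine ⟨((d₁ hN0).congr (mo.mul (hmG _)) key).transfer mo me hw0 hw0' h (hmG _) ?_,
      ((m₁ hN0).congr key).transfer mo me hw0 hw0' h ⟨_, suppBound_refM hq0 hq1 hc0 he⟩⟩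
    filter_upwards [hw0', ae_refM e N] with y h1 hy; obtain ⟨t, ht, hty⟩ := h1
    rcases eq_or_ne (hInf e q y) 0 with h0 | h0
    · exact ⟨0, le_rfl, by rw [h0, zero_mul, ofReal_zero]⟩
    · have hy' : OnSupp q o 0 y := by
        rcases hy with ⟨θ, hθ, rfl⟩ | ⟨k, hk, rfl⟩
        · exact Or.inl ⟨θ, hθ, rfl⟩
        · refine absurd ?_ h0
          rw [hInf_split hq (e:ℂ) (k+1), hFin_mu_eq_zero hq0 hc0.ne' (Nat.lt_succ_self k), zero_mul]
      obtain ⟨v, hv, hvy⟩ := (hpos hb0 hN0 hbA (by rwa [mul_comm]) y hy').mul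
        (OnSupp.isPos_hInf hq0 hq1 hb0 hN0 hy' (f := o) (abs_lt_one hb0 ho)
          (abs_lt_one (by positivity) (by nlinarith)))
      refine ⟨t*(1/v), by positivity, ?_⟩; rw [hty, hvy]; push_cast; rfl

end

/-! ### The integrand of the Clebsch-Gordan integral -/

/-- The common data of the measures in the Clebsch-Gordan integral: the parameters `C`, `c`, `b`,
the larger one `e` and the smaller one `o` of `b` and `c`, and the number `N` of mass points. -/
structure CGBase (q C c b e o:ℝ) (N:ℕ) : Prop where
  q_pos : 0 < q
  q_lt : q < 1
  C_pos : 0 < C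
  C_lt : C < 1
  c_pos : 0 < c
  b_pos : 0 < b
  C_mul_c : C*c = q
  C_mul_b : C*b < 1
  c_mul_b : c*b < 1
  cases : (e = b ∧ o = c) ∨ (e = c ∧ o = b)
  o_lt : o < 1
  masses : ∀ k, k < N ↔ 1 < e*q^k

namespace CGBase

variable {q C c b e o : ℝ} {N : ℕ} (H : CGBase q C c b e o N)

include H

lemma norm_lt : ‖(q:ℂ)‖ < 1 := norm_lt_one H.q_pos H.q_lt

lemma q_ne : (q:ℂ) ≠ 0 := by exact_mod_cast H.q_pos.ne'

lemma C_ne : (C:ℂ) ≠ 0 := by exact_mod_cast H.C_pos.ne'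

lemma c_ne : (c:ℂ) ≠ 0 := by exact_mod_cast H.c_pos.ne'

lemma C_mul_c' : (C:ℂ)*c = q := by exact_mod_cast H.C_mul_c

lemma e_pos : 0 < e := by
  have := H.b_pos; have := H.c_pos; rcases H.cases with ⟨rfl, -⟩ | ⟨rfl, -⟩ <;> assumption

lemma o_pos : 0 < o := by
  have := H.b_pos; have := H.c_pos; rcases H.cases with ⟨-, rfl⟩ | ⟨-, rfl⟩ <;> assumption

lemma e_mul_C : e*C < 1 := by
  rcases H.cases with ⟨rfl, -⟩ | ⟨rfl, -⟩
  · rw [mul_comm]; exact H.C_mul_b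
  · rw [mul_comm, H.C_mul_c]; exact H.q_lt

lemma e_mul_o : e*o < 1 := by
  have := H.c_mul_b; rcases H.cases with ⟨rfl, rfl⟩ | ⟨rfl, rfl⟩
  · grind
  grind

lemma isFiniteMeasure : IsFiniteMeasure (refM q e N) := isFiniteMeasure_refM H.q_pos H.q_lt e N

lemma isPos_hInf {f : ℝ} (hf0 : 0 < f) (hf : f < 1) (hef : e*f < 1) {y : ℝ}
    (hy : OnSupp q e N y) : IsPos (hInf f q y) :=
  hy.isPos_hInf H.q_pos H.q_lt H.e_pos H.masses (abs_lt_one hf0 hf)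
    (abs_lt_one (mul_pos H.e_pos hf0) hef)

lemma isPos_hInf_C {y : ℝ} (hy : OnSupp q e N y) : IsPos (hInf C q y) :=
  H.isPos_hInf H.C_pos H.C_lt H.e_mul_C hy

lemma isPos_hInf_o {y : ℝ} (hy : OnSupp q e N y) : IsPos (hInf o q y) :=
  H.isPos_hInf H.o_pos H.o_lt H.e_mul_o hy

lemma hFin_c_nonneg (D:ℕ) {y : ℝ} (hy : OnSupp q e N y) : ∃ t : ℝ, 0 ≤ t ∧ hFin c q D y = t := by
  rcases H.cases with ⟨-, h⟩ | ⟨h, -⟩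
  · subst h
    have h2 := mul_lt_one_left H.o_pos.le H.o_lt (pow_le_one₀ H.q_pos.le H.q_lt.le (n := D))
    have h3 : e*(o*q^D) < 1 := by
      rw [← mul_assoc]
      exact mul_lt_one_left (mul_pos H.e_pos H.o_pos).le H.e_mul_o
        (pow_le_one₀ H.q_pos.le H.q_lt.le)
    obtain ⟨t, ht, h1⟩ := (H.isPos_hInf_o hy).div
      (H.isPos_hInf (mul_pos H.o_pos (pow_pos H.q_pos D)) h2 h3 hy)
    refine ⟨t, ht.le, ?_⟩
    have h4 := (H.isPos_hInf (mul_pos H.o_pos (pow_pos H.q_pos D)) h2 h3 hy).ne_zero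
    rw [← h1, hInf_split H.norm_lt (o:ℂ) D y, eq_div_iff h4]; simp
  · subst h; exact OnSupp.hFin_nonneg H.q_pos H.q_lt H.e_pos H.masses hy D

end CGBase

lemma isPos_awConst {q a b c d : ℝ} (hq0 : 0 < q) (hq1 : q < 1) (hab : a*b < 1) (hac : a*c < 1)
    (had : a*d < 1) (hbc : b*c < 1) (hbd : b*d < 1) (hcd : c*d < 1)
    (h : a*b*c*d < 1) : IsPos (awConst q a b c d) := by
  have p : ∀ {x : ℝ}, x < 1 → IsPos (Π(x;q)) := isPos_qPochInf hq0 hq1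
  simp only [awConst, qPochInfs_cons, qPochInfs_nil, mul_one, ← ofReal_mul]
  exact ((p hq1).mul ((p hab).mul ((p hac).mul ((p had).mul ((p hbc).mul ((p hbd).mul
    (p hcd))))))).div (p h)

/-- The factorizations at a point `y` that turn the square root of the density of the continuous
dual `q`-Hahn measure, relative to the reference measure, into a rational expression. -/
def CDHFactor (q C b o : ℝ) (n₁ n₂ n : ℕ) (a x z t : ℂ) (φ : ℝ → ℂ) (y:ℝ) : Prop :=
  ∃ α G : ℝ, 0 ≤ α ∧ 0 ≤ G ∧ hInf a q y = α ∧ φ y = α*G^2/hInf o q y ∧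
    sPoly C b q n₂ (q*(q^n₁/q^n₂)) y = t*awPoly x b z 0 q n y*G*hInf C q y

namespace CGBase

variable {q C c b e o : ℝ} {N : ℕ} (H : CGBase q C c b e o N)

include H

/-- The Clebsch-Gordan integral in terms of a common reference measure. -/
theorem integral_geomMean_cdh {M : Measure ℝ} {g : ℝ → ℝ} {R : ℝ} {PA φ G : ℝ → ℂ}
    {A B a x z E t : ℂ} {n n₁ n₂ : ℕ} (hg : Measurable g)
    (hg0 : ∀ᵐ y ∂refM q e N, 0 ≤ g y)
    (hM : M = (refM q e N).withDensity fun y => ENNReal.ofReal (g y))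
    (hgG : ∀ᵐ y ∂refM q e N, ∃ r : ℝ, 0 ≤ r ∧ G y = r ∧ g y = R*r^2/(hInf o q y).re)
    (ha : C*((q:ℂ)^n₂/q^n₁) = a) (hP : IsPos (awConst q x b z 0))
    (hD : AWDensity q (refM q e N) φ x b z 0)
    (hφ : ∀ y, OnSupp q e N y → CDHFactor q C b o n₁ n₂ n a x z t φ y)
    (hz : ∀ᵐ y ∂refM q e N, hInf a q y = 0 → wFun q A B a y*G y = 0) (hE : E*t = 1)
    (hI : Integrable (fun y => PA y*(cgFun q A B C b n₁ n₂ y*(G y/(hInf C q y*hInf o q y))))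
      (refM q e N)) (νA νP jc:ℂ) :
    Integrable (fun y => νA*PA y*(νP*awPoly x b z 0 q n y) *
        (jc*wFun q A B a y/(√(hInf a q y).re : ℂ))) (geomMean (awMeasure x b z 0 q) M) ∧
    ∫ y, νA*PA y*(νP*awPoly x b z 0 q n y)*(jc*wFun q A B a y/(√(hInf a q y).re : ℂ))
        ∂geomMean (awMeasure x b z 0 q) M =
      √((awConst q x b z 0).re*R)*(νA*νP*jc)*E *
        ∫ y, PA y*(cgFun q A B C b n₁ n₂ y*(G y/(hInf C q y*hInf o q y))) ∂refM q e N := by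
  have hfin := H.isFiniteMeasure; obtain ⟨k, hk, hkP⟩ := hP
  have hre : ∀ α G v : ℝ, ((k:ℂ)*(α*G^2/v)).re = k*(α*G^2/v) := fun α G v => by
    exact_mod_cast ofReal_re _
  rw [← integral_const_mul]
  refine integral_geomMean (f := fun y => (awConst q x b z 0*φ y).re)
    (measurable_re.comp (hD.measurable.const_mul _)) hg ?_ hg0 hD.eq hM ?_ (hI.const_mul _)
  · filter_upwards [ae_refM e N] with y hy; obtain ⟨α, G, h0, -, -, h1, -⟩ := hφ y hy
    obtain ⟨v, hv, hvH⟩ := H.isPos_hInf_o hy; rw [h1, hvH, hkP, hre]; positivity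
  · filter_upwards [hgG, hz, ae_refM e N] with y ⟨r, hr, hGr, h1⟩ h3 hy
    obtain ⟨α, s, h0, hs, hα, hφy, hS⟩ := hφ y hy; obtain ⟨v, hv, hvH⟩ := H.isPos_hInf_o hy
    have hC := (H.isPos_hInf_C hy).ne_zero; have hv' := ofReal_ne hv; rw [hα, hGr] at h3
    rw [cgFun, ha, hS, hφy, h1, hvH, hα, hkP, hGr, hre, ofReal_re, ofReal_re, ofReal_re,
      show k*(α*s^2/v)*(R*r^2/v) = k*R*(α*(s*r/v)^2) by ring, Real.sqrt_mul' _ (by positivity),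
      sqrt_mul h0, Real.sqrt_sq (by positivity)]
    rcases h0.eq_or_lt with rfl | h0
    · rw [Real.sqrt_zero]; push_cast
      linear_combination -(√(k*R)*(νA*νP*jc)*E*PA y*t*awPoly x b z 0 q n y*s*hInf C q y /
        (hInf C q y*v))*h3 ofReal_zero
    · have hs := ofReal_ne (sqrt_pos.2 h0); push_cast
      generalize ((√(k*R):ℝ):ℂ) = W, ((√α:ℝ):ℂ) = S, wFun q A B a y = w,
        awPoly x b z 0 q n y = f, hInf C q y = c at *
      field_simp; linear_combination -(W*s*r*νA*PA y*νP*f*jc*w)*hE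

lemma cdhFactor_le (n₁ d:ℕ) {y : ℝ} (hy : OnSupp q e N y) :
    CDHFactor q C b o n₁ (n₁+d) n₁ (C*q^d:ℝ) (C*q^d:ℝ) c ((-1)^d*C⁻¹^d*(q^(d.choose 2))⁻¹)
      (fun y => 1/(hInf (C*q^d:ℝ) q y*hInf o q y)) y := by
  have hqc := H.q_ne; have hqd := pow_le_one₀ H.q_pos.le H.q_lt.le (n := d)
  obtain ⟨α, hα0, hα⟩ := H.isPos_hInf (mul_pos H.C_pos (pow_pos H.q_pos d))
    (mul_lt_one_left H.C_pos.le H.C_lt hqd)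
    (by rw [← mul_assoc]; exact mul_lt_one_left (mul_pos H.e_pos H.C_pos).le H.e_mul_C hqd) hy
  have hα' := ofReal_ne hα0; refine ⟨α, 1/α, hα0.le, by positivity, hα, ?_, ?_⟩
  · beta_reduce; rw [hα]; push_cast; field_simp
  · rw [sPoly_eq_hFin_mul_awPoly hqc (fun j => ?_) H.C_mul_c' (fun j => ?_) n₁ d
      (by rw [pow_add]; field_simp) y,
      hInf_split H.norm_lt (C:ℂ) d y]
    · push_cast at hα ⊢; rw [hα]; field_simp
    · exact_mod_cast (mul_lt_one_left H.q_pos.le H.q_lt (pow_le_one₀ H.q_pos.le H.q_lt.le)).ne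
    · exact_mod_cast (mul_lt_one_left (mul_pos H.C_pos H.b_pos).le H.C_mul_b
        (pow_le_one₀ H.q_pos.le H.q_lt.le)).ne

lemma hInf_div_pow (D:ℕ) (y:ℝ) : hInf (C/q^D:ℝ) q y =
    ((C/q^D:ℝ)^D*(q:ℂ)^(D.choose 2))^2*hFin c q D y*hInf C q y := by
  have h : ((C/q^D:ℝ):ℂ)*q^D = C := by push_cast; exact div_mul_cancel₀ _ (pow_ne_zero _ H.q_ne)
  rw [hInf_split H.norm_lt _ D y, h, hFin_reflect (ofReal_ne (div_pos H.C_pos (pow_pos H.q_pos D)))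
    H.q_ne (C := c) (by rw [h, H.C_mul_c'])]
  ring

lemma cdhFactor_ge (n₂ D:ℕ) {y : ℝ} (hy : OnSupp q e N y) :
    CDHFactor q C b o (n₂+D) n₂ n₂ (C/q^D:ℝ) (c*q^D:ℝ) C ((C/q^D)^D*q^(D.choose 2))
      (fun y => hFin c q D y*(1/(hInf C q y*hInf o q y))) y := by
  have hqc := H.q_ne; have hq := H.q_pos; have hqD := pow_pos hq D; have hC := H.C_pos
  have hc := H.c_pos; obtain ⟨h, hh0, hh⟩ := H.hFin_c_nonneg D hy
  obtain ⟨a, ha0, ha⟩ := H.isPos_hInf_C hy; have ha' := ofReal_ne ha0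
  have hT := pow_ne_zero D (div_ne_zero H.C_ne (pow_ne_zero D hqc))
  have ne1 : ∀ {x : ℝ}, 0 < x → x < 1 → ∀ j : ℕ, (x:ℂ)*q^j ≠ 1 := fun h0 h1 j => by
    exact_mod_cast (mul_lt_one_left h0.le h1 (pow_le_one₀ hq.le H.q_lt.le)).ne
  have mlt : ∀ {x : ℝ}, 0 < x → x < 1 → x*q^D < 1 := fun h0 h1 =>
    mul_lt_one_left h0.le h1 (pow_le_one₀ hq.le H.q_lt.le)
  have hCb : ∀ j : ℕ, (C:ℂ)*b*q^j ≠ 1 := by simpa using ne1 (mul_pos H.C_pos H.b_pos) H.C_mul_b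
  have hqq := ne1 hq H.q_lt
  have hreg : AWRegular (c*q^D:ℝ) C b 0 q := by
    refine ⟨hqc, hqq, fun j => by simpa using (pow_ne_zero 2 hqc).symm, fun j => ?_, fun j => ?_,
      by simp, hCb, by simp, by simp⟩
    · rw [← ofReal_mul]; refine ne1 (by positivity) ?_ j
      rw [mul_right_comm, mul_comm c, H.C_mul_c]; exact mlt hq H.q_lt
    · rw [← ofReal_mul]; have := H.b_pos; refine ne1 (by positivity) ?_ j
      rw [mul_right_comm]; exact mlt (mul_pos hc H.b_pos) H.c_mul_b
  refine ⟨((C/q^D)^D*q^(D.choose 2))^2*h*a, 1/((C/q^D)^D*q^(D.choose 2)*a), by positivity,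
    by positivity, ?_, ?_, ?_⟩
  · rw [H.hInf_div_pow, hh, ha]; push_cast; rfl
  · beta_reduce; rw [hh, ha]; push_cast; field_simp
  · rw [pow_add, mul_div_cancel_left₀ _ (pow_ne_zero _ hqc), sPoly_eq_awPoly hqc hqq H.C_mul_c' hCb,
      ha, awPoly_comm₂ _ _ (C:ℂ), awPoly_swap (ofReal_ne (by positivity)) H.C_ne hreg, awPoly_comm₂]
    push_cast; field_simp

end CGBase

/-! ### The parameters in terms of powers of the base -/

namespace Params

variable (P : Params)

/-- `q^{2k₁}`. -/
def κ₁ : ℝ := P.q^(2*P.k₁)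

/-- `q^{2k₂}`. -/
def κ₂ : ℝ := P.q^(2*P.k₂)

/-- The base `q²` as a real number. -/
def Qr : ℝ := P.q^2

/-- The parameter `q^{2k₂-2k₁+1}`. -/
def pC : ℝ := P.κ₂*P.q/P.κ₁

/-- The parameter `q^{2k₁-2k₂+1}`. -/
def pc : ℝ := P.κ₁*P.q/P.κ₂

/-- The parameter `q^{2k₁+2k₂-1}`. -/
def pb : ℝ := P.κ₁*P.κ₂/P.q

lemma Q_eq : P.Q = (P.Qr:ℂ) := by simp [Q, Qr]

namespace Admissible

variable {P} (h : P.Admissible)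

include h

lemma κ₁_pos : 0 < P.κ₁ := Real.rpow_pos_of_pos h.q_pos _

lemma κ₂_pos : 0 < P.κ₂ := Real.rpow_pos_of_pos h.q_pos _

lemma κ₁_lt : P.κ₁ < 1 := Real.rpow_lt_one h.q_pos.le h.q_lt_one (by linarith [h.k₁_pos])

lemma κ₂_le : P.κ₂ ≤ P.κ₁ :=
  Real.rpow_le_rpow_of_exponent_ge h.q_pos h.q_lt_one.le (by linarith [h.k₁_le_k₂])

lemma κ₂_lt : P.κ₂ < 1 := h.κ₂_le.trans_lt h.κ₁_lt

lemma Qr_pos : 0 < P.Qr := pow_pos h.q_pos 2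

lemma Qr_lt : P.Qr < 1 := pow_lt_one₀ h.q_pos.le h.q_lt_one two_ne_zero

lemma s_ne : P.s ≠ 0 := fun h0 => by
  have := h.s_large; rw [h0, abs_zero] at this; exact absurd (inv_pos.2 h.q_pos) (not_lt.2 this)

lemma rpow_two_mul_nat (n:ℕ) : P.q^(2*(n:ℝ)) = P.Qr^n := by
  rw [Real.rpow_mul h.q_pos.le, Real.rpow_natCast, Qr]; norm_num

lemma qp_sub_add_one (n m:ℕ) : P.qp (2*P.k₂-2*P.k₁+2*n-2*m+1) = ((P.pC*P.Qr^n/P.Qr^m:ℝ):ℂ) := by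
  rw [qp, rpow_add h.q_pos, rpow_sub h.q_pos, rpow_add h.q_pos,
    rpow_sub h.q_pos, h.rpow_two_mul_nat, h.rpow_two_mul_nat, Real.rpow_one, pC, κ₁, κ₂]
  congr 1; ring

lemma qp_sub_add_one' (n m:ℕ) : P.qp (2*P.k₁-2*P.k₂+2*n-2*m+1) = ((P.pc*P.Qr^n/P.Qr^m:ℝ):ℂ) := by
  rw [qp, rpow_add h.q_pos, rpow_sub h.q_pos, rpow_add h.q_pos,
    rpow_sub h.q_pos, h.rpow_two_mul_nat, h.rpow_two_mul_nat, Real.rpow_one, pc, κ₁, κ₂]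
  congr 1; ring

lemma qp_pC : P.qp (2*P.k₂-2*P.k₁+1) = P.pC := by simpa using h.qp_sub_add_one 0 0

lemma qp_pc : P.qp (2*P.k₁-2*P.k₂+1) = P.pc := by simpa using h.qp_sub_add_one' 0 0

lemma qp_pb : P.qp (2*P.k₁+2*P.k₂-1) = P.pb := by
  rw [qp, rpow_sub h.q_pos, rpow_add h.q_pos, Real.rpow_one, pb, κ₁, κ₂]

lemma qp_neg : P.qp (-2*P.k₂) = ((P.κ₂:ℝ):ℂ)⁻¹ := by
  rw [qp, neg_mul, Real.rpow_neg h.q_pos.le, κ₂, Complex.ofReal_inv]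

lemma ascA_eq (p:ℕ) : P.ascA p = P.s*P.κ₁/(P.κ₂*(P.Qr:ℂ)^p) := by
  rw [ascA, qp, rpow_sub h.q_pos, rpow_sub h.q_pos, h.rpow_two_mul_nat, κ₁, κ₂]; push_cast
  rw [div_div, mul_div_assoc]

lemma ascB_eq (p:ℕ) : P.ascB p = P.κ₁*P.κ₂*(P.Qr:ℂ)^p/P.s := by
  rw [ascB, qp, rpow_add h.q_pos, rpow_add h.q_pos, h.rpow_two_mul_nat, κ₁, κ₂]; push_cast; rfl

lemma qp_eps : P.qp (1-2*P.eps) = P.pC/(P.Qr:ℂ)^P.L := by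
  have : 1-2*P.eps = 2*P.k₂-2*P.k₁+2*((0:ℕ):ℝ)-2*(P.L:ℝ)+1 := by rw [eps]; push_cast; ring
  rw [this, h.qp_sub_add_one]; push_cast; simp

lemma qp_eps' : P.qp (2-2*P.eps) = P.q*P.pC/(P.Qr:ℂ)^P.L := by
  have : (2:ℝ)-2*P.eps = 1+(1-2*P.eps) := by ring
  rw [mul_div_assoc, ← h.qp_eps, this, qp, rpow_add h.q_pos, Real.rpow_one]; push_cast; rfl

lemma qp_jacobi (n₁ n₂:ℕ) : P.qp (1-2*P.eps-2*(((n₁:ℤ)-n₂-P.L : ℤ) : ℝ)) =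
    P.pC*((P.Qr:ℂ)^n₂/(P.Qr:ℂ)^n₁) := by
  have : 1-2*P.eps-2*(((n₁:ℤ)-n₂-P.L : ℤ) : ℝ) = 2*P.k₂-2*P.k₁+2*(n₂:ℝ)-2*(n₁:ℝ)+1 := by
    rw [eps]; push_cast; ring
  rw [this, h.qp_sub_add_one]; push_cast; rw [mul_div_assoc]

lemma uDisc_eq (l:ℕ) : uDisc P l = P.s*P.κ₁/P.κ₂*P.Qr^P.K/P.Qr^l := by
  rw [uDisc, rpow_sub h.q_pos, rpow_add h.q_pos, rpow_sub h.q_pos,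
    h.rpow_two_mul_nat, h.rpow_two_mul_nat, κ₁, κ₂]
  ring

lemma rpow_add_two_mul (p:ℕ) : P.q^(2*P.k₂+2*(p:ℝ)) = P.κ₂*P.Qr^p := by
  rw [rpow_add h.q_pos, h.rpow_two_mul_nat, κ₂]

lemma one_lt_abs_uDisc (l:ℕ) : 1 < |uDisc P l| := by
  have h1 := h.K_lower; have h2 := Real.rpow_pos_of_pos h.q_pos (2*P.k₁-2*P.k₂+2*(P.K:ℝ)-2*(l:ℝ))
  rw [uDisc, abs_mul, abs_of_pos h2]
  refine h1.trans_le (mul_le_mul_of_nonneg_left ?_ (abs_nonneg _))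
  exact Real.rpow_le_rpow_of_exponent_ge h.q_pos h.q_lt_one.le
    (by linarith [(Nat.cast_nonneg l : (0:ℝ) ≤ l)])

lemma pC_pos : 0 < P.pC := div_pos (mul_pos h.κ₂_pos h.q_pos) h.κ₁_pos

lemma pC_le : P.pC ≤ P.q := by
  rw [pC, div_le_iff₀ h.κ₁_pos, mul_comm]; exact mul_le_mul_of_nonneg_left h.κ₂_le h.q_pos.le

lemma pc_pos : 0 < P.pc := div_pos (mul_pos h.κ₁_pos h.q_pos) h.κ₂_pos

lemma pb_pos : 0 < P.pb := div_pos (mul_pos h.κ₁_pos h.κ₂_pos) h.q_pos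

lemma pC_mul_pc : P.pC*P.pc = P.Qr := by
  have := h.κ₁_pos.ne'; have := h.κ₂_pos.ne'; rw [pC, pc, Qr]; field_simp

lemma pC_mul_pb : P.pC*P.pb = P.κ₂^2 := by
  have := h.κ₁_pos.ne'; have := h.q_pos.ne'; rw [pC, pb]; field_simp

lemma pc_mul_pb : P.pc*P.pb = P.κ₁^2 := by
  have := h.κ₂_pos.ne'; have := h.q_pos.ne'; rw [pc, pb]; field_simp

lemma exists_cgBase : ∃ e o N, CGBase P.Qr P.pC P.pc P.pb e o N := by
  have h1 : P.pC*P.pb < 1 := by rw [h.pC_mul_pb]; exact pow_lt_one₀ h.κ₂_pos.le h.κ₂_lt two_ne_zero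
  have h2 : P.pc*P.pb < 1 := by rw [h.pc_mul_pb]; exact pow_lt_one₀ h.κ₁_pos.le h.κ₁_lt two_ne_zero
  have h3 : ∀ e : ℝ, ∃ N : ℕ, ∀ k, k < N ↔ 1 < e*P.Qr^k := fun e => by
    classical
    have hex : ∃ N : ℕ, e*P.Qr^N ≤ 1 := by
      have := ((tendsto_pow_atTop_nhds_zero_of_lt_one h.Qr_pos.le h.Qr_lt).const_mul e)
      rw [mul_zero] at this; exact (this.eventually_le_const zero_lt_one).exists
    refine ⟨Nat.find hex, fun k => ⟨fun hk => not_le.1 (Nat.find_min hex hk), fun hk => ?_⟩⟩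
    by_contra! hle; have h4 := Nat.find_spec hex; rcases le_or_gt e 0 with he | he
    · have : e*P.Qr^k ≤ 0 := mul_nonpos_of_nonpos_of_nonneg he (pow_nonneg h.Qr_pos.le _); linarith
    · have := mul_le_mul_of_nonneg_left (pow_le_pow_of_le_one h.Qr_pos.le h.Qr_lt.le hle) he.le
      linarith
  rcases le_total P.pc P.pb with hle | hle
  · obtain ⟨N, hN⟩ := h3 P.pb
    refine ⟨P.pb, P.pc, N, h.Qr_pos, h.Qr_lt, h.pC_pos, h.pC_le.trans_lt h.q_lt_one,
      h.pc_pos, h.pb_pos, h.pC_mul_pc, h1, h2, Or.inl ⟨rfl, rfl⟩, ?_, hN⟩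
    nlinarith [h.pc_pos]
  · obtain ⟨N, hN⟩ := h3 P.pc
    refine ⟨P.pc, P.pb, N, h.Qr_pos, h.Qr_lt, h.pC_pos, h.pC_le.trans_lt h.q_lt_one,
      h.pc_pos, h.pb_pos, h.pC_mul_pc, h1, h2, Or.inr ⟨rfl, rfl⟩, ?_, hN⟩
    nlinarith [h.pb_pos]

lemma inv_sq_le : (P.s^2)⁻¹ ≤ P.Qr := by
  have h1 : (P.q⁻¹)^2 ≤ P.s^2 := by
    rw [← sq_abs P.s]; exact pow_le_pow_left₀ (inv_pos.2 h.q_pos).le h.s_large 2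
  have h2 := pow_pos h.q_pos 2; rw [inv_pow] at h1; rw [Qr]; exact inv_le_of_inv_le₀ h2 h1

lemma div_sq_lt_one {x : ℝ} (h1 : x ≤ 1) : x/P.s^2 < 1 := by
  rw [div_eq_mul_inv]; have := inv_pos.2 (pow_pos (abs_pos.2 h.s_ne) 2); rw [sq_abs] at this
  nlinarith [h.inv_sq_le, h.Qr_lt]

lemma norm_Qr_lt : ‖(P.Qr:ℂ)‖ < 1 := norm_lt_one h.Qr_pos h.Qr_lt

lemma ofReal_s_ne : (P.s:ℂ) ≠ 0 := by exact_mod_cast h.s_ne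

lemma ofReal_κ₁_ne : (P.κ₁:ℂ) ≠ 0 := by exact_mod_cast h.κ₁_pos.ne'

lemma ofReal_κ₂_ne : (P.κ₂:ℂ) ≠ 0 := by exact_mod_cast h.κ₂_pos.ne'

lemma ofReal_Qr_ne : (P.Qr:ℂ) ≠ 0 := by exact_mod_cast h.Qr_pos.ne'

lemma ofReal_q_ne : (P.q:ℂ) ≠ 0 := by exact_mod_cast h.q_pos.ne'

/-- The masses `W_p` in closed form. -/
lemma ascInvMass_eq (p:ℕ) : P.ascInvMass p = ((P.s:ℂ)^2)⁻¹^p*(P.Qr:ℂ)^(p^2) *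
    (1-(P.κ₂:ℂ)^2/P.s^2*P.Qr^(2*p))*qPoch ((P.κ₂:ℂ)^2) P.Qr p *
    Π((P.Qr:ℂ)/P.s^2*P.Qr^p;P.Qr) /
    (qPoch P.Qr P.Qr p*Π((P.κ₂:ℂ)^2/P.s^2*P.Qr^p;P.Qr)) := by
  have hs := h.ofReal_s_ne; have hκ := h.ofReal_κ₂_ne; have hq := h.norm_Qr_lt
  have hκ2 : P.κ₂^2 ≤ 1 := pow_le_one₀ h.κ₂_pos.le h.κ₂_lt.le
  have nt : ‖(P.κ₂:ℂ)^2/P.s^2‖ < 1 := by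
    rw [← ofReal_pow, ← ofReal_pow, ← ofReal_div, norm_real, norm_of_nonneg (by positivity)]
    exact h.div_sq_lt_one hκ2
  have nQ : ‖(P.Qr:ℂ)/P.s^2‖ < 1 := by
    rw [← ofReal_pow, ← ofReal_div, norm_real,
      norm_of_nonneg (div_nonneg h.Qr_pos.le (by positivity))]
    exact h.div_sq_lt_one h.Qr_lt.le
  have e1 : ((P.κ₂:ℂ)⁻¹*P.s)^2 = (P.κ₂^2/P.s^2:ℂ)⁻¹ := by
    rw [inv_div, mul_pow, inv_pow, mul_comm, div_eq_mul_inv]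
  have e2 : ((P.κ₂:ℂ)⁻¹*P.s)⁻¹*((P.κ₂:ℂ)⁻¹/P.s)⁻¹ = (P.κ₂:ℂ)^2 := by field_simp
  have e3 : ((P.κ₂:ℂ)⁻¹*P.s)⁻¹*((P.κ₂:ℂ)⁻¹/P.s)*P.Qr = P.Qr/P.s^2 := by field_simp
  have e4 : ((P.κ₂:ℂ)⁻¹/P.s)/((P.κ₂:ℂ)⁻¹*P.s) = ((P.s:ℂ)^2)⁻¹ := by field_simp
  have f1 := qPochInf_split hq (P.κ₂^2/P.s^2:ℂ) p; have f2 := qPochInf_step hq (P.κ₂^2/P.s^2:ℂ)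
  have f3 := qPochInf_split hq (P.Qr/P.s^2:ℂ) p; have n0 := qPochInf_ne hq nt
  have n1 := qPoch_ne hq nt p; have n2 := qPoch_ne hq nQ p; have n3 := qPoch_ne hq hq p
  have n4 : Π((P.κ₂:ℂ)^2/P.s^2*P.Qr^p;P.Qr) ≠ 0 := right_ne_zero_of_mul (f1 ▸ n0)
  have n5 : Π((P.κ₂:ℂ)^2/P.s^2*P.Qr;P.Qr) ≠ 0 := right_ne_zero_of_mul (f2 ▸ n0)
  have n6 : 1-(P.κ₂:ℂ)^2/P.s^2 ≠ 0 := left_ne_zero_of_mul (f2 ▸ n0)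
  have f4 : qPoch ((P.κ₂:ℂ)^2/P.s^2) P.Qr p * Π((P.κ₂:ℂ)^2/P.s^2*P.Qr^p;P.Qr) =
      (1-(P.κ₂:ℂ)^2/P.s^2)*Π((P.κ₂:ℂ)^2/P.s^2*P.Qr;P.Qr) := by
    rw [← f1, f2]
  simp only [ascInvMass, qPochs_cons, qPochs_nil, mul_one, h.qp_neg, P.Q_eq, e1, e2, e3, e4, inv_inv]
  rw [f3]; generalize (P.κ₂^2/P.s^2:ℂ) = t at *
  rw [div_mul_eq_mul_div, div_mul_eq_mul_div, div_eq_div_iff (by positivity) (by positivity)]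
  linear_combination (((P.s:ℂ)^2)⁻¹^p*(P.Qr:ℂ)^(p^2) *
    (1-t*P.Qr^(2*p))*qPoch ((P.κ₂:ℂ)^2) P.Qr p*qPoch (P.Qr/P.s^2) P.Qr p *
    Π((P.Qr:ℂ)/P.s^2*P.Qr^p;P.Qr)*qPoch P.Qr P.Qr p)*f4

lemma isPos_ascInvMass (p:ℕ) : IsPos (P.ascInvMass p) := by
  have hκ2 : P.κ₂^2 < 1 := pow_lt_one₀ h.κ₂_pos.le h.κ₂_lt two_ne_zero
  have hs2 : 0 < P.s^2 := sq_pos_of_ne_zero h.s_ne; have hQp := pow_pos h.Qr_pos p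
  have hQp1 := pow_le_one₀ h.Qr_pos.le h.Qr_lt.le (n := p)
  have t1 : P.κ₂^2/P.s^2 < 1 := h.div_sq_lt_one hκ2.le
  have t2 : P.Qr/P.s^2 < 1 := h.div_sq_lt_one h.Qr_lt.le
  have mlt : ∀ {x : ℝ}, 0 ≤ x → x < 1 → ∀ n, x*P.Qr^n < 1 := fun h0 h1 n =>
    mul_lt_one_left h0 h1 (pow_le_one₀ h.Qr_pos.le h.Qr_lt.le)
  have pI : ∀ {x : ℝ}, x < 1 → IsPos (Π(x;P.Qr)) := isPos_qPochInf h.Qr_pos h.Qr_lt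
  have pF : ∀ {x : ℝ}, x < 1 → ∀ n, IsPos (qPoch x P.Qr n) := isPos_qPoch h.Qr_pos h.Qr_lt
  rw [h.ascInvMass_eq]
  have r1 : IsPos (((P.s:ℂ)^2)⁻¹^p) := by rw [← ofReal_pow]; exact (IsPos.of_real hs2).inv.pow p
  have r2 : IsPos ((P.Qr:ℂ)^(p^2)) := (IsPos.of_real h.Qr_pos).pow _
  have r3 : IsPos (1-(P.κ₂:ℂ)^2/P.s^2*P.Qr^(2*p)) :=
    ⟨1-P.κ₂^2/P.s^2*P.Qr^(2*p), sub_pos.2 (mlt (by positivity) t1 _), by push_cast; rfl⟩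
  have r4 : IsPos (qPoch ((P.κ₂:ℂ)^2) P.Qr p) := by rw [← ofReal_pow]; exact pF hκ2 p
  have r5 : IsPos (Π((P.Qr:ℂ)/P.s^2*P.Qr^p;P.Qr)) := by
    have := pI (mlt (div_nonneg h.Qr_pos.le hs2.le) t2 p); push_cast at this; exact this
  have r6 : IsPos (Π((P.κ₂:ℂ)^2/P.s^2*P.Qr^p;P.Qr)) := by
    have := pI (mlt (div_nonneg (sq_nonneg P.κ₂) hs2.le) t1 p); push_cast at this; exact this
  exact ((((r1.mul r2).mul r3).mul r4).mul r5).div ((pF h.Qr_lt p).mul r6)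

end Admissible

end Params

/-! ### The quotient of the spectral measures -/

/-- The theta function `(z, q / z; q)_∞`. -/
def qTheta (q z:ℂ) : ℂ := Π(z;q)*Π(q/z;q)

lemma qTheta_step {q z : ℂ} (hq : ‖q‖ < 1) (hq0 : q ≠ 0) (hz : z ≠ 0) :
    -z*qTheta q (z*q) = qTheta q z := by
  have e1 : q/(z*q) = z⁻¹ := by field_simp
  rw [qTheta, qTheta, e1, qPochInf_step hq z, qPochInf_step hq z⁻¹, inv_mul_eq_div]; field_simp
  ring

lemma qTheta_mul_pow {q z : ℂ} (hq : ‖q‖ < 1) (hq0 : q ≠ 0) (hz : z ≠ 0) (n:ℕ) :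
    (-z)^n*q^(n.choose 2)*qTheta q (z*q^n) = qTheta q z := by
  induction n with
  | zero => simp
  | succ n ih =>
    have h := qTheta_step hq hq0 (mul_ne_zero hz (pow_ne_zero n hq0))
    rw [← ih, ← h, choose_succ_succ' n 1, choose_one_right]; rw [pow_succ q n, ← mul_assoc z]; ring

/-- The constant in the quotient of the measures `ν` and `m`. -/
def nuRatio (q A B C c b:ℂ) (L p:ℕ) (W:ℂ) : ℂ := Π(A*B;q)^2*(Π(A*b*q^p;q)*Π(B*b*q^p;q)) /
    ((A*B)^L*((A*B*C^2)^p*(q^(p.choose 2))^2) * (Π(A*C*q^p;q)*Π(B*C*q^p;q)) * (Π(q;q)*Π(c*b;q)*W))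

section

variable {q C c Y : ℂ} (hq : ‖q‖ < 1) (hq0 : q ≠ 0) (hC : C ≠ 0) (hCc : C*c = q) (hY : Y ≠ 0)

include hq hq0 hC hCc hY

lemma qTheta_mul_qTheta (L:ℕ) : qTheta q (C/q^L/Y)*qTheta q (C/q^L*Y) =
      ((C/q^L)^2)^L*(q^(L.choose 2))^2*(symPoch C q Y*symPoch c q Y) := by
  have hL := pow_ne_zero L hq0; have hc : c ≠ 0 := fun h => hq0 (by rw [← hCc, h, mul_zero])
  have h1 := qTheta_mul_pow hq hq0 (z := C/q^L/Y) (by positivity) L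
  have h2 := qTheta_mul_pow hq hq0 (z := C/q^L*Y) (by positivity) L
  have e1 : C/q^L/Y*q^L = C*Y⁻¹ := by field_simp
  have e2 : C/q^L*Y*q^L = C*Y := by field_simp
  have e3 : q/(C*Y⁻¹) = c*Y := by rw [← hCc]; field_simp
  have e4 : q/(C*Y) = c*Y⁻¹ := by rw [← hCc]; field_simp
  rw [e1, qTheta, e3] at h1; rw [e2, qTheta, e4] at h2
  have e5 : ((C/q^L)^2)^L = (-(C/q^L/Y))^L*(-(C/q^L*Y))^L := by rw [← mul_pow]; congr 1; field_simp
  rw [← h1, ← h2, e5, symPoch, symPoch]; ring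

end

/-- The quotient of the densities of `ν` and `m` on the interval, up to the factors that do not
depend on `x`. -/
lemma nu_quotient_cont {q ρ C c b u Y α β W : ℂ} {L p : ℕ} (hq : ‖q‖ < 1) (hq0 : q ≠ 0)
    (hC : C ≠ 0) (hCc : C*c = q) (hρ : ρ ≠ 0) (hu : u ≠ 0) (hY : Y ≠ 0)
    (hα : α*(ρ*C*q^p) = q) (hβ : β = ρ*b*q^p)
    (h1 : qTheta q (ρ*u*C) ≠ 0) (h2 : qTheta q (ρ/u*C) ≠ 0) :
    Π(ρ*u*(ρ/u);q)^2*(qTheta q (C/q^L/Y)*qTheta q (C/q^L*Y)) /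
      (symPoch (ρ*u) q Y*symPoch (ρ/u) q Y * (qTheta q (ρ*C/q^L*u)*qTheta q (ρ*C/q^L/u))) *
      (symPoch α q u*symPoch β q u/(Π(q;q)*Π(c*b;q)*W)) =
    nuRatio q (ρ*u) (ρ/u) C c b L p W *
      (symPoch C q Y*symPoch c q Y/(symPoch (ρ*u) q Y*symPoch (ρ/u) q Y)) := by
  have hL := pow_ne_zero L hq0; have hp := pow_ne_zero p hq0
  have hα0 : α ≠ 0 := fun h => hq0 (by rw [← hα, h, zero_mul])
  have a1 := qTheta_mul_pow hq hq0 (z := ρ*C/q^L*u) (by positivity) L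
  have a2 := qTheta_mul_pow hq hq0 (z := ρ*C/q^L/u) (by positivity) L
  have e1 : ρ*C/q^L*u*q^L = ρ*u*C := by field_simp
  have e2 : ρ*C/q^L/u*q^L = ρ/u*C := by field_simp
  rw [e1] at a1; rw [e2] at a2; have b1 := qTheta_mul_pow hq hq0 (z := ρ*u*C) (by positivity) p
  have b2 := qTheta_mul_pow hq hq0 (z := ρ/u*C) (by positivity) p
  have e3 : q/(ρ*u*C*q^p) = α*u⁻¹ := by
    rw [div_eq_iff (by positivity)]; linear_combination -hα-α*ρ*C*q^p*mul_inv_cancel₀ hu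
  have e4 : q/(ρ/u*C*q^p) = α*u := by
    rw [div_eq_iff (by positivity)]; linear_combination -hα-α*ρ*C*q^p*mul_inv_cancel₀ hu
  rw [qTheta, e3] at b1; rw [qTheta, e4] at b2; rw [← b1] at h1; rw [← b2] at h2
  have n1 := left_ne_zero_of_mul (right_ne_zero_of_mul h1)
  have n2 := right_ne_zero_of_mul (right_ne_zero_of_mul h1)
  have n3 := left_ne_zero_of_mul (right_ne_zero_of_mul h2)
  have n4 := right_ne_zero_of_mul (right_ne_zero_of_mul h2)
  have m1 : ρ*u*b*q^p = β*u := by rw [hβ]; ring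
  have m2 : ρ/u*b*q^p = β*u⁻¹ := by rw [hβ]; field_simp
  have p1 : (-(ρ*C/q^L*u))^L*(-(ρ*C/q^L/u))^L = ((C/q^L)^2)^L*(ρ*u*(ρ/u))^L := by
    rw [← mul_pow, ← mul_pow]; congr 1; field_simp
  have p2 : (-(ρ*u*C))^p*(-(ρ/u*C))^p = (ρ*u*(ρ/u)*C^2)^p := by rw [← mul_pow]; congr 1; ring
  have hΘ : qTheta q (ρ*C/q^L*u)*qTheta q (ρ*C/q^L/u) =
      ((C/q^L)^2)^L*(q^(L.choose 2))^2*((ρ*u*(ρ/u))^L * ((ρ*u*(ρ/u)*C^2)^p*(q^(p.choose 2))^2) *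
        (Π(ρ*u*C*q^p;q)*Π(ρ/u*C*q^p;q))*symPoch α q u) := by
    rw [← a1, ← a2, ← b1, ← b2, ← p2, symPoch]
    linear_combination (q^(L.choose 2)*(-(ρ*u*C))^p*q^(p.choose 2) * (Π(ρ*u*C*q^p;q)*Π(α*u⁻¹;q)) *
      (q^(L.choose 2)*(-(ρ/u*C))^p*q^(p.choose 2) *
      (Π(ρ/u*C*q^p;q)*Π(α*u;q))))*p1
  have n5 : symPoch α q u ≠ 0 := mul_ne_zero n4 n2
  have n6 : ((C/q^L)^2)^L*(q^(L.choose 2))^2 ≠ 0 := by positivity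
  rw [qTheta_mul_qTheta hq hq0 hC hCc hY, nuRatio, m1, m2, hΘ,
    show symPoch β q u = Π(β*u;q)*Π(β*u⁻¹;q) from rfl]
  generalize ((C/q^L)^2)^L*(q^(L.choose 2))^2 = K at n6 ⊢; generalize symPoch α q u = S at n5 ⊢
  generalize (ρ*u*(ρ/u))^L*((ρ*u*(ρ/u)*C^2)^p*(q^(p.choose 2))^2) *
        (Π(ρ*u*C*q^p;q)*Π(ρ/u*C*q^p;q)) = T
  have : ∀ c0 SC Sc SA SB z1 z2 D : ℂ, c0*(K*(SC*Sc))/(SA*SB*(K*(T*S))) *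
      (S*(z1*z2)/D) = c0*(z1*z2)/(T*D)*(SC*Sc/(SA*SB)) := by
    intro c0 SC Sc SA SB z1 z2 D
    have : c0*(K*(SC*Sc))/(SA*SB*(K*(T*S)))*(S*(z1*z2)/D) =
        (K*S)/(K*S)*(c0*(z1*z2)/(T*D)*(SC*Sc/(SA*SB))) := by
      simp only [div_eq_mul_inv, mul_inv]; ring
    rw [this, div_self (mul_ne_zero n6 n5), one_mul]
  exact this _ _ _ _ _ _ _ _

lemma sq_pow_choose_two (q:ℂ) (n:ℕ) : (q^(n.choose 2))^2 = q^((n:ℤ)^2-n) := by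
  have h : (2*n.choose 2+n:ℤ) = (n:ℤ)^2 := by
    rcases n with _ | n
    · simp
    · have : (2*(n+1).choose 2 : ℤ) = (n+1)*n := by exact_mod_cast two_mul_choose_two n
      rw [this]; push_cast; ring
  rw [← h, add_sub_cancel_right, ← pow_mul, ← zpow_natCast]; congr 1; push_cast; ring

/-- The masses of the Al-Salam-Chihara measure in base `q`. -/
lemma awMass_asc {q : ℝ} (hq0 : 0 < q) (hq1 : q < 1) {α β : ℂ} {k : ℕ} (h : 1 < ‖α*q^k‖)
    (hαβ : ‖α*β‖ < 1) :
    awMass α β 0 0 q k = Π(α*β;q)*(1-((α*q^k)^2)⁻¹) * ((q:ℂ)^(1+k)/(α*q^k)^2)^k*Π(q/(α*(α*q^k));q) /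
      (qPoch q q k*symPoch β q (α*q^k)) := by
  have hq := norm_lt_one hq0 hq1; have hqc := ofReal_ne hq0; have hqk := pow_ne_zero k hqc
  have hu : α*q^k ≠ 0 := fun h0 => by rw [h0, norm_zero] at h; linarith
  have hα : α ≠ 0 := left_ne_zero_of_mul hu; rw [awMass_eq hq0 hq1 h hαβ (by simp) (by simp)]
  set u := α*q^k with hudef; have h1 := qPoch_inv_mul_inv_pow hqc (x := α*u/q) (by positivity) k
  have h2 := qPoch_inv_mul_inv_pow hqc (x := 1) one_ne_zero k
  have e1 : (α*u/q)⁻¹*((q:ℂ)^k)⁻¹ = (u^2)⁻¹*q := by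
    rw [inv_div, ← mul_left_inj' hqk]; rw [hudef]; field_simp
  have e2 : α*u/q*q = α^2*q^k := by rw [hudef]; field_simp
  rw [e1, e2] at h1; simp only [inv_one, one_mul] at h2; have h3 := qPochInf_step hq (u^2)⁻¹
  have h4 := qPochInf_split hq ((u^2)⁻¹*q) k
  have e3 : (u^2)⁻¹*q*q^k = q/(α*u) := by rw [hudef]; field_simp
  rw [e3] at h4
  have n1 : qPoch ((u^2)⁻¹*q) q k ≠ 0 := by
    refine qPoch_ne hq ?_ k; rw [norm_mul, norm_inv, norm_pow]
    have : 1 ≤ ‖u‖ ^ 2 := one_le_pow₀ h.le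
    exact (mul_le_of_le_one_left (norm_nonneg _) (inv_le_one_of_one_le₀ this)).trans_lt hq
  have n2 := qPoch_ne hq hq k; have n3 := qPochInf_ne hq hq
  have n4 : (q:ℂ)^((k+1).choose 2) ≠ 0 := pow_ne_zero _ hqc
  have n5 : (-(α*u/q))^k ≠ 0 := pow_ne_zero _ (neg_ne_zero.2 (div_ne_zero (mul_ne_zero hα hu) hqc))
  have n6 : qPoch ((q:ℂ)^k)⁻¹ q k ≠ 0 := by rw [← h2] at n2; exact right_ne_zero_of_mul n2
  have e4 : ((q:ℂ)^(1+k)/u^2)^k*(-(α*u/q))^k = (-1)^k := by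
    rw [← mul_pow]; congr 1; rw [hudef, pow_add]; field_simp
  have key : Π((u^2)⁻¹;q)/(qPoch (α^2*q^k) q k*qPoch ((q:ℂ)^k)⁻¹ q k *
      Π(q;q)) = (1-(u^2)⁻¹)*((q:ℂ)^(1+k)/u^2)^k * Π(q/(α*u);q)/(qPoch q q k*Π(q;q)) := by
    rw [h3, h4, ← h1, ← h2]; have n7 : (-1:ℂ)^k ≠ 0 := pow_ne_zero _ (by norm_num)
    rw [div_eq_div_iff (by simp only [ne_eq, mul_eq_zero, not_or]; tauto)
      (by simp only [ne_eq, mul_eq_zero, not_or]; tauto)]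
    linear_combination (-(1-(u^2)⁻¹)*Π(q/(α*u);q)*q^((k+1).choose 2) *
      qPoch ((u^2)⁻¹*q) q k*qPoch ((q:ℂ)^k)⁻¹ q k*Π(q;q))*e4
  rw [key]
  simp only [qPochInfs_cons, qPochInfs_nil, mul_zero,
    qPochInf_zero_left, mul_one, symPoch_zero_left, div_one]
  field_simp

/-- The quotient of the masses of `ν` and `m`, up to the factors that depend on `y`. -/
lemma nu_quotient_disc {q : ℝ} (hq0 : 0 < q) (hq1 : q < 1) {ρ C c b u α β W M : ℂ} {L p k : ℕ}
    {i : ℤ} (hC : C ≠ 0) (hCc : C*c = q) (hρ : ρ ≠ 0) (hi : i+k+1 = L+p)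
    (hα : α*(ρ*C*q^p) = q) (hβ : β = ρ*b*q^p) (hu : u = α*q^k)
    (h : 1 < ‖u‖) (hcb : ‖c*b‖ < 1) (hM : M = awMass α β 0 0 q k)
    (hBC : Π(ρ/u*C*q^p;q) ≠ 0) :
    Π(ρ*u*(ρ/u);q)^2*(((C/q^L)^2)^L*(q^(L.choose 2))^2) / Π(q;q)^2*(1-(ρ*C/(q:ℂ)^L)^2*(q:ℂ)^(2*i)) *
      (ρ*C/(q:ℂ)^L)^(-2*i-2)*(q:ℂ)^(-i*(i+1))/(W*M) =
    nuRatio q (ρ*u) (ρ/u) C c b L p W := by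
  have hq := norm_lt_one hq0 hq1; have hqc := ofReal_ne hq0; have hL := pow_ne_zero L hqc
  have hp := pow_ne_zero p hqc; have hk := pow_ne_zero k hqc
  have hα0 : α ≠ 0 := fun h => hqc (by rw [← hα, h, zero_mul])
  have hu0 : u ≠ 0 := hu ▸ mul_ne_zero hα0 hk
  have hαβ : α*β = c*b := by rw [hβ, ← mul_left_inj' hC]; linear_combination b*hα-b*hCc
  rw [awMass_asc hq0 hq1 (hu ▸ h) (hαβ ▸ hcb), ← hu, hαβ] at hM
  have e1 : ρ*u*C*q^p = q*q^k := by rw [hu]; linear_combination (q:ℂ)^k*hα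
  have e2 : ρ/u*C*q^p = q/(α*u) := by
    rw [eq_div_iff (by positivity)]; field_simp; linear_combination hα
  have m1 : ρ*u*b*q^p = β*u := by rw [hβ]; ring
  have m2 : ρ/u*b*q^p = β*u⁻¹ := by rw [hβ]; field_simp
  have hv : u = (ρ*C)⁻¹*(q:ℂ)^(1+k-p:ℤ) := by
    rw [hu, zpow_sub₀ hqc, zpow_add₀ hqc, zpow_one, zpow_natCast, zpow_natCast]; field_simp
    linear_combination hα
  have hdu : ρ*C/(q:ℂ)^L*(q:ℂ)^i = u⁻¹ := by
    have : i = L+p-k-1 := by omega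
    rw [hv, this, mul_inv, inv_inv, ← zpow_neg, div_eq_mul_inv, ← zpow_natCast, ← zpow_neg,
      mul_assoc, ← zpow_add₀ hqc]
    congr 2; ring
  have e3 : (ρ*C/(q:ℂ)^L)^2*(q:ℂ)^(2*i) = (u^2)⁻¹ := by
    rw [← inv_pow, ← hdu, mul_pow, two_mul, zpow_add₀ hqc, sq ((q:ℂ)^i)]
  have hpow : ((C/(q:ℂ)^L)^2)^L*(q^(L.choose 2))^2 * (ρ*C/(q:ℂ)^L)^(-2*i-2)*(q:ℂ)^(-i*(i+1)) *
      ((ρ*u*(ρ/u))^L*((ρ*u*(ρ/u)*C^2)^p*(q^(p.choose 2))^2)) =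
      ((q:ℂ)^(1+k)/u^2)^k := by
    have hv0 : ρ*C ≠ 0 := mul_ne_zero hρ hC; have f0 : ρ*u*(ρ/u) = ρ^2 := by field_simp
    have f1 : ((C/(q:ℂ)^L)^2)^L*(ρ^2)^L = (ρ*C)^(2*L:ℤ)*(q:ℂ)^(-2*(L:ℤ)^2) := by
      rw [show (-2*(L:ℤ)^2) = -((L*2*L:ℕ):ℤ) by push_cast; ring, zpow_neg,
        show (2*L:ℤ) = ((2*L:ℕ):ℤ) by push_cast; rfl, zpow_natCast, zpow_natCast,
        pow_mul (ρ*C), pow_mul (q:ℂ), pow_mul (q:ℂ), ← inv_pow, ← mul_pow, ← mul_pow]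
      field_simp; rw [div_eq_mul_one_div, mul_pow]
    have f2 : (ρ^2*C^2)^p = (ρ*C)^(2*p:ℤ) := by
      rw [show (2*p:ℤ) = ((2*p:ℕ):ℤ) by push_cast; rfl, zpow_natCast, ← mul_pow, pow_mul]
    have f3 : (ρ*C/(q:ℂ)^L)^(-2*i-2) = (ρ*C)^(-2*i-2)*(q:ℂ)^(-L*(-2*i-2)) := by
      rw [div_zpow, zpow_mul, zpow_neg, zpow_natCast, inv_zpow, div_eq_mul_inv]
    have f4' : (q:ℂ)^(1+k)/u^2 = (ρ*C)^(2:ℤ)*(q:ℂ)^(1+k-2*(1+k-p) : ℤ) := by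
      rw [hv, zpow_sub₀ hqc _ (2*_), two_mul, zpow_add₀ hqc, mul_pow, inv_pow, zpow_ofNat,
        show (1+k:ℤ) = ((1+k:ℕ):ℤ) by push_cast; rfl, zpow_natCast]
      field_simp; rw [zpow_add₀ hqc, pow_add, pow_one]; ring
    have f4 : ((q:ℂ)^(1+k)/u^2)^k = (ρ*C)^(2*k:ℤ)*(q:ℂ)^((1+k-2*(1+k-p))*k : ℤ) := by
      rw [f4', mul_pow, ← zpow_natCast, ← zpow_natCast, ← zpow_mul, ← zpow_mul]
    have hii : i = L+p-k-1 := by omega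
    rw [f0, f2, f3, f4, sq_pow_choose_two, sq_pow_choose_two]
    calc _ = ((C/(q:ℂ)^L)^2)^L*(ρ^2)^L*q^((L:ℤ)^2-L) *
          ((ρ*C)^(-2*i-2)*(q:ℂ)^(-L*(-2*i-2)))*(q:ℂ)^(-i*(i+1)) *
          ((ρ*C)^(2*p:ℤ)*q^((p:ℤ)^2-p)) := by ring
      _ = (ρ*C)^((2*L:ℤ)+(-2*i-2)+2*p) *
          (q:ℂ)^(-2*(L:ℤ)^2+((L:ℤ)^2-L)+(-L*(-2*i-2))+(-i*(i+1)) + ((p:ℤ)^2-p)) := by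
        rw [f1, zpow_add₀ hv0, zpow_add₀ hv0, zpow_add₀ hqc, zpow_add₀ hqc, zpow_add₀ hqc,
          zpow_add₀ hqc]
        ring
      _ = _ := by
        rw [hii]; congr 2 <;> ring
  have n1 := qPochInf_ne hq hq; have n2 := qPochInf_split hq (q:ℂ) k
  have n3 : 1-(u^2)⁻¹ ≠ 0 := by
    intro h0; have h1 : (u^2)⁻¹ = 1 := (sub_eq_zero.1 h0).symm; have h2 := congrArg norm h1
    rw [norm_inv, norm_pow, norm_one, inv_eq_one] at h2
    exact absurd h2 (one_lt_pow₀ h two_ne_zero).ne'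
  have n4 := qPochInf_ne hq hcb; have n5 : ((q:ℂ)^(1+k)/u^2)^k ≠ 0 := by positivity
  have n6 := qPoch_ne hq hq k; have n13 : Π((q:ℂ)/(α*u);q) ≠ 0 := e2 ▸ hBC
  rw [e3, nuRatio, m1, m2, e1, e2, hM, show symPoch β q u = Π(β*u;q) * Π(β*u⁻¹;q) from rfl]
  have n7 : Π((q:ℂ)*q^k;q) ≠ 0 := right_ne_zero_of_mul (n2 ▸ n1); rw [← hpow] at n5 ⊢; rw [n2]
  generalize Π(β*u;q)*Π(β*u⁻¹;q) = z; generalize ((C/(q:ℂ)^L)^2)^L*(q^(L.choose 2))^2 = x₁ at n5 ⊢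
  generalize (ρ*C/(q:ℂ)^L)^(-2*i-2) = x₂ at n5 ⊢; generalize (q:ℂ)^(-i*(i+1)) = x₃ at n5 ⊢
  generalize (ρ*u*(ρ/u))^L*((ρ*u*(ρ/u)*C^2)^p*(q^(p.choose 2))^2) = x₄ at n5 ⊢
  have n8 := right_ne_zero_of_mul n5; have n9 := right_ne_zero_of_mul (left_ne_zero_of_mul n5)
  have n10 := left_ne_zero_of_mul (left_ne_zero_of_mul n5); have n11 := left_ne_zero_of_mul n10
  have n12 := right_ne_zero_of_mul n10; rcases eq_or_ne z 0 with rfl | hz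
  · simp
  rcases eq_or_ne W 0 with rfl | hW
  · simp
  generalize 1-(u^2)⁻¹ = v at n3 ⊢; field_simp

lemma continuousOn_hInf {q : ℂ} (hq : ‖q‖ < 1) (f:ℂ) : ContinuousOn (hInf f q) (Icc (-1) 1) := by
  have h : Continuous fun t : ℝ => symPoch f q (exp ((arccos t:ℝ)*I)) := by
    have he : Continuous fun t : ℝ => exp ((arccos t:ℝ)*I) := Complex.continuous_exp.comp
        ((Complex.continuous_ofReal.comp Real.continuous_arccos).mul continuous_const)
    exact ((continuous_qPochInf hq).comp (continuous_const.mul he)).mul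
      ((continuous_qPochInf hq).comp (continuous_const.mul (he.inv₀ fun t => exp_ne_zero _)))
  refine h.continuousOn.congr fun t ht => ?_; refine hInf_eq (exp_ne_zero _) ?_
  rw [exp_add_inv, cos_arccos ht.1 ht.2]

lemma IsPos.re_div_mul {W M : ℂ} (X g:ℂ) (hW : IsPos W) (hM : IsPos M) :
    (X*g).re/(W.re*M.re) = (X/(W*M)*g).re := by
  have e : X/(W*M)*g = X*g/((W.re*M.re:ℝ):ℂ) := by rw [ofReal_mul, hW.coe_re, hM.coe_re]; ring
  rw [e, Complex.div_ofReal_re]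

namespace Params.Admissible

variable {P : Params} (h : P.Admissible)

include h

/-- The density of `ν` in terms of theta functions. -/
lemma nuDensity_eq {u Y : ℂ} (hu : u ≠ 0) (hY : Y ≠ 0) : P.nuDensity u Y =
    1/(2*π)*(Π(u^2;P.Qr)*Π((u^2)⁻¹;P.Qr)) * (Π(P.q/P.s*u*(P.q/P.s/u);P.Qr)^2 *
        (qTheta P.Qr (P.pC/P.Qr^P.L/Y)*qTheta P.Qr (P.pC/P.Qr^P.L*Y)) /
      (symPoch (P.q/P.s*u) P.Qr Y*symPoch (P.q/P.s/u) P.Qr Y *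
        (qTheta P.Qr (P.q/P.s*P.pC/P.Qr^P.L*u) * qTheta P.Qr (P.q/P.s*P.pC/P.Qr^P.L/u)))) := by
  have hs := h.ofReal_s_ne
  have e0 : (P.Qr:ℂ)/P.s^2 = P.q/P.s*u*(P.q/P.s/u) := by rw [Qr]; push_cast; field_simp
  have e1 : (P.q:ℂ)*P.pC/P.Qr^P.L/P.s = P.q/P.s*P.pC/P.Qr^P.L := by ring
  have e2 : ∀ z : ℂ, (P.Qr:ℂ)*u/z = P.Qr/(z/u) := fun z => by grind
  simp only [nuDensity, P.Q_eq, h.qp_eps, h.qp_eps', e0, e1, e2, qPochInfs, List.map_cons,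
    List.map_nil, List.prod_cons, List.prod_nil, mul_one, qTheta, symPoch]
  have e3 : (P.q:ℂ)*u/(P.s*Y) = P.q/P.s*u*Y⁻¹ := by field_simp
  have e4 : (P.q:ℂ)/(P.s*u*Y) = P.q/P.s/u*Y⁻¹ := by field_simp
  have e5 : (P.q:ℂ)*Y*u/P.s = P.q/P.s*u*Y := by field_simp
  have e6 : (P.q:ℂ)*Y/(u*P.s) = P.q/P.s/u*Y := by field_simp
  grind

lemma ascA_mul (p:ℕ) : P.ascA p*(P.q/P.s*P.pC*(P.Qr:ℂ)^p) = P.Qr := by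
  have := h.ofReal_s_ne; have := h.ofReal_κ₁_ne; have := h.ofReal_κ₂_ne
  have := pow_ne_zero p h.ofReal_Qr_ne
  rw [h.ascA_eq, pC]; push_cast; field_simp; rw [Qr]; push_cast; rfl

lemma ascB_eq' (p:ℕ) : P.ascB p = P.q/P.s*P.pb*(P.Qr:ℂ)^p := by
  have := h.ofReal_s_ne; have := h.ofReal_q_ne; rw [h.ascB_eq, pb]; push_cast; field_simp

lemma ascA_mul_ascB (p:ℕ) : P.ascA p*P.ascB p = ((P.κ₁^2:ℝ):ℂ) := by
  have := h.ofReal_s_ne; have := h.ofReal_κ₂_ne; have := pow_ne_zero p h.ofReal_Qr_ne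
  rw [h.ascA_eq, h.ascB_eq]; push_cast; field_simp

lemma awWeight_asc (p:ℕ) (θ:ℝ) : ((awWeight (P.ascA p) (P.ascB p) 0 0 P.Q θ : ℝ) : ℂ) =
    1/(2*π)*(Π(P.Qr;P.Qr)*Π(P.pc*P.pb;P.Qr)) * (Π(exp (θ*I)^2;P.Qr) * Π((exp (θ*I)^2)⁻¹;P.Qr)) /
      (symPoch (P.ascA p) P.Qr (exp (θ*I)) * symPoch (P.ascB p) P.Qr (exp (θ*I))) := by
  have hcos := exp_add_inv θ
  have hA : P.ascA p = ((P.s*P.κ₁/(P.κ₂*P.Qr^p) : ℝ) : ℂ) := by rw [h.ascA_eq]; push_cast; rfl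
  have hB : P.ascB p = ((P.κ₁*P.κ₂*P.Qr^p/P.s:ℝ):ℂ) := by rw [h.ascB_eq]; push_cast; rfl
  have hpos : IsPos (Π(P.Qr;P.Qr)*Π(P.ascA p*P.ascB p;P.Qr)) := by
    rw [h.ascA_mul_ascB]
    exact (isPos_qPochInf h.Qr_pos h.Qr_lt h.Qr_lt).mul (isPos_qPochInf h.Qr_pos h.Qr_lt
      (pow_lt_one₀ h.κ₁_pos.le h.κ₁_lt two_ne_zero))
  have hcb : (P.pc:ℂ)*P.pb = P.ascA p*P.ascB p := by
    rw [h.ascA_mul_ascB, ← h.pc_mul_pb]; push_cast; rfl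
  rw [hcb, ← hInf_eq (exp_ne_zero _) hcos, ← hInf_eq (exp_ne_zero _) hcos]
  have e1 : exp (2*I*θ) = exp (θ*I)^2 := by rw [← Complex.exp_nat_mul]; congr 1; push_cast; ring
  have e2 : exp (I*θ) = exp (θ*I) := by rw [mul_comm]
  simp only [awWeight, P.Q_eq, qPochInfs_cons, qPochInfs_nil, mul_zero, zero_mul, qPochInf_zero_left, mul_one, div_one, e1, e2]
  rw [norm_div, div_pow, norm_mul, mul_pow, ofReal_mul, ofReal_mul, hpos.coe_re,
    ofReal_div, ofReal_div, sq_norm_qPochInf_exp_sq h.Qr_pos h.Qr_lt, ofReal_mul, ofReal_mul]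
  rw [hA, hB, sq_norm_qPochInf_exp h.Qr_pos h.Qr_lt, sq_norm_qPochInf_exp h.Qr_pos h.Qr_lt]
  push_cast; ring

lemma norm_rho_mul_C_lt : ‖(P.q/P.s*P.pC:ℂ)‖ < 1 := by
  have h1 : |P.q/P.s| ≤ P.Qr := by
    have hs := abs_pos.2 h.s_ne; rw [abs_div, abs_of_pos h.q_pos, div_le_iff₀ hs, Qr]
    have := mul_le_mul_of_nonneg_left h.s_large (sq_nonneg P.q)
    have h2 : P.q^2*P.q⁻¹ = P.q := by grind
    linarith
  rw [← ofReal_div, ← ofReal_mul, norm_real, norm_eq_abs, abs_mul, abs_of_pos h.pC_pos]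
  exact mul_lt_one_left (abs_nonneg _) (h1.trans_lt h.Qr_lt) (h.pC_le.trans h.q_lt_one.le)

lemma qTheta_rho_ne_zero {θ : ℝ} (hθ : θ ∈ Ioo 0 π) {v : ℂ}
    (hv : v = exp (θ*I) ∨ v = (exp (θ*I))⁻¹) :
    qTheta P.Qr (P.q/P.s*P.pC*v) ≠ 0 := by
  have hq := h.norm_Qr_lt
  have hvn : ‖v‖ = 1 := by rcases hv with rfl | rfl <;> simp [Complex.norm_exp_ofReal_mul_I]
  refine mul_ne_zero (qPochInf_ne hq ?_) ?_
  · rw [norm_mul, hvn, mul_one]; exact h.norm_rho_mul_C_lt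
  · have h1 := qPochInf_exp_ne_zero h.Qr_pos h.Qr_lt (P.Qr/(P.q/P.s*P.pC)) hθ.1 hθ.2
    have h2 : (P.Qr:ℂ)/(P.q/P.s*P.pC*v) = ((P.Qr/(P.q/P.s*P.pC) : ℝ) : ℂ)*v⁻¹ := by
      push_cast; rw [← div_div, div_eq_mul_inv _ v]
    rw [h2]; rcases hv with rfl | rfl
    · intro h3; refine h1 ?_
      rw [← map_eq_zero (conj), conj_qPochInf _ hq, map_mul, conj_ofReal,
        ← exp_conj, map_mul, conj_ofReal, Complex.conj_I, mul_neg, exp_neg]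
      exact h3
    grind

/-- The quotient of `ν` and `m` on the interval. -/
lemma nuOverM_cont (p:ℕ) {x y : ℝ} (hx : x ∈ Icc (-1:ℝ) 1) {u : ℂ} (hu : u ≠ 0)
    (hux : u+u⁻¹ = 2*x) (hy : ‖(P.q/P.s:ℂ)*expArg y‖ < 1)
    (hy' : ‖(P.q/P.s:ℂ)*(expArg y)⁻¹‖ < 1) :
    SpecPoint.nuOverM P p y (.cont x) =
      (nuRatio P.Qr (P.q/P.s*u) (P.q/P.s/u) P.pC P.pc P.pb P.L p (P.ascInvMass p) *
        (hInf P.pC P.Qr y*hInf P.pc P.Qr y /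
          (hInf (P.q/P.s*u) P.Qr y*hInf (P.q/P.s/u) P.Qr y))).re := by
  have hq := h.norm_Qr_lt; have hρ0 : (P.q/P.s:ℂ) ≠ 0 := div_ne_zero h.ofReal_q_ne h.ofReal_s_ne
  set ρ : ℂ := P.q/P.s with hρ; set Y := expArg y with hYdef; have hY : Y ≠ 0 := expArg_ne_zero y
  set W := P.ascInvMass p with hW; have hC0 := ofReal_ne h.pC_pos
  have hCc : (P.pC:ℂ)*P.pc = P.Qr := by exact_mod_cast h.pC_mul_pc
  -- The quotient as a function of `x`, with the common zeros cancelled.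
  let G : ℝ → ℂ := fun t => Π(ρ*ρ;P.Qr)^2*hInf (P.ascB p) P.Qr t /
    ((ρ*ρ)^P.L*((ρ*ρ*P.pC^2)^p*((P.Qr:ℂ)^(p.choose 2))^2) * hInf (ρ*P.pC*P.Qr^p) P.Qr t *
      (Π(P.Qr;P.Qr)*Π(P.pc*P.pb;P.Qr)*W)) *
    (hInf P.pC P.Qr y*hInf P.pc P.Qr y/(hInf (ρ*Y) P.Qr t*hInf (ρ*Y⁻¹) P.Qr t))
  have hG : ∀ {t : ℝ} {v : ℂ}, v ≠ 0 → v+v⁻¹ = 2*t → G t =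
      nuRatio P.Qr (ρ*v) (ρ/v) P.pC P.pc P.pb P.L p W * (hInf P.pC P.Qr y*hInf P.pc P.Qr y /
          (hInf (ρ*v) P.Qr y*hInf (ρ/v) P.Qr y)) := by
    intro t v hv hvt; have e1 : ρ*v*(ρ/v) = ρ*ρ := by field_simp
    have e2 : hInf (P.ascB p) P.Qr t = Π(ρ*v*P.pb*P.Qr^p;P.Qr) * Π(ρ/v*P.pb*P.Qr^p;P.Qr) := by
      rw [hInf_eq hv hvt, symPoch, h.ascB_eq']; congr 2 <;> (rw [hρ]; ring)
    have e3 : hInf (ρ*P.pC*P.Qr^p) P.Qr t = Π(ρ*v*P.pC*P.Qr^p;P.Qr) * Π(ρ/v*P.pC*P.Qr^p;P.Qr) := by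
      rw [hInf_eq hv hvt, symPoch]; congr 2 <;> ring
    have e4 : hInf (ρ*Y) P.Qr t*hInf (ρ*Y⁻¹) P.Qr t = hInf (ρ*v) P.Qr y*hInf (ρ/v) P.Qr y := by
      rw [hInf_eq hv hvt, hInf_eq hv hvt, hInf, hInf, symPoch, symPoch, symPoch, symPoch, ← hYdef]
      ring
    simp only [G, nuRatio]; grind
  have hcont : ContinuousOn G (Icc (-1) 1) := by
    have hne : ∀ {f : ℂ}, ‖f‖ < 1 → ∀ t ∈ Icc (-1:ℝ) 1, hInf f P.Qr t ≠ 0 := by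
      intro f hf t ht; rw [← cos_arccos ht.1 ht.2, hInf_eq (exp_ne_zero _) (exp_add_inv _)]
      exact symPoch_ne hq hf (Complex.norm_exp_ofReal_mul_I _)
    have n1 : ‖ρ*P.pC*(P.Qr:ℂ)^p‖ < 1 := by
      rw [norm_mul, norm_pow]
      exact mul_lt_one_left (norm_nonneg _) h.norm_rho_mul_C_lt (pow_le_one₀ (norm_nonneg _) hq.le)
    have n2 : (ρ*ρ)^P.L*((ρ*ρ*P.pC^2)^p*((P.Qr:ℂ)^(p.choose 2))^2) ≠ 0 := by
      have := h.ofReal_Qr_ne; positivity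
    have n3 : Π(P.Qr;P.Qr)*Π(P.pc*P.pb;P.Qr)*W ≠ 0 := by
      refine mul_ne_zero (mul_ne_zero (isPos_qPochInf h.Qr_pos h.Qr_lt h.Qr_lt).ne_zero ?_)
        (h.isPos_ascInvMass p).ne_zero
      rw [← ofReal_mul, h.pc_mul_pb]
      exact (isPos_qPochInf h.Qr_pos h.Qr_lt (pow_lt_one₀ h.κ₁_pos.le h.κ₁_lt two_ne_zero)).ne_zero
    refine ContinuousOn.mul (ContinuousOn.div (continuousOn_const.mul (continuousOn_hInf hq _))
      ((continuousOn_const.mul (continuousOn_hInf hq _)).mul continuousOn_const) fun t ht => ?_)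
      (ContinuousOn.div continuousOn_const ((continuousOn_hInf hq _).mul (continuousOn_hInf hq _))
        fun t ht => ?_)
    · exact mul_ne_zero (mul_ne_zero n2 (hne n1 t ht)) n3
    · exact mul_ne_zero (hne hy t ht) (hne hy' t ht)
  rw [← hG hu hux]; have hcl : x ∈ closure (Ioo (-1:ℝ) 1) := by rwa [closure_Ioo (by norm_num)]
  refine extendFrom_eq hcl ?_
  have hlim : Tendsto (fun t => (G t).re) (𝓝[Ioo (-1) 1] x) (𝓝 (G x).re) :=
    (Complex.continuous_re.tendsto _).comp
      ((hcont x hx).mono_left (nhdsWithin_mono _ Set.Ioo_subset_Icc_self))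
  refine hlim.congr' ?_; filter_upwards [self_mem_nhdsWithin] with t ht
  have hθ : arccos t ∈ Ioo 0 π := by
    refine ⟨Real.arccos_pos.2 ht.2, lt_of_le_of_ne (Real.arccos_le_pi t) fun h0 => ?_⟩
    rw [Real.arccos_eq_pi] at h0; linarith [ht.1]
  have hct : cos (arccos t) = t := cos_arccos ht.1.le ht.2.le
  set v := exp ((arccos t:ℝ)*I) with hvdef; have hv0 : v ≠ 0 := exp_ne_zero _
  have hvt : v+v⁻¹ = 2*t := by rw [exp_add_inv, hct]
  have hnu : P.nuDensity (expArg t) Y = P.nuDensity v Y := by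
    rcases expArg_eq_or hv0 hvt with h1 | h1
    · rw [h1]
    · rw [h1, h.nuDensity_eq (inv_ne_zero hv0) hY, h.nuDensity_eq hv0 hY]
      simp only [inv_pow, inv_inv, div_inv_eq_mul, ← div_eq_mul_inv]
      rw [mul_comm (qPochInf (v^2)⁻¹ _), mul_comm (P.q/P.s/v:ℂ), mul_comm (symPoch _ _ _),
        mul_comm (qTheta _ (P.q/P.s*P.pC/P.Qr^P.L/v))]
  have hw := h.awWeight_asc p (arccos t); rw [← hvdef] at hw
  have hN : Π(v^2;P.Qr)*Π((v^2)⁻¹;P.Qr) ≠ 0 := by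
    have n : ∀ e : ℝ, Π(e*v;P.Qr) ≠ 0 := fun e => qPochInf_exp_ne_zero h.Qr_pos h.Qr_lt e hθ.1 hθ.2
    have h1 := qPochInf_sq hq (p := (P.q:ℂ)) (by rw [Qr]; push_cast; rfl) v
    have h2 : Π(v^2;P.Qr) ≠ 0 := by
      rw [← h1]; refine mul_ne_zero (mul_ne_zero ?_ ?_) (mul_ne_zero (n _) ?_)
      · simpa using n 1
      · simpa using n (-1)
      · simpa using n (-P.q)
    rw [← sq_norm_qPochInf_exp_sq h.Qr_pos h.Qr_lt]
    exact_mod_cast pow_ne_zero 2 (norm_ne_zero_iff.2 h2)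
  have e1 := nu_quotient_cont (b := P.pb) (Y := Y) (W := W) (L := P.L) hq h.ofReal_Qr_ne hC0 hCc hρ0
    hv0 hY (h.ascA_mul p) (h.ascB_eq' p)
    (by rw [mul_right_comm]; exact h.qTheta_rho_ne_zero hθ (Or.inl rfl))
    (by rw [div_mul_eq_mul_div, div_eq_mul_inv]; exact h.qTheta_rho_ne_zero hθ (Or.inr rfl))
  rw [hG hv0 hvt, hnu]; have hWre := (h.isPos_ascInvMass p).coe_re; rw [← hW] at hWre ⊢
  rw [← Complex.div_ofReal_re]; congr 1
  rw [ofReal_mul, hWre, hw, h.nuDensity_eq hv0 hY, ← hρ, hInf, hInf, hInf, hInf, ← hYdef, ← e1]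
  have hpi : (1/(2*π) : ℂ) ≠ 0 := by simp
  generalize Π(v^2;P.Qr)*Π((v^2)⁻¹;P.Qr) = N at hN ⊢; generalize (1/(2*π) : ℂ) = t at hpi ⊢
  have gen : ∀ X S z : ℂ, t*N*X/(W*(t*z*N/S)) = X*(S/(z*W)) := fun X S z => by
    have : t*N*X/(W*(t*z*N/S)) = (t*N)/(t*N)*(X*(S/(z*W))) := by
      simp only [div_eq_mul_inv, mul_inv, inv_inv]; ring
    rw [this, div_self (mul_ne_zero hpi hN), one_mul]
  rw [gen]

lemma uDisc_eq_ascA {p l : ℕ} (hl : l ≤ P.K+p) : (uDisc P l:ℂ) = P.ascA p*(P.Qr:ℂ)^(P.K+p-l) := by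
  obtain ⟨k, hk⟩ := exists_eq_add_of_le hl; have h1 := pow_ne_zero p h.ofReal_Qr_ne
  have h2 := pow_ne_zero l h.ofReal_Qr_ne; have h3 := h.ofReal_κ₂_ne
  have h4 : (P.Qr:ℂ)^P.K*P.Qr^p = P.Qr^l*P.Qr^k := by rw [← pow_add, ← pow_add, hk]
  rw [h.uDisc_eq, h.ascA_eq, hk, Nat.add_sub_cancel_left]; push_cast; grind

lemma ofReal_uDisc_ne (l:ℕ) : (uDisc P l:ℂ) ≠ 0 := by
  have := h.one_lt_abs_uDisc l; intro h0; rw [Complex.ofReal_eq_zero] at h0; grind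

lemma rho_ne : (P.q/P.s:ℂ) ≠ 0 := div_ne_zero h.ofReal_q_ne h.ofReal_s_ne

lemma pC_mul_zpow (l:ℕ) : (P.pC:ℂ)/(P.Qr:ℂ)^P.L *
    (P.Qr:ℂ)^((P.L:ℤ)-1-P.K+l) = (P.q/P.s*uDisc P l:ℂ)⁻¹ := by
  have h1 := h.ofReal_s_ne; have h2 := h.ofReal_κ₁_ne; have h3 := h.ofReal_κ₂_ne
  have h4 := h.ofReal_q_ne; have h5 := h.ofReal_Qr_ne
  rw [h.uDisc_eq, pC, zpow_add₀ h5, zpow_sub₀ h5, zpow_sub₀ h5, zpow_one, zpow_natCast,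
    zpow_natCast, zpow_natCast]
  push_cast; refine eq_inv_of_mul_eq_one_left ?_; field_simp; rw [Qr]; push_cast; rfl

lemma nuMassDen_eq (l:ℕ) {Z : ℂ} (hZ : Z ≠ 0) : P.nuMassDen ((P.L:ℤ)-1-P.K+l) Z =
      symPoch (P.q/P.s*uDisc P l) P.Qr Z * symPoch (P.q/P.s/uDisc P l) P.Qr Z := by
  have h1 := h.ofReal_s_ne; have h4 := h.ofReal_q_ne; have hu := h.ofReal_uDisc_ne l
  have hrel := h.pC_mul_zpow l; have hC0 := ofReal_ne h.pC_pos
  have hL := pow_ne_zero P.L h.ofReal_Qr_ne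
  have hi : (P.Qr:ℂ)^((P.L:ℤ)-1-P.K+l) = (P.q/P.s*uDisc P l*(P.pC/P.Qr^P.L) : ℂ)⁻¹ := by grind
  have hQ : (P.Qr:ℂ) = P.q^2 := by rw [Qr]; push_cast; rfl
  simp only [nuMassDen, P.Q_eq, h.qp_eps, qPochInfs_cons, qPochInfs_nil, mul_one, zpow_neg, hi, inv_inv, symPoch]
  have hv : (P.pC:ℂ)/(P.Qr:ℂ)^P.L ≠ 0 := div_ne_zero hC0 hL; grind

/-- The masses of `ν` with the singularities in `Y` removed. -/
lemma nuMass_eq {l : ℕ} {Y : ℂ} (hY : Y ≠ 0) {g : ℂ → ℂ} (hg : ContinuousAt g Y)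
    (hgZ : ∀ Z : ℂ, Z ≠ 0 → symPoch (P.q/P.s*uDisc P l) P.Qr Z ≠ 0 →
      symPoch (P.q/P.s/uDisc P l) P.Qr Z ≠ 0 →
      symPoch P.pC P.Qr Z*symPoch P.pc P.Qr Z = g Z*(symPoch (P.q/P.s*uDisc P l) P.Qr Z *
          symPoch (P.q/P.s/uDisc P l) P.Qr Z)) :
    P.nuMass ((P.L:ℤ)-1-P.K+l) Y = Π(P.q/P.s*uDisc P l*(P.q/P.s/uDisc P l);P.Qr)^2 *
        (((P.pC/(P.Qr:ℂ)^P.L)^2)^P.L*((P.Qr:ℂ)^(P.L.choose 2))^2) /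
        Π(P.Qr;P.Qr)^2 *
        (1-(P.q/P.s*P.pC/(P.Qr:ℂ)^P.L)^2 * (P.Qr:ℂ)^(2*((P.L:ℤ)-1-P.K+l))) *
        (P.q/P.s*P.pC/(P.Qr:ℂ)^P.L)^(-2*((P.L:ℤ)-1-P.K+l)-2) *
        (P.Qr:ℂ)^(-((P.L:ℤ)-1-P.K+l)*(((P.L:ℤ)-1-P.K+l)+1))*g Y := by
  have hq := h.norm_Qr_lt; have hs := h.ofReal_s_ne; have hu := h.ofReal_uDisc_ne l
  have hρ := h.rho_ne; have hQ0 := h.ofReal_Qr_ne; have hC0 := ofReal_ne h.pC_pos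
  have hCc : (P.pC:ℂ)*P.pc = P.Qr := by exact_mod_cast h.pC_mul_pc
  set i : ℤ := (P.L:ℤ)-1-P.K+l with hi; set u : ℂ := ((uDisc P l:ℝ):ℂ) with hudef; rw [nuMass]
  -- The zeros of the denominator form a countable set.
  have hden : Y ∈ closure {Z : ℂ | Z ≠ 0 ∧ P.nuMassDen i Z ≠ 0} := by
    let S : Set ℂ := {0} ∪ ⋃ j : ℕ, ⋃ v ∈ ({P.q/P.s*u, P.q/P.s/u} : Set ℂ),
      ({(v*P.Qr^j)⁻¹, v*P.Qr^j} : Set ℂ)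
    have hS : S.Countable := by
      refine (Set.countable_singleton _).union (Set.countable_iUnion fun j => ?_)
      refine Set.Countable.biUnion (Set.toFinite _).countable fun v _ => (Set.toFinite _).countable
    refine closure_mono ?_ ((hS.dense_compl ℝ) Y); intro Z hZ; rw [Set.mem_compl_iff] at hZ
    have hZ0 : Z ≠ 0 := fun h0 => hZ (Or.inl h0); refine ⟨hZ0, ?_⟩; rw [h.nuMassDen_eq l hZ0]
    have key : ∀ v ∈ ({P.q/P.s*u, P.q/P.s/u} : Set ℂ), symPoch v P.Qr Z ≠ 0 := by
      intro v hv
      refine mul_ne_zero (qPochInf_ne_zero hq fun j hj => hZ (Or.inr ?_))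
        (qPochInf_ne_zero hq fun j hj => hZ (Or.inr ?_))
      · refine Set.mem_iUnion.2 ⟨j, Set.mem_biUnion hv (Or.inl ?_)⟩; grind
      · refine Set.mem_iUnion.2 ⟨j, Set.mem_biUnion hv (Or.inr ?_)⟩; grind
    grind
  refine extendFrom_eq hden ?_
  have hlim := (tendsto_const_nhds (x := Π(P.q/P.s*u*(P.q/P.s/u);P.Qr)^2 *
        (((P.pC/(P.Qr:ℂ)^P.L)^2)^P.L*((P.Qr:ℂ)^(P.L.choose 2))^2) /
        Π(P.Qr;P.Qr)^2 *
        (1-(P.q/P.s*P.pC/(P.Qr:ℂ)^P.L)^2*(P.Qr:ℂ)^(2*i)) *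
        (P.q/P.s*P.pC/(P.Qr:ℂ)^P.L)^(-2*i-2) *
        (P.Qr:ℂ)^(-i*(i+1)))).mul (hg.mono_left
          (nhdsWithin_le_nhds (s := {Z : ℂ | Z ≠ 0 ∧ P.nuMassDen i Z ≠ 0})))
  refine hlim.congr' ?_; filter_upwards [self_mem_nhdsWithin] with Z hZ; obtain ⟨hZ0, hZd⟩ := hZ
  rw [h.nuMassDen_eq l hZ0] at hZd
  have hgz := hgZ Z hZ0 (left_ne_zero_of_mul hZd) (right_ne_zero_of_mul hZd)
  have e0 : (P.Qr:ℂ)/P.s^2 = P.q/P.s*u*(P.q/P.s/u) := by rw [Qr]; push_cast; field_simp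
  have e1 : (P.q:ℂ)*P.pC/P.Qr^P.L/P.s = P.q/P.s*P.pC/P.Qr^P.L := by ring
  have hθ := qTheta_mul_qTheta hq hQ0 hC0 hCc hZ0 P.L; rw [qTheta, qTheta, hgz] at hθ
  simp only [nuMassFormula, P.Q_eq, h.qp_eps, h.qp_eps', e0, e1, qPochInfs, List.map_cons,
    List.map_nil, List.prod_cons, List.prod_nil, mul_one]
  rw [h.nuMassDen_eq l hZ0]; grind

lemma ascB_mul_uDisc {p l : ℕ} (hl : l ≤ P.K+p) :
    P.ascB p*uDisc P l = ((P.κ₁^2*P.Qr^(P.K+p-l) : ℝ) : ℂ) := by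
  rw [h.uDisc_eq_ascA hl, ← mul_assoc, mul_comm (P.ascB p), h.ascA_mul_ascB]; simp

lemma isPos_awMass_asc {p l : ℕ} (hl : l ≤ P.K+p) :
    IsPos (awMass (P.ascA p) (P.ascB p) 0 0 P.Qr (P.K+p-l)) := by
  have hu1 := h.one_lt_abs_uDisc l
  have hu2 : 1 < uDisc P l^2 := by simp [*]
  have hu0 := h.ofReal_uDisc_ne l
  have hκ : P.κ₁^2 < 1 := pow_lt_one₀ h.κ₁_pos.le h.κ₁_lt two_ne_zero; have hx := h.uDisc_eq_ascA hl
  have hB := h.ascB_mul_uDisc hl; set k := P.K+p-l with hk; set u := uDisc P l with hudef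
  have hqk := pow_pos h.Qr_pos k; have hqk1 := pow_le_one₀ h.Qr_pos.le h.Qr_lt.le (n := k)
  have hκ0 := h.κ₁_pos
  have pI : ∀ {x : ℝ}, x < 1 → IsPos (Π(x;P.Qr)) := isPos_qPochInf h.Qr_pos h.Qr_lt
  have hαu : (P.Qr:ℂ)/(P.ascA p*(u:ℂ)) = ((P.Qr*P.Qr^k/u^2:ℝ):ℂ) := by
    have : P.ascA p ≠ 0 := left_ne_zero_of_mul (hx ▸ hu0); have h2 := pow_ne_zero k h.ofReal_Qr_ne
    push_cast; grind
  have hBu' : P.ascB p*(u:ℂ)⁻¹ = ((P.κ₁^2*P.Qr^k/u^2:ℝ):ℂ) := by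
    rw [ofReal_div, ← hB]; push_cast; field_simp
  have hdiv : ∀ {x : ℝ}, 0 ≤ x → x < 1 → x/u^2 < 1 := fun h0 h1 => by
    rw [div_lt_one (by positivity)]; linarith
  have hlt : P.κ₁^2*P.Qr^k < 1 := mul_lt_one_left (by positivity) hκ hqk1
  have hltq : P.Qr*P.Qr^k < 1 := mul_lt_one_left h.Qr_pos.le h.Qr_lt hqk1
  rw [awMass_asc h.Qr_pos h.Qr_lt (by rw [← hx, norm_real]; exact hu1) (by
    rw [h.ascA_mul_ascB, norm_real]; exact abs_lt_one (by positivity) hκ), ← hx, hαu,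
    h.ascA_mul_ascB, symPoch, hB, hBu']
  have r1 : IsPos (1-((u:ℂ)^2)⁻¹) :=
    ⟨1-(u^2)⁻¹, sub_pos.2 (inv_lt_one_of_one_lt₀ hu2), by push_cast; rfl⟩
  have r2 : IsPos ((P.Qr:ℂ)^(1+k)/(u:ℂ)^2) :=
    ⟨P.Qr^(1+k)/u^2, div_pos (pow_pos h.Qr_pos _) (by positivity), by push_cast; rfl⟩
  exact ((((pI hκ).mul r1).mul (r2.pow k)).mul (pI (hdiv (mul_pos h.Qr_pos hqk).le hltq))).div
    ((isPos_qPoch h.Qr_pos h.Qr_lt h.Qr_lt k).mul ((pI hlt).mul (pI (hdiv (by positivity) hlt))))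

/-- The quotient of `ν` and `m` at the mass points. -/
lemma nuOverM_disc {p l : ℕ} (hl : l ≤ P.K+p) {y : ℝ} {g : ℂ → ℂ} (hg : ContinuousAt g (expArg y))
    (hgZ : ∀ Z : ℂ, Z ≠ 0 → symPoch (P.q/P.s*uDisc P l) P.Qr Z ≠ 0 →
      symPoch (P.q/P.s/uDisc P l) P.Qr Z ≠ 0 →
      symPoch P.pC P.Qr Z*symPoch P.pc P.Qr Z = g Z*(symPoch (P.q/P.s*uDisc P l) P.Qr Z *
          symPoch (P.q/P.s/uDisc P l) P.Qr Z)) :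
    SpecPoint.nuOverM P p y (.disc l) = (nuRatio P.Qr (P.q/P.s*uDisc P l) (P.q/P.s/uDisc P l)
        P.pC P.pc P.pb P.L p (P.ascInvMass p)*g (expArg y)).re := by
  have hC0 := ofReal_ne h.pC_pos; have hCc : (P.pC:ℂ)*P.pc = P.Qr := by exact_mod_cast h.pC_mul_pc
  have hκ : P.κ₁^2 < 1 := pow_lt_one₀ h.κ₁_pos.le h.κ₁_lt two_ne_zero; have hκ0 := h.κ₁_pos
  have hu1 := h.one_lt_abs_uDisc l
  rw [SpecPoint.nuOverM, h.nuMass_eq (expArg_ne_zero y) hg hgZ, P.Q_eq]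
  rw [← nu_quotient_disc (W := P.ascInvMass p) h.Qr_pos h.Qr_lt hC0 hCc h.rho_ne
    (i := (P.L:ℤ)-1-P.K+l) (k := P.K+p-l) (by omega) (h.ascA_mul p) (h.ascB_eq' p)
    (h.uDisc_eq_ascA hl) (by simp [*]) ?_ rfl ?_]
  · exact IsPos.re_div_mul _ _ (h.isPos_ascInvMass p) (h.isPos_awMass_asc hl)
  · rw [← ofReal_mul, h.pc_mul_pb, norm_real]; simp [*]
  · refine qPochInf_ne h.norm_Qr_lt ?_
    have e : (P.q/P.s/uDisc P l*P.pC*P.Qr^p : ℂ) = P.q/P.s*P.pC*((uDisc P l:ℂ)⁻¹*P.Qr^p) := by ring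
    rw [e, norm_mul]; refine mul_lt_one_left (norm_nonneg _) h.norm_rho_mul_C_lt ?_
    rw [norm_mul, norm_inv, norm_pow, norm_real, norm_eq_abs]
    exact mul_le_one₀ (inv_le_one_of_one_le₀ hu1.le) (pow_nonneg (norm_nonneg _) _)
      (pow_le_one₀ (norm_nonneg _) h.norm_Qr_lt.le)

end Params.Admissible

/-! ### The constants -/

/-- The square of the factor that makes an Askey-Wilson polynomial orthonormal. -/
def awNormSq (a b c d q:ℂ) (n:ℕ) : ℂ :=
  qPoch (a*b*c*d) q (2*n)/qPochs [q, a*b, a*c, a*d, b*c, b*d, c*d, a*b*c*d*q^((n:ℤ)-1)] q n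

/-- All `q`-shifted factorials of the pair `x`, `y` are positive; this holds for pairs of real
numbers less than `1` and for pairs of conjugate numbers. -/
def PairPos (q x y:ℂ) : Prop := IsPos (Π(x;q)*Π(y;q)) ∧ ∀ n, IsPos (qPoch x q n*qPoch y q n)

section

variable {q : ℝ} (hq0 : 0 < q) (hq1 : q < 1)

include hq0 hq1

lemma PairPos.of_real {x y : ℝ} (hx : x < 1) (hy : y < 1) : PairPos q x y :=
  ⟨(isPos_qPochInf hq0 hq1 hx).mul (isPos_qPochInf hq0 hq1 hy),
    fun n => (isPos_qPoch hq0 hq1 hx n).mul (isPos_qPoch hq0 hq1 hy n)⟩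

lemma PairPos.of_conj {x : ℂ} (hx : ‖x‖ < 1) : PairPos q x (conj x) := by
  have hq := norm_lt_one hq0 hq1; refine ⟨?_, fun n => ?_⟩
  · rw [← conj_qPochInf x hq]; exact .mul_conj (qPochInf_ne hq hx)
  · rw [← conj_qPoch]; exact .mul_conj (qPoch_ne hq hx n)

variable {a b c d : ℂ} {x z v : ℝ} (hab : a*b = x) (hcd : c*d = z) (hx : x < 1) (hz : z < 1)
  (h : a*b*c*d = v*q) (hv0 : 0 ≤ v) (hv : v < 1) (hc : PairPos q (a*c) (b*c))
  (hd : PairPos q (a*d) (b*d))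

include hab hcd hx hz h hv0 hv hc hd

lemma isPos_awConst_of_pairPos : IsPos (awConst q a b c d) := by
  have p : ∀ {x : ℝ}, x < 1 → IsPos (Π(x;q)) := isPos_qPochInf hq0 hq1
  have := ((p hq1).mul ((p hx).mul ((p hz).mul (hc.1.mul hd.1)))).div
    (p (mul_lt_one_left hv0 hv hq1.le))
  simp only [awConst, qPochInfs_cons, qPochInfs_nil, h]; rw [hab, hcd]; convert this using 1
  push_cast; ring

lemma isPos_awNormSq (n:ℕ) : IsPos (awNormSq a b c d q n) := by
  have p : ∀ {x : ℝ}, x < 1 → ∀ n, IsPos (qPoch x q n) := isPos_qPoch hq0 hq1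
  have e : qPoch (v*q*q^((n:ℤ)-1)) q n = qPoch ((v*q^n:ℝ):ℂ) q n := by
    have : (q:ℂ) ≠ 0 := by exact_mod_cast hq0.ne'
    rw [zpow_sub_one₀ this, zpow_natCast]; push_cast; grind
  have := (p (mul_lt_one_left hv0 hv hq1.le) (2*n)).div
    ((p hq1 n).mul ((p hx n).mul ((p hz n).mul ((hc.2 n).mul ((hd.2 n).mul
      (p (mul_lt_one_left hv0 hv (pow_le_one₀ hq0.le hq1.le (n := n))) n))))))
  simp only [awNormSq, qPochs_cons, qPochs_nil, h, e]; rw [hab, hcd]; convert this using 1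
  push_cast; ring

lemma awNormSq_mul_awConst (n:ℕ) : awNormSq a b c d q n*awConst q a b c d =
    qPochInfs [q*q^n, a*b*q^n, a*c*q^n, a*d*q^n, b*c*q^n, b*d*q^n,
      c*d*q^n] q*(1-v*q^(2*n))/Π(v*q^n;q) := by
  have hq := norm_lt_one hq0 hq1; have hqc := ofReal_ne hq0
  have p : ∀ {x : ℝ}, x < 1 → qPoch x q n ≠ 0 := fun h => (isPos_qPoch hq0 hq1 h n).ne_zero
  have hvn := mul_lt_one_left hv0 hv (pow_le_one₀ hq0.le hq1.le (n := n)); have n1 := p hq1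
  have n2 := p hx; have n3 := p hz; have n4 := left_ne_zero_of_mul (hc.2 n).ne_zero
  have n5 := right_ne_zero_of_mul (hc.2 n).ne_zero; have n6 := left_ne_zero_of_mul (hd.2 n).ne_zero
  have n7 := right_ne_zero_of_mul (hd.2 n).ne_zero; have n8 := p hvn
  have n9 := (isPos_qPochInf hq0 hq1 hvn).ne_zero
  have n0 := (isPos_qPochInf hq0 hq1 (mul_lt_one_left hv0 hv hq1.le)).ne_zero; rw [← hab] at n2
  rw [← hcd] at n3; push_cast at n8 n9 n0
  have e : (v:ℂ)*q*q^((n:ℤ)-1) = v*q^n := by rw [zpow_sub_one₀ hqc, zpow_natCast]; field_simp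
  have s1 := qPochInf_split hq (v*q:ℂ) (2*n); have s2 := qPochInf_split hq (v*q^n:ℂ) n
  have s3 := qPochInf_step hq (v*q^(2*n) : ℂ); rw [mul_right_comm] at s1
  rw [mul_assoc (v:ℂ), ← pow_add, ← two_mul, s3] at s2
  simp only [awNormSq, awConst, qPochInfs_cons, qPochInfs_nil, qPochs_cons, qPochs_nil, h, e, qPochInf_split hq (q:ℂ) n, qPochInf_split hq (a*b) n,
    qPochInf_split hq (a*c) n, qPochInf_split hq (a*d) n, qPochInf_split hq (b*c) n,
    qPochInf_split hq (b*d) n, qPochInf_split hq (c*d) n]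
  rw [s1] at n0 ⊢; rw [s2] at n9 ⊢; have m1 := left_ne_zero_of_mul n0
  have m2 := right_ne_zero_of_mul n0; have m3 := left_ne_zero_of_mul (right_ne_zero_of_mul n9)
  generalize Π(v*q^(2*n)*q;q) = t at *
  generalize qPoch (v*q) q (2*n) = t' at *
  generalize 1-(v:ℂ)*q^(2*n) = t'' at *
  field_simp

end

lemma sq_pow_choose {q : ℂ} (hq : q ≠ 0) (n:ℕ) : (q^2)^(n.choose 2) = q^(n*n)/q^n := by
  rw [eq_div_iff (pow_ne_zero n hq), ← pow_mul, ← pow_add]; congr 1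
  induction n with
  | zero => rfl
  | succ n ih => rw [choose_succ_succ' n 1, choose_one_right]; linarith

section

variable {q s σ κ₁ κ₂ : ℂ} (hq : q ≠ 0) (hs : s ≠ 0) (hσ : σ ≠ 0) (h₁ : κ₁ ≠ 0)
  (h₂ : κ₂ ≠ 0)

include hq hs hσ h₁ h₂

/-- The sign and the powers in the constants, for `n₁ ≤ n₂`. -/
lemma cgTau_const_le (n d L:ℕ) : (-1)^d*(-(s/σ))^L*(-s/q)^((n:ℤ)-(n+d:ℕ)-L) *
      ((-1)^d*(κ₂*q/κ₁)^d*(q^2)^(d.choose 2)) *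
      cgTau (q^2) (-(κ₂/(κ₁*s))) (s*κ₁/q) n (n+d) =
    (-1)^(n+d)*((q/σ)^L*(κ₂^(n+d)*q^((n+d)^2))) := by
  have e : (-s/q)^((n:ℤ)-(n+d:ℕ)-L) = ((-(s/q))^d*(-(s/q))^L)⁻¹ := by
    rw [← pow_add, ← zpow_natCast, ← zpow_neg, neg_div]; congr 1; push_cast; ring
  have h0 : ((-1:ℂ)^d)^2 = 1 := by rw [← pow_mul, mul_comm, pow_mul]; simp
  have h3 := pow_ne_zero d (neg_ne_zero.2 (one_ne_zero (α := ℂ)))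
  have h4 := pow_ne_zero L (neg_ne_zero.2 (one_ne_zero (α := ℂ)))
  have e2 : (q^2)^(n*(n+d)) = q^(2*n*(n+d)) := by ring
  rw [cgTau, e, sq_pow_choose hq, sq_pow_choose hq, e2]
  simp only [neg_pow (_/_:ℂ), div_pow, mul_pow, pow_add]; generalize (-1:ℂ)^d = x at *
  generalize (-1:ℂ)^L = z at *
  generalize (-1:ℂ)^n = w at *
  field_simp; ring_nf

/-- The sign and the powers in the constants, for `n₁ ≥ n₂`. -/
lemma cgTau_const_ge (n d L:ℕ) : (-(s/σ))^L*(-s/q)^(((n+d:ℕ):ℤ)-n-L) *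
      ((κ₂*q/κ₁/(q^2)^d)^d*(q^2)^(d.choose 2))⁻¹ *
      cgTau (q^2) (-(κ₂/(κ₁*s))) (s*κ₁/q) (n+d) n =
    (-1)^n*((q/σ)^L*(κ₂^n*q^(n^2))) := by
  have e : (-s/q)^(((n+d:ℕ):ℤ)-n-L) = (-(s/q))^d/(-(s/q))^L := by
    rw [neg_div, ← zpow_natCast, ← zpow_natCast, ← zpow_sub₀ (neg_ne_zero.2 (div_ne_zero hs hq))]
    simp
  have h0 : ((-1:ℂ)^d)^2 = 1 := by rw [← pow_mul, mul_comm, pow_mul]; simp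
  have h4 := pow_ne_zero L (neg_ne_zero.2 (one_ne_zero (α := ℂ)))
  have e2 : (q^2)^((n+d)*n) = q^(2*n*(n+d)) := by ring
  have e3 : ((q^2)^d)^d = q^(2*d*d) := by ring
  rw [cgTau, e, sq_pow_choose hq, sq_pow_choose hq, e2, div_pow (_/_), e3]
  simp only [neg_pow (_/_:ℂ), div_pow, mul_pow, pow_add]; generalize (-1:ℂ)^d = x at *
  generalize (-1:ℂ)^L = z at *
  generalize (-1:ℂ)^n = w at *
  field_simp; ring_nf; grind

end

lemma awNormSq_zero_zero (a b q:ℂ) (n:ℕ) :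
    awNormSq a b 0 0 q n = (qPoch q q n*qPoch (a*b) q n)⁻¹ := by
  simp [awNormSq, qPochs]

namespace Params

variable (P : Params)

/-- The square of the constant that the normalized functions have in common. -/
def theta : ℂ := (P.Qr/P.s^2)^P.L*(Π(P.Qr;P.Qr)^2*Π(P.pc*P.pb;P.Qr) * Π(P.pC*P.pb;P.Qr))

namespace Admissible

variable {P} (h : P.Admissible)

include h

lemma pC_mul_pb_lt : P.pC*P.pb < 1 := by
  rw [h.pC_mul_pb]; exact pow_lt_one₀ h.κ₂_pos.le h.κ₂_lt two_ne_zero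

lemma pc_mul_pb_lt : P.pc*P.pb < 1 := by
  rw [h.pc_mul_pb]; exact pow_lt_one₀ h.κ₁_pos.le h.κ₁_lt two_ne_zero

lemma isPos_theta : IsPos P.theta := by
  have p : ∀ {x : ℝ}, x < 1 → IsPos (Π(x;P.Qr)) := isPos_qPochInf h.Qr_pos h.Qr_lt
  have h1 : IsPos ((P.Qr:ℂ)/P.s^2) :=
    ⟨P.Qr/P.s^2, div_pos h.Qr_pos (sq_pos_of_ne_zero h.s_ne), by simp⟩
  have h2 := p h.pC_mul_pb_lt; have h3 := p h.pc_mul_pb_lt; push_cast at h2 h3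
  exact (h1.pow _).mul ((((p h.Qr_lt).pow 2).mul h3).mul h2)

lemma awNormSq_asc (p n:ℕ) : awNormSq (P.ascA p) (P.ascB p) 0 0 P.Qr n =
    (qPoch P.Qr P.Qr n*qPoch (P.pc*P.pb) P.Qr n)⁻¹ := by
  rw [awNormSq_zero_zero, h.ascA_mul_ascB, ← h.pc_mul_pb]; push_cast; rfl

lemma awNormSq_ascInv (n:ℕ) : awNormSq (P.qp (-2*P.k₂)*P.s) (P.qp (-2*P.k₂)/P.s) 0 0 (P.Qr:ℂ)⁻¹ n =
      (P.κ₂^n*P.q^(n^2))^2 * (qPoch P.Qr P.Qr n*qPoch (P.pC*P.pb) P.Qr n)⁻¹ := by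
  have hs := h.ofReal_s_ne; have hκ := h.ofReal_κ₂_ne; have hq := h.ofReal_q_ne
  have hQ := h.ofReal_Qr_ne
  have e : P.qp (-2*P.k₂)*P.s*(P.qp (-2*P.k₂)/P.s) = ((P.κ₂:ℂ)^2)⁻¹ := by rw [h.qp_neg]; field_simp
  have e2 : (P.pC:ℂ)*P.pb = (P.κ₂:ℂ)^2 := by exact_mod_cast h.pC_mul_pb
  have e3 : ((-(P.Qr:ℂ)⁻¹)^n*((P.Qr:ℂ)^(n.choose 2))⁻¹) *
      ((-((P.κ₂:ℂ)^2)⁻¹)^n*((P.Qr:ℂ)^(n.choose 2))⁻¹) *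
      (P.κ₂^n*P.q^(n^2))^2 = 1 := by
    rw [mul_mul_mul_comm, ← mul_pow, Qr, ofReal_pow, sq_pow_choose hq, neg_mul_neg, mul_pow,
      inv_pow, inv_pow]
    field_simp; ring
  have n1 := e3 ▸ one_ne_zero (α := ℂ)
  rw [awNormSq_zero_zero, e, e2, qPoch_inv_base' hQ hQ, qPoch_inv_base' hQ (pow_ne_zero 2 hκ)]
  grind

/-- The norms of the three orthogonal polynomials that do not depend on `x` and `y`. -/
lemma sqrt_awNormSq (p n₁ n₂:ℕ) {N ν : ℂ} (hN : IsPos N) (hν : IsPos ν)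
    (hνN : ν*N = Π(P.Qr*P.Qr^n₁;P.Qr)*Π(P.Qr*P.Qr^n₂;P.Qr) *
      Π(P.pC*P.pb*P.Qr^n₂;P.Qr)*Π(P.pc*P.pb*P.Qr^n₁;P.Qr)) :
    (√N.re:ℂ)*(√ν.re:ℂ) * ((P.q/(|P.s|:ℝ))^P.L*(P.κ₂^n₂*P.q^(n₂^2))) =
    (√(awNormSq (P.ascA p) (P.ascB p) 0 0 P.Qr n₁).re : ℂ) *
      (√(awNormSq (P.qp (-2*P.k₂)*P.s) (P.qp (-2*P.k₂)/P.s) 0 0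
        (P.Qr:ℂ)⁻¹ n₂).re : ℂ)*(√P.theta.re:ℂ) := by
  have hq := h.norm_Qr_lt
  have pp : ∀ {x : ℝ}, x < 1 → ∀ n, IsPos (qPoch x P.Qr n) := isPos_qPoch h.Qr_pos h.Qr_lt
  have p1 := pp h.Qr_lt; have p2 := pp h.pC_mul_pb_lt n₂; have p3 := pp h.pc_mul_pb_lt n₁
  push_cast at p2 p3
  have x1 : IsPos ((P.q/(|P.s|:ℝ))^P.L : ℂ) :=
    IsPos.pow (.div (.of_real h.q_pos) (.of_real (abs_pos.2 h.s_ne))) _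
  have x2 : IsPos (P.κ₂^n₂*P.q^(n₂^2) : ℂ) :=
    ((IsPos.of_real h.κ₂_pos).pow _).mul ((IsPos.of_real h.q_pos).pow _)
  have hf : IsPos (awNormSq (P.ascA p) (P.ascB p) 0 0 P.Qr n₁) := by
    rw [h.awNormSq_asc]; exact ((p1 n₁).mul p3).inv
  have hg : IsPos (awNormSq (P.qp (-2*P.k₂)*P.s) (P.qp (-2*P.k₂)/P.s) 0 0 (P.Qr:ℂ)⁻¹ n₂) := by
    rw [h.awNormSq_ascInv]; exact (x2.pow 2).mul ((p1 n₂).mul p2).inv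
  refine IsPos.eq_of_sq_eq ((hN.sqrt.mul hν.sqrt).mul (x1.mul x2))
    ((hf.sqrt.mul hg.sqrt).mul h.isPos_theta.sqrt) ?_
  have e : ((P.q/(|P.s|:ℝ):ℂ)^P.L)^2 = (P.Qr/P.s^2)^P.L := by
    rw [← pow_mul, mul_comm, pow_mul, div_pow, ← ofReal_pow |P.s|, sq_abs, Qr]; simp
  simp only [mul_pow _ _ 2, hN.sq_sqrt, hν.sq_sqrt, hf.sq_sqrt, hg.sq_sqrt, h.isPos_theta.sq_sqrt, e]
  rw [mul_comm N, hνN, h.awNormSq_asc, h.awNormSq_ascInv, theta, sq (qPochInf _ _)]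
  nth_rw 1 [qPochInf_split hq (P.Qr:ℂ) n₁]
  rw [qPochInf_split hq (P.Qr:ℂ) n₂, qPochInf_split hq (P.pC*P.pb:ℂ) n₂,
    qPochInf_split hq (P.pc*P.pb:ℂ) n₁]
  have := (p1 n₁).ne_zero; have := (p1 n₂).ne_zero; have := p2.ne_zero; have := p3.ne_zero; grind

end Admissible

end Params

/-! ### The Clebsch-Gordan integral at a point of the spectrum -/

lemma cdh_norm {q x y z : ℝ} (hq0 : 0 < q) (hq1 : q < 1) (hxy : x*y < 1) (hxz : x*z < 1)
    (hyz : y*z < 1) (n:ℕ) : IsPos (awConst q x y z 0) ∧ IsPos (awNormSq x y z 0 q n) ∧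
    awNormSq x y z 0 q n*awConst q x y z 0 = Π(q*q^n;q) *
      Π(x*y*q^n;q)*Π(x*z*q^n;q)*Π(y*z*q^n;q) := by
  have h1 := PairPos.of_real hq0 hq1 hxz hyz
  have h2 : PairPos q ((x:ℂ)*0) (y*0) := by
    simpa using PairPos.of_real hq0 hq1 (zero_lt_one' ℝ) (zero_lt_one' ℝ)
  push_cast at h1; have e : (x:ℂ)*y = ((x*y:ℝ):ℂ) := by simp
  have e2 : (z:ℂ)*0 = ((0:ℝ):ℂ) := by simp
  have e3 : (x:ℂ)*y*z*0 = ((0:ℝ):ℂ)*q := by simp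
  refine ⟨isPos_awConst_of_pairPos hq0 hq1 e e2 hxy zero_lt_one e3 le_rfl zero_lt_one h1 h2,
    isPos_awNormSq hq0 hq1 e e2 hxy zero_lt_one e3 le_rfl zero_lt_one h1 h2 n, ?_⟩
  rw [awNormSq_mul_awConst hq0 hq1 e e2 hxy zero_lt_one e3 le_rfl zero_lt_one h1 h2]
  simp [qPochInfs, mul_assoc]

lemma cg_const {T nu th S V Z nf ng σ ς jc E τ w f g ε K : ℂ} (hc : T*nu*(ε*K)*th = 1)
    (hn : S*V*Z = nf*ng*th) (hτ : σ*ς*jc*E*τ = w*Z) :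
    w*(nf*ng)*(f*g) = σ*ε*ς*(S*T*(nu*V*jc)*E*(K*(τ*f*g))) := by
  grind

/-- The integral formula for `F_{n₁, n₂}(x, p)`, and the absolute convergence of the integral. -/
def Params.HasCGIntegral (P : Params) (X : SpecPoint) (n₁ n₂ p:ℕ) : Prop :=
  Integrable (fun y : ℝ => X.awOrthoAt P p y*P.cdhOrtho n₁ n₂ y *
      P.jacobi ((n₁:ℤ)-n₂-P.L) (X.u P) (expArg y))
    (geomMean (P.cdhMeasure n₁ n₂) (X.measureM P p)) ∧
  P.F n₁ n₂ (X.x P) p = (if n₁ ≤ n₂ then (-1:ℂ)^(n₂-n₁) else 1)*(-1:ℂ)^(p-X.deg P p) *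
      (-(Real.sign P.s:ℂ))^P.L *
      ∫ y, X.awOrthoAt P p y*P.cdhOrtho n₁ n₂ y * P.jacobi ((n₁:ℤ)-n₂-P.L) (X.u P) (expArg y)
        ∂(geomMean (P.cdhMeasure n₁ n₂) (X.measureM P p))

namespace Params.Admissible

variable {P : Params} (h : P.Admissible)

include h

lemma jacobi_eq (n₁ n₂:ℕ) {u : ℂ} (hu : u ≠ 0) (y:ℝ) : P.jacobi ((n₁:ℤ)-n₂-P.L) u (expArg y) =
      (-(P.s:ℂ)/P.q)^((n₁:ℤ)-n₂-P.L) *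
        wFun P.Qr (P.q/P.s*u) (P.q/P.s/u) (P.pC*((P.Qr:ℂ)^n₂/P.Qr^n₁)) y /
      (√(hInf (P.pC*((P.Qr:ℂ)^n₂/P.Qr^n₁)) P.Qr y).re : ℂ) := by
  have hs := h.ofReal_s_ne; have hY := expArg_ne_zero y
  have e : P.q/P.s*u*(P.q/P.s/u) = (P.Qr:ℂ)/P.s^2 := by rw [Qr]; push_cast; field_simp
  have e' : (P.Qr:ℂ)/P.s^2 = ((P.Qr/P.s^2:ℝ):ℂ) := by simp
  have hAB : ‖P.q/P.s*u*(P.q/P.s/u)‖ < 1 := by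
    rw [e, e', norm_real]
    exact abs_lt_one (div_pos h.Qr_pos (sq_pos_of_ne_zero h.s_ne)) (h.div_sq_lt_one h.Qr_lt.le)
  have e1 : P.q*expArg y*u/P.s = P.q/P.s*u*expArg y := by ring
  have e2 : P.q*expArg y/(u*P.s) = P.q/P.s/u*expArg y := by ring
  rw [jacobi, h.qp_jacobi, P.Q_eq, ← e, e1, e2, phi21Entire_eq_wFun h.Qr_pos h.Qr_lt
    (mul_pow_ne_one h.norm_Qr_lt hAB) hY (expArg_add_inv y)]
  simp [qPochInfs, hInf, symPoch, div_eq_mul_inv]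

/-- The proposition for one value of `x`, given the density of `dm(y; a, b, c, d | q²)` with respect
to the reference measure, the quotient of `ν` and `m`, and the value of the integral without the
normalizing constants. -/
theorem hasCGIntegral {e o : ℝ} {N : ℕ} (H : CGBase P.Qr P.pC P.pc P.pb e o N)
    {X : SpecPoint} {p : ℕ} (n₁ n₂:ℕ) {a b c d A B R K f₁ f₂ f₃ f₄ : ℂ} {C' : ℝ}
    {φ G : ℝ → ℂ} (hX : X.awParams P = (a, b, c, d)) (hu : X.u P ≠ 0) (hA : A = P.q/P.s*X.u P)
    (hB : B = P.q/P.s/X.u P)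
    (hC' : ∀ᵐ y ∂refM P.Qr e N, IsPos (hInf C' P.Qr y)) (hGm : Measurable G)
    (hG : ∀ᵐ y ∂refM P.Qr e N, ∃ t : ℝ, 0 ≤ t ∧ G y = t)
    (hD : AWDensity P.Qr (refM P.Qr e N) φ a b c d)
    (hφ : ∀ y, φ y = G y/(hInf C' P.Qr y*hInf o P.Qr y))
    (hν : ∀ᵐ y ∂refM P.Qr e N, G y ≠ 0 → X.nuOverM P p y = (R*(G y*hInf C' P.Qr y)).re)
    (hN : IsPos (awConst P.Qr a b c d)) (hn : IsPos (awNormSq a b c d P.Qr (X.deg P p)))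
    (hz : ∀ D, ∀ᵐ y ∂refM P.Qr e N, hFin P.pc P.Qr D y = 0 →
      wFun P.Qr A B ((P.pC/P.Qr^D:ℝ):ℂ) y*G y = 0)
    (hmom : AWMoments P.Qr (refM P.Qr e N)
      (fun y => G y/(hInf P.pC P.Qr y*hInf o P.Qr y)) f₁ f₂ f₃ f₄)
    (hK : ∫ y, awPoly a b c d P.Qr (X.deg P p) y*(cgFun P.Qr A B P.pC P.pb n₁ n₂ y *
        (G y/(hInf P.pC P.Qr y*hInf o P.Qr y))) ∂refM P.Qr e N =
      K*(cgTau P.Qr (-(P.κ₂/(P.κ₁*P.s))) (P.s*P.κ₁/P.q) n₁ n₂ *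
        awPoly (P.s*P.κ₁/(P.κ₂*P.Qr^p)) (P.κ₁*P.κ₂*P.Qr^p/P.s) 0 0 P.Qr n₁ (X.x P) *
        awPoly (P.s/P.κ₂) (1/(P.κ₂*P.s)) 0 0 (P.Qr:ℂ)⁻¹ n₂ (mu (P.κ₂*P.Qr^p/P.s))))
    (hKpos : IsPos ((-1)^(p-X.deg P p)*K))
    (hconst : awNormSq a b c d P.Qr (X.deg P p)*awConst P.Qr a b c d*R*K^2*P.theta = 1) :
    P.HasCGIntegral X n₁ n₂ p := by
  have hq := h.norm_Qr_lt; have hs := h.ofReal_s_ne; have hQ := h.ofReal_Qr_ne; have hQ0 := h.Qr_pos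
  have hθ := h.isPos_theta; set m := X.deg P p; set Λ := refM P.Qr e N
  set nA := awNormSq a b c d P.Qr m; set NA := awConst P.Qr a b c d
  have hsq : ((-1:ℂ)^(p-m))^2 = 1 := by rw [← pow_mul, mul_comm, pow_mul]; simp
  have hR : IsPos R := by
    have hK2 := hKpos.pow 2; rw [mul_pow, hsq, one_mul] at hK2
    have : R = (nA*NA*K^2*P.theta)⁻¹ := eq_inv_of_mul_eq_one_left (by rw [← hconst]; ring)
    rw [this]; exact (((hn.mul hN).mul hK2).mul hθ).inv
  obtain ⟨r, hr0, rfl⟩ := hR; obtain ⟨k, hk0, hk⟩ := hN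
  -- The density of `M` with respect to the reference measure.
  set g : ℝ → ℝ := fun y => (NA*φ y).re*(r*(G y*hInf C' P.Qr y)).re with hgdef
  have hν' : Measurable fun y => ((r:ℂ)*(G y*hInf C' P.Qr y)).re :=
    measurable_re.comp ((hGm.mul (measurable_hInf hq C')).const_mul _)
  have hφm : Measurable fun y => (NA*φ y).re := measurable_re.comp (hD.measurable.const_mul NA)
  have hφ0 : ∀ᵐ y ∂Λ, 0 ≤ (NA*φ y).re ∧ (φ y ≠ 0 → G y ≠ 0) ∧
      ∃ t : ℝ, 0 ≤ t ∧ G y = t ∧ g y = k*r*t^2/(hInf o P.Qr y).re := by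
    filter_upwards [hG, hC', ae_refM e N] with y ⟨t, ht, hGt⟩ ⟨w, hw0, hw⟩ hy
    obtain ⟨v, hv0, hv⟩ := H.isPos_hInf_o hy
    have e1 : (NA*φ y).re = k*(t/(w*v)) := by rw [hφ, hGt, hw, hv, hk]; exact_mod_cast ofReal_re _
    have e2 : ((r:ℂ)*(G y*hInf C' P.Qr y)).re = r*(t*w) := by
      rw [hGt, hw]; exact_mod_cast ofReal_re _
    refine ⟨by rw [e1]; positivity, fun h0 h4 => h0 (by rw [hφ, h4, zero_div]), t, ht, hGt, ?_⟩
    simp only [hgdef, e1, e2, hv, ofReal_re]; field_simp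
  have hg0 : ∀ᵐ y ∂Λ, 0 ≤ g y := by
    filter_upwards [hφ0, ae_refM e N] with y ⟨_, _, t, _, _, h1⟩ hy
    have := (H.isPos_hInf_o hy).re_pos; rw [h1]; positivity
  have hM : X.measureM P p = Λ.withDensity fun y => ENNReal.ofReal (g y) := by
    have e2 : (fun y => ENNReal.ofReal (X.nuOverM P p y)) =ᵐ[Λ.withDensity fun y =>
        ENNReal.ofReal (NA*φ y).re] fun y => ENNReal.ofReal (r*(G y*hInf C' P.Qr y)).re := by
      refine (ae_withDensity_iff hφm.ennreal_ofReal).2 ?_; filter_upwards [hν, hφ0] with y h1 h2 h3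
      rw [h1 (h2.2.1 fun h0 => h3 (by rw [h0]; simp))]
    rw [SpecPoint.measureM, SpecPoint.awMeasureAt, hX, P.Q_eq, hD.eq, withDensity_congr_ae e2,
      ← withDensity_mul _ hφm.ennreal_ofReal hν'.ennreal_ofReal]
    refine withDensity_congr_ae ?_; filter_upwards [hφ0] with y h1
    rw [Pi.mul_apply, ← ENNReal.ofReal_mul h1.1]
  have hAB : ‖A*B‖ < 1 := by
    have : A*B = ((P.Qr/P.s^2:ℝ):ℂ) := by rw [hA, hB, Qr]; push_cast; field_simp
    rw [this, norm_real]
    exact abs_lt_one (div_pos h.Qr_pos (sq_pos_of_ne_zero h.s_ne)) (h.div_sq_lt_one h.Qr_lt.le)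
  have hI : Integrable (fun y => awPoly a b c d P.Qr m y *
      (cgFun P.Qr A B P.pC P.pb n₁ n₂ y*(G y/(hInf P.pC P.Qr y*hInf o P.Qr y)))) Λ := by
    simp only [← mul_assoc]
    exact hmom.mul_continuous ((continuous_awPoly hQ m).mul
      (continuous_cgFun h.Qr_pos h.Qr_lt (mul_pow_ne_one hq hAB) _ _ _ _))
  have hσ := ofReal_ne (abs_pos.2 h.s_ne)
  have hsign : (Real.sign P.s:ℂ) = P.s/(|P.s|:ℝ) := by
    rw [eq_div_iff hσ]; rcases lt_or_gt_of_ne h.s_ne with h1 | h1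
    · rw [Real.sign_of_neg h1, abs_of_neg h1]; push_cast; ring
    · rw [Real.sign_of_pos h1, abs_of_pos h1]; push_cast; ring
  have hF : P.F n₁ n₂ (X.x P) p = (-1)^n₂ *
      ((√(awNormSq (P.ascA p) (P.ascB p) 0 0 P.Qr n₁).re : ℂ) *
      (√(awNormSq (P.qp (-2*P.k₂)*P.s) (P.qp (-2*P.k₂)/P.s) 0 0 (P.Qr:ℂ)⁻¹ n₂).re : ℂ)) *
      (awPoly (P.s*P.κ₁/(P.κ₂*P.Qr^p)) (P.κ₁*P.κ₂*P.Qr^p/P.s) 0 0 P.Qr n₁ (X.x P) *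
        awPoly (P.s/P.κ₂) (1/(P.κ₂*P.s)) 0 0 (P.Qr:ℂ)⁻¹ n₂ (mu (P.κ₂*P.Qr^p/P.s))) := by
    have e1 : (P.s/P.κ₂:ℂ) = P.qp (-2*P.k₂)*P.s := by rw [h.qp_neg]; ring
    have e2 : (1/(P.κ₂*P.s) : ℂ) = P.qp (-2*P.k₂)/P.s := by rw [h.qp_neg]; field_simp
    rw [e1, e2, ← h.ascA_eq, ← h.ascB_eq, F, awOrtho, awOrtho, h.rpow_add_two_mul, P.Q_eq]
    simp only [awNormSq]; ring
  -- The constant of the polynomials in `y`.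
  have hcst : (√(k*r) : ℂ)*(√nA.re:ℂ)*((-1)^(p-m)*K)*(√P.theta.re:ℂ) = 1 := by
    have x1 : IsPos (√(k*r) : ℂ) := .of_real (sqrt_pos.2 (mul_pos hk0 hr0))
    refine IsPos.eq_of_sq_eq (((x1.mul hn.sqrt).mul hKpos).mul hθ.sqrt) .one ?_
    have e1 : ((√(k*r) : ℝ) : ℂ)^2 = k*r := by
      rw [← ofReal_pow, Real.sq_sqrt (mul_pos hk0 hr0).le]; push_cast; rfl
    rw [one_pow]; refine Eq.trans ?_ hconst
    simp only [mul_pow _ _ 2, hn.sq_sqrt, hθ.sq_sqrt, e1, hsq, hk]; ring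
  have hQq : (P.Qr:ℂ) = (P.q:ℂ)^2 := by rw [Qr]; push_cast; rfl
  have hCe : (P.pC:ℂ) = P.κ₂*P.q/P.κ₁ := by rw [pC]; push_cast; rfl
  have hCc : (P.pC:ℂ)*P.pc = P.Qr := H.C_mul_c'
  have fin : ∀ {x z : ℝ} {α E t : ℂ} {φ' : ℝ → ℂ},
      P.cdhA n₁ n₂ = x → P.cdhC n₁ n₂ = z → P.pC*((P.Qr:ℂ)^n₂/P.Qr^n₁) = α → E*t = 1 →
      x*P.pb < 1 → x*z < 1 → P.pb*z < 1 →
      Π(P.Qr*P.Qr^min n₁ n₂;P.Qr)*Π(x*P.pb*P.Qr^min n₁ n₂;P.Qr) *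
        Π(x*z*P.Qr^min n₁ n₂;P.Qr)*Π(P.pb*z*P.Qr^min n₁ n₂;P.Qr) =
        Π(P.Qr*P.Qr^n₁;P.Qr)*Π(P.Qr*P.Qr^n₂;P.Qr) *
        Π(P.pC*P.pb*P.Qr^n₂;P.Qr)*Π(P.pc*P.pb*P.Qr^n₁;P.Qr) →
      AWDensity P.Qr Λ φ' x P.pb z 0 →
      (∀ y, OnSupp P.Qr e N y → CDHFactor P.Qr P.pC P.pb o n₁ n₂ (min n₁ n₂) α x z t φ' y) →
      (∀ᵐ y ∂Λ, hInf α P.Qr y = 0 → wFun P.Qr A B α y*G y = 0) →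
      (if n₁ ≤ n₂ then (-1:ℂ)^(n₂-n₁) else 1)*(-(P.s/(|P.s|:ℝ)))^P.L *
        (-(P.s:ℂ)/P.q)^((n₁:ℤ)-n₂-P.L)*E *
        cgTau (P.q^2) (-(P.κ₂/(P.κ₁*P.s))) (P.s*P.κ₁/P.q) n₁ n₂ =
        (-1)^n₂*((P.q/(|P.s|:ℝ))^P.L*(P.κ₂^n₂*P.q^(n₂^2))) → P.HasCGIntegral X n₁ n₂ p := by
    intro x z α E t φ' hx hz ha hE h1 h2 h3 hpr hD' hdat hz0 hτ
    obtain ⟨c1, c2, c3⟩ := cdh_norm h.Qr_pos h.Qr_lt h1 h2 h3 (min n₁ n₂)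
    obtain ⟨i1, i2⟩ := H.integral_geomMean_cdh (hφm.mul hν') hg0 hM (hφ0.mono fun y hy => hy.2.2)
      ha c1 hD' hdat hz0 hE hI (√nA.re:ℂ)
      (√(awNormSq x P.pb z 0 P.Qr (min n₁ n₂)).re : ℂ) ((-(P.s:ℂ)/P.q)^((n₁:ℤ)-n₂-P.L))
    have hfun : ∀ y, X.awOrthoAt P p y*P.cdhOrtho n₁ n₂ y *
        P.jacobi ((n₁:ℤ)-n₂-P.L) (X.u P) (expArg y) = _ := fun y => by
      rw [SpecPoint.awOrthoAt, hX, cdhOrtho, hx, cdhB, hz, h.qp_pb, P.Q_eq,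
        h.jacobi_eq _ _ hu, ← hA, ← hB, ha, awOrtho]
    have hms : P.cdhMeasure n₁ n₂ = awMeasure x P.pb z 0 P.Qr := by
      rw [cdhMeasure, hx, cdhB, hz, h.qp_pb, P.Q_eq]
    rw [HasCGIntegral]; simp only [hfun, hms]; refine ⟨i1, Eq.trans ?_ (congrArg _ i2.symm)⟩
    rw [hF, hK, sqrt_mul c1.re_pos.le, hsign, ofReal_mul]; rw [← hQq] at hτ
    exact cg_const hcst (h.sqrt_awNormSq p n₁ n₂ c1 c2 (c3.trans hpr)) hτ
  have hCb := h.pC_mul_pb_lt; have hcb := h.pc_mul_pb_lt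
  have mlt : ∀ {x : ℝ}, 0 < x → x < 1 → ∀ d, x*P.Qr^d < 1 := fun h0 h1 _ =>
    mul_lt_one_left h0.le h1 (pow_le_one₀ hQ0.le h.Qr_lt.le)
  have hC := H.C_pos; have hc := H.c_pos; have hb := H.b_pos; rcases le_or_gt n₁ n₂ with hle | hlt
  · obtain ⟨d', rfl⟩ := exists_eq_add_of_le hle
    have ha : P.pC*((P.Qr:ℂ)^(n₁+d')/P.Qr^n₁) = ((P.pC*P.Qr^d':ℝ):ℂ) := by
      rw [pow_add, mul_div_cancel_left₀ _ (pow_ne_zero _ hQ)]; push_cast; rfl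
    have hmin := min_eq_left hle
    refine fin (x := P.pC*P.Qr^d') ?_ (by rw [cdhC, if_pos hle, h.qp_pc]) ha
      (E := (-1)^d'*P.pC^d'*P.Qr^(d'.choose 2)) ?_ (by rw [mul_right_comm]; exact mlt (by positivity) hCb _)
      (by rw [mul_right_comm, h.pC_mul_pc]; exact mlt hQ0 h.Qr_lt _)
      (by rwa [mul_comm]) ?_ (awDensity_cdh_of_le H.q_pos H.q_lt H.C_pos H.C_lt H.c_pos H.b_pos H.C_mul_c
        H.C_mul_b H.c_mul_b H.cases H.o_lt H.masses d') (by rw [hmin]; exact fun y hy => H.cdhFactor_le n₁ d' hy)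
      ?_ ?_
    · rw [cdhA, if_pos hle, h.qp_sub_add_one, ← ha]; push_cast; ring
    · have h1 : ((-1:ℂ)^d')*(-1)^d' = 1 := by rw [← mul_pow]; simp
      have := H.C_ne; push_cast; rw [inv_pow]; field_simp; linear_combination h1
    · rw [hmin]; push_cast
      rw [show (P.pC*P.Qr^d'*P.pc*P.Qr^n₁:ℂ) = P.Qr*P.Qr^(n₁+d') by rw [← hCc, pow_add]; ring]
      ring_nf
    · filter_upwards [ae_refM e N] with y hy h0
      refine absurd h0 (H.isPos_hInf (by positivity) (mlt hC H.C_lt _) ?_ hy).ne_zero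
      rw [← mul_assoc]; exact mlt (mul_pos H.e_pos hC) H.e_mul_C _
    · rw [if_pos hle, Nat.add_sub_cancel_left, hCe, hQq]
      exact cgTau_const_le h.ofReal_q_ne hs hσ h.ofReal_κ₁_ne h.ofReal_κ₂_ne n₁ d' P.L
  · obtain ⟨D, rfl⟩ := exists_eq_add_of_le hlt.le; have hle : ¬ n₂+D ≤ n₂ := not_le.2 hlt
    have hD0 := pow_ne_zero D hQ
    have ha : P.pC*((P.Qr:ℂ)^n₂/P.Qr^(n₂+D)) = ((P.pC/P.Qr^D:ℝ):ℂ) := by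
      rw [pow_add]; push_cast; field_simp
    have hmin := min_eq_right hlt.le
    refine fin (x := P.pc*P.Qr^D) ?_ (by rw [cdhC, if_neg hle, h.qp_pC]) ha
      (E := ((P.pC/P.Qr^D)^D*P.Qr^(D.choose 2))⁻¹)
      (inv_mul_cancel₀ (mul_ne_zero (pow_ne_zero _ (div_ne_zero H.C_ne hD0)) (pow_ne_zero _ hQ)))
      (by rw [mul_right_comm]; exact mlt (by positivity) hcb _)
      (by rw [mul_right_comm, mul_comm P.pc, h.pC_mul_pc]; exact mlt hQ0 h.Qr_lt _)
      (by rwa [mul_comm]) ?_ (awDensity_cdh_of_ge H.q_pos H.q_lt H.C_pos H.C_lt H.c_pos H.b_pos H.C_mul_c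
        H.C_mul_b H.c_mul_b H.cases H.o_lt H.masses D)
      (by rw [hmin]; exact fun y hy => H.cdhFactor_ge n₂ D hy)
      ?_ ?_
    · rw [cdhA, if_neg hle, h.qp_sub_add_one', pow_add, ← mul_assoc, mul_right_comm,
        mul_div_cancel_right₀ _ (pow_pos h.Qr_pos n₂).ne']
    · rw [hmin]; push_cast
      rw [show (P.pc*P.Qr^D*P.pC*P.Qr^n₂:ℂ) = P.Qr*P.Qr^(n₂+D) by rw [← hCc, pow_add]; ring]
      ring_nf
    · filter_upwards [hz D, ae_refM e N] with y h1 hy h0; rw [H.hInf_div_pow] at h0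
      exact h1 (((mul_eq_zero.1 h0).resolve_right (H.isPos_hInf_C hy).ne_zero) |> mul_eq_zero.1
        |>.resolve_left (pow_ne_zero 2 (mul_ne_zero (pow_ne_zero _
          (ofReal_ne (div_pos hC (pow_pos hQ0 D)))) (pow_ne_zero _ hQ))))
    · rw [if_neg hle, one_mul, hCe, hQq]
      exact cgTau_const_ge h.ofReal_q_ne hs hσ h.ofReal_κ₁_ne h.ofReal_κ₂_ne n₂ D P.L

end Params.Admissible

/-! ### The constants at the points of the spectrum -/

namespace Params.Admissible

variable {P : Params} (h : P.Admissible)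

include h

/-- The constant for the points `x` in `[-1, 1]` and for the mass points that are close to it. -/
lemma const_near {A B : ℂ} (hAB : A*B = ((P.Qr/P.s^2:ℝ):ℂ))
    (hC : PairPos P.Qr (A*P.pC) (B*P.pC)) (hb : PairPos P.Qr (A*P.pb) (B*P.pb))
    (p:ℕ) {K : ℂ} (hK : K = (P.pb:ℂ)⁻¹^p * qPochs [P.pb*A, P.pb*B, P.pb*P.pC] P.Qr p *
      ((P.κ₂:ℂ)^2*P.Qr^p/P.s^2)^p/(Π(P.Qr;P.Qr)*Π(A*B;P.Qr) *
        Π(P.pb*A;P.Qr)*Π(P.pb*B;P.Qr)*Π(P.pb*P.pC;P.Qr))) :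
    IsPos K ∧ IsPos (awConst P.Qr A B P.pC P.pb) ∧ IsPos (awNormSq A B P.pC P.pb P.Qr p) ∧
    awNormSq A B P.pC P.pb P.Qr p*awConst P.Qr A B P.pC P.pb *
      nuRatio P.Qr A B P.pC P.pc P.pb P.L p (P.ascInvMass p)*K^2*P.theta = 1 := by
  have hq := h.norm_Qr_lt; have hs := h.ofReal_s_ne; have hQ := h.ofReal_Qr_ne
  have hs2 := sq_pos_of_ne_zero h.s_ne
  have pI : ∀ {x : ℝ}, x < 1 → IsPos (Π(x;P.Qr)) := isPos_qPochInf h.Qr_pos h.Qr_lt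
  have pF : ∀ {x : ℝ}, x < 1 → ∀ n, IsPos (qPoch x P.Qr n) := isPos_qPoch h.Qr_pos h.Qr_lt
  have mlt : ∀ {x : ℝ}, 0 ≤ x → x < 1 → ∀ n, x*P.Qr^n < 1 := fun h0 h1 n =>
    mul_lt_one_left h0 h1 (pow_le_one₀ h.Qr_pos.le h.Qr_lt.le)
  have hκ : P.κ₂^2 < 1 := pow_lt_one₀ h.κ₂_pos.le h.κ₂_lt two_ne_zero; have hκ0 := h.κ₂_pos
  have hv0 : 0 ≤ P.κ₂^2/P.s^2 := by bound
  have hv := h.div_sq_lt_one hκ.le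
  have hCb : (P.pC:ℂ)*P.pb = ((P.κ₂^2:ℝ):ℂ) := by rw [← h.pC_mul_pb]; push_cast; rfl
  have hABCb : A*B*P.pC*P.pb = ((P.κ₂^2/P.s^2:ℝ):ℂ)*P.Qr := by
    rw [mul_assoc, hAB, hCb]; push_cast; ring
  have hz0 := div_pos h.Qr_pos hs2; have hz := h.div_sq_lt_one h.Qr_lt.le
  have hN := awNormSq_mul_awConst h.Qr_pos h.Qr_lt hAB hCb hz hκ hABCb hv0 hv hC hb p
  have c0 := pI h.Qr_lt; have cz := pI hz; have cC := pI hκ; have cC' := pF hκ p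
  have cz' := (pI (mlt hz0.le hz p)).ne_zero; have cv' := (pI (mlt hv0 hv p)).ne_zero
  have cq' := (pF h.Qr_lt p).ne_zero
  have cv2 : IsPos (1-P.κ₂^2/P.s^2*P.Qr^(2*p)) := ⟨_, sub_pos.2 (mlt hv0 hv (2*p)), by simp⟩
  have cθ := h.isPos_theta.ne_zero; rw [theta, h.ascInvMass_eq]; rw [theta] at cθ
  have e1 : (P.pb:ℂ)*A = A*P.pb := mul_comm _ _; have e2 : (P.pb:ℂ)*B = B*P.pb := mul_comm _ _
  have e3 : (P.pb:ℂ)*P.pC = P.pC*P.pb := mul_comm _ _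
  simp only [qPochs_cons, qPochs_nil, e1, e2, e3, hAB, hCb] at hK
  have hKp : IsPos K := by
    have := ((((IsPos.of_real h.pb_pos).inv.pow p).mul ((hb.2 p).mul cC')).mul
      ((((IsPos.of_real hκ0).pow 2).mul ((IsPos.of_real h.Qr_pos).pow p)).div
        (IsPos.of_real hs2) |>.pow p)).div (((c0.mul cz).mul hb.1).mul cC)
    rw [hK]; convert this using 1; push_cast; ring
  refine ⟨hKp, isPos_awConst_of_pairPos h.Qr_pos h.Qr_lt hAB hCb hz hκ hABCb hv0 hv hC hb,
    isPos_awNormSq h.Qr_pos h.Qr_lt hAB hCb hz hκ hABCb hv0 hv hC hb p, ?_⟩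
  have hpw : ((P.pb:ℂ)⁻¹^p*((P.κ₂:ℂ)^2*P.Qr^p/P.s^2)^p)^2 =
      (P.Qr/P.s^2*P.pC^2)^p*((P.Qr:ℂ)^(p.choose 2))^2 * (((P.s:ℂ)^2)⁻¹^p*P.Qr^(p^2)) := by
    have hb0 := ofReal_ne h.pb_pos; rw [← ofReal_pow, ← hCb, pow_right_comm, sq_pow_choose hQ]
    simp only [mul_pow, div_pow, inv_pow]; field_simp; ring
  have n1 := (hb.2 p).ne_zero; have n2 := hb.1.ne_zero; have n3 := hC.1.ne_zero
  have n4 := cC'.ne_zero; have n5 := cC.ne_zero; have n6 := c0.ne_zero; have n7 := cz.ne_zero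
  have n8 := cv2.ne_zero; have n9 := h.pc_mul_pb_lt; have n10 := (pI n9).ne_zero
  have m1 : Π(A*P.pC*P.Qr^p;P.Qr)*Π(B*P.pC*P.Qr^p;P.Qr) ≠ 0 := by
    refine right_ne_zero_of_mul (a := qPoch (A*P.pC) P.Qr p*qPoch (B*P.pC) P.Qr p) ?_
    rwa [mul_mul_mul_comm, ← qPochInf_split hq, ← qPochInf_split hq]
  have m2 := left_ne_zero_of_mul m1; have m3 := right_ne_zero_of_mul m1
  have hL : ((P.Qr:ℂ)/P.s^2)^P.L ≠ 0 := pow_ne_zero _ (div_ne_zero hQ (pow_ne_zero 2 hs))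
  rw [hN, hK, nuRatio]
  simp only [qPochInfs_cons, qPochInfs_nil, hAB, hCb, ofReal_div, ofReal_pow, ofReal_mul] at *
  rw [qPochInf_split hq _ p] at n6; rw [qPochInf_split hq _ p] at n5
  rw [qPochInf_split hq (A*P.pb:ℂ) p, qPochInf_split hq (B*P.pb:ℂ) p] at n2
  rw [qPochInf_split hq (P.Qr:ℂ) p, qPochInf_split hq (A*P.pb:ℂ) p,
    qPochInf_split hq (B*P.pb:ℂ) p, qPochInf_split hq ((P.κ₂:ℂ)^2) p]
  have hP1 : ((P.Qr:ℂ)/P.s^2*P.pC^2)^p*((P.Qr:ℂ)^(p.choose 2))^2 *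
        (((P.s:ℂ)^2)⁻¹^p*P.Qr^(p^2)) ≠ 0 := by
    have hC0 := ofReal_ne h.pC_pos; positivity
  clear hK hKp hN cθ hABCb hAB
  generalize (P.pb:ℂ)⁻¹^p = t1, ((P.κ₂:ℂ)^2*P.Qr^p/P.s^2)^p = t2, ((P.Qr:ℂ)/P.s^2)^P.L = t3,
    ((P.Qr:ℂ)/P.s^2*P.pC^2)^p*((P.Qr:ℂ)^(p.choose 2))^2 = t4,
    ((P.s:ℂ)^2)⁻¹^p*(P.Qr:ℂ)^(p^2) = t5 at *
  simp only [mul_one, ne_eq, mul_eq_zero, not_or] at *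
  generalize Π(P.Qr*P.Qr^p;P.Qr) = x1, Π(P.Qr/P.s^2*P.Qr^p;P.Qr) = x2,
    Π(A*P.pC*P.Qr^p;P.Qr) = x3, Π(A*P.pb*P.Qr^p;P.Qr) = x4,
    Π(B*P.pC*P.Qr^p;P.Qr) = x5, Π(B*P.pb*P.Qr^p;P.Qr) = x6,
    Π(P.κ₂^2*P.Qr^p;P.Qr) = x7, Π(P.κ₂^2/P.s^2*P.Qr^p;P.Qr) = x8,
    Π((P.Qr/P.s^2:ℂ);P.Qr) = x9, Π(P.pc*P.pb;P.Qr) = y1,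
    qPoch P.Qr P.Qr p = y2, qPoch (A*P.pb) P.Qr p = y3, qPoch (B*P.pb) P.Qr p = y4,
    qPoch ((P.κ₂:ℂ)^2) P.Qr p = y5, 1-(P.κ₂:ℂ)^2/P.s^2*P.Qr^(2*p) = y6 at *
  obtain ⟨⟨-, n11⟩, -, n12⟩ := n2; obtain ⟨n13, n14⟩ := n1; obtain ⟨-, n15⟩ := n5
  obtain ⟨-, n16⟩ := n6; obtain ⟨n17, n18⟩ := hP1; field_simp; grind

/-- The constant for the mass points `x` with small parameter `A`. -/
lemma const_far {A B : ℂ} {N m p : ℕ} (hp : p = N+m) (hA : A = ((P.pc/P.Qr^N:ℝ):ℂ))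
    (hB : B = ((P.pC*P.Qr^N/P.s^2:ℝ):ℂ)) {K ω : ℂ}
    (hω : ω = A^(2*N)*((P.Qr:ℂ)^(N.choose 2))^2)
    (hK : K = (-(P.pC*B))^N*(P.Qr:ℂ)^(N.choose 2)*ω *
      ((P.pb:ℂ)⁻¹^m*qPochs [P.pb*B, P.pb*(P.pC*(P.Qr:ℂ)^N), (P.pb:ℂ)*P.pc] P.Qr m) *
      ((P.κ₂:ℂ)^2*((P.Qr:ℂ)^N)^2*P.Qr^m/P.s^2)^m /
      (Π(P.Qr;P.Qr)*Π(A*B;P.Qr)*Π(P.pb*B;P.Qr) *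
        Π(P.pb*(P.pC*(P.Qr:ℂ)^N);P.Qr)*Π(P.pb*P.pc;P.Qr))) :
    IsPos ((-1)^N*K) ∧ IsPos (awConst P.Qr P.pc B (P.pC*(P.Qr:ℂ)^N) P.pb) ∧
    IsPos (awNormSq P.pc B (P.pC*(P.Qr:ℂ)^N) P.pb P.Qr m) ∧
    awNormSq P.pc B (P.pC*(P.Qr:ℂ)^N) P.pb P.Qr m * awConst P.Qr P.pc B (P.pC*(P.Qr:ℂ)^N) P.pb *
      (nuRatio P.Qr A B P.pC P.pc P.pb P.L p (P.ascInvMass p)/ω)*K^2*P.theta = 1 := by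
  have hq := h.norm_Qr_lt; have hs := h.ofReal_s_ne; have hQ := h.ofReal_Qr_ne
  have hs2 := sq_pos_of_ne_zero h.s_ne
  have pI : ∀ {x : ℝ}, x < 1 → IsPos (Π(x;P.Qr)) := isPos_qPochInf h.Qr_pos h.Qr_lt
  have pF : ∀ {x : ℝ}, x < 1 → ∀ n, IsPos (qPoch x P.Qr n) := isPos_qPoch h.Qr_pos h.Qr_lt
  have mlt : ∀ {x : ℝ}, 0 ≤ x → x < 1 → ∀ n, x*P.Qr^n < 1 := fun h0 h1 n =>
    mul_lt_one_left h0 h1 (pow_le_one₀ h.Qr_pos.le h.Qr_lt.le)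
  have hκ : P.κ₂^2 < 1 := pow_lt_one₀ h.κ₂_pos.le h.κ₂_lt two_ne_zero; have hκ0 := h.κ₂_pos
  have hC0 := h.pC_pos; have hc0 := h.pc_pos; have hb0 := h.pb_pos; have hQ0 := h.Qr_pos
  have hQN := pow_ne_zero N hQ; have hC1 : P.pC < 1 := h.pC_le.trans_lt h.q_lt_one
  have hv0 : 0 ≤ P.κ₂^2/P.s^2 := by positivity
  have hv := h.div_sq_lt_one hκ.le; have hz := h.div_sq_lt_one h.Qr_lt.le
  have rCc : (P.pC:ℂ)*P.pc = P.Qr := by exact_mod_cast h.pC_mul_pc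
  have rC0 := ofReal_ne hC0; have rc : (P.pc:ℂ) = P.Qr/P.pC := by rw [← rCc]; field_simp
  have rCb : (P.pC:ℂ)*P.pb = (P.κ₂:ℂ)^2 := by exact_mod_cast h.pC_mul_pb
  have hB' : B = P.pC*P.Qr^N/P.s^2 := by rw [hB]; push_cast; rfl
  have hA' : A = P.pc/P.Qr^N := by rw [hA]; push_cast; rfl
  have hAB : A*B = P.Qr/P.s^2 := by rw [hA', hB', rc]; field_simp
  have hcB : (P.pc:ℂ)*B = ((P.Qr/P.s^2*P.Qr^N:ℝ):ℂ) := by rw [hB']; push_cast; rw [← rCc]; ring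
  have hCb : (P.pC:ℂ)*P.Qr^N*P.pb = ((P.κ₂^2*P.Qr^N:ℝ):ℂ) := by push_cast; rw [← rCb]; ring
  have hBb : B*P.pb = ((P.κ₂^2/P.s^2*P.Qr^N:ℝ):ℂ) := by rw [hB']; push_cast; rw [← rCb]; ring
  have hBb1 := mlt hv0 hv N; have hcb1 := h.pc_mul_pb_lt
  have hv' : (P.pc:ℂ)*B*(P.pC*P.Qr^N)*P.pb = ((P.κ₂^2/P.s^2*P.Qr^(2*N) : ℝ) : ℂ)*P.Qr := by
    rw [hB']; push_cast; rw [← rCb, ← rCc]; ring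
  have hpb : PairPos P.Qr (P.pc*P.pb) (B*P.pb) := by
    rw [hBb, ← ofReal_mul]; exact .of_real h.Qr_pos h.Qr_lt hcb1 hBb1
  have hpC : PairPos P.Qr (P.pc*(P.pC*P.Qr^N)) (B*(P.pC*P.Qr^N)) := by
    have e1 : (P.pc:ℂ)*(P.pC*P.Qr^N) = ((P.Qr*P.Qr^N:ℝ):ℂ) := by push_cast; rw [← rCc]; ring
    have e2 : B*(P.pC*P.Qr^N) = ((P.pC*P.Qr^N*(P.pC*P.Qr^N)/P.s^2 : ℝ) : ℂ) := by
      rw [hB']; push_cast; ring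
    have h3 := (mlt hC0.le hC1 N).le; rw [e1, e2]
    exact .of_real h.Qr_pos h.Qr_lt (mlt h.Qr_pos.le h.Qr_lt N)
      (h.div_sq_lt_one (mul_le_one₀ h3 (by positivity) h3))
  have hx1 := mlt (div_pos h.Qr_pos hs2).le hz N; have hz1 := mlt (sq_nonneg P.κ₂) hκ N
  have hw0 : 0 ≤ P.κ₂^2/P.s^2*P.Qr^(2*N) := by positivity
  have hw1 := mlt hv0 hv (2*N)
  have hN := awNormSq_mul_awConst h.Qr_pos h.Qr_lt hcB hCb hx1 hz1 hv' hw0 hw1 hpC hpb m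
  have c0 := pI h.Qr_lt; have cz := pI hz; have cC := pI hz1; have cC' := pF hz1 m
  rw [← hCb] at cC cC'; push_cast at cz; rw [← hAB] at cz
  have e1 : (P.pb:ℂ)*P.pc = P.pc*P.pb := mul_comm _ _; have e2 : (P.pb:ℂ)*B = B*P.pb := mul_comm _ _
  have e3 : (P.pb:ℂ)*(P.pC*P.Qr^N) = P.pC*P.Qr^N*P.pb := mul_comm _ _
  simp only [qPochs_cons, qPochs_nil, e1, e2, e3] at hK
  have hB0 : IsPos B := ⟨_, by positivity, hB⟩
  have hω0 : IsPos ω := by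
    rw [hω]; exact (IsPos.pow ⟨_, by positivity, hA⟩ _).mul (((IsPos.of_real hQ0).pow _).pow _)
  have hKp : IsPos ((-1)^N*K) := by
    have := ((((((IsPos.of_real hC0).mul hB0).pow N).mul ((IsPos.of_real hQ0).pow (N.choose 2))).mul hω0).mul
      (((IsPos.of_real hb0).inv.pow m).mul ((hpb.2 m).mul cC'))).mul
      (((((IsPos.of_real hκ0).pow 2).mul (((IsPos.of_real hQ0).pow N).pow 2)).mul
        ((IsPos.of_real hQ0).pow m)).div (IsPos.of_real hs2) |>.pow m) |>.div
      (((c0.mul cz).mul hpb.1).mul cC)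
    rw [hK, neg_pow]; convert this using 1
    have h1 : ((-1:ℂ)^N)*(-1)^N = 1 := by rw [← mul_pow]; simp
    push_cast
    linear_combination ((P.pC*B)^N*(P.Qr:ℂ)^(N.choose 2)*ω *
      ((P.pb:ℂ)⁻¹^m*(qPoch (B*P.pb) P.Qr m*(qPoch (P.pC*P.Qr^N*P.pb) P.Qr m *
        (qPoch (P.pc*P.pb) P.Qr m*1)))) *
      ((P.κ₂:ℂ)^2*((P.Qr:ℂ)^N)^2*P.Qr^m/P.s^2)^m /
      (Π(P.Qr;P.Qr)*Π(A*B;P.Qr)*Π(B*P.pb;P.Qr) * Π(P.pC*P.Qr^N*P.pb;P.Qr)*Π(P.pc*P.pb;P.Qr)))*h1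
  refine ⟨hKp, isPos_awConst_of_pairPos h.Qr_pos h.Qr_lt hcB hCb hx1 hz1 hv' hw0 hw1 hpC hpb,
    isPos_awNormSq h.Qr_pos h.Qr_lt hcB hCb hx1 hz1 hv' hw0 hw1 hpC hpb m, ?_⟩
  have hpw : ((-(P.pC*B))^N*(P.Qr:ℂ)^(N.choose 2)*(P.pb:ℂ)⁻¹^m *
      ((P.κ₂:ℂ)^2*((P.Qr:ℂ)^N)^2*P.Qr^m/P.s^2)^m)^2*ω =
      (P.Qr/P.s^2*P.pC^2)^p*((P.Qr:ℂ)^(p.choose 2))^2 * (((P.s:ℂ)^2)⁻¹^p*P.Qr^(p^2)) := by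
    have hb0 := ofReal_ne hb0
    have hch : ∀ n : ℕ, ((P.Qr:ℂ)^(n.choose 2))^2 = P.Qr^(n*n)/P.Qr^n := fun n => by
      rw [pow_right_comm, sq_pow_choose hQ]
    have hsg : ((-(P.pC*B))^N)^2 = ((P.pC*B)^N)^2 := by rw [pow_right_comm, neg_sq, pow_right_comm]
    simp only [mul_pow _ _ 2, hsg]; rw [hω, hA', hB', ← rCb, rc, hp, hch, hch]
    simp only [mul_pow, div_pow, inv_pow]; field_simp; ring
  have n2 := hpb.1.ne_zero; have n4 := cC'.ne_zero; have n5 := cC.ne_zero; have n6 := c0.ne_zero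
  have n7 := cz.ne_zero; have n3 := hpC.1.ne_zero; have n1 := (hpb.2 m).ne_zero
  have nω := hω0.ne_zero; have cκ := (pI hκ).ne_zero; have cv := (pI (mlt hv0 hv m)).ne_zero
  have n8 := sub_ne_zero.2 (mlt hv0 hv (2*p)).ne'
  have hL : ((P.Qr:ℂ)/P.s^2)^P.L ≠ 0 := pow_ne_zero _ (div_ne_zero hQ (pow_ne_zero 2 hs))
  have n8' : (1:ℂ)-P.κ₂^2/P.s^2*P.Qr^(2*p) ≠ 0 := by exact_mod_cast n8
  have hP1 : ((P.Qr:ℂ)/P.s^2*P.pC^2)^p*((P.Qr:ℂ)^(p.choose 2))^2 *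
        (((P.s:ℂ)^2)⁻¹^p*P.Qr^(p^2)) ≠ 0 := by positivity
  -- All infinite products in terms of those that remain.
  have g1 : (P.pc:ℂ)*B*P.Qr^m = P.Qr/P.s^2*P.Qr^p := by rw [hcB, hp]; push_cast; ring
  have g2 : (P.pc:ℂ)*(P.pC*P.Qr^N)*P.Qr^m = P.Qr*P.Qr^p := by rw [hp, ← rCc]; ring
  have g3 : B*(P.pC*P.Qr^N)*P.Qr^m = B*P.pC*P.Qr^p := by rw [hp]; ring
  have g4 : (P.pC:ℂ)*P.Qr^N*P.pb*P.Qr^m = P.κ₂^2*P.Qr^p := by rw [hCb, hp]; push_cast; ring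
  have g5 : ((P.κ₂^2/P.s^2*P.Qr^(2*N) : ℝ) : ℂ)*P.Qr^(2*m) =
      P.κ₂^2/P.s^2*P.Qr^(2*p) := by rw [hp]; push_cast; ring
  have g6 : ((P.κ₂^2/P.s^2*P.Qr^(2*N) : ℝ) : ℂ)*P.Qr^m =
      B*P.pb*P.Qr^p := by rw [hBb, hp]; push_cast; ring
  have g7 : (P.κ₂:ℂ)^2/P.s^2*P.Qr^p = B*P.pb*P.Qr^m := by rw [hBb, hp]; push_cast; ring
  have g8 : A*P.pb*P.Qr^p = P.pc*P.pb*P.Qr^m := by rw [hA', hp]; field_simp; ring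
  have g9 : A*P.pC*P.Qr^p = P.Qr*P.Qr^m := by rw [hA', hp, rc]; field_simp; ring
  have cq' := (pF h.Qr_lt p).ne_zero; have ck' := (pF hκ p).ne_zero
  have n9 := right_ne_zero_of_mul n3; rw [qPochInf_split hq _ m, g3] at n9
  have n10 := left_ne_zero_of_mul n3; rw [qPochInf_split hq _ m, g2] at n10
  have n11 : Π((P.Qr/P.s^2*P.Qr^p:ℂ);P.Qr) ≠ 0 := by
    have := hcB ▸ (pI hx1).ne_zero; rw [qPochInf_split hq _ m, g1] at this
    exact right_ne_zero_of_mul this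
  have n12 : Π((P.Qr*P.Qr^m:ℂ);P.Qr) ≠ 0 := right_ne_zero_of_mul (qPochInf_split hq (P.Qr:ℂ) m ▸ n6)
  have n13 : Π((B*P.pb*P.Qr^p:ℂ);P.Qr) ≠ 0 :=
    right_ne_zero_of_mul (qPochInf_split hq (B*P.pb:ℂ) p ▸ right_ne_zero_of_mul n2)
  rw [theta, h.ascInvMass_eq, hN, hK, nuRatio]
  rw [qPochInf_split hq (P.pc*P.pb:ℂ) m, qPochInf_split hq (B*P.pb:ℂ) m] at n2
  rw [qPochInf_split hq _ m, g4] at n5; rw [hAB] at n7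
  simp only [qPochInfs_cons, qPochInfs_nil, hAB, rCb, g1, g2,
    g3, g4, g5, g6, g7, g8, g9, qPochInf_split hq (P.pc*P.pb:ℂ) m,
    qPochInf_split hq (B*P.pb:ℂ) m, qPochInf_split hq (P.pC*P.Qr^N*P.pb:ℂ) m,
    qPochInf_split hq ((P.κ₂:ℂ)^2) p, qPochInf_split hq (P.Qr:ℂ) p]
  have hpw' : ((-(P.pC*B))^N*(P.Qr:ℂ)^(N.choose 2))^2*(((P.pb:ℂ)⁻¹^m)^2 *
      (((P.κ₂:ℂ)^2*((P.Qr:ℂ)^N)^2*P.Qr^m/P.s^2)^m)^2*ω) = _ :=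
    Eq.trans (by ring) hpw
  push_cast at ck'; clear hK hKp hN hcB hBb hCb hpw cz cC cC' c0 hB' hA' hω
  generalize (P.pb:ℂ)⁻¹^m = t1, (-(P.pC*B))^N*(P.Qr:ℂ)^(N.choose 2) = t0,
    ((P.κ₂:ℂ)^2*((P.Qr:ℂ)^N)^2*P.Qr^m/P.s^2)^m = t2,
    ((P.Qr:ℂ)/P.s^2)^P.L = t3,
    ((P.Qr:ℂ)/P.s^2*P.pC^2)^p*((P.Qr:ℂ)^(p.choose 2))^2 = t4,
    ((P.s:ℂ)^2)⁻¹^p*(P.Qr:ℂ)^(p^2) = t5 at *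
  clear rCb rc rCc hAB g1 g2 g3 g4 g5 g6 g7 g8 g9 n1 n3 n6 hv' hpb hpC e1 e2 e3
  simp only [mul_one, ne_eq, mul_eq_zero, not_or] at *
  obtain ⟨⟨n14, n15⟩, n16, n17⟩ := n2; obtain ⟨n18, n19⟩ := hP1; have n5 := n5.2; have n9 := n9.2
  have n10 := n10.2
  generalize Π(P.Qr*P.Qr^p;P.Qr) = x1, Π(P.Qr/P.s^2*P.Qr^p;P.Qr) = x2,
    Π(P.Qr*P.Qr^m;P.Qr) = x3, Π(P.pc*P.pb*P.Qr^m;P.Qr) = x4,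
    Π(B*P.pC*P.Qr^p;P.Qr) = x5, Π(B*P.pb*P.Qr^p;P.Qr) = x6,
    Π(P.κ₂^2*P.Qr^p;P.Qr) = x7, Π(B*P.pb*P.Qr^m;P.Qr) = x8,
    Π((P.Qr/P.s^2:ℂ);P.Qr) = x9, qPoch (P.pc*P.pb) P.Qr m = y1,
    qPoch P.Qr P.Qr p = y2, qPoch (P.pC*(P.Qr:ℂ)^N*P.pb) P.Qr m = y3,
    qPoch (B*P.pb) P.Qr m = y4, qPoch ((P.κ₂:ℂ)^2) P.Qr p = y5,
    1-(P.κ₂:ℂ)^2/P.s^2*P.Qr^(2*p) = y6 at *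
  field_simp; linear_combination hpw'

end Params.Admissible

/-! ### The points of the interval -/

namespace CGBase

variable {q C c b e o : ℝ} {N : ℕ} (H : CGBase q C c b e o N)

include H

/-- A mass point of the reference measure that is not a zero of `(c z, c / z; q)_∞` is close to
`[-1, 1]`. -/
lemma norm_lt_one_or {y : ℝ} (hy : OnSupp q e N y) {ρ : ℂ} (hρ : ‖ρ‖ < 1) (hbρ : b * ‖ρ‖ < 1) :
    hInf c q y = 0 ∨ ‖ρ*expArg y‖ < 1 ∧ ‖ρ*(expArg y)⁻¹‖ < 1 := by
  rcases hy with ⟨θ, -, rfl⟩ | ⟨k, hk, rfl⟩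
  · right; have hz := norm_exp_mul_I θ
    rcases expArg_eq_or (exp_ne_zero _) (exp_add_inv θ) with h | h <;>
      simp only [h, norm_mul, norm_inv, hz, inv_one, inv_inv, mul_one, hρ, and_self]
  rcases H.cases with ⟨rfl, -⟩ | ⟨rfl, -⟩
  · right; have hv := (H.masses k).1 hk; have hv0 : (0:ℝ) < e*q^k := by linarith
    have hz : ((e*q^k:ℝ):ℂ) ≠ 0 := by exact_mod_cast hv0.ne'
    have hz' : ‖((e*q^k:ℝ):ℂ)‖ = e*q^k := by rw [norm_real, norm_of_nonneg hv0.le]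
    have h1 : ‖ρ*((e*q^k:ℝ):ℂ)‖ < 1 := by
      rw [norm_mul, hz', mul_comm, mul_right_comm]
      exact mul_lt_one_left (by have := H.b_pos; positivity) hbρ (pow_le_one₀ H.q_pos.le H.q_lt.le)
    have h2 : ‖ρ*((e*q^k:ℝ):ℂ)⁻¹‖ < 1 := by
      rw [norm_mul, norm_inv, hz']
      exact mul_lt_one_left (norm_nonneg _) hρ (inv_le_one_of_one_le₀ hv.le)
    rcases expArg_eq_or hz mu_add_inv with h | h <;> rw [h]
    · grind
    grind
  · left
    rw [hInf_split H.norm_lt (e:ℂ) (k+1), hFin_mu_eq_zero H.q_pos H.c_pos.ne' (Nat.lt_succ_self k),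
      zero_mul]

lemma hInf_c_nonneg {y : ℝ} (hy : OnSupp q e N y) : ∃ t : ℝ, 0 ≤ t ∧ hInf c q y = t := by
  rcases H.cases with ⟨-, h⟩ | ⟨h, -⟩
  · subst h; obtain ⟨t, ht, h⟩ := H.isPos_hInf_o hy; grind
  · subst h; exact hy.hInf_nonneg H.q_pos H.q_lt H.c_pos

end CGBase

namespace Params.Admissible

variable {P : Params} (h : P.Admissible)

include h

lemma norm_rho_lt : ‖(P.q/P.s:ℂ)‖ < 1 ∧ P.pb * ‖(P.q/P.s:ℂ)‖ < 1 := by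
  have h1 : ‖(P.q/P.s:ℂ)‖ = P.q / |P.s| := by
    rw [norm_div, norm_real, norm_real, norm_of_nonneg h.q_pos.le, norm_eq_abs]
  have hs := abs_pos.2 h.s_ne
  have hs1 : 1 < |P.s| := (one_lt_inv₀ h.q_pos |>.2 h.q_lt_one).trans_le h.s_large
  have hq := h.q_pos; rw [h1]; refine ⟨(div_lt_one hs).2 (h.q_lt_one.trans hs1), ?_⟩
  have : P.pb*(P.q / |P.s|) = P.κ₁*P.κ₂ / |P.s| := by rw [pb]; field_simp
  rw [this, div_lt_one hs]; exact (mul_lt_one_left h.κ₁_pos.le h.κ₁_lt h.κ₂_lt.le).trans hs1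

omit h in
lemma mu_eq (p:ℕ) : (P.κ₂*(P.Qr:ℂ)^p/P.s)+(P.κ₂*(P.Qr:ℂ)^p/P.s)⁻¹ =
    2*(mu (P.κ₂*P.Qr^p/P.s) : ℝ) := by
  rw [← mu_add_inv]; push_cast; rfl

lemma regular {A B C b : ℂ} (hAB : ‖A*B‖ < 1) (hAC : ‖A*C‖ < 1) (hAb : ‖A*b‖ < 1)
    (hBC : ‖B*C‖ < 1) (hBb : ‖B*b‖ < 1) (hCb : ‖C*b‖ < 1) (ht : ‖A*B*C*b/P.Qr^2‖ < 1) :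
    AWRegular A B C b P.Qr := by
  have hq := h.norm_Qr_lt
  refine ⟨h.ofReal_Qr_ne, mul_pow_ne_one hq hq, fun j hj => ?_, mul_pow_ne_one hq hAB,
    mul_pow_ne_one hq hAC, mul_pow_ne_one hq hAb, mul_pow_ne_one hq hBC, mul_pow_ne_one hq hBb,
    mul_pow_ne_one hq hCb⟩
  refine mul_pow_ne_one hq ht j ?_
  rw [div_mul_eq_mul_div, hj, div_self (pow_ne_zero 2 h.ofReal_Qr_ne)]

lemma norm_pb_lt {A : ℂ} (hbA : P.pb * ‖A‖ < 1) : ‖A*P.pb‖ < 1 := by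
  rwa [norm_mul, norm_real, norm_of_nonneg h.pb_pos.le, mul_comm]

lemma norm_pC_lt {A : ℂ} (hA : ‖A‖ < 1) : ‖A*P.pC‖ < 1 := by
  rw [norm_mul, norm_real, norm_of_nonneg h.pC_pos.le]
  exact mul_lt_one_left (norm_nonneg _) hA (h.pC_le.trans h.q_lt_one.le)

lemma norm_pC_mul_pb : ‖(P.pC*P.pb:ℂ)‖ < 1 := by
  rw [← ofReal_mul, norm_real]; exact abs_lt_one (mul_pos h.pC_pos h.pb_pos) h.pC_mul_pb_lt

lemma norm_pc_mul_pb : ‖(P.pc*P.pb:ℂ)‖ < 1 := by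
  rw [← ofReal_mul, norm_real]; exact abs_lt_one (mul_pos h.pc_pos h.pb_pos) h.pc_mul_pb_lt

omit h in
lemma rho_sq : (P.q/P.s:ℂ)^2 = ((P.Qr/P.s^2:ℝ):ℂ) := by rw [Qr]; push_cast; rw [div_pow]

lemma norm_AB_lt {A B : ℂ} (hAB : A*B = ((P.Qr/P.s^2:ℝ):ℂ)) : ‖A*B‖ < 1 := by
  rw [hAB, norm_real]
  exact abs_lt_one (div_pos h.Qr_pos (sq_pos_of_ne_zero h.s_ne)) (h.div_sq_lt_one h.Qr_lt.le)

lemma norm_total_lt {T : ℂ} {n : ℕ} (hT : T = ((P.Qr/P.s^2:ℝ):ℂ)*(P.pC*P.pb) *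
    P.Qr^n) : ‖T/P.Qr^2‖ < 1 := by
  have hCb : (P.pC:ℂ)*P.pb = ((P.κ₂^2:ℝ):ℂ) := by rw [← h.pC_mul_pb]; push_cast; rfl
  have e : T/P.Qr^2 = (((P.s^2)⁻¹/P.Qr*P.κ₂^2*P.Qr^n : ℝ) : ℂ) := by
    have := h.ofReal_Qr_ne; have := h.ofReal_s_ne; rw [hT, hCb]; push_cast; field_simp
  have hs := sq_pos_of_ne_zero h.s_ne; have hQ := h.Qr_pos; have hκ := h.κ₂_pos
  rw [e, norm_real, norm_of_nonneg (by positivity)]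
  have h1 : (P.s^2)⁻¹/P.Qr ≤ 1 := (div_le_one hQ).2 h.inv_sq_le
  have h2 : P.κ₂^2 < 1 := pow_lt_one₀ hκ.le h.κ₂_lt two_ne_zero
  exact mul_lt_one_left (by positivity)
    (mul_lt_one_of_nonneg_of_lt_one_right h1 (by positivity) h2) (pow_le_one₀ hQ.le h.Qr_lt.le)

/-- The formula at a point `x` for which `awParams` is `(q u / s, q / (u s), C, b)`. -/
lemma hasCGIntegral_near {e o : ℝ} {N : ℕ} (H : CGBase P.Qr P.pC P.pc P.pb e o N)
    {X : SpecPoint} {p : ℕ} (n₁ n₂:ℕ) {A B : ℂ} {G : ℝ → ℂ}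
    (hX : X.awParams P = (A, B, (P.pC:ℂ), (P.pb:ℂ))) (hm : X.deg P p = p) (hu : X.u P ≠ 0)
    (hux : X.u P+(X.u P)⁻¹ = 2*X.x P) (hA : A = P.q/P.s*X.u P)
    (hB : B = P.q/P.s/X.u P)
    (hAC : ‖A*P.pC‖ < 1) (hBC : ‖B*P.pC‖ < 1) (hAb : ‖A*P.pb‖ < 1)
    (hBb : ‖B*P.pb‖ < 1) (hC : PairPos P.Qr (A*P.pC) (B*P.pC))
    (hb : PairPos P.Qr (A*P.pb) (B*P.pb)) (hGm : Measurable G)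
    (hG : ∀ᵐ y ∂refM P.Qr e N, ∃ t : ℝ, 0 ≤ t ∧ G y = t)
    (hD : AWDensity P.Qr (refM P.Qr e N) (fun y => G y/(hInf P.pC P.Qr y*hInf o P.Qr y))
      A B P.pC P.pb)
    (hM : AWMoments P.Qr (refM P.Qr e N)
      (fun y => G y/(hInf P.pC P.Qr y*hInf o P.Qr y)) A B P.pC P.pb)
    (hν : ∀ᵐ y ∂refM P.Qr e N, G y ≠ 0 → X.nuOverM P p y =
      (nuRatio P.Qr A B P.pC P.pc P.pb P.L p (P.ascInvMass p) * (G y*hInf P.pC P.Qr y)).re)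
    (hz : ∀ D, ∀ᵐ y ∂refM P.Qr e N, hFin P.pc P.Qr D y = 0 →
      wFun P.Qr A B ((P.pC/P.Qr^D:ℝ):ℂ) y*G y = 0) :
    P.HasCGIntegral X n₁ n₂ p := by
  have hAB : A*B = ((P.Qr/P.s^2:ℝ):ℂ) := by rw [← rho_sq, hA, hB]; field_simp
  have hAB1 := h.norm_AB_lt hAB; have hCb1 := h.norm_pC_mul_pb
  have hT : ‖A*B*P.pC*P.pb/P.Qr^2‖ < 1 := h.norm_total_lt (n := 0) (by
    rw [hAB, pow_zero, mul_one, mul_assoc])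
  have hQ : (P.q:ℂ)^2 = P.Qr := by rw [Qr]; push_cast; rfl
  have hκ : ∀ j : ℕ, (P.κ₁:ℂ)^2*(P.Qr:ℂ)^j ≠ 1 := mul_pow_ne_one h.norm_Qr_lt <| by
    rw [← ofReal_pow, norm_real]
    exact abs_lt_one (pow_pos h.κ₁_pos 2) (pow_lt_one₀ h.κ₁_pos.le h.κ₁_lt two_ne_zero)
  have hI := integral_awPoly_mul_cgFun h.Qr_pos h.Qr_lt hQ h.ofReal_κ₁_ne h.ofReal_κ₂_ne
    h.ofReal_s_ne hu hux (by rw [hA]; ring) (by rw [hB]; field_simp) (by rw [pC]; push_cast; rfl)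
    (by rw [pb]; push_cast; rfl) hM (h.regular hAB1 hAC hAb hBC hBb hCb1 hT) (mu_eq p) hAB1 hAC
    hAb hBC hBb hCb1 hκ n₁ n₂
  generalize hK : (P.pb:ℂ)⁻¹^p*_*_/_ = K at hI
  obtain ⟨c1, c2, c3, c4⟩ := h.const_near hAB hC hb p hK.symm
  exact h.hasCGIntegral H n₁ n₂ hX hu hA hB (ae_refM e N |>.mono fun y hy => H.isPos_hInf_C hy)
    hGm hG hD (fun y => rfl) hν c2 (by rwa [hm]) hz hM (by rwa [hm])
    (by rwa [hm, Nat.sub_self, pow_zero, one_mul]) (by rwa [hm])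

/-- The formula for `x` in `[-1, 1]`. -/
theorem hasCGIntegral_cont {e o : ℝ} {N : ℕ} (H : CGBase P.Qr P.pC P.pc P.pb e o N)
    {x : ℝ} (hx : x ∈ Icc (-1:ℝ) 1) (n₁ n₂ p:ℕ) :
    P.HasCGIntegral (.cont x) n₁ n₂ p := by
  have hq := h.norm_Qr_lt; obtain ⟨hρ, hbρ⟩ := h.norm_rho_lt; have hu := expArg_ne_zero x
  have hu1 : ‖expArg x‖ = 1 := by
    have hc : cos (arccos x) = x := cos_arccos hx.1 hx.2; have hn := norm_exp_mul_I (arccos x)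
    have := expArg_eq_or (y := x) (exp_ne_zero _) (by rw [exp_add_inv (arccos x), hc])
    rcases this with h | h <;> rw [h]
    · simp
    simp
  set A : ℂ := P.q/P.s*expArg x with hA
  have hB : conj A = P.q/P.s/expArg x := by
    rw [hA, map_mul, map_div₀, conj_ofReal, conj_ofReal, ← Complex.inv_eq_conj hu1,
      div_eq_mul_inv _ (expArg x)]
  have hA1 : ‖A‖ = ‖(P.q/P.s:ℂ)‖ := by simp [*]
  have hB1 : ‖conj A‖ = ‖A‖ := RCLike.norm_conj A; have hA2 := hρ; have hA3 := hbρ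
  rw [← hA1] at hA2 hA3; have hAC := h.norm_pC_lt hA2; have hAb := h.norm_pb_lt hA3
  obtain ⟨hD, hM⟩ := aw_cont H.q_pos H.q_lt H.C_pos H.C_lt H.c_pos H.b_pos H.C_mul_c H.C_mul_b
    H.c_mul_b H.cases H.o_lt H.masses hA2 hA3
  have hφ : (fun y => hInf P.pc P.Qr y*(1/(hInf A P.Qr y*hInf (conj A) P.Qr y *
      hInf P.pC P.Qr y*hInf o P.Qr y))) = fun y => hInf P.pc P.Qr y/(hInf A P.Qr y *
      hInf (conj A) P.Qr y)/(hInf P.pC P.Qr y*hInf o P.Qr y) := by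
    ring
  rw [hφ] at hD hM
  refine h.hasCGIntegral_near H n₁ n₂ ?_ rfl hu (expArg_add_inv x) hA hB hAC
    (h.norm_pC_lt (hB1 ▸ hA2)) hAb (h.norm_pb_lt (hB1 ▸ hA3)) ?_ ?_ ?_ ?_ hD hM ?_ fun D => ?_
  · rw [SpecPoint.awParams, h.qp_pC, h.qp_pb, hB, hA]; ring
  · rw [← conj_ofReal P.pC, ← map_mul, conj_ofReal]; exact .of_conj h.Qr_pos h.Qr_lt hAC
  · rw [← conj_ofReal P.pb, ← map_mul, conj_ofReal]; exact .of_conj h.Qr_pos h.Qr_lt hAb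
  · exact (measurable_hInf hq _).div ((measurable_hInf hq _).mul (measurable_hInf hq _))
  · filter_upwards [ae_refM e N] with y hy; obtain ⟨t, ht, hty⟩ := H.hInf_c_nonneg hy
    by_cases hne : hInf A P.Qr y = 0
    · exact ⟨0, le_rfl, by rw [hne, zero_mul, div_zero, ofReal_zero]⟩
    obtain ⟨r, hr, hr'⟩ := isPos_hInf_mul_hInf_conj A hq hne
    exact ⟨t/r, by positivity, by rw [hty, hr', ofReal_div]⟩
  · filter_upwards [ae_refM e N] with y hy hne; rcases H.norm_lt_one_or hy hρ hbρ with h0 | ⟨h1, h2⟩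
    · grind
    · rw [h.nuOverM_cont p hx hu (expArg_add_inv x) h1 h2, ← hA, ← hB]; ring
  · refine Eventually.of_forall fun y hy => ?_
    rw [hInf_split hq (P.pc:ℂ) D, hy, zero_mul, zero_div, mul_zero]

lemma abs_rho_div_uDisc_lt (l:ℕ) : |P.q/P.s/uDisc P l| < 1 ∧
    |P.pb*(P.q/P.s/uDisc P l)| < 1 := by
  obtain ⟨hρ, hbρ⟩ := h.norm_rho_lt; rw [← ofReal_div, norm_real, norm_eq_abs] at hρ hbρ
  have hu := inv_le_one_of_one_le₀ (h.one_lt_abs_uDisc l).le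
  rw [div_eq_mul_inv _ (uDisc P l), ← mul_assoc, abs_mul, abs_mul _ (_)⁻¹, abs_inv, abs_mul,
    abs_of_pos h.pb_pos]
  exact ⟨mul_lt_one_left (abs_nonneg _) hρ hu,
    mul_lt_one_left (mul_nonneg h.pb_pos.le (abs_nonneg _)) hbρ hu⟩

/-- The formula for the mass points `x_l` with `l ≤ K`. -/
theorem hasCGIntegral_disc_of_le {e o : ℝ} {N : ℕ} (H : CGBase P.Qr P.pC P.pc P.pb e o N)
    {l : ℕ} (hl : l ≤ P.K) (n₁ n₂ p:ℕ) : P.HasCGIntegral (.disc l) n₁ n₂ p := by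
  have hq := h.norm_Qr_lt; obtain ⟨j, hj⟩ := exists_eq_add_of_le hl; have hs := h.s_ne
  have hs2 := sq_pos_of_ne_zero hs; have hq0 := h.q_pos; have hQ0 := h.Qr_pos; have hκ₁ := h.κ₁_pos
  have hκ₂ := h.κ₂_pos
  have hA : P.q/P.s*uDisc P l = P.pc*P.Qr^j := by
    have := (pow_pos hQ0 l).ne'; rw [h.uDisc_eq, hj, pow_add, pc]; field_simp
  have hA0 : 0 < P.pc*P.Qr^j := mul_pos h.pc_pos (pow_pos hQ0 j)
  set B : ℝ := P.q/P.s/uDisc P l with hB; obtain ⟨hB1, hbB⟩ := h.abs_rho_div_uDisc_lt l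
  rw [← hB] at hB1 hbB; have hu0 : uDisc P l ≠ 0 := fun h0 => hA0.ne' (by grind)
  have hAB : P.pc*P.Qr^j*B = P.Qr/P.s^2 := by rw [← hA, hB, Qr]; field_simp
  have hB0 : 0 < B := pos_of_mul_pos_right (hAB ▸ div_pos hQ0 hs2) hA0.le
  have hAB1 : P.pc*P.Qr^j*B < 1 := hAB ▸ h.div_sq_lt_one h.Qr_lt.le
  have hA' : ((P.pc*P.Qr^j:ℝ):ℂ) = P.q/P.s*uDisc P l := by rw [← hA]; push_cast; rfl
  have hB' : (B:ℂ) = P.q/P.s/uDisc P l := by simp [*]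
  have hQj := pow_le_one₀ hQ0.le h.Qr_lt.le (n := j)
  have hAC : P.pc*P.Qr^j*P.pC < 1 := by
    rw [mul_right_comm, mul_comm P.pc, h.pC_mul_pc]; exact mul_lt_one_left hQ0.le h.Qr_lt hQj
  have hAb : P.pc*P.Qr^j*P.pb < 1 := by
    rw [mul_right_comm]; exact mul_lt_one_left (mul_pos h.pc_pos h.pb_pos).le h.pc_mul_pb_lt hQj
  have nR : ∀ {t r : ℝ}, 0 < t → 0 < r → t*r < 1 → ‖(t*r:ℂ)‖ < 1 := fun h0 h1 h2 => by
    rw [← ofReal_mul, norm_real]; exact abs_lt_one (mul_pos h0 h1) h2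
  have hBC : B*P.pC < 1 := mul_lt_one_left hB0.le (abs_of_pos hB0 ▸ hB1)
    (h.pC_le.trans h.q_lt_one.le)
  have hBb : B*P.pb < 1 := by rw [mul_comm]; exact (le_abs_self _).trans_lt hbB
  -- Where `(c z, c / z; q)_j` does not vanish, also `(B z, B / z; q)_∞` does not.
  have hpos : ∀ {y : ℝ}, OnSupp P.Qr e N y → hFin P.pc P.Qr j y ≠ 0 → IsPos (hInf B P.Qr y) := by
    intro y hy hne; rcases H.cases with ⟨rfl, -⟩ | ⟨rfl, -⟩
    · exact hy.isPos_hInf H.q_pos H.q_lt H.e_pos H.masses hB1 hbB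
    · refine OnSupp.isPos_hInf (N := N-j) H.q_pos H.q_lt hA0 (fun k => ?_) (hy.imp_right ?_) hB1
        (abs_lt_one (mul_pos hA0 hB0) hAB1)
      · rw [Nat.lt_sub_iff_add_lt, H.masses, pow_add, mul_assoc, mul_comm (_^k)]
      · rintro ⟨k, hk, rfl⟩
        have hjk : j ≤ k := not_lt.1 fun hlt => hne (hFin_mu_eq_zero H.q_pos H.c_pos.ne' hlt)
        exact ⟨k-j, by omega, by rw [mul_assoc, ← pow_add, Nat.add_sub_cancel' hjk]⟩
  obtain ⟨hD, hM⟩ := aw_disc H.q_pos H.q_lt H.C_pos H.C_lt H.c_pos H.b_pos H.C_mul_c H.C_mul_b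
    H.c_mul_b H.cases H.o_lt H.masses (B := B) (j := j) hB1
    (abs_lt_one (mul_pos hA0 hB0) hAB1) hbB
  have hφ : (fun y => hFin P.pc P.Qr j y*(1/(hInf B P.Qr y*hInf P.pC P.Qr y *
      hInf o P.Qr y))) = fun y => hFin P.pc P.Qr j y/hInf B P.Qr y /
      (hInf P.pC P.Qr y*hInf o P.Qr y) := by
    ring
  rw [hφ] at hD hM; have hu : (uDisc P l:ℂ) ≠ 0 := by simp [*]
  refine h.hasCGIntegral_near H n₁ n₂ ?_ (if_pos hl) hu mu_add_inv hA' hB' (nR hA0 h.pC_pos hAC)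
    (nR hB0 h.pC_pos hBC) (nR hA0 h.pb_pos hAb) (nR hB0 h.pb_pos hBb) ?_ ?_ ?_ ?_ hD hM ?_
    fun D => ?_
  · rw [SpecPoint.awParams, if_pos hl, h.qp_pC, h.qp_pb, hB', hA']; ring
  · rw [← ofReal_mul, ← ofReal_mul]; exact .of_real h.Qr_pos h.Qr_lt hAC hBC
  · rw [← ofReal_mul, ← ofReal_mul]; exact .of_real h.Qr_pos h.Qr_lt hAb hBb
  · exact (continuous_hFin _ _ _).measurable.div (measurable_hInf hq _)
  · filter_upwards [ae_refM e N] with y hy; by_cases h0 : hFin P.pc P.Qr j y = 0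
    · exact ⟨0, le_rfl, by simp [*]⟩
    obtain ⟨t, ht, hty⟩ := H.hFin_c_nonneg j hy; obtain ⟨r, hr, hr'⟩ := hpos hy h0
    exact ⟨t/r, by positivity, by rw [hty, hr', ofReal_div]⟩
  · filter_upwards [ae_refM e N] with y hy hne; have hY := expArg_ne_zero y
    have hBy := (hpos hy (left_ne_zero_of_mul hne)).ne_zero
    have hc : ∀ f : ℂ, ContinuousAt (symPoch f P.Qr) (expArg y) := fun f =>
      (differentiableAt_symPoch hq hY).continuousAt
    rw [h.nuOverM_disc (g := fun Z => qPoch (P.pc*Z) P.Qr j*qPoch (P.pc*Z⁻¹) P.Qr j *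
      symPoch P.pC P.Qr Z/symPoch B P.Qr Z) (by omega), ← hA', ← hB']
    · rw [hInf, hInf, hFin_eq_qPoch hY (expArg_add_inv y)]; ring
    · refine ContinuousAt.div (.mul (.mul ?_ ?_) (hc _)) (hc _) hBy
      · unfold qPoch; fun_prop
      · unfold qPoch; fun_prop (disch := assumption)
    · intro Z hZ _ hZB; rw [← hB'] at hZB; rw [← hA', ← hB', div_mul_eq_mul_div, eq_div_iff hZB]
      simp only [symPoch]; rw [qPochInf_split hq (P.pc*Z) j, qPochInf_split hq (P.pc*Z⁻¹) j]
      push_cast; ring_nf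
  · refine Eventually.of_forall fun y hy => ?_; rcases le_total D j with hDj | hDj
    · rw [← Nat.add_sub_cancel' hDj, hFin_add, hy, zero_mul, zero_div, mul_zero]
    · obtain ⟨M, rfl⟩ := exists_eq_add_of_le hDj; rw [hFin_add] at hy
      rw [wFun_symm H.q_pos H.q_lt (M := M) (mul_pow_ne_one hq (nR hA0 hB0 hAB1))]
      · have : (P.pc*P.Qr^j:ℂ) = ((P.pc*P.Qr^j:ℝ):ℂ) := by push_cast; rfl
        grind
      · have h1 := pow_ne_zero j h.ofReal_Qr_ne; have h2 := pow_ne_zero M h.ofReal_Qr_ne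
        rw [pow_add]; push_cast; field_simp; linear_combination H.C_mul_c'

/-- The formula for the mass points `x_l` with `l > K`. -/
theorem hasCGIntegral_disc_of_lt {e o : ℝ} {M : ℕ} (H : CGBase P.Qr P.pC P.pc P.pb e o M)
    {l : ℕ} (hl : P.K < l) (n₁ n₂:ℕ) {p : ℕ} (hlp : l ≤ P.K+p) :
    P.HasCGIntegral (.disc l) n₁ n₂ p := by
  have hq := h.norm_Qr_lt; obtain ⟨N, hN⟩ := exists_eq_add_of_le hl.le
  obtain ⟨m, rfl⟩ : ∃ m, p = N+m := exists_eq_add_of_le (by omega); have hs := h.s_ne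
  have hs2 := sq_pos_of_ne_zero hs; have hq0 := h.q_pos; have hQ0 := h.Qr_pos; have hκ₁ := h.κ₁_pos
  have hκ₂ := h.κ₂_pos; have hc0 := h.pc_pos; have hC0 := h.pC_pos; have hb0 := h.pb_pos
  have hQN := pow_pos hQ0 N; have hQN1 := pow_le_one₀ hQ0.le h.Qr_lt.le (n := N)
  have hA : P.q/P.s*uDisc P l = P.pc/P.Qr^N := by
    have := (pow_pos hQ0 P.K).ne'; rw [h.uDisc_eq, hN, pow_add, pc]; field_simp
  have hA0 : 0 < P.pc/P.Qr^N := div_pos hc0 hQN; set B : ℝ := P.q/P.s/uDisc P l with hB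
  obtain ⟨hB1, hbB⟩ := h.abs_rho_div_uDisc_lt l; rw [← hB] at hB1 hbB
  have hu0 : uDisc P l ≠ 0 := fun h0 => hA0.ne' (by rw [← hA, h0, mul_zero])
  have hAB : P.pc/P.Qr^N*B = P.Qr/P.s^2 := by rw [← hA, hB, Qr]; field_simp
  have hB0 : 0 < B := pos_of_mul_pos_right (hAB ▸ div_pos hQ0 hs2) hA0.le
  have hBe : B = P.pC*P.Qr^N/P.s^2 := by
    have : P.Qr/P.s^2 = P.pc/P.Qr^N*(P.pC*P.Qr^N/P.s^2) := by rw [← h.pC_mul_pc]; field_simp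
    exact mul_left_cancel₀ hA0.ne' (hAB.trans this)
  have hAB1 : P.pc/P.Qr^N*B < 1 := hAB ▸ h.div_sq_lt_one h.Qr_lt.le
  have hA' : ((P.pc/P.Qr^N:ℝ):ℂ) = P.q/P.s*uDisc P l := by rw [← hA]; push_cast; rfl
  have hB' : (B:ℂ) = P.q/P.s/uDisc P l := by rw [hB]; push_cast; rfl
  have hu : (uDisc P l:ℂ) ≠ 0 := by exact_mod_cast hu0
  have hC' : ((P.pC*P.Qr^N:ℝ):ℂ) = P.pC*(P.Qr:ℂ)^N := by push_cast; rfl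
  have hcB : P.pc*B < 1 := by
    have : P.pc*B = P.pc/P.Qr^N*B*P.Qr^N := by field_simp
    rw [this]; exact mul_lt_one_left (mul_pos hA0 hB0).le hAB1 hQN1
  have mulN : ∀ {t : ℝ}, 0 < t → t < 1 → t*P.Qr^N < 1 := fun h0 h1 => mul_lt_one_left h0.le h1 hQN1
  have hC1 := h.pC_le.trans_lt h.q_lt_one; have hCN := mul_pos hC0 hQN
  have nR : ∀ {t r : ℝ}, 0 < t → 0 < r → t*r < 1 → ‖(t*r:ℂ)‖ < 1 := fun h0 h1 h2 => by
    rw [← ofReal_mul, norm_real]; exact abs_lt_one (mul_pos h0 h1) h2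
  have hBb : B*P.pb < 1 := by rw [mul_comm]; exact (le_abs_self _).trans_lt hbB
  have hBC : B*P.pC < 1 := mul_lt_one_left hB0.le (abs_of_pos hB0 ▸ hB1) hC1.le
  have heB : |e*B| < 1 := by
    rcases H.cases with ⟨rfl, -⟩ | ⟨rfl, -⟩
    · exact hbB
    · exact abs_lt_one (mul_pos hc0 hB0) hcB
  have hpos : ∀ᵐ y ∂refM P.Qr e M, IsPos (hInf B P.Qr y) := (ae_refM e M).mono
    fun y hy => OnSupp.isPos_hInf H.q_pos H.q_lt H.e_pos H.masses hy hB1 heB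
  have hD := awDensity_disc H.q_pos H.q_lt H.C_pos H.C_lt H.c_pos H.b_pos H.C_mul_c H.C_mul_b
    H.c_mul_b H.cases H.o_lt H.masses hB1 (abs_lt_one (mul_pos hc0 hB0) hcB) hbB N
  have hM := (aw_disc H.q_pos H.q_lt H.C_pos H.C_lt H.c_pos H.b_pos H.C_mul_c H.C_mul_b
    H.c_mul_b H.cases H.o_lt H.masses (B := B) (j := 0) hB1
    (by rw [pow_zero, mul_one]; exact abs_lt_one (mul_pos hc0 hB0) hcB) hbB).2
  have hφ : (fun y => hFin P.pc P.Qr 0 y*(1/(hInf B P.Qr y*hInf P.pC P.Qr y *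
      hInf o P.Qr y))) = fun y => 1/hInf B P.Qr y/(hInf P.pC P.Qr y*hInf o P.Qr y) := by
    ext y; rw [hFin_zero, one_mul, div_div, mul_assoc (hInf B P.Qr y)]
  rw [hφ, pow_zero, mul_one] at hM; rw [hC'] at hD
  have hdeg : SpecPoint.deg P (N+m) (.disc l) = m := by rw [SpecPoint.deg, if_neg (by omega)]; omega
  have hQ : (P.q:ℂ)^2 = P.Qr := by rw [Qr]; push_cast; rfl
  have hcCN : ‖(P.pc*(P.pC*P.Qr^N) : ℂ)‖ < 1 := by
    rw [← hC']; refine nR hc0 hCN ?_; rw [← mul_assoc, mul_comm P.pc, h.pC_mul_pc]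
    exact mulN hQ0 h.Qr_lt
  have hBCN : ‖(B*(P.pC*P.Qr^N) : ℂ)‖ < 1 := by
    rw [← hC']; refine nR hB0 hCN ?_; rw [← mul_assoc]; exact mulN (mul_pos hB0 hC0) hBC
  have hCNb : ‖(P.pC*P.Qr^N*P.pb:ℂ)‖ < 1 := by
    rw [← hC']; refine nR hCN hb0 ?_; rw [mul_right_comm]
    exact mulN (mul_pos hC0 hb0) h.pC_mul_pb_lt
  have hQN' := pow_ne_zero N h.ofReal_Qr_ne; have hcb := h.norm_pc_mul_pb
  have hT : ‖(P.pc*B*(P.pC*P.Qr^N)*P.pb/P.Qr^2 : ℂ)‖ < 1 := by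
    refine h.norm_total_lt (n := 2*N) ?_; rw [← hAB]; push_cast; rw [two_mul, pow_add]; field_simp
  have hI := integral_awPoly_mul_cgFun' (m := m) (C := P.pC) (b := P.pb) h.Qr_pos h.Qr_lt hQ
    h.ofReal_κ₁_ne h.ofReal_κ₂_ne
    h.ofReal_s_ne hu (mu_add_inv (v := uDisc P l)) (by rw [hA']; ring)
    (by rw [hB']; field_simp)
    (by rw [pC]; push_cast; rfl) (by rw [pb]; push_cast; rfl) (by rw [pc]; push_cast; rfl)
    (by push_cast; rw [div_mul_cancel₀ _ hQN']) rfl hM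
    (h.regular (nR hc0 hB0 hcB) hcCN hcb hBCN (nR hB0 hb0 hBb) hCNb hT) (mu_eq _)
    (nR hA0 hB0 hAB1) (nR hc0 hB0 hcB) hcb (nR hB0 hC0 hBC) (nR hB0 hb0 hBb) h.norm_pC_mul_pb n₁ n₂
  generalize hω : ((P.pc/P.Qr^N:ℝ):ℂ)^(2*N)*((P.Qr:ℂ)^N.choose 2)^2 = ω at hI
  generalize hK : (-(P.pC*B:ℂ))^N*_*_*_*_/_ = K at hI
  obtain ⟨c1, c2, c3, c4⟩ := h.const_far rfl rfl (B := B) (by rw [hBe]) hω.symm hK.symm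
  have hω0 : ω ≠ 0 := by
    rw [← hω]
    exact mul_ne_zero (pow_ne_zero _ (by exact_mod_cast hA0.ne'))
      (pow_ne_zero _ (pow_ne_zero _ h.ofReal_Qr_ne))
  refine h.hasCGIntegral H n₁ n₂ (C' := P.pC*P.Qr^N) ?_ hu hA' hB' ?_ ?_ ?_ hD ?_ ?_ c2
    (by rwa [hdeg]) (fun D => ?_) hM (by rwa [hdeg]) (by rwa [hdeg, Nat.add_sub_cancel])
    (by rwa [hdeg])
  · rw [SpecPoint.awParams, if_neg (by omega), h.qp_pc, h.qp_pb, h.qp_sub_add_one, hBe, ← hC', hN, pow_add,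
      mul_comm (P.Qr^P.K), ← mul_assoc, mul_div_cancel_right₀ _ (pow_pos hQ0 P.K).ne']
    push_cast; rfl
  · refine (ae_refM e M).mono fun y hy => H.isPos_hInf hCN (mulN hC0 hC1) ?_ hy; rw [← mul_assoc]
    exact mulN (mul_pos H.e_pos hC0) H.e_mul_C
  · exact (measurable_hInf hq _).const_div 1
  · exact hpos.mono fun y hy => hy.inv.imp fun t ht => ⟨ht.1.le, by rw [one_div, ht.2]⟩
  · intro y; rw [hC', div_div, mul_assoc]
  · filter_upwards [hpos] with y hBy _; have hY := expArg_ne_zero y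
    have hc : ∀ f : ℂ, ContinuousAt (symPoch f P.Qr) (expArg y) := fun f =>
      (differentiableAt_symPoch hq hY).continuousAt
    rw [h.nuOverM_disc (g := fun Z => symPoch (P.pC*P.Qr^N) P.Qr Z/(ω*symPoch B P.Qr Z)) (by omega),
      ← hA', ← hB', hC']
    · rw [hInf, hInf]; congr 1; field_simp
    · exact (hc _).div (continuousAt_const.mul (hc _)) (mul_ne_zero hω0 hBy.ne_zero)
    · intro Z hZ _ hZB; rw [← hB'] at hZB
      have hc' : (P.pc:ℂ)*P.pC = P.Qr := by rw [mul_comm]; exact H.C_mul_c'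
      have hθ := qTheta_mul_qTheta hq h.ofReal_Qr_ne H.c_ne hc' hZ N
      have e1 : (P.Qr:ℂ)/(P.pc/P.Qr^N/Z) = P.pC*P.Qr^N*Z := by
        have := H.c_ne; rw [← hc']; field_simp
      have e2 : (P.Qr:ℂ)/(P.pc/P.Qr^N*Z) = P.pC*P.Qr^N*Z⁻¹ := by
        have := H.c_ne; rw [← hc']; field_simp
      rw [qTheta, qTheta, e1, e2, ← pow_mul] at hθ; push_cast at hω; rw [hω] at hθ
      rw [← hA', ← hB', div_mul_eq_mul_div, eq_div_iff (mul_ne_zero hω0 hZB)]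
      simp only [symPoch] at hθ ⊢; push_cast; rw [div_eq_mul_inv _ Z] at hθ
      linear_combination (-Π(B*Z;P.Qr)*Π(B*Z⁻¹;P.Qr))*hθ
  · refine Eventually.of_forall fun y hy => ?_
    rw [wFun_symm H.q_pos H.q_lt (M := N+D) (mul_pow_ne_one hq (nR hA0 hB0 hAB1)), hFin_add]
    · have : ((P.pc/P.Qr^N:ℝ):ℂ)*P.Qr^N = P.pc := by push_cast; rw [div_mul_cancel₀ _ hQN']
      rw [this, hy, mul_zero, mul_zero, zero_mul, zero_mul]
    · have h2 := pow_ne_zero D h.ofReal_Qr_ne; rw [pow_add]; push_cast; field_simp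
      linear_combination H.C_mul_c'

end Params.Admissible

end AWClebschGordan

end

open AWClebschGordan in
theorem proposition3p5 (P : Params) (hP : P.Admissible) (n₁ n₂ p:ℕ)
    (X : SpecPoint) (hX : X.InSupport P p) :
    MeasureTheory.Integrable
      (fun y : ℝ => X.awOrthoAt P p y*P.cdhOrtho n₁ n₂ y *
        P.jacobi ((n₁:ℤ) - n₂ - P.L) (X.u P) (expArg y))
      (geomMean (P.cdhMeasure n₁ n₂) (X.measureM P p)) ∧
    P.F n₁ n₂ (X.x P) p =
      (if n₁ ≤ n₂ then (-1:ℂ)^(n₂ - n₁) else 1)*(-1:ℂ)^(p - X.deg P p) *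
        (-(Real.sign P.s:ℂ))^P.L *
        ∫ y, X.awOrthoAt P p y*P.cdhOrtho n₁ n₂ y *
            P.jacobi ((n₁:ℤ) - n₂ - P.L) (X.u P) (expArg y)
          ∂(geomMean (P.cdhMeasure n₁ n₂) (X.measureM P p)) := by
  obtain ⟨e, o, N, H⟩ := hP.exists_cgBase
  rcases X with x | l
  · exact hP.hasCGIntegral_cont H hX n₁ n₂ p
  · rcases le_or_gt l P.K with hl | hl
    · exact hP.hasCGIntegral_disc_of_le H hl n₁ n₂ p
    · exact hP.hasCGIntegral_disc_of_lt H hl n₁ n₂ hX
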